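/- Let $k$ be an algebraically closed field of characteristic zero and $G$ an affine algebraic group over $k$. A variety is a reduced, separated $k$-scheme of finite type. A $G$-chain is a pure-dimensional $G$-variety $X$ with finitely many $G$-orbits, each of codimension $0$ (these are open) or $1$ (these are closed). For a $G$-scheme $Y$ let $\mathrm{Vect}^G(Y)$ be the category of $G$-equivariant vector bundles (of finite rank) on $Y$. A variety $X$ is weakly normal if every finite, birational, bijective morphism $Y \to X$ with $Y$ a variety is an isomorphism. Let $X$ be a weakly normal $G$-chain and let $\nu : \tilde X \to X$ be its normalization, with the $G$-action on $\tilde X$ for which $\nu$ is equivariant. Let $\{Z_i\}_{i \in S_Z}$ be the codimension-one orbits of $X$ and $\{\tilde Z_k\}_{k \in S_{\tilde Z}}$ the codimension-one orbits of $\tilde X$, all with their reduced subscheme structures, and let $\{U_j\}_{j\in S_U}$ be the open orbits of $\tilde X$. Then: 1. $\nu$ is an isomorphism over every open orbit of $X$, and the open orbits of $\tilde X$ are exactly the preimages of the open orbits of $X$ (so the $U_j$ are identified with the open orbits of $X$). 2. For every $k \in S_{\tilde Z}$ there is exactly one $a(k) \in S_U$ such that $\tilde Z_k$ lies in the closure of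 $U_{a(k)}$; the union $U_{a(k)} \cup \tilde Z_k$ is open in $\tilde X$; and there is exactly one $\nu(k) \in S_Z$ such that $\nu(\tilde Z_k) \subseteq Z_{\nu(k)}$. 3. Let $\Gamma$ be the directed graph with vertex set $S_U \sqcup S_{\tilde Z}^{(1)} \sqcup S_{\tilde Z}^{(2)} \sqcup S_Z$ (where $S_{\tilde Z}^{(1)}$ and $S_{\tilde Z}^{(2)}$ are two copies of $S_{\tilde Z}$) and, for every $k \in S_{\tilde Z}$, arrows $a(k) \to k^{(1)} \leftarrow k^{(2)} \to \nu(k)$. Let $F$ be the diagram of $G$-schemes on $\Gamma$ with $F(j) = U_j$, $F(k^{(1)}) = U_{a(k)} \cup \tilde Z_k$ (an open subscheme of $\tilde X$), $F(k^{(2)}) = \tilde Z_k$, $F(i) = Z_i$, whose maps are the inclusions $U_{a(k)} \hookrightarrow U_{a(k)} \cup \tilde Z_k \hookleftarrow \tilde Z_k$ and the restriction $\tilde Z_k \to Z_{\nu(k)}$ of $\nu$. The functor given by pullback along the canonical maps $F(v) \to X$, $$\mathrm{Vect}^G(X) \longrightarrow \lim_{\Gamma^{\mathrm{op}}} \mathrm{Vect}^G(F(-)),$$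 is an equivalence of categories. Here the limit is the 2-limit of categories: an object is a family of $\mathcal E_v \in \mathrm{Vect}^G(F(v))$, one for each vertex $v$, together with an isomorphism $F(e)^*\mathcal E_w \cong \mathcal E_v$ for each arrow $e : v \to w$ (and no cocycle conditions); a morphism is a family of morphisms compatible with these isomorphisms. -/

import Mathlib

open CategoryTheory AlgebraicGeometry MonoidalCategory CartesianMonoidalCategory MonObj
universe u

namespace EquivariantChain

noncomputable section

section Modules
variable {X Y Z W : Scheme.{u}}

lemma opens_map_final (f : X ⟶ Y) : (TopologicalSpace.Opens.map f.base).Final where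
  out V := by
    have t : Limits.IsTerminal (StructuredArrow.mk (S := V) (T := TopologicalSpace.Opens.map f.base) (Y := ⊤) (homOfLE le_top)) :=
      Limits.IsTerminal.ofUniqueHom (fun A => StructuredArrow.homMk (homOfLE le_top) (Subsingleton.elim _ _))
        (fun A m => by ext; exact Subsingleton.elim _ _)
    have := t.hasTerminal
    exact isConnected_of_hasTerminal _

/-- The pullback of a free sheaf of modules is free. -/
def pullFree (f : X ⟶ Y) (I : Type u) : (Scheme.Modules.pullback f).obj (SheafOfModules.free (R := Y.ringCatSheaf) I) ≅ SheafOfModules.free (R := X.ringCatSheaf) I := 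
  haveI := opens_map_final f
  haveI : (SheafOfModules.pushforward.{u} f.toRingCatSheafHom).IsRightAdjoint := 
    (Scheme.Modules.pullbackPushforwardAdjunction f).isRightAdjoint
  SheafOfModules.pullbackObjFreeIso f.toRingCatSheafHom I

/-- The canonical isomorphism `f^* g^* M ≅ h^* M` attached to an equality `f ≫ g = h`. -/
def pullIso {f : X ⟶ Y} {g : Y ⟶ Z} {h : X ⟶ Z} (e : f ≫ g = h) (M : Z.Modules) :
    (Scheme.Modules.pullback f).obj ((Scheme.Modules.pullback g).obj M) ≅
      (Scheme.Modules.pullback h).obj M :=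
  (Scheme.Modules.pullbackComp f g).app M ≪≫ (Scheme.Modules.pullbackCongr e).app M

lemma pullIso_assoc {f : X ⟶ Y} {g : Y ⟶ Z} {h : Z ⟶ W} {fg : X ⟶ Z} {gh : Y ⟶ W} {k : X ⟶ W}
    (e₁ : f ≫ g = fg) (e₂ : g ≫ h = gh) (e₃ : fg ≫ h = k) (e₄ : f ≫ gh = k) (M : W.Modules) :
    (pullIso e₁ ((Scheme.Modules.pullback h).obj M)).hom ≫ (pullIso e₃ M).hom =
      (Scheme.Modules.pullback f).map (pullIso e₂ M).hom ≫ (pullIso e₄ M).hom := by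
  subst e₁ e₂ e₄
  have := congr_arg (fun t => t.app M) (Scheme.Modules.pseudofunctor_associativity f g h)
  simp only [eqToHom_app, NatTrans.comp_app, Functor.whiskerRight_app, Functor.associator_hom_app,
    Functor.whiskerLeft_app, Category.id_comp] at this
  have this2 : (Scheme.Modules.pullbackComp f g).hom.app ((Scheme.Modules.pullback h).obj M) ≫
      (Scheme.Modules.pullbackComp (f ≫ g) h).hom.app M =
      (Scheme.Modules.pullback f).map ((Scheme.Modules.pullbackComp g h).hom.app M) ≫
        (Scheme.Modules.pullbackComp f (g ≫ h)).hom.app M ≫ eqToHom (by simp) := by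
    rw [← this, Iso.hom_inv_id_app_assoc, ← Functor.map_comp_assoc, Iso.hom_inv_id_app,
      CategoryTheory.Functor.map_id, Category.id_comp]
  simp only [pullIso, Scheme.Modules.pullbackCongr, Iso.trans_hom, Iso.app_hom, eqToIso.hom,
    eqToHom_app, eqToHom_refl, NatTrans.id_app, Category.comp_id]
  rw [reassoc_of% this2, eqToHom_trans, eqToHom_refl, Category.comp_id]
lemma pullIso_naturality {f : X ⟶ Y} {g : Y ⟶ Z} {h : X ⟶ Z} (e : f ≫ g = h) {M N : Z.Modules}
    (φ : M ⟶ N) :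
    (Scheme.Modules.pullback f).map ((Scheme.Modules.pullback g).map φ) ≫ (pullIso e N).hom =
      (pullIso e M).hom ≫ (Scheme.Modules.pullback h).map φ := by
  have h1 := (Scheme.Modules.pullbackComp f g).hom.naturality φ
  have h2 := (Scheme.Modules.pullbackCongr e).hom.naturality φ
  simp only [Functor.comp_map] at h1
  simp only [pullIso, Iso.trans_hom, Iso.app_hom, Category.assoc]
  rw [← h2, reassoc_of% h1]

lemma pullIso_inv_naturality {f : X ⟶ Y} {g : Y ⟶ Z} {h : X ⟶ Z} (e : f ≫ g = h) {M N : Z.Modules}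
    (φ : M ⟶ N) :
    (pullIso e M).inv ≫ (Scheme.Modules.pullback f).map ((Scheme.Modules.pullback g).map φ) =
      (Scheme.Modules.pullback h).map φ ≫ (pullIso e N).inv := by
  rw [Iso.inv_comp_eq, ← Category.assoc, ← pullIso_naturality, Category.assoc, Iso.hom_inv_id,
    Category.comp_id]

/-- A vector bundle: an `𝒪_X`-module that is locally free of finite (locally constant) rank. -/
def IsVectorBundle (M : X.Modules) : Prop :=
  ∀ x : X, ∃ U : X.Opens, x ∈ U ∧ ∃ n : ℕ,
    Nonempty ((Scheme.Modules.pullback U.ι).obj M ≅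
      SheafOfModules.free (R := U.toScheme.ringCatSheaf) (ULift.{u} (Fin n)))

lemma IsVectorBundle.pullback {M : Y.Modules} (hM : IsVectorBundle M) (f : X ⟶ Y) :
    IsVectorBundle ((Scheme.Modules.pullback f).obj M) := by
  intro x
  obtain ⟨U, hU, n, ⟨e⟩⟩ := hM (f x)
  refine ⟨f ⁻¹ᵁ U, hU, n, ⟨?_⟩⟩
  exact pullIso rfl M ≪≫ (pullIso (morphismRestrict_ι f U) M).symm ≪≫ (Scheme.Modules.pullback (f ∣_ U)).mapIso e ≪≫ pullFree _ _

end Modules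

section Equivariant
variable {S : Scheme.{u}} {G : Over S} [GrpObj G]

variable (G) in
/-- Schemes over `S` with an action of the group scheme `G`, and equivariant morphisms. -/
abbrev GSch := Mod (Over S) G

/-- A `G`-equivariant vector bundle on `X`: a vector bundle `E` together with, for all `S`-schemes
`T` and `T`-points `g` of `G` and `x` of `X`, an isomorphism `x^* E ≅ (g • x)^* E` (written
`x^* E ≅ y^* E` for `y = g • x`), compatible with base change in `T` and multiplicative in `g`.
By the Yoneda lemma this is the same as an isomorphism `pr₂^* E ≅ σ^* E` on `G × X`, with `σ` the
action map, that satisfies the cocycle condition on `G × G × X` (take `T = G × X`). -/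
structure VectG (X : GSch G) where
  sheaf : X.X.left.Modules
  isVectorBundle : IsVectorBundle sheaf
  act {T : Over S} (g : T ⟶ G) (x y : T ⟶ X.X) (h : g • x = y) :
    (Scheme.Modules.pullback x.left).obj sheaf ≅ (Scheme.Modules.pullback y.left).obj sheaf
  act_naturality {T T' : Over S} (f : T' ⟶ T) (g : T ⟶ G) (x y : T ⟶ X.X) (h : g • x = y) :
    (pullIso (Over.comp_left _ _ _ f x).symm sheaf).hom ≫
        (act (f ≫ g) (f ≫ x) (f ≫ y) (by rw [← h, ModObj.comp_smul])).hom =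
      (Scheme.Modules.pullback f.left).map (act g x y h).hom ≫
        (pullIso (Over.comp_left _ _ _ f y).symm sheaf).hom
  act_mul {T : Over S} (g g' : T ⟶ G) (x y z : T ⟶ X.X) (h : g • x = y) (h' : g' • y = z) :
    (act (g' * g) x z (by rw [mul_smul, h, h'])).hom = (act g x y h).hom ≫ (act g' y z h').hom

namespace VectG
variable {X Y Z : GSch G}
/-- Morphisms of equivariant vector bundles: `𝒪_X`-linear maps that commute with the action. -/
@[ext]
structure Hom (E F : VectG X) where
  hom : E.sheaf ⟶ F.sheaf
  comm {T : Over S} (g : T ⟶ G) (x y : T ⟶ X.X) (h : g • x = y) :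
    (E.act g x y h).hom ≫ (Scheme.Modules.pullback y.left).map hom =
      (Scheme.Modules.pullback x.left).map hom ≫ (F.act g x y h).hom

lemma Hom.comm_assoc {E F : VectG X} (a : Hom E F) {T : Over S} (g : T ⟶ G) (x y : T ⟶ X.X)
    (h : g • x = y) {M : T.left.Modules}
    (b : (Scheme.Modules.pullback y.left).obj F.sheaf ⟶ M) :
    (E.act g x y h).hom ≫ (Scheme.Modules.pullback y.left).map a.hom ≫ b =
      (Scheme.Modules.pullback x.left).map a.hom ≫ (F.act g x y h).hom ≫ b := by
  rw [← Category.assoc, a.comm, Category.assoc]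

instance : Category (VectG X) where
  Hom := Hom
  id E := { hom := 𝟙 _, comm := by intros; simp }
  comp a b := { hom := a.hom ≫ b.hom, comm := by intros; simp [Hom.comm_assoc, Hom.comm] }
  id_comp _ := Hom.ext (Category.id_comp _)
  comp_id _ := Hom.ext (Category.comp_id _)
  assoc _ _ _ := Hom.ext (Category.assoc _ _ _)

@[ext] lemma hom_ext {E F : VectG X} {a b : E ⟶ F} (h : a.hom = b.hom) : a = b := Hom.ext h
@[simp] lemma id_hom (E : VectG X) : Hom.hom (𝟙 E) = 𝟙 _ := rfl
@[simp] lemma comp_hom {E F H : VectG X} (a : E ⟶ F) (b : F ⟶ H) : (a ≫ b).hom = a.hom ≫ b.hom := rfl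

lemma act_naturality' (E : VectG X) {T T' : Over S} (f : T' ⟶ T) (g : T ⟶ G) (x y : T ⟶ X.X)
    (h : g • x = y) (g' : T' ⟶ G) (x' y' : T' ⟶ X.X) (h' : g' • x' = y')
    (hg : f ≫ g = g') (hx : f ≫ x = x') (hy : f ≫ y = y') :
    (pullIso (by rw [← hx, Over.comp_left]) E.sheaf).hom ≫ (E.act g' x' y' h').hom =
      (Scheme.Modules.pullback f.left).map (E.act g x y h).hom ≫
        (pullIso (by rw [← hy, Over.comp_left]) E.sheaf).hom := by
  subst hg hx hy
  exact E.act_naturality f g x y h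

/-- The pullback of an equivariant vector bundle along an equivariant morphism. -/
def pullbackObj (m : X ⟶ Y) (E : VectG Y) : VectG X where
  sheaf := (Scheme.Modules.pullback m.hom.left).obj E.sheaf
  isVectorBundle := E.isVectorBundle.pullback _
  act g x y h := pullIso (Over.comp_left _ _ _ x m.hom).symm E.sheaf ≪≫
    E.act g (x ≫ m.hom) (y ≫ m.hom) (by rw [← h, IsModHom.map_smul]) ≪≫
    (pullIso (Over.comp_left _ _ _ y m.hom).symm E.sheaf).symm
  act_naturality {T T'} f g x y h := by
    have hn := E.act_naturality' f g (x ≫ m.hom) (y ≫ m.hom) (by rw [← h, IsModHom.map_smul])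
      (f ≫ g) ((f ≫ x) ≫ m.hom) ((f ≫ y) ≫ m.hom)
      (by rw [← h, ModObj.comp_smul, IsModHom.map_smul]) rfl (Category.assoc _ _ _).symm
      (Category.assoc _ _ _).symm
    have hx (x : T ⟶ X.X) := pullIso_assoc (Over.comp_left _ _ _ f x).symm
      (Over.comp_left _ _ _ x m.hom).symm (Over.comp_left _ _ _ (f ≫ x) m.hom).symm
      (by simp) E.sheaf
    simp only [Iso.trans_hom, Iso.symm_hom, Functor.map_comp]
    rw [reassoc_of% hx x, reassoc_of% hn]
    simp only [Category.assoc]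
    congr 2
    rw [Iso.comp_inv_eq]
    refine Eq.trans ?_ (Category.assoc _ _ _).symm
    rw [hx y, ← Functor.map_comp_assoc, Iso.inv_hom_id,
      CategoryTheory.Functor.map_id, Category.id_comp]
  act_mul g g' x y z h h' := by
    simp [E.act_mul g g' (x ≫ m.hom) (y ≫ m.hom) (z ≫ m.hom) (by rw [← h, IsModHom.map_smul]) (by rw [← h', IsModHom.map_smul])]

/-- The pullback functor `m^* : Vect^G(Y) ⥤ Vect^G(X)` of an equivariant morphism `m : X ⟶ Y`. -/
@[simps]
def pullback (m : X ⟶ Y) : VectG Y ⥤ VectG X where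
  obj E := E.pullbackObj m
  map {E F} a :=
    { hom := (Scheme.Modules.pullback m.hom.left).map a.hom
      comm g x y h := by
        simp only [pullbackObj, Iso.trans_hom, Iso.symm_hom, Category.assoc]
        rw [reassoc_of% (pullIso_naturality (Over.comp_left _ _ _ x m.hom).symm a.hom),
          ← a.comm_assoc, pullIso_inv_naturality] }
  map_id E := by ext1; exact CategoryTheory.Functor.map_id _ _
  map_comp a b := by ext1; exact CategoryTheory.Functor.map_comp _ _ _

lemma pullback_act (m : X ⟶ Y) (E : VectG Y) {T : Over S} (g : T ⟶ G) (x y : T ⟶ X.X)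
    (h : g • x = y) (x' y' : T ⟶ Y.X) (hx : x ≫ m.hom = x') (hy : y ≫ m.hom = y') :
    ((pullback m).obj E).act g x y h =
      pullIso (by rw [← hx, Over.comp_left]) E.sheaf ≪≫
        E.act g x' y' (by rw [← hx, ← hy, ← h, IsModHom.map_smul]) ≪≫
          (pullIso (by rw [← hy, Over.comp_left]) E.sheaf).symm := by
  subst hx hy
  rfl

lemma left_comp {m : X ⟶ Y} {n : Y ⟶ Z} {p : X ⟶ Z} (e : m ≫ n = p) :
    m.hom.left ≫ n.hom.left = p.hom.left := by
  subst e
  rfl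

lemma pullbackComp_comm_aux {A B C D : Scheme.{u}} {x y : A ⟶ B} {m : B ⟶ C} {n : C ⟶ D}
    {p : B ⟶ D} {xm ym : A ⟶ C} {xp yp : A ⟶ D} (e : m ≫ n = p) (hxm : x ≫ m = xm)
    (hym : y ≫ m = ym) (hxn : xm ≫ n = xp) (hyn : ym ≫ n = yp) (hxp : x ≫ p = xp)
    (hyp : y ≫ p = yp) (F : D.Modules)
    (φ : (Scheme.Modules.pullback xp).obj F ≅ (Scheme.Modules.pullback yp).obj F) :
    (pullIso hxm ((Scheme.Modules.pullback n).obj F) ≪≫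
      (pullIso hxn F ≪≫ φ ≪≫ (pullIso hyn F).symm) ≪≫
        (pullIso hym ((Scheme.Modules.pullback n).obj F)).symm).hom ≫
      (Scheme.Modules.pullback y).map (pullIso e F).hom =
    (Scheme.Modules.pullback x).map (pullIso e F).hom ≫
      (pullIso hxp F ≪≫ φ ≪≫ (pullIso hyp F).symm).hom := by
  simp only [Iso.trans_hom, Iso.symm_hom, Category.assoc]
  rw [← reassoc_of% pullIso_assoc hxm e hxn hxp F]
  congr 3
  rw [Iso.inv_comp_eq, Iso.inv_comp_eq, reassoc_of% pullIso_assoc hym e hyn hyp F,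
    Iso.hom_inv_id, Category.comp_id]

lemma pullbackComp_comm {m : X ⟶ Y} {n : Y ⟶ Z} {p : X ⟶ Z} (e : m ≫ n = p) (E : VectG Z)
    {T : Over S} (g : T ⟶ G) (x y : T ⟶ X.X) (h : g • x = y) :
    (((pullback m).obj ((pullback n).obj E)).act g x y h).hom ≫
      (Scheme.Modules.pullback y.left).map (pullIso (left_comp e) E.sheaf).hom =
    (Scheme.Modules.pullback x.left).map (pullIso (left_comp e) E.sheaf).hom ≫
      (((pullback p).obj E).act g x y h).hom := by
  have hp (x : T ⟶ X.X) : x ≫ p.hom = (x ≫ m.hom) ≫ n.hom := by rw [← e]; simp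
  rw [pullback_act p _ g x y h _ _ (hp x) (hp y)]
  exact pullbackComp_comm_aux (left_comp e) _ _ _ _ _ _ E.sheaf _

/-- An isomorphism of the underlying sheaves that commutes with the action is an isomorphism of
equivariant vector bundles. -/
@[simps]
def isoMk {E F : VectG X} (e : E.sheaf ≅ F.sheaf)
    (comm : ∀ {T : Over S} (g : T ⟶ G) (x y : T ⟶ X.X) (h : g • x = y),
      (E.act g x y h).hom ≫ (Scheme.Modules.pullback y.left).map e.hom =
        (Scheme.Modules.pullback x.left).map e.hom ≫ (F.act g x y h).hom) : E ≅ F where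
  hom := { hom := e.hom, comm := comm }
  inv := 
    { hom := e.inv
      comm g x y h := by
        rw [← cancel_epi ((Scheme.Modules.pullback x.left).map e.hom), ← reassoc_of% comm g x y h,
          ← Functor.map_comp, ← Functor.map_comp_assoc]
        simp }

/-- The canonical isomorphism `m^* n^* E ≅ p^* E` for `m ≫ n = p`. -/
def pullbackCompIso {m : X ⟶ Y} {n : Y ⟶ Z} {p : X ⟶ Z} (e : m ≫ n = p) (E : VectG Z) :
    (pullback m).obj ((pullback n).obj E) ≅ (pullback p).obj E :=
  isoMk (pullIso (left_comp e) E.sheaf) (pullbackComp_comm e E)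

end VectG
end Equivariant

section Actions
variable {S : Scheme.{u}} {G : Over S} [GrpObj G]

/-- The action on `Y` obtained by restricting the action on `X` along a monomorphism. -/
@[reducible] def modObjOfMono {X Y : Over S} [ModObj G X] (j : Y ⟶ X) [Mono j] (a : G ⊗ Y ⟶ Y)
    (ha : a ≫ j = (G ◁ j) ≫ γ[G, X]) : ModObj G Y where
  smul := a
  one_smul := by
    change η ▷ Y ≫ a = (λ_ Y).hom
    rw [← cancel_mono j, Category.assoc, ha, ← whisker_exchange_assoc, ModObj.one_smul_self,
      leftUnitor_naturality]
  mul_smul := by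
    change μ ▷ Y ≫ a = (α_ G G Y).hom ≫ G ◁ a ≫ a
    rw [← cancel_mono j]
    simp only [Category.assoc, ha]
    rw [← whisker_exchange_assoc, ModObj.mul_smul_self, ← whiskerLeft_comp_assoc, ha]
    simp

/-- A set `A` of points of `X` is `G`-stable: for every point of `G × X` whose projection to `X` lies
in `A`, its image under the action map lies in `A`. -/
def IsStable {X : GSch G} (A : Set X.X.left) : Prop :=
  ∀ p : ↥(G ⊗ X.X).left, (snd G X.X).left p ∈ A → (γ[G, X.X]).left p ∈ A

/-- A `G`-orbit: the image of the orbit map `G ⟶ X`, `g ↦ g • x`, of an `S`-point `x` of `X`.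
When `S` is the spectrum of an algebraically closed field these are the orbits of closed points. -/
def IsOrbit {X : GSch G} (A : Set X.X.left) : Prop :=
  ∃ x : 𝟙_ (Over S) ⟶ X.X, A = Set.range ((𝟙 G : G ⟶ G) • (toUnit G ≫ x) : G ⟶ X.X).left

lemma IsOrbit.isStable {X : GSch G} {A : Set X.X.left} (h : IsOrbit A) : IsStable A := by
  obtain ⟨x, rfl⟩ := h
  rintro p ⟨q, hq⟩
  set o : G ⟶ X.X := (𝟙 G : G ⟶ G) • (toUnit G ≫ x) with ho
  obtain ⟨z, hz₁, hz₂⟩ := Scheme.Pullback.exists_preimage_pullback (f := o.left)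
    (g := (snd G X.X).left) q p hq
  let T : Over S := Over.mk (Limits.pullback.fst o.left (snd G X.X).left ≫ G.hom)
  let b : T ⟶ G := Over.homMk (Limits.pullback.fst o.left (snd G X.X).left) rfl
  have hT : Limits.pullback.snd o.left (snd G X.X).left ≫ (G ⊗ X.X).hom = T.hom := by
    rw [← Over.w (snd G X.X), ← Limits.pullback.condition_assoc, Over.w]
    rfl
  let c : T ⟶ G ⊗ X.X := Over.homMk (Limits.pullback.snd o.left (snd G X.X).left) hT
  have hbc : b ≫ o = c ≫ snd G X.X := by
    ext1
    exact Limits.pullback.condition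
  have key : c ≫ γ[G, X.X] = ((c ≫ fst G X.X) * b) ≫ o := by
    have h1 : c ≫ γ[G, X.X] = (c ≫ fst G X.X) • (c ≫ snd G X.X) := by
      rw [Hom.smul_def, ← comp_lift, lift_fst_snd, Category.comp_id]
    rw [h1, ← hbc, ho, ModObj.comp_smul, ModObj.comp_smul, smul_smul]
    simp
  have h2 := congr_arg (fun t => t.left z) key
  refine ⟨((c ≫ fst G X.X) * b).left z, ?_⟩
  rw [← hz₂]
  exact h2.symm

lemma IsStable.union {X : GSch G} {A B : Set X.X.left} (hA : IsStable A) (hB : IsStable B) :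
    IsStable (A ∪ B) := fun p hp => hp.imp (hA p) (hB p)

lemma IsStable.range_subset {X : GSch G} {A : Set X.X.left} (hA : IsStable A) {Y : Over S}
    (j : Y ⟶ X.X) (hj : Set.range j.left ⊆ A) :
    Set.range ((G ◁ j) ≫ γ[G, X.X]).left ⊆ A := by
  rintro _ ⟨p, rfl⟩
  refine hA ((G ◁ j).left p) (hj ⟨(snd G Y).left p, ?_⟩)
  have := congr_arg (fun t => t.left p) (whiskerLeft_snd G j)
  exact this.symm

/-- The `G`-scheme `Y` with the restricted action `a`, for a monomorphism `j : Y ⟶ X`. -/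
def subGSch (X : GSch G) {Y : Over S} (j : Y ⟶ X.X) [Mono j] (a : G ⊗ Y ⟶ Y)
    (ha : a ≫ j = (G ◁ j) ≫ γ[G, X.X]) : GSch G :=
  letI := modObjOfMono j a ha
  CategoryTheory.Mod.mk Y

def subGSchι (X : GSch G) {Y : Over S} (j : Y ⟶ X.X) [Mono j] (a : G ⊗ Y ⟶ Y)
    (ha : a ≫ j = (G ◁ j) ≫ γ[G, X.X]) : subGSch X j a ha ⟶ X where
  hom := j
  isModHom := ⟨ha⟩

def subGSchLift (X : GSch G) {Y : Over S} (j : Y ⟶ X.X) [Mono j] (a : G ⊗ Y ⟶ Y)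
    (ha : a ≫ j = (G ◁ j) ≫ γ[G, X.X]) {W : GSch G} (f : W ⟶ X) (f' : W.X ⟶ Y)
    (hf : f' ≫ j = f.hom) : W ⟶ subGSch X j a ha where
  hom := f'
  isModHom := ⟨by
    have h := f.isModHom.smul_hom
    change γ[G, W.X] ≫ f' = (G ◁ f') ≫ a
    change γ[G, W.X] ≫ f.hom = (G ◁ f.hom) ≫ γ[G, X.X] at h
    rw [← cancel_mono j, Category.assoc, Category.assoc, hf, h, ha, ← hf]
    simp⟩

section Open
variable {X : GSch G} (U : X.X.left.Opens) (hU : IsStable (U : Set X.X.left))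

abbrev openOver : Over S := Over.mk (U.ι ≫ X.X.hom)
abbrev openOverι : openOver U ⟶ X.X := Over.homMk U.ι rfl
instance : Mono (openOverι U) :=
  haveI : Mono (openOverι U).left := inferInstanceAs (Mono U.ι)
  Over.mono_of_mono_left _

/-- A `G`-stable open subscheme, as a `G`-scheme. -/
def openSub : GSch G :=
  subGSch X (openOverι U)
    (Over.homMk (IsOpenImmersion.lift U.ι ((G ◁ openOverι U) ≫ γ[G, X.X]).left
      (by simpa using hU.range_subset (openOverι U) (by simp)))
      (by simp))
    (by ext1; simp)

def openSubι : openSub U hU ⟶ X := subGSchι X (openOverι U) _ _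

def openSubLift {W : GSch G} (f : W ⟶ X) (hf : Set.range f.hom.left ⊆ U) : W ⟶ openSub U hU :=
  subGSchLift X (openOverι U) _ _ f (Over.homMk (IsOpenImmersion.lift U.ι f.hom.left
    (by simpa using hf)) (by simp)) (by ext1; simp)

lemma openSubLift_ι {W : GSch G} (f : W ⟶ X) (hf : Set.range f.hom.left ⊆ U) :
    openSubLift U hU f hf ≫ openSubι U hU = f := by
  ext1; ext1
  exact IsOpenImmersion.lift_fac U.ι f.hom.left (by simpa using hf)
end Open

section Closed

/-- A morphism from a reduced scheme with image in a closed set `Z` factors through the reduced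
induced subscheme structure on `Z`. -/
def reducedLift {T X : Scheme.{u}} [IsReduced T] (f : T ⟶ X) (Z : TopologicalSpace.Closeds X)
    (h : Set.range f ⊆ Z) : T ⟶ (Scheme.IdealSheafData.vanishingIdeal Z).subscheme :=
  IsClosedImmersion.lift (Scheme.IdealSheafData.vanishingIdeal Z).subschemeι f (by
    rw [Scheme.IdealSheafData.ker_subschemeι, ← Scheme.IdealSheafData.map_bot,
      ← Scheme.nilradical_eq_bot, ← Scheme.IdealSheafData.vanishingIdeal_top,
      Scheme.IdealSheafData.map_vanishingIdeal]
    apply Scheme.IdealSheafData.vanishingIdeal_antimono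
    rw [TopologicalSpace.Closeds.closure_le]
    simpa using h)

lemma reducedLift_ι {T X : Scheme.{u}} [AlgebraicGeometry.IsReduced T] (f : T ⟶ X)
    (Z : TopologicalSpace.Closeds X) (h : Set.range f ⊆ Z) :
    reducedLift f Z h ≫ (Scheme.IdealSheafData.vanishingIdeal Z).subschemeι = f :=
  IsClosedImmersion.lift_fac _ _ _

lemma isReduced_vanishingIdeal {X : Scheme.{u}} (Z : TopologicalSpace.Closeds X) :
    AlgebraicGeometry.IsReduced (Scheme.IdealSheafData.vanishingIdeal Z).subscheme := by
  have (U : X.affineOpens) : _root_.IsReduced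
      (Γ(X, U) ⧸ (Scheme.IdealSheafData.vanishingIdeal Z).ideal U) := by
    rw [← Ideal.isRadical_iff_quotient_reduced, Scheme.IdealSheafData.vanishingIdeal_ideal]
    exact PrimeSpectrum.isRadical_vanishingIdeal _
  have (i : X.affineOpens) : AlgebraicGeometry.IsReduced
      ((Scheme.IdealSheafData.vanishingIdeal Z).subschemeCover.openCover.X i) :=
    inferInstanceAs (AlgebraicGeometry.IsReduced
      (Spec (.of (Γ(X, i) ⧸ (Scheme.IdealSheafData.vanishingIdeal Z).ideal i))))
  exact @IsReduced.of_openCover _ (Scheme.IdealSheafData.vanishingIdeal Z).subschemeCover.openCover this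

variable {X : GSch G} (Z : TopologicalSpace.Closeds X.X.left) (hZ : IsStable (Z : Set X.X.left))

abbrev closedOver : Over S :=
  Over.mk ((Scheme.IdealSheafData.vanishingIdeal Z).subschemeι ≫ X.X.hom)
abbrev closedOverι : closedOver Z ⟶ X.X :=
  Over.homMk (Scheme.IdealSheafData.vanishingIdeal Z).subschemeι rfl
instance : Mono (closedOverι Z) :=
  haveI : Mono (closedOverι Z).left :=
    inferInstanceAs (Mono (Scheme.IdealSheafData.vanishingIdeal Z).subschemeι)
  Over.mono_of_mono_left _


section
variable {k : Type u} [Field k] {G : Over (Spec (.of k))} [GrpObj G]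
  [GeometricallyReduced G.hom] {X : GSch G} [LocallyOfFiniteType X.X.hom]
  (Z : TopologicalSpace.Closeds X.X.left) (hZ : IsStable (Z : Set X.X.left))

lemma isReduced_closed : AlgebraicGeometry.IsReduced (G ⊗ closedOver Z).left := by
  have := isReduced_vanishingIdeal Z
  have : AlgebraicGeometry.IsReduced (closedOver Z).left := this
  have : LocallyOfFiniteType (closedOver Z).hom :=
    inferInstanceAs (LocallyOfFiniteType ((Scheme.IdealSheafData.vanishingIdeal Z).subschemeι ≫ X.X.hom))
  have : IsLocallyNoetherian (closedOver Z).left :=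
    LocallyOfFiniteType.isLocallyNoetherian (closedOver Z).hom
  exact inferInstanceAs (AlgebraicGeometry.IsReduced (Limits.pullback G.hom (closedOver Z).hom))

/-- A `G`-stable closed subset with its reduced subscheme structure, as a `G`-scheme. -/
def closedSub : GSch G :=
  haveI := isReduced_closed Z (G := G)
  subGSch X (closedOverι Z)
    (Over.homMk (reducedLift ((G ◁ closedOverι Z) ≫ γ[G, X.X]).left Z
      (hZ.range_subset (closedOverι Z) (by simp)))
      (by
        simp only [Over.mk_hom]
        rw [← Category.assoc, reducedLift_ι, Over.w]))
    (by ext1; exact reducedLift_ι _ _ (hZ.range_subset (closedOverι Z) (by simp)))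

def closedSubι : closedSub Z hZ ⟶ X := subGSchι X (closedOverι Z) _ _

def closedSubLift {W : GSch G} [AlgebraicGeometry.IsReduced W.X.left] (f : W ⟶ X)
    (hf : Set.range f.hom.left ⊆ Z) : W ⟶ closedSub Z hZ :=
  subGSchLift X (closedOverι Z) _ _ f (Over.homMk (reducedLift f.hom.left Z hf) (by
      simp only [Over.mk_hom]
      rw [← Category.assoc, reducedLift_ι, Over.w]))
    (by ext1; exact reducedLift_ι _ _ hf)

lemma closedSubLift_ι {W : GSch G} [AlgebraicGeometry.IsReduced W.X.left] (f : W ⟶ X)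
    (hf : Set.range f.hom.left ⊆ Z) : closedSubLift Z hZ f hf ≫ closedSubι Z hZ = f := by
  ext1; ext1
  exact reducedLift_ι _ _ hf
end

end Closed

end Actions
section GraphLimit
universe v₁ v₂ u₁ u₂
variable {V : Type u₁} [Quiver.{v₁} V]

/-- The 2-limit (pseudo-limit) of a diagram of categories indexed by the opposite of a graph `V`:
a category `C v` for each vertex and a functor `R e : C w ⥤ C v` for each arrow `e : v ⟶ w`.
An object consists of an object of `C v` for each vertex and an isomorphism for each arrow.
As the diagram is indexed by a graph, there are no further conditions. -/
structure GraphLimit (C : V → Type u₂) [∀ v, Category.{v₂} (C v)]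
    (R : ∀ {v w : V}, (v ⟶ w) → C w ⥤ C v) where
  obj (v : V) : C v
  iso {v w : V} (e : v ⟶ w) : (R e).obj (obj w) ≅ obj v

namespace GraphLimit
variable {C : V → Type u₂} [∀ v, Category.{v₂} (C v)] {R : ∀ {v w : V}, (v ⟶ w) → C w ⥤ C v}

/-- Morphisms of families: one morphism for each vertex, compatible with the isomorphisms. -/
@[ext]
structure Hom (A B : GraphLimit C R) where
  app (v : V) : A.obj v ⟶ B.obj v
  comm {v w : V} (e : v ⟶ w) : (A.iso e).hom ≫ app v = (R e).map (app w) ≫ (B.iso e).hom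

lemma Hom.comm_assoc {A B : GraphLimit C R} (a : Hom A B) {v w : V} (e : v ⟶ w) {c : C v}
    (b : B.obj v ⟶ c) :
    (A.iso e).hom ≫ a.app v ≫ b = (R e).map (a.app w) ≫ (B.iso e).hom ≫ b := by
  rw [← Category.assoc, a.comm, Category.assoc]

instance : Category (GraphLimit C R) where
  Hom := Hom
  id A := { app := fun v => 𝟙 _, comm := by intros; simp }
  comp a b := { app := fun v => a.app v ≫ b.app v, comm := by intros; simp [Hom.comm_assoc, Hom.comm] }
  id_comp _ := Hom.ext (funext fun _ => Category.id_comp _)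
  comp_id _ := Hom.ext (funext fun _ => Category.comp_id _)
  assoc _ _ _ := Hom.ext (funext fun _ => Category.assoc _ _ _)

end GraphLimit
end GraphLimit

section
variable {S : Scheme.{u}} {G : Over S} [GrpObj G] {X : GSch G} {V : Type u} [Quiver.{u} V]

/-- The functor from `Vect^G(X)` to the 2-limit of the categories `Vect^G(F v)`, given by pulling
back along the legs of a cocone `F v ⟶ X`. -/
def VectG.toGraphLimit (F : V ⥤q GSch G) (t : (v : V) → (F.obj v ⟶ X))
    (ht : ∀ {v w : V} (e : v ⟶ w), F.map e ≫ t w = t v) :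
    VectG X ⥤ GraphLimit (fun v => VectG (F.obj v)) (fun e => VectG.pullback (F.map e)) where
  obj E :=
    { obj := fun v => (VectG.pullback (t v)).obj E
      iso := fun e => VectG.pullbackCompIso (ht e) E }
  map a :=
    { app := fun v => (VectG.pullback (t v)).map a
      comm := fun e => by
        ext1
        exact (pullIso_naturality (VectG.left_comp (ht e)) a.hom).symm }
  map_id E := GraphLimit.Hom.ext (funext fun v => (VectG.pullback (t v)).map_id E)
  map_comp a b := GraphLimit.Hom.ext (funext fun v => (VectG.pullback (t v)).map_comp a b)
end

section Chains
variable {k : Type u} [Field k] {G : Over (Spec (.of k))} [GrpObj G]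

/-- A `k`-variety: a reduced, separated scheme of finite type over `k`. -/
class IsVariety (X : Over (Spec (.of k))) : Prop where
  isReduced : AlgebraicGeometry.IsReduced X.left
  isSeparated : IsSeparated X.hom
  locallyOfFiniteType : LocallyOfFiniteType X.hom
  quasiCompact : QuasiCompact X.hom

attribute [instance] IsVariety.isReduced IsVariety.locallyOfFiniteType

/-- A `G`-chain: a `G`-variety with finitely many orbits, pure dimensional, all of whose orbits have
codimension `0` or `1`. -/
class IsGChain (X : GSch G) : Prop extends IsVariety X.X where
  finite_orbits : {A : Set X.X.left | IsOrbit A}.Finite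
  pure_dim : ∀ C ∈ irreducibleComponents X.X.left,
    topologicalKrullDim C = topologicalKrullDim X.X.left
  codim_le_one : ∀ A : Set X.X.left, IsOrbit A →
    topologicalKrullDim A = topologicalKrullDim X.X.left ∨
      topologicalKrullDim A + 1 = topologicalKrullDim X.X.left

/-- The open (codimension `0`) orbits of a `G`-chain. -/
@[ext]
structure OpenOrbit (X : GSch G) where
  carrier : X.X.left.Opens
  isOrbit : IsOrbit (carrier : Set X.X.left)
  codim_zero : topologicalKrullDim (carrier : Set X.X.left) = topologicalKrullDim X.X.left

/-- The closed orbits of codimension `1` of a `G`-chain. -/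
@[ext]
structure ClosedOrbit (X : GSch G) where
  carrier : TopologicalSpace.Closeds X.X.left
  isOrbit : IsOrbit (carrier : Set X.X.left)
  codim_one : topologicalKrullDim (carrier : Set X.X.left) + 1 = topologicalKrullDim X.X.left

/-- An open orbit `U` and an adjacent closed orbit `Z` of codimension `1`, together with the open
subscheme `U ∪ Z`. -/
@[ext]
structure SimpleSubchain (X : GSch G) where
  U : OpenOrbit X
  Z : ClosedOrbit X
  adjacent : (Z.carrier : Set X.X.left) ⊆ closure (U.carrier : Set X.X.left)
  carrier : X.X.left.Opens
  coe_carrier : (carrier : Set X.X.left) = (U.carrier : Set X.X.left) ∪ Z.carrier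

lemma SimpleSubchain.isStable {X : GSch G} (W : SimpleSubchain X) :
    IsStable (W.carrier : Set X.X.left) := by
  rw [W.coe_carrier]
  exact W.U.isOrbit.isStable.union W.Z.isOrbit.isStable

/-- All local rings are integrally closed domains. -/
def IsNormalScheme (X : Scheme.{u}) : Prop :=
  ∀ x : X, IsDomain (X.presheaf.stalk x) ∧ IsIntegrallyClosed (X.presheaf.stalk x)

/-- `f` restricts to an isomorphism between dense open subschemes `f⁻¹(V)` and `V`. -/
def IsBirationalHom {Y X : Scheme.{u}} (f : Y ⟶ X) : Prop :=
  ∃ V : X.Opens, Dense (V : Set X) ∧ Dense ((f ⁻¹ᵁ V : Y.Opens) : Set Y) ∧ IsIso (f ∣_ V)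

/-- `ν : Y ⟶ X` is the normalization of the variety `X`: `ν` is finite and birational and `Y` is
normal. -/
structure IsNormalization {Y X : Scheme.{u}} (ν : Y ⟶ X) : Prop where
  isNormal : IsNormalScheme Y
  isFinite : IsFinite ν
  isBirational : IsBirationalHom ν

/-- Every finite, birational, bijective morphism from a reduced scheme to `X` is an isomorphism. -/
def IsWeaklyNormal (X : Scheme.{u}) : Prop :=
  ∀ ⦃Y : Scheme.{u}⦄ (f : Y ⟶ X), AlgebraicGeometry.IsReduced Y → IsFinite f →
    IsBirationalHom f → Function.Bijective f → IsIso f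

variable [GeometricallyReduced G.hom]


section Diagram
variable {X X' : GSch G} 

/-- The vertices of the graph `Γ`, for the normalization `ν : X' ⟶ X`: the open orbits `U_j` of `X'`
(which are those of `X`), the simple chains `U_j ∪ Z'_l` in `X'`, the closed orbits `Z'_l` of `X'`,
and the closed orbits `Z_i` of `X`. -/
inductive Vertex (ν : X' ⟶ X) : Type u
  | openOrbit (j : OpenOrbit X')
  | simple (W : SimpleSubchain X')
  | normClosed (l : ClosedOrbit X')
  | closed (i : ClosedOrbit X)

/-- The arrows of `Γ`: `U_j → U_j ∪ Z'_l ← Z'_l` for each simple chain, and `Z'_l → Z_i` whenever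
`ν` maps `Z'_l` to `Z_i`. -/
inductive Arrow (ν : X' ⟶ X) : Vertex ν → Vertex ν → Type u
  | openIncl (W : SimpleSubchain X') : Arrow ν (.openOrbit W.U) (.simple W)
  | closedIncl (W : SimpleSubchain X') : Arrow ν (.normClosed W.Z) (.simple W)
  | restrict (l : ClosedOrbit X') (i : ClosedOrbit X)
      (h : (l.carrier : Set X'.X.left) ⊆ ν.hom.left ⁻¹' i.carrier) :
      Arrow ν (.normClosed l) (.closed i)

instance (ν : X' ⟶ X) : Quiver (Vertex ν) := ⟨Arrow ν⟩

variable [IsVariety X.X] [IsVariety X'.X] (ν : X' ⟶ X)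

/-- The orbit as an open subscheme with its `G`-action. -/
def OpenOrbit.toGSch (U : OpenOrbit X) : GSch G := openSub U.carrier U.isOrbit.isStable
def OpenOrbit.ι (U : OpenOrbit X) : U.toGSch ⟶ X := openSubι U.carrier U.isOrbit.isStable
/-- The orbit with its reduced subscheme structure and `G`-action. -/
def ClosedOrbit.toGSch (Z : ClosedOrbit X) : GSch G := closedSub Z.carrier Z.isOrbit.isStable
def ClosedOrbit.ι (Z : ClosedOrbit X) : Z.toGSch ⟶ X := closedSubι Z.carrier Z.isOrbit.isStable
def SimpleSubchain.toGSch (W : SimpleSubchain X) : GSch G := openSub W.carrier W.isStable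
def SimpleSubchain.ι (W : SimpleSubchain X) : W.toGSch ⟶ X := openSubι W.carrier W.isStable

lemma ClosedOrbit.range_ι (Z : ClosedOrbit X) : Set.range Z.ι.hom.left = Z.carrier := by
  refine (Scheme.IdealSheafData.range_subschemeι _).trans ?_
  simp

instance (Z : ClosedOrbit X) : AlgebraicGeometry.IsReduced Z.toGSch.X.left :=
  isReduced_vanishingIdeal Z.carrier

def SimpleSubchain.openIncl (W : SimpleSubchain X) : W.U.toGSch ⟶ W.toGSch :=
  openSubLift W.carrier W.isStable W.U.ι (by
    refine (Scheme.Opens.range_ι W.U.carrier).le.trans ?_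
    rw [W.coe_carrier]
    exact Set.subset_union_left)

def SimpleSubchain.closedIncl (W : SimpleSubchain X) : W.Z.toGSch ⟶ W.toGSch :=
  openSubLift W.carrier W.isStable W.Z.ι (by
    rw [ClosedOrbit.range_ι, W.coe_carrier]
    exact Set.subset_union_right)

def orbitRestrict (l : ClosedOrbit X') (i : ClosedOrbit X)
    (h : (l.carrier : Set X'.X.left) ⊆ ν.hom.left ⁻¹' i.carrier) : l.toGSch ⟶ i.toGSch :=
  closedSubLift i.carrier i.isOrbit.isStable (l.ι ≫ ν) (by
    rintro _ ⟨p, rfl⟩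
    exact h (l.range_ι.le ⟨p, rfl⟩))

lemma SimpleSubchain.openIncl_ι_assoc (W : SimpleSubchain X') :
    W.openIncl ≫ W.ι ≫ ν = W.U.ι ≫ ν :=
  (Category.assoc _ _ _).symm.trans (congr_arg (· ≫ ν) (openSubLift_ι W.carrier W.isStable W.U.ι _))

lemma SimpleSubchain.closedIncl_ι_assoc (W : SimpleSubchain X') :
    W.closedIncl ≫ W.ι ≫ ν = W.Z.ι ≫ ν :=
  (Category.assoc _ _ _).symm.trans (congr_arg (· ≫ ν) (openSubLift_ι W.carrier W.isStable W.Z.ι _))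

lemma orbitRestrict_ι (l : ClosedOrbit X') (i : ClosedOrbit X)
    (h : (l.carrier : Set X'.X.left) ⊆ ν.hom.left ⁻¹' i.carrier) :
    orbitRestrict ν l i h ≫ i.ι = l.ι ≫ ν :=
  closedSubLift_ι i.carrier i.isOrbit.isStable (l.ι ≫ ν) _

/-- The diagram of `G`-schemes indexed by `Γ`: inclusions and restrictions of `ν`. -/
@[simps]
def chainDiagram : Vertex ν ⥤q GSch G where
  obj
    | .openOrbit j => j.toGSch
    | .simple W => W.toGSch
    | .normClosed l => l.toGSch
    | .closed i => i.toGSch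
  map
    | .openIncl W => W.openIncl
    | .closedIncl W => W.closedIncl
    | .restrict l i h => orbitRestrict ν l i h

/-- The maps from the schemes in the diagram to `X`. -/
def chainCocone : (v : Vertex ν) → ((chainDiagram ν).obj v ⟶ X)
  | .openOrbit j => j.ι ≫ ν
  | .simple W => W.ι ≫ ν
  | .normClosed l => l.ι ≫ ν
  | .closed i => i.ι

lemma chainCocone_comm {v w : Vertex ν} (e : v ⟶ w) :
    (chainDiagram ν).map e ≫ chainCocone ν w = chainCocone ν v := by
  change Arrow ν v w at e
  cases e with
  | openIncl W => exact W.openIncl_ι_assoc ν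
  | closedIncl W => exact W.closedIncl_ι_assoc ν
  | restrict l i h => exact orbitRestrict_ι ν l i h

/-- The functor from `Vect^G(X)` to the 2-limit of the categories `Vect^G(-)` of the diagram. -/
def chainComparison : VectG X ⥤
    GraphLimit (fun v : Vertex ν => VectG ((chainDiagram ν).obj v))
      (fun e => VectG.pullback ((chainDiagram ν).map e)) :=
  VectG.toGraphLimit (chainDiagram ν) (chainCocone ν) (chainCocone_comm ν)

end Diagram
end Chains
end
end EquivariantChain

open EquivariantChain

/-!
Let `ν : X' ⟶ X` be the normalization of a weakly normal `G`-chain.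

*Orbits.* The orbits are constructible, and every closed point lies on one; as there are finitely many
orbits, they cover `X` (`exists_isOrbit_mem`). By dimension, the generic points of `X` lie on the open
orbits and not on the closed ones, so the open orbits are dense. The map `ν` is an isomorphism over
a dense open subset, so it is one over each open orbit: the locus over which a morphism is an
isomorphism satisfies flat descent, and the action `G × X ⟶ X` spreads it over the whole orbit
(`IsOrbit.isIso_morphismRestrict`). The local rings of `X'` are domains, so a point of a closed orbit of
`X'` is the specialization of only one generic point; this singles out the open orbit adjacent to it
(`ClosedOrbit.exists_simpleSubchain`, `SimpleSubchain.eq_of_Z_eq`).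

*Functions.* Let `U` be the union of the open orbits of `X`. On an affine open subset, consider the
functions on `X'` such that, for each closed orbit `Z` of `X`, the restrictions to the closed orbits of
`X'` over `Z` are the pullbacks of one function on `Z`. Adjoining to the functions on `X` all functions on `X'` that vanish outside of `ν⁻¹(U)`
defines a scheme that is finite, birational and bijective over `X`. Weak normality says that it is
`X`, hence functions on `X'` vanishing outside of `ν⁻¹(U)` come from `X`
(`IsWeaklyNormal.exists_app_eq`). It follows that the functions above are exactly the functions on `X`
(`IsWeaklyNormal.exists_function`). Since `X'` is covered by the open orbits and the simple chains
of `X'`, the functions on `X` are the compatible families of functions on the vertices of the diagram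
(`isGluing_chain`). This is a finite limit, so it is preserved by the flat projections to `X` from
`G × X` and `G × G × X` (`SchemeCocone.IsGluing.of_flat`).

*Bundles.* As soon as functions are glued from the diagram, so are sections of vector bundles; this
gives full faithfulness. The sections of a compatible family of vector bundles form a sheaf of modules
on `X`, and it is a vector bundle inducing the family if the family has local bases
(`IsGluing.glue_isVectorBundle`). The action of `G` is an isomorphism between bundles on `G × X`
satisfying an identity on `G × G × X`, and it glues by full faithfulness on these products
(`toGraphLimit_isEquivalence`).

*Local bases.* A family on the diagram glues first to a bundle `E` on `X'`, along an open covering. Near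
a point of a closed orbit `Z` of `X` there remain `E` and a bundle `C` on `Z`, identified on the closed
orbits of `X'` over `Z`. A basis of `E` near the finite fibre and a basis of `C` differ there by
invertible matrices. Since the closed orbits of `X'` are disjoint, these lift to a matrix of functions on
`X'` that is invertible near the fibre; changing the basis of `E` by it makes the two bases compatible
(`exists_isBasisOn_compatible`, `hasLocalBases_chain`).
-/

namespace EquivariantChain

noncomputable section

/-! ### Sections of modules and their pullbacks -/

section Sections
variable {X Y Z W : Scheme.{u}}

/-- Restriction of sections of a sheaf of modules. -/
def res (M : X.Modules) {U V : X.Opens} (h : V ≤ U) : Γ(M, U) →+ Γ(M, V) :=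
  (M.presheaf.map (homOfLE h).op).hom

/-- Restriction of functions. -/
def resF {U V : X.Opens} (h : V ≤ U) : Γ(X, U) →+* Γ(X, V) :=
  (X.presheaf.map (homOfLE h).op).hom

@[simp] lemma res_self (M : X.Modules) {U : X.Opens} (h : U ≤ U) (s : Γ(M, U)) : res M h s = s := by
  simp [res]

@[simp] lemma res_res (M : X.Modules) {U V W : X.Opens} (h : V ≤ U) (h' : W ≤ V) (s : Γ(M, U)) :
    res M h' (res M h s) = res M (h'.trans h) s := by
  have : (homOfLE (h'.trans h)).op = (homOfLE h).op ≫ (homOfLE h').op := rfl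
  simp [res, this]

@[simp] lemma resF_self {U : X.Opens} (h : U ≤ U) (s : Γ(X, U)) : resF h s = s := by
  simp [resF]

@[simp] lemma resF_resF {U V W : X.Opens} (h : V ≤ U) (h' : W ≤ V) (s : Γ(X, U)) :
    resF h' (resF h s) = resF (h'.trans h) s := by
  have : (homOfLE (h'.trans h)).op = (homOfLE h).op ≫ (homOfLE h').op := rfl
  simp [resF, this]

lemma res_smul (M : X.Modules) {U V : X.Opens} (h : V ≤ U) (r : Γ(X, U)) (s : Γ(M, U)) :
    res M h (r • s) = resF h r • res M h s :=
  Scheme.Modules.map_smul _ _ _ _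

lemma app_res {M N : X.Modules} (φ : M ⟶ N) {U V : X.Opens} (h : V ≤ U) (s : Γ(M, U)) :
    φ.app V (res M h s) = res N h (φ.app U s) :=
  congr($(φ.mapPresheaf.naturality (homOfLE h).op) s)

lemma comp_app_apply {M N K : X.Modules} (φ : M ⟶ N) (ψ : N ⟶ K) {U : X.Opens} (s : Γ(M, U)) :
    (φ ≫ ψ).app U s = ψ.app U (φ.app U s) := rfl

@[simp] lemma hom_inv_app_apply {M N : X.Modules} (e : M ≅ N) {U : X.Opens} (s : Γ(M, U)) :
    e.inv.app U (e.hom.app U s) = s := by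
  rw [← comp_app_apply, e.hom_inv_id]
  rfl

@[simp] lemma inv_hom_app_apply {M N : X.Modules} (e : M ≅ N) {U : X.Opens} (s : Γ(N, U)) :
    e.hom.app U (e.inv.app U s) = s :=
  hom_inv_app_apply e.symm s

lemma app_sum_smul {M N : X.Modules} (φ : M ⟶ N) {U : X.Opens} {I : Type*} (t : Finset I)
    (a : I → Γ(X, U)) (s : I → Γ(M, U)) :
    φ.app U (∑ i ∈ t, a i • s i) = ∑ i ∈ t, a i • φ.app U (s i) := by
  rw [map_sum]
  exact Finset.sum_congr rfl fun i _ => φ.app_smul _ _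

/-- The pullback of functions `Γ(Y, V) → Γ(X, W)` along `f`, where `f` maps `W` to `V`. -/
def pbF (f : X ⟶ Y) {V : Y.Opens} {W : X.Opens} (h : W ≤ f ⁻¹ᵁ V) : Γ(Y, V) →+* Γ(X, W) :=
  (f.appLE V W h).hom

/-- The section of `f^* M` over `W` defined by a section of `M` over `V`, where `f` maps `W` to
`V`. -/
def pb (f : X ⟶ Y) (M : Y.Modules) {V : Y.Opens} {W : X.Opens} (h : W ≤ f ⁻¹ᵁ V) :
    Γ(M, V) →+ Γ((Scheme.Modules.pullback f).obj M, W) :=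
  (res _ h).comp (((Scheme.Modules.pullbackPushforwardAdjunction f).unit.app M).app V).hom

lemma pb_smul (f : X ⟶ Y) (M : Y.Modules) {V : Y.Opens} {W : X.Opens} (h : W ≤ f ⁻¹ᵁ V)
    (r : Γ(Y, V)) (s : Γ(M, V)) : pb f M h (r • s) = pbF f h r • pb f M h s := by
  have h1 := ((Scheme.Modules.pullbackPushforwardAdjunction f).unit.app M).app_smul r s
  change res _ h (((Scheme.Modules.pullbackPushforwardAdjunction f).unit.app M).app V (r • s)) = _
  rw [h1]
  exact res_smul _ h (f.app V r) _

@[simp] lemma res_pb (f : X ⟶ Y) (M : Y.Modules) {V : Y.Opens} {W W' : X.Opens} (h : W ≤ f ⁻¹ᵁ V)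
    (h' : W' ≤ W) (s : Γ(M, V)) : res _ h' (pb f M h s) = pb f M (h'.trans h) s := by
  simp [pb]

@[simp] lemma pb_res (f : X ⟶ Y) (M : Y.Modules) {V V' : Y.Opens} {W : X.Opens} (h : W ≤ f ⁻¹ᵁ V')
    (h' : V' ≤ V) (s : Γ(M, V)) :
    pb f M h (res M h' s) = pb f M (h.trans (f.preimage_mono h')) s := by
  have := app_res ((Scheme.Modules.pullbackPushforwardAdjunction f).unit.app M) h' s
  refine (congr_arg (res _ h) this).trans ?_
  exact res_res _ (f.preimage_mono h') h _

lemma map_pb (f : X ⟶ Y) {M N : Y.Modules} (φ : M ⟶ N) {V : Y.Opens} {W : X.Opens}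
    (h : W ≤ f ⁻¹ᵁ V) (s : Γ(M, V)) :
    ((Scheme.Modules.pullback f).map φ).app W (pb f M h s) = pb f N h (φ.app V s) := by
  have := (Scheme.Modules.pullbackPushforwardAdjunction f).unit.naturality φ
  have := congr($(congr_arg (fun t => Scheme.Modules.Hom.app t V) this) s)
  change _ = res _ h (((Scheme.Modules.pullbackPushforwardAdjunction f).unit.app N).app V (φ.app V s))
  change ((Scheme.Modules.pullbackPushforwardAdjunction f).unit.app N).app V (φ.app V s) = _ at this
  rw [this]
  exact app_res ((Scheme.Modules.pullback f).map φ) h _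

lemma pb_self (f : X ⟶ Y) (M : Y.Modules) {V : Y.Opens} (s : Γ(M, V)) :
    pb f M (le_refl (f ⁻¹ᵁ V)) s =
      ((Scheme.Modules.pullbackPushforwardAdjunction f).unit.app M).app V s :=
  res_self _ _ _

/-- Morphisms out of `f^* M` are determined by their values on pulled back sections. -/
lemma pullback_hom_ext (f : X ⟶ Y) {M : Y.Modules} {N : X.Modules}
    {φ ψ : (Scheme.Modules.pullback f).obj M ⟶ N}
    (h : ∀ (V : Y.Opens) (s : Γ(M, V)), φ.app (f ⁻¹ᵁ V) (pb f M le_rfl s) =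
      ψ.app (f ⁻¹ᵁ V) (pb f M le_rfl s)) : φ = ψ := by
  apply ((Scheme.Modules.pullbackPushforwardAdjunction f).homEquiv _ _).injective
  apply Scheme.Modules.hom_ext
  intro V
  ext s
  have := h V s
  rw [pb_self] at this
  rw [Adjunction.homEquiv_unit, Adjunction.homEquiv_unit]
  exact this

lemma pullbackComp_inv_pb (f : X ⟶ Y) (g : Y ⟶ Z) (M : Z.Modules) {U : Z.Opens} (s : Γ(M, U)) :
    ((Scheme.Modules.pullbackComp f g).inv.app M).app (f ⁻¹ᵁ g ⁻¹ᵁ U)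
      (pb (f ≫ g) M (le_refl ((f ≫ g) ⁻¹ᵁ U)) s) =
      pb f ((Scheme.Modules.pullback g).obj M) (V := g ⁻¹ᵁ U) le_rfl (pb g M le_rfl s) := by
  have h := unit_conjugateEquiv
    ((Scheme.Modules.pullbackPushforwardAdjunction g).comp
      (Scheme.Modules.pullbackPushforwardAdjunction f))
    (Scheme.Modules.pullbackPushforwardAdjunction (f ≫ g)) (Scheme.Modules.pullbackComp f g).inv M
  rw [Scheme.Modules.conjugateEquiv_pullbackComp_inv] at h
  rw [Adjunction.comp_unit_app] at h
  have h' : ∀ s : Γ(M, U), _ := fun s =>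
    ConcreteCategory.congr_hom (congr_arg (fun t => Scheme.Modules.Hom.app t U) h) s
  simp only [Scheme.Modules.Hom.comp_app, Scheme.Modules.pushforward_map_app,
    Scheme.Modules.pushforwardComp_hom_app_app] at h'
  rw [pb_self, pb_self, pb_self]
  exact (h' s).symm

lemma pullIso_hom_pb {f : X ⟶ Y} {g : Y ⟶ Z} {h : X ⟶ Z} (e : f ≫ g = h) (M : Z.Modules)
    {U : Z.Opens} {V : Y.Opens} {W : X.Opens} (hV : V ≤ g ⁻¹ᵁ U) (hW : W ≤ f ⁻¹ᵁ V) (s : Γ(M, U)) :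
    (pullIso e M).hom.app W (pb f _ hW (pb g M hV s)) =
      pb h M (hW.trans ((f.preimage_mono hV).trans (by subst e; rfl))) s := by
  subst e
  have h1 := congr_arg (((Scheme.Modules.pullbackComp f g).hom.app M).app _)
    (pullbackComp_inv_pb f g M s)
  have h2 := inv_hom_app_apply ((Scheme.Modules.pullbackComp f g).app M)
    (U := f ⁻¹ᵁ g ⁻¹ᵁ U) (pb (f ≫ g) M (le_refl ((f ≫ g) ⁻¹ᵁ U)) s)
  have h3 : (pullIso (rfl : f ≫ g = f ≫ g) M).hom = (Scheme.Modules.pullbackComp f g).hom.app M := by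
    simp [pullIso, Scheme.Modules.pullbackCongr]
  have h1 := h1.symm.trans h2
  have h4 : pb g M hV s = res _ hV (pb g M le_rfl s) := by simp
  rw [h3, h4, pb_res, ← res_pb f _ (le_refl (f ⁻¹ᵁ g ⁻¹ᵁ U)) (hW.trans (f.preimage_mono hV)),
    app_res, h1]
  exact res_pb (f ≫ g) M le_rfl _ s

lemma pullIso_inv_pb {f : X ⟶ Y} {g : Y ⟶ Z} {h : X ⟶ Z} (e : f ≫ g = h) (M : Z.Modules)
    {U : Z.Opens} {V : Y.Opens} {W : X.Opens} (hV : V ≤ g ⁻¹ᵁ U) (hW : W ≤ f ⁻¹ᵁ V)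
    (hW' : W ≤ h ⁻¹ᵁ U) (s : Γ(M, U)) :
    (pullIso e M).inv.app W (pb h M hW' s) = pb f _ hW (pb g M hV s) := by
  rw [← pullIso_hom_pb e M hV hW]
  exact hom_inv_app_apply _ _

end Sections

section Bases
variable {X Y Z W : Scheme.{u}}

/-! ### Gluing of sections -/

lemma section_ext (M : X.Modules) {U : X.Opens} {s t : Γ(M, U)}
    (h : ∀ x ∈ U, ∃ (V : X.Opens) (hV : V ≤ U), x ∈ V ∧ res M hV s = res M hV t) : s = t := by
  choose V hV hx hs using h
  refine TopCat.Sheaf.eq_of_locally_eq' ⟨M.presheaf, M.isSheaf⟩ (fun x : U => V x.1 x.2) U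
    (fun x => homOfLE (hV x.1 x.2)) ?_ _ _ (fun x => hs x.1 x.2)
  intro x hxU
  exact TopologicalSpace.Opens.mem_iSup.mpr ⟨⟨x, hxU⟩, hx x hxU⟩

lemma section_glue (M : X.Modules) {U : X.Opens} {I : Type*} (V : I → X.Opens) (hV : ∀ i, V i ≤ U)
    (hcov : ∀ x ∈ U, ∃ i, x ∈ V i) (s : ∀ i, Γ(M, V i))
    (hs : ∀ i j, res M (inf_le_left : V i ⊓ V j ≤ V i) (s i) =
      res M (inf_le_right : V i ⊓ V j ≤ V j) (s j)) :
    ∃ t : Γ(M, U), ∀ i, res M (hV i) t = s i := by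
  obtain ⟨t, ht, -⟩ := TopCat.Sheaf.existsUnique_gluing' ⟨M.presheaf, M.isSheaf⟩ V U
    (fun i => homOfLE (hV i)) (fun x hx => TopologicalSpace.Opens.mem_iSup.mpr (hcov x hx)) s hs
  exact ⟨t, ht⟩

lemma function_ext {U : X.Opens} {s t : Γ(X, U)}
    (h : ∀ x ∈ U, ∃ (V : X.Opens) (hV : V ≤ U), x ∈ V ∧ resF hV s = resF hV t) : s = t := by
  choose V hV hx hs using h
  refine TopCat.Sheaf.eq_of_locally_eq' X.sheaf (fun x : U => V x.1 x.2) U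
    (fun x => homOfLE (hV x.1 x.2)) ?_ _ _ (fun x => hs x.1 x.2)
  intro x hxU
  exact TopologicalSpace.Opens.mem_iSup.mpr ⟨⟨x, hxU⟩, hx x hxU⟩

lemma function_glue {U : X.Opens} {I : Type*} (V : I → X.Opens) (hV : ∀ i, V i ≤ U)
    (hcov : ∀ x ∈ U, ∃ i, x ∈ V i) (s : ∀ i, Γ(X, V i))
    (hs : ∀ i j, resF (inf_le_left : V i ⊓ V j ≤ V i) (s i) =
      resF (inf_le_right : V i ⊓ V j ≤ V j) (s j)) :
    ∃ t : Γ(X, U), ∀ i, resF (hV i) t = s i := by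
  obtain ⟨t, ht, -⟩ := TopCat.Sheaf.existsUnique_gluing' X.sheaf V U
    (fun i => homOfLE (hV i)) (fun x hx => TopologicalSpace.Opens.mem_iSup.mpr (hcov x hx)) s hs
  exact ⟨t, ht⟩

/-! ### Local bases -/

/-- The sections `e` form a basis of `M` over `U`: they induce an isomorphism of `𝒪_U ^ I` with the
restriction of `M` to `U`. -/
def IsBasisOn {I : Type*} [Fintype I] (M : X.Modules) {U : X.Opens} (e : I → Γ(M, U)) : Prop :=
  ∀ (V : X.Opens) (h : V ≤ U),
    Function.Bijective (fun a : I → Γ(X, V) => ∑ i, a i • res M h (e i))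

variable {I : Type*} [Fintype I]

lemma IsBasisOn.res {M : X.Modules} {U V : X.Opens} {e : I → Γ(M, U)} (he : IsBasisOn M e)
    (h : V ≤ U) : IsBasisOn M (fun i => res M h (e i)) := by
  intro W hW
  simpa using he W (hW.trans h)

lemma IsBasisOn.congr {M : X.Modules} {U : X.Opens} {e e' : I → Γ(M, U)} (he : IsBasisOn M e)
    (h : ∀ i, e i = e' i) : IsBasisOn M e' := by
  obtain rfl : e = e' := funext h
  exact he

lemma IsBasisOn.existsUnique {M : X.Modules} {U V : X.Opens} {e : I → Γ(M, U)}
    (he : IsBasisOn M e) (h : V ≤ U) (s : Γ(M, V)) :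
    ∃! a : I → Γ(X, V), ∑ i, a i • EquivariantChain.res M h (e i) = s :=
  (he V h).existsUnique s

lemma res_sum_smul (M : X.Modules) {U V : X.Opens} (h : V ≤ U) (a : I → Γ(X, U))
    (e : I → Γ(M, U)) : res M h (∑ i, a i • e i) = ∑ i, resF h (a i) • res M h (e i) := by
  rw [map_sum]
  exact Finset.sum_congr rfl fun i _ => res_smul _ _ _ _

lemma pb_sum_smul (f : X ⟶ Y) (M : Y.Modules) {V : Y.Opens} {W : X.Opens} (h : W ≤ f ⁻¹ᵁ V)
    (a : I → Γ(Y, V)) (e : I → Γ(M, V)) :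
    pb f M h (∑ i, a i • e i) = ∑ i, pbF f h (a i) • pb f M h (e i) := by
  rw [map_sum]
  exact Finset.sum_congr rfl fun i _ => pb_smul _ _ _ _ _

/-- Being a basis is a local property. -/
lemma IsBasisOn.of_local {M : X.Modules} {U : X.Opens} {e : I → Γ(M, U)}
    (h : ∀ x ∈ U, ∃ (V : X.Opens) (hV : V ≤ U), x ∈ V ∧
      IsBasisOn M (fun i => EquivariantChain.res M hV (e i))) : IsBasisOn M e := by
  choose V hV hx hb using h
  intro W hW
  constructor
  · intro a b hab
    funext i
    refine function_ext fun x hxW => ⟨W ⊓ V x (hW hxW), inf_le_left, ⟨hxW, hx x (hW hxW)⟩, ?_⟩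
    have := (hb x (hW hxW) (W ⊓ V x (hW hxW)) inf_le_right).injective
      (a₁ := fun i => resF inf_le_left (a i)) (a₂ := fun i => resF inf_le_left (b i)) (by
        have := congr_arg (EquivariantChain.res M (inf_le_left : W ⊓ V x (hW hxW) ≤ W)) hab
        simpa only [res_sum_smul, res_res] using this)
    exact congr_fun this i
  · intro s
    have hs (x : W) := (hb x.1 (hW x.2)).existsUnique (inf_le_right : W ⊓ V x.1 (hW x.2) ≤ _)
      (EquivariantChain.res M inf_le_left s)
    choose a ha ha' using hs
    have key (i : I) := function_glue (fun x : W => W ⊓ V x.1 (hW x.2)) (fun x => inf_le_left)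
      (fun x hxW => ⟨⟨x, hxW⟩, hxW, hx x (hW hxW)⟩) (fun x => a x i) (by
        intro x y
        set D := (W ⊓ V x.1 (hW x.2)) ⊓ (W ⊓ V y.1 (hW y.2)) with hD
        have hDx : D ≤ V x.1 (hW x.2) := inf_le_left.trans inf_le_right
        have := (hb x.1 (hW x.2) D hDx).injective
          (a₁ := fun i => resF inf_le_left (a x i)) (a₂ := fun i => resF inf_le_right (a y i)) (by
            have h1 := congr_arg (EquivariantChain.res M (inf_le_left : D ≤ _)) (ha x)
            have h2 := congr_arg (EquivariantChain.res M (inf_le_right : D ≤ _)) (ha y)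
            simp only [res_sum_smul, res_res] at h1 h2 ⊢
            rw [h1, h2])
        exact congr_fun this i)
    choose b hb' using key
    refine ⟨b, section_ext M fun x hxW => ⟨W ⊓ V x (hW hxW), inf_le_left, ⟨hxW, hx x _⟩, ?_⟩⟩
    have := ha ⟨x, hxW⟩
    simp only [res_sum_smul, res_res] at this ⊢
    rw [← this]
    exact Finset.sum_congr rfl fun i _ => by rw [← hb' i ⟨x, hxW⟩]

lemma IsBasisOn.map_iso {M N : X.Modules} {U : X.Opens} {e : I → Γ(M, U)} (he : IsBasisOn M e)
    (φ : M ≅ N) : IsBasisOn N (fun i => φ.hom.app U (e i)) := by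
  intro V hV
  have h1 : Function.Bijective (φ.hom.app V) :=
    ⟨Function.LeftInverse.injective (g := φ.inv.app V) fun s => hom_inv_app_apply _ _,
      Function.RightInverse.surjective (g := φ.inv.app V) fun s => inv_hom_app_apply _ _⟩
  convert h1.comp (he V hV) using 1
  funext a
  simp [app_res]

/-- A morphism mapping a local basis to a local basis, locally on `X`, is an isomorphism. -/
lemma isIso_of_isBasisOn {M N : X.Modules} (φ : M ⟶ N)
    (h : ∀ x : X, ∃ (U : X.Opens) (n : ℕ) (e : ULift.{u} (Fin n) → Γ(M, U)), x ∈ U ∧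
      IsBasisOn M e ∧ IsBasisOn N (fun i => φ.app U (e i))) : IsIso φ := by
  choose U n e hx he he' using h
  have hb (x : X) (V : X.Opens) (hV : V ≤ U x) : Function.Bijective (φ.app V) := by
    refine ((he x V hV).of_comp_iff _).mp ?_
    convert he' x V hV using 1
    funext a
    simp [app_res]
  rw [Scheme.Modules.Hom.isIso_iff_isIso_app]
  intro V
  rw [ConcreteCategory.isIso_iff_bijective]
  constructor
  · intro s t hst
    refine section_ext M fun x hxV => ⟨V ⊓ U x, inf_le_left, ⟨hxV, hx x⟩, ?_⟩
    apply (hb x _ inf_le_right).injective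
    rw [app_res, app_res]
    exact congr_arg _ hst
  · intro t
    choose s hs using fun x : X => (hb x (V ⊓ U x) inf_le_right).surjective
      (res N inf_le_left t)
    obtain ⟨s', hs'⟩ := section_glue M (fun x : X => V ⊓ U x) (fun x => inf_le_left)
      (fun x hxV => ⟨x, hxV, hx x⟩) s (by
        intro x y
        apply (hb x _ (inf_le_left.trans inf_le_right)).injective
        rw [app_res, app_res, hs, hs, res_res, res_res])
    refine ⟨s', section_ext N fun x hxV => ⟨V ⊓ U x, inf_le_left, ⟨hxV, hx x⟩, ?_⟩⟩
    rw [← app_res, hs', hs]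

/-! ### Free modules -/

/-- The structure sheaf, as a sheaf of modules. -/
def unitMod (X : Scheme.{u}) : X.Modules := SheafOfModules.unit X.ringCatSheaf

/-- The free sheaf of modules on a set `J`. -/
def freeMod (X : Scheme.{u}) (J : Type u) : X.Modules := SheafOfModules.free (R := X.ringCatSheaf) J

/-- The canonical sections of a free module. -/
def freeBasis (X : Scheme.{u}) (J : Type u) (U : X.Opens) (j : J) : Γ(freeMod X J, U) :=
  (SheafOfModules.freeSection (R := X.ringCatSheaf) j).val (.op U)

/-- The section of the structure sheaf, as a module, given by a function. -/
def unitSec {U : X.Opens} (r : Γ(X, U)) : Γ(unitMod X, U) := r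

/-- The inclusion of the `j`-th summand into a free module. -/
def freeIncl (X : Scheme.{u}) {J : Type u} (j : J) : unitMod X ⟶ freeMod X J :=
  SheafOfModules.ιFree j

lemma unitSec_eq {U : X.Opens} (r : Γ(X, U)) : unitSec r = r • unitSec (1 : Γ(X, U)) :=
  (_root_.mul_one r).symm

lemma res_unitSec {U V : X.Opens} (h : V ≤ U) (r : Γ(X, U)) :
    res (unitMod X) h (unitSec r) = unitSec (resF h r) := rfl

lemma freeIncl_app {J : Type u} (j : J) (U : X.Opens) (r : Γ(X, U)) :
    (freeIncl X j).app U (unitSec r) = r • freeBasis X J U j := by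
  rw [unitSec_eq, Scheme.Modules.Hom.app_smul]
  rfl

lemma res_freeBasis {J : Type u} (j : J) {U V : X.Opens} (h : V ≤ U) :
    res _ h (freeBasis X J U j) = freeBasis X J V j :=
  (SheafOfModules.freeSection (R := X.ringCatSheaf) j).property (homOfLE h).op

/-- The morphism from a free module given by global sections. -/
def ofSections (M : X.Modules) {J : Type u} (e : J → Γ(M, (⊤ : X.Opens))) : freeMod X J ⟶ M :=
  (SheafOfModules.freeHomEquiv M).symm fun j =>
    { val := fun _ => res M le_top (e j)
      property := fun _ => res_res M _ _ _ }

lemma ofSections_freeBasis (M : X.Modules) {J : Type u} (e : J → Γ(M, (⊤ : X.Opens)))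
    (U : X.Opens) (j : J) :
    (ofSections M e).app U (freeBasis X J U j) = res M le_top (e j) := by
  have := SheafOfModules.sectionsMap_freeHomEquiv_symm_freeSection (M := M)
    (fun j => { val := fun _ => res M le_top (e j), property := fun _ => res_res M _ _ _ }) j
  exact congr_arg (fun t => t.val (.op U)) this

lemma free_hom_ext {M : X.Modules} {J : Type u} {φ ψ : freeMod X J ⟶ M}
    (h : ∀ j, φ.app ⊤ (freeBasis X J ⊤ j) = ψ.app ⊤ (freeBasis X J ⊤ j)) : φ = ψ := by
  apply (SheafOfModules.freeHomEquiv M).injective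
  funext j
  ext U
  have := congr_arg (res M (le_top : U.unop ≤ ⊤)) (h j)
  rw [← app_res, ← app_res, res_freeBasis] at this
  exact this

lemma sum_app {M N : X.Modules} {J : Type*} (t : Finset J) (φ : J → (M ⟶ N)) (U : X.Opens)
    (s : Γ(M, U)) : (∑ j ∈ t, φ j).app U s = ∑ j ∈ t, (φ j).app U s := by
  classical
  induction t using Finset.induction_on with
  | empty => simp
  | insert a t ha ih =>
    rw [Finset.sum_insert ha, Finset.sum_insert ha, ← ih]
    rfl

/-- The standard sections of a free module form a basis over every open set. -/
lemma freeBasis_isBasisOn (X : Scheme.{u}) (J : Type u) [Fintype J] (U : X.Opens) :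
    IsBasisOn (freeMod X J) (freeBasis X J U) := by
  classical
  intro V hV
  simp only [res_freeBasis]
  let π (j : J) : freeMod X J ⟶ unitMod X :=
    ofSections (unitMod X) fun i => unitSec (if i = j then 1 else 0)
  have hπ (i j : J) : (π j).app V (freeBasis X J V i) = unitSec (if i = j then 1 else 0) := by
    rw [ofSections_freeBasis]
    rw [res_unitSec]
    split_ifs <;> simp
  have hsum : ∑ j, π j ≫ freeIncl X j = 𝟙 (freeMod X J) := by
    apply free_hom_ext
    intro i
    rw [sum_app]
    have (j : J) : (π j ≫ freeIncl X j).app ⊤ (freeBasis X J ⊤ i) =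
        if i = j then freeBasis X J ⊤ i else 0 := by
      rw [comp_app_apply, ofSections_freeBasis, res_self, freeIncl_app]
      split_ifs with h
      · rw [h, one_smul]
      · rw [zero_smul]
    rw [Finset.sum_congr rfl fun j _ => this j]
    simp
  have hc (a : J → Γ(X, V)) (j : J) : (π j).app V (∑ i, a i • freeBasis X J V i) = unitSec (a j) := by
    rw [app_sum_smul]
    simp only [hπ]
    rw [Finset.sum_eq_single j]
    · rw [if_pos rfl, ← unitSec_eq]
    · intro i _ hij
      rw [if_neg hij]
      exact MulZeroClass.mul_zero (a i)
    · simp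
  constructor
  · intro a b hab
    funext j
    have := congr_arg ((π j).app V) hab
    rw [hc, hc] at this
    exact this
  · intro s
    refine ⟨fun j => (π j).app V s, ?_⟩
    have := congr_arg (fun t => Scheme.Modules.Hom.app t V s) hsum
    dsimp only at this
    rw [sum_app] at this
    refine Eq.trans ?_ this
    refine Finset.sum_congr rfl fun j _ => ?_
    rw [comp_app_apply]
    exact (freeIncl_app j V _).symm

/-- A global basis identifies a module with a free module. -/
lemma IsBasisOn.isIso_ofSections {M : X.Modules} {J : Type u} [Fintype J]
    {e : J → Γ(M, (⊤ : X.Opens))} (he : IsBasisOn M e) : IsIso (ofSections M e) := by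
  rw [Scheme.Modules.Hom.isIso_iff_isIso_app]
  intro V
  rw [ConcreteCategory.isIso_iff_bijective]
  refine ((freeBasis_isBasisOn X J ⊤ V le_top).of_comp_iff _).mp ?_
  convert he V le_top using 1
  funext a
  simp [app_res, ofSections_freeBasis]

/-- The isomorphism of a free module with a module that has a global basis. -/
def IsBasisOn.freeIso {M : X.Modules} {J : Type u} [Fintype J]
    {e : J → Γ(M, (⊤ : X.Opens))} (he : IsBasisOn M e) : freeMod X J ≅ M :=
  haveI := he.isIso_ofSections
  asIso (ofSections M e)

lemma IsBasisOn.freeIso_hom_freeBasis {M : X.Modules} {J : Type u} [Fintype J]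
    {e : J → Γ(M, (⊤ : X.Opens))} (he : IsBasisOn M e) (j : J) :
    he.freeIso.hom.app ⊤ (freeBasis X J ⊤ j) = e j :=
  (ofSections_freeBasis M e ⊤ j).trans (res_self _ _ _)

lemma pullFree_hom_pb (f : X ⟶ Y) {J : Type u} (j : J) :
    Scheme.Modules.Hom.app (X := X) (M := (Scheme.Modules.pullback f).obj (freeMod Y J))
      (N := freeMod X J) (pullFree f J).hom ⊤
      (pb f (freeMod Y J) (show (⊤ : X.Opens) ≤ f ⁻¹ᵁ ⊤ from le_rfl) (freeBasis Y J ⊤ j)) = freeBasis X J ⊤ j := by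
  have := opens_map_final f
  have : (SheafOfModules.pushforward.{u} f.toRingCatSheafHom).IsRightAdjoint :=
    (Scheme.Modules.pullbackPushforwardAdjunction f).isRightAdjoint
  have h := SheafOfModules.pullback_map_ιFree_comp_pullbackObjFreeIso_hom f.toRingCatSheafHom j
  have h1 : freeBasis Y J ⊤ j = (freeIncl Y j).app ⊤ (unitSec 1) := rfl
  rw [h1, ← map_pb]
  have h2 := congr_arg (fun t : (Scheme.Modules.pullback f).obj (unitMod Y) ⟶ freeMod X J =>
    t.app ⊤ (pb f (unitMod Y) (le_refl (f ⁻¹ᵁ ⊤)) (unitSec 1))) h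
  refine h2.trans ?_
  change (freeIncl X j).app ⊤ (Scheme.Modules.Hom.app (X := X)
    (M := (Scheme.Modules.pullback f).obj (unitMod Y)) (N := unitMod X)
    (SheafOfModules.pullbackObjUnitToUnit f.toRingCatSheafHom) ⊤ _) = _
  have h3 : Scheme.Modules.Hom.app (X := X)
    (M := (Scheme.Modules.pullback f).obj (unitMod Y)) (N := unitMod X)
    (SheafOfModules.pullbackObjUnitToUnit f.toRingCatSheafHom) ⊤
      (pb f (unitMod Y) (le_refl (f ⁻¹ᵁ ⊤)) (unitSec 1)) = unitSec 1 := by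
    have h4 := SheafOfModules.pullbackPushforwardAdjunction_homEquiv_pullbackObjUnitToUnit
      f.toRingCatSheafHom
    rw [pb_self]
    rw [Adjunction.homEquiv_unit] at h4
    have h5 := congr_arg (fun t : unitMod Y ⟶ (Scheme.Modules.pushforward f).obj (unitMod X) =>
      t.app ⊤ (unitSec 1)) h4
    refine h5.trans ?_
    exact map_one (f.app ⊤).hom
  rw [h3, freeIncl_app, one_smul]

/-- The canonical sections of a free module pull back to a basis. -/
lemma pb_freeBasis_isBasisOn (f : X ⟶ Y) (J : Type u) [Fintype J] :
    IsBasisOn ((Scheme.Modules.pullback f).obj (freeMod Y J)) (U := (⊤ : X.Opens))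
      (fun j => pb f (freeMod Y J) (show (⊤ : X.Opens) ≤ f ⁻¹ᵁ ⊤ from le_rfl) (freeBasis Y J ⊤ j)) := by
  have h := (freeBasis_isBasisOn X J ⊤).map_iso
    ((pullFree f J).symm : freeMod X J ≅ (Scheme.Modules.pullback f).obj (freeMod Y J))
  refine h.congr fun j => Eq.symm ?_
  rw [← pullFree_hom_pb f j]
  exact (hom_inv_app_apply (M := (Scheme.Modules.pullback f).obj (freeMod Y J))
    (N := freeMod X J) (pullFree f J) _).symm

lemma IsBasisOn.pb_top (f : X ⟶ Y) {M : Y.Modules} {J : Type u} [Fintype J]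
    {e : J → Γ(M, (⊤ : Y.Opens))} (he : IsBasisOn M e) :
    IsBasisOn ((Scheme.Modules.pullback f).obj M) (U := (⊤ : X.Opens))
      (fun j => pb f M (show (⊤ : X.Opens) ≤ f ⁻¹ᵁ ⊤ from le_rfl) (e j)) := by
  have h := (pb_freeBasis_isBasisOn f J).map_iso ((Scheme.Modules.pullback f).mapIso he.freeIso)
  refine h.congr fun j => ?_
  refine (map_pb f he.freeIso.hom _ _).trans ?_
  rw [he.freeIso_hom_freeBasis]

/-! ### Open immersions -/

lemma res_bijective_of_eq (M : X.Modules) {U V : X.Opens} (h : V ≤ U) (e : V = U) :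
    Function.Bijective (res M h) := by
  subst e
  rw [show ⇑(res M h) = id from funext (res_self M h)]
  exact Function.bijective_id

lemma pb_bijective (j : X ⟶ Y) [IsOpenImmersion j] (M : Y.Modules) {V : Y.Opens}
    (hV : V ≤ j.opensRange) {W : X.Opens} (h : W = j ⁻¹ᵁ V) :
    Function.Bijective (pb j M h.le) := by
  subst h
  have h1 := (Scheme.Modules.restrictAdjunction j).unit_leftAdjointUniq_hom_app
    (Scheme.Modules.pullbackPushforwardAdjunction j) M
  have h2 (s : Γ(M, V)) : pb j M (le_refl (j ⁻¹ᵁ V)) s =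
      ((Scheme.Modules.restrictFunctorIsoPullback j).hom.app M).app (j ⁻¹ᵁ V)
        (((Scheme.Modules.restrictAdjunction j).unit.app M).app V s) := by
    rw [pb_self]
    exact ConcreteCategory.congr_hom (congr_arg (fun t => Scheme.Modules.Hom.app t V) h1).symm s
  have h3 : Function.Bijective (((Scheme.Modules.restrictFunctorIsoPullback j).hom.app M).app
      (j ⁻¹ᵁ V)) := (ConcreteCategory.isIso_iff_bijective _).mp inferInstance
  have h4 : Function.Bijective (((Scheme.Modules.restrictAdjunction j).unit.app M).app V) := by
    rw [Scheme.Modules.restrictAdjunction_unit_app_app]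
    have : j ''ᵁ j ⁻¹ᵁ V = V := by
      rw [Scheme.Hom.image_preimage_eq_opensRange_inf, inf_eq_right.mpr hV]
    exact res_bijective_of_eq M _ this
  refine Eq.mpr (congr_arg Function.Bijective (funext h2)) (h3.comp h4)

lemma pbF_bijective (j : X ⟶ Y) [IsOpenImmersion j] {V : Y.Opens}
    (hV : V ≤ j.opensRange) {W : X.Opens} (h : W = j ⁻¹ᵁ V) :
    Function.Bijective (pbF j h.le) := by
  subst h
  have : IsIso (j.app V) := j.isIso_app V hV
  change Function.Bijective (j.appLE V (j ⁻¹ᵁ V) le_rfl)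
  rw [← Scheme.Hom.app_eq_appLE]
  exact (ConcreteCategory.isIso_iff_bijective _).mp inferInstance

lemma resF_pbF (f : X ⟶ Y) {V : Y.Opens} {W W' : X.Opens} (h : W ≤ f ⁻¹ᵁ V)
    (h' : W' ≤ W) (s : Γ(Y, V)) : resF h' (pbF f h s) = pbF f (h'.trans h) s :=
  ConcreteCategory.congr_hom (f.appLE_map h (homOfLE h').op) s

lemma pbF_resF (f : X ⟶ Y) {V V' : Y.Opens} {W : X.Opens} (h : W ≤ f ⁻¹ᵁ V')
    (h' : V' ≤ V) (s : Γ(Y, V)) :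
    pbF f h (resF h' s) = pbF f (h.trans (f.preimage_mono h')) s :=
  ConcreteCategory.congr_hom (f.map_appLE h (homOfLE h').op) s

lemma pbF_pbF {f : X ⟶ Y} {g : Y ⟶ Z} {h : X ⟶ Z} (e : f ≫ g = h)
    {U : Z.Opens} {V : Y.Opens} {W : X.Opens} (hV : V ≤ g ⁻¹ᵁ U) (hW : W ≤ f ⁻¹ᵁ V) (s : Γ(Z, U)) :
    pbF f hW (pbF g hV s) =
      pbF h (hW.trans ((f.preimage_mono hV).trans (by subst e; rfl))) s := by
  subst e
  exact ConcreteCategory.congr_hom (Scheme.Hom.appLE_comp_appLE f g U V W hV hW) s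

/-- Bases over an open subset contained in the range of an open immersion can be detected after
pulling back. -/
lemma isBasisOn_pb_iff (j : X ⟶ Y) [IsOpenImmersion j] (M : Y.Modules) {V : Y.Opens}
    (hV : V ≤ j.opensRange) {W : X.Opens} (h : W = j ⁻¹ᵁ V) {J : Type*} [Fintype J]
    (e : J → Γ(M, V)) :
    IsBasisOn ((Scheme.Modules.pullback j).obj M) (fun i => pb j M h.le (e i)) ↔
      IsBasisOn M e := by
  subst h
  have key (V' : Y.Opens) (h' : V' ≤ V) :
      Function.Bijective (fun a : J → Γ(X, j ⁻¹ᵁ V') =>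
        ∑ i, a i • res _ (j.preimage_mono h') (pb j M (le_refl (j ⁻¹ᵁ V)) (e i))) ↔
      Function.Bijective (fun a : J → Γ(Y, V') => ∑ i, a i • res M h' (e i)) := by
    have h1 := pb_bijective j M (h'.trans hV) (rfl : j ⁻¹ᵁ V' = _)
    have h2 : Function.Bijective (fun (a : J → Γ(Y, V')) i => pbF j (le_refl (j ⁻¹ᵁ V')) (a i)) :=
      (pbF_bijective j (h'.trans hV) rfl).comp_left
    rw [← h2.of_comp_iff, ← h1.of_comp_iff' (fun a : J → Γ(Y, V') => ∑ i, a i • res M h' (e i))]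
    have : (pb j M (le_refl (j ⁻¹ᵁ V'))) ∘ (fun a : J → Γ(Y, V') => ∑ i, a i • res M h' (e i)) =
        (fun a : J → Γ(X, j ⁻¹ᵁ V') =>
          ∑ i, a i • res _ (j.preimage_mono h') (pb j M (le_refl (j ⁻¹ᵁ V)) (e i))) ∘
          (fun (a : J → Γ(Y, V')) i => pbF j (le_refl (j ⁻¹ᵁ V')) (a i)) := by
      funext a
      simp only [Function.comp_apply, pb_sum_smul, res_pb, pb_res]
    rw [this]
  constructor
  · intro H V' h'
    exact (key V' h').mp (H (j ⁻¹ᵁ V') (j.preimage_mono h'))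
  · intro H W' hW'
    have h' : j ''ᵁ W' ≤ V := (j.image_mono hW').trans (j.image_preimage_le V)
    have h2 := (key (j ''ᵁ W') h').mpr (H _ h')
    have h3 : j ⁻¹ᵁ j ''ᵁ W' = W' := j.preimage_image_eq W'
    generalize_proofs at h2
    revert h2
    generalize j ⁻¹ᵁ j ''ᵁ W' = D at *
    intro h2
    subst h3
    exact h2

lemma isBasisOn_pullIso_iff {f : X ⟶ Y} {g : Y ⟶ Z} {h : X ⟶ Z} (e : f ≫ g = h) (M : Z.Modules)
    {U : Z.Opens} {V : Y.Opens} {W : X.Opens} (hV : V ≤ g ⁻¹ᵁ U) (hW : W ≤ f ⁻¹ᵁ V)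
    (hW' : W ≤ h ⁻¹ᵁ U) (s : I → Γ(M, U)) :
    IsBasisOn ((Scheme.Modules.pullback f).obj ((Scheme.Modules.pullback g).obj M))
      (fun j => pb f _ hW (pb g M hV (s j))) ↔
    IsBasisOn ((Scheme.Modules.pullback h).obj M) (fun j => pb h M hW' (s j)) :=
  ⟨fun H => (H.map_iso (pullIso e M)).congr fun j => pullIso_hom_pb e M hV hW (s j),
    fun H => (H.map_iso (pullIso e M).symm).congr fun j => pullIso_inv_pb e M hV hW hW' (s j)⟩

lemma IsBasisOn.pb_aux {j : Z ⟶ X} [IsOpenImmersion j] {i : W ⟶ Y} [IsOpenImmersion i]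
    {g : Z ⟶ W} {f : X ⟶ Y} {h : Z ⟶ Y} (hg : g ≫ i = h) (hj : j ≫ f = h) {M : Y.Modules}
    {J : Type u} [Fintype J] {V : Y.Opens} (hV : V ≤ i.opensRange) (hiV : ⊤ = i ⁻¹ᵁ V)
    {e : J → Γ(M, V)} (he : IsBasisOn M e) {U : X.Opens} (hU : U ≤ j.opensRange)
    (hjU : ⊤ = j ⁻¹ᵁ U) (hUV : U ≤ f ⁻¹ᵁ V) :
    IsBasisOn ((Scheme.Modules.pullback f).obj M) (fun k => EquivariantChain.pb f M hUV (e k)) := by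
  have hh : (⊤ : Z.Opens) ≤ h ⁻¹ᵁ V := by
    subst hg
    exact fun x _ => hiV.le (Set.mem_univ (g x))
  rw [← isBasisOn_pb_iff j _ hU hjU, isBasisOn_pullIso_iff hj M hUV hjU.le hh,
    ← isBasisOn_pullIso_iff hg M hiV.le (show (⊤ : Z.Opens) ≤ g ⁻¹ᵁ ⊤ from le_rfl) hh]
  exact ((isBasisOn_pb_iff i M hV hiV e).mpr he).pb_top g

/-- A basis over `V` pulls back to a basis over any open set mapping to `V`. -/
lemma IsBasisOn.pb (f : X ⟶ Y) {M : Y.Modules} {J : Type u} [Fintype J] {V : Y.Opens}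
    {e : J → Γ(M, V)} (he : IsBasisOn M e) {W : X.Opens} (h : W ≤ f ⁻¹ᵁ V) :
    IsBasisOn ((Scheme.Modules.pullback f).obj M) (fun j => EquivariantChain.pb f M h (e j)) := by
  obtain ⟨g, hg⟩ : ∃ g : W.toScheme ⟶ V.toScheme, g ≫ V.ι = W.ι ≫ f :=
    ⟨_, IsOpenImmersion.lift_fac V.ι (W.ι ≫ f) (by
      rintro _ ⟨x, rfl⟩
      exact (Scheme.Opens.range_ι V).ge (h x.2))⟩
  exact IsBasisOn.pb_aux hg rfl (by simp) (by simp) he (by simp) (by simp) h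

/-! ### Vector bundles -/

/-- A vector bundle is a module with local bases. -/
lemma isVectorBundle_iff {M : X.Modules} : IsVectorBundle M ↔
    ∀ x : X, ∃ (U : X.Opens) (n : ℕ) (e : ULift.{u} (Fin n) → Γ(M, U)), x ∈ U ∧
      IsBasisOn M e := by
  refine forall_congr' fun x => ⟨?_, ?_⟩
  · rintro ⟨U, hx, n, ⟨φ⟩⟩
    have h1 := (freeBasis_isBasisOn U.toScheme (ULift.{u} (Fin n)) ⊤).map_iso
      (show freeMod U.toScheme (ULift.{u} (Fin n)) ≅ (Scheme.Modules.pullback U.ι).obj M from φ.symm)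
    choose e he using fun i => (pb_bijective U.ι M (V := U) (by simp) (W := ⊤) (by simp)).surjective
      (Scheme.Modules.Hom.app (X := U.toScheme) (M := freeMod U.toScheme (ULift.{u} (Fin n)))
        (N := (Scheme.Modules.pullback U.ι).obj M) φ.inv ⊤ (freeBasis _ _ _ i))
    refine ⟨U, n, e, hx, (isBasisOn_pb_iff U.ι M (by simp) (W := ⊤) (by simp) e).mp ?_⟩
    simp only [he]
    exact h1
  · rintro ⟨U, n, e, hx, he⟩
    refine ⟨U, hx, n, ⟨?_⟩⟩
    have h1 := (isBasisOn_pb_iff U.ι M (by simp) (W := ⊤) (by simp) e).mpr he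
    exact h1.freeIso.symm

end Bases

section Descent
variable {X Y Z W : Scheme.{u}}

/-! ### Descent of modules along a cocone of schemes -/

/-- A morphism of modules given by its effect on sections. -/
def homOfSections (M N : X.Modules) (φ : ∀ U : X.Opens, Γ(M, U) → Γ(N, U))
    (hadd : ∀ U s t, φ U (s + t) = φ U s + φ U t)
    (hsmul : ∀ (U : X.Opens) (r : Γ(X, U)) (s : Γ(M, U)), φ U (r • s) = r • φ U s)
    (hres : ∀ (U V : X.Opens) (h : V ≤ U) (s : Γ(M, U)), φ V (res M h s) = res N h (φ U s)) :
    M ⟶ N :=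
  SheafOfModules.Hom.mk (PresheafOfModules.homMk
    { app := fun U => AddCommGrpCat.ofHom (AddMonoidHom.mk' (φ U.unop) (hadd U.unop))
      naturality := fun U V f => by
        ext s
        exact hres U.unop V.unop f.unop.le s } fun U r s => hsmul U.unop r s)

lemma pbF_self (f : X ⟶ Y) {V : Y.Opens} (r : Γ(Y, V)) :
    pbF f (le_refl (f ⁻¹ᵁ V)) r = f.app V r := by
  simp [pbF, Scheme.Hom.app_eq_appLE]

/-- A diagram of schemes indexed by a graph with vertices `V` and arrows `E`, with a cocone to
`P`. -/
structure SchemeCocone (P : Scheme.{u}) where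
  V : Type u
  E : Type u
  s : E → V
  t : E → V
  F : V → Scheme.{u}
  f (e : E) : F (s e) ⟶ F (t e)
  p (v : V) : F v ⟶ P
  w (e : E) : f e ≫ p (t e) = p (s e)

/-- The morphisms `φ : p^* M ⟶ p^* N` and `ψ : q^* M ⟶ q^* N` agree, for `q = f ≫ p`. -/
def HomCompat {f : X ⟶ Y} {p : Y ⟶ Z} {q : X ⟶ Z} (w : f ≫ p = q) {M N : Z.Modules}
    (φ : (Scheme.Modules.pullback p).obj M ⟶ (Scheme.Modules.pullback p).obj N)
    (ψ : (Scheme.Modules.pullback q).obj M ⟶ (Scheme.Modules.pullback q).obj N) : Prop :=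
  (pullIso w M).hom ≫ ψ = (Scheme.Modules.pullback f).map φ ≫ (pullIso w N).hom

/-- The pullback of `ψ` along `p` is `φ`. -/
def MapEq (p : X ⟶ Y) {M N : Y.Modules} (ψ : M ⟶ N)
    (φ : (Scheme.Modules.pullback p).obj M ⟶ (Scheme.Modules.pullback p).obj N) : Prop :=
  (Scheme.Modules.pullback p).map ψ = φ

/-- The pullbacks of `φ` and `ψ` along `p` agree. -/
def PullbackEq (p : X ⟶ Y) {M N : Y.Modules} (φ ψ : M ⟶ N) : Prop :=
  (Scheme.Modules.pullback p).map φ = (Scheme.Modules.pullback p).map ψ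

/-- The morphisms `ε : p^* M ⟶ N` and `ε' : q^* M ⟶ N'` agree under `α : f^* N ⟶ N'`, for
`q = f ≫ p`. -/
def CounitCompat {f : X ⟶ Y} {p : Y ⟶ Z} {q : X ⟶ Z} (w : f ≫ p = q) {M : Z.Modules}
    {N : Y.Modules} {N' : X.Modules} (ε : (Scheme.Modules.pullback p).obj M ⟶ N)
    (ε' : (Scheme.Modules.pullback q).obj M ⟶ N') (α : (Scheme.Modules.pullback f).obj N ⟶ N') :
    Prop :=
  (Scheme.Modules.pullback f).map ε ≫ α = (pullIso w M).hom ≫ ε'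

namespace SchemeCocone
variable {P : Scheme.{u}} (D : SchemeCocone P)

lemma preimage_le (e : D.E) (W : P.Opens) :
    D.p (D.s e) ⁻¹ᵁ W ≤ D.f e ⁻¹ᵁ D.p (D.t e) ⁻¹ᵁ W := by
  rw [← D.w e]
  exact le_rfl

/-- Functions on open subsets of `P` are determined by their pullbacks to the diagram. -/
def IsSeparating : Prop :=
  ∀ (W : P.Opens) (a b : Γ(P, W)),
    (∀ v, pbF (D.p v) (le_refl (D.p v ⁻¹ᵁ W)) a = pbF (D.p v) le_rfl b) → a = b

/-- Functions on open subsets of `P` are the compatible families of functions on the diagram, i.e.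
`P` is the colimit of the diagram as far as functions are concerned. -/
def IsGluing : Prop :=
  D.IsSeparating ∧ ∀ (W : P.Opens) (c : ∀ v, Γ(D.F v, D.p v ⁻¹ᵁ W)),
    (∀ e, pbF (D.f e) (D.preimage_le e W) (c (D.t e)) = c (D.s e)) →
      ∃ a : Γ(P, W), ∀ v, pbF (D.p v) le_rfl a = c v

/-- A family of modules on a diagram of schemes, with transition isomorphisms. -/
structure Family where
  A (v : D.V) : (D.F v).Modules
  α (e : D.E) : (Scheme.Modules.pullback (D.f e)).obj (A (D.t e)) ≅ A (D.s e)

variable {D}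

/-- Families of sections compatible with the transition isomorphisms. -/
def Family.Compatible (A : D.Family) {W : P.Opens} (a : ∀ v, Γ(A.A v, D.p v ⁻¹ᵁ W)) : Prop :=
  ∀ e, (A.α e).hom.app _ (pb (D.f e) (A.A (D.t e)) (D.preimage_le e W) (a (D.t e))) = a (D.s e)

variable (D) in
/-- The family obtained from a module by pullback. -/
def pullFamily (N : P.Modules) : D.Family where
  A v := (Scheme.Modules.pullback (D.p v)).obj N
  α e := pullIso (D.w e) N

lemma pullFamily_compatible (N : P.Modules) {W : P.Opens} (n : Γ(N, W)) :
    (D.pullFamily N).Compatible (fun v => pb (D.p v) N (le_refl (D.p v ⁻¹ᵁ W)) n) :=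
  fun e => pullIso_hom_pb (D.w e) N _ _ n

lemma Family.Compatible.res {A : D.Family} {W W' : P.Opens} {a : ∀ v, Γ(A.A v, D.p v ⁻¹ᵁ W)}
    (ha : A.Compatible a) (h : W' ≤ W) :
    A.Compatible (fun v => EquivariantChain.res _ ((D.p v).preimage_mono h) (a v)) := by
  intro e
  have := congr_arg (EquivariantChain.res _ ((D.p (D.s e)).preimage_mono h)) (ha e)
  rw [← app_res, res_pb] at this
  rw [pb_res]
  exact this

lemma Family.Compatible.smul {A : D.Family} {W : P.Opens} {a : ∀ v, Γ(A.A v, D.p v ⁻¹ᵁ W)}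
    (ha : A.Compatible a) (r : Γ(P, W)) :
    A.Compatible (fun v => pbF (D.p v) (le_refl (D.p v ⁻¹ᵁ W)) r • a v) := by
  intro e
  rw [pb_smul, Scheme.Modules.Hom.app_smul, ha e, pbF_pbF (D.w e)]

lemma Family.Compatible.add {A : D.Family} {W : P.Opens} {a b : ∀ v, Γ(A.A v, D.p v ⁻¹ᵁ W)}
    (ha : A.Compatible a) (hb : A.Compatible b) : A.Compatible (fun v => a v + b v) := by
  intro e
  rw [map_add, map_add, ha e, hb e]

/-- Over a gluing cocone, if the family `A` has a compatible family of bases then every compatible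
family of sections is a unique linear combination of it. -/
lemma IsGluing.exists_coeff (hD : D.IsGluing) {A : D.Family} {I : Type*} [Fintype I]
    {U W : P.Opens} {b : I → ∀ v, Γ(A.A v, D.p v ⁻¹ᵁ U)} (hb : ∀ i, A.Compatible (b i))
    (hb' : ∀ v, IsBasisOn (A.A v) (fun i => b i v)) (h : W ≤ U)
    {a : ∀ v, Γ(A.A v, D.p v ⁻¹ᵁ W)} (ha : A.Compatible a) :
    ∃ c : I → Γ(P, W), ∀ v, a v = ∑ i, pbF (D.p v) (le_refl (D.p v ⁻¹ᵁ W)) (c i) •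
      EquivariantChain.res _ ((D.p v).preimage_mono h) (b i v) := by
  choose c hc hc' using fun v => (hb' v).existsUnique ((D.p v).preimage_mono h) (a v)
  have key (i : I) := hD.2 W (fun v => c v i) (fun e => by
    refine congr_fun (hc' (D.s e) (fun i => pbF (D.f e) (D.preimage_le e W) (c (D.t e) i)) ?_) i
    rw [← ha e]
    dsimp only
    rw [← hc (D.t e), pb_sum_smul, app_sum_smul]
    refine Finset.sum_congr rfl fun i _ => ?_
    rw [((hb i).res h) e])
  choose d hd using key
  refine ⟨d, fun v => ?_⟩
  rw [← hc v]
  exact Finset.sum_congr rfl fun i _ => by rw [hd i v]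

lemma IsSeparating.section_ext (hD : D.IsSeparating) {N : P.Modules} (hN : IsVectorBundle N)
    {W : P.Opens} {a b : Γ(N, W)}
    (h : ∀ v, pb (D.p v) N (le_refl (D.p v ⁻¹ᵁ W)) a = pb (D.p v) N le_rfl b) : a = b := by
  refine EquivariantChain.section_ext N fun x hx => ?_
  obtain ⟨U, n, e, hxU, he⟩ := isVectorBundle_iff.mp hN x
  refine ⟨W ⊓ U, inf_le_left, ⟨hx, hxU⟩, ?_⟩
  obtain ⟨c, hc⟩ := (he _ (inf_le_right : W ⊓ U ≤ U)).surjective (EquivariantChain.res N inf_le_left a)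
  obtain ⟨d, hd⟩ := (he _ (inf_le_right : W ⊓ U ≤ U)).surjective (EquivariantChain.res N inf_le_left b)
  dsimp only at hc hd
  rw [← hc, ← hd]
  refine Finset.sum_congr rfl fun i _ => ?_
  congr 1
  refine hD _ _ _ fun v => ?_
  have h1 := congr_arg (EquivariantChain.res _ ((D.p v).preimage_mono (inf_le_left : W ⊓ U ≤ W))) (h v)
  rw [res_pb, res_pb] at h1
  rw [← pb_res (D.p v) N (le_refl (D.p v ⁻¹ᵁ (W ⊓ U))) inf_le_left a,
    ← pb_res (D.p v) N (le_refl (D.p v ⁻¹ᵁ (W ⊓ U))) inf_le_left b, ← hc, ← hd, pb_sum_smul,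
    pb_sum_smul] at h1
  have h2 := (he.pb (D.p v) ((D.p v).preimage_mono (inf_le_right : W ⊓ U ≤ U))) _ le_rfl
  refine congr_fun (h2.injective (a₁ := fun i => pbF (D.p v) le_rfl (c i))
    (a₂ := fun i => pbF (D.p v) le_rfl (d i)) ?_) i
  simpa only [res_self, pb_res] using h1

/-- Over a gluing cocone, the sections of a vector bundle are the compatible families of sections of
its pullbacks. -/
lemma IsGluing.exists_section (hD : D.IsGluing) {N : P.Modules} (hN : IsVectorBundle N)
    {W : P.Opens} {a : ∀ v, Γ((Scheme.Modules.pullback (D.p v)).obj N, D.p v ⁻¹ᵁ W)}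
    (ha : (D.pullFamily N).Compatible a) :
    ∃ n : Γ(N, W), ∀ v, pb (D.p v) N (le_refl (D.p v ⁻¹ᵁ W)) n = a v := by
  choose U k e hxU he using isVectorBundle_iff.mp hN
  have key (x : P) : ∃ n : Γ(N, W ⊓ U x), ∀ v, pb (D.p v) N (le_refl (D.p v ⁻¹ᵁ (W ⊓ U x))) n =
      EquivariantChain.res _ ((D.p v).preimage_mono inf_le_left) (a v) := by
    obtain ⟨c, hc⟩ := hD.exists_coeff (A := D.pullFamily N)
      (fun i => (pullFamily_compatible N (D := D) (e x i)))
      (fun v => (he x).pb (D.p v) le_rfl) (inf_le_right : W ⊓ U x ≤ U x) (ha.res inf_le_left)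
    refine ⟨∑ i, c i • EquivariantChain.res N inf_le_right (e x i), fun v => ?_⟩
    refine Eq.trans ?_ (hc v).symm
    rw [pb_sum_smul]
    refine Finset.sum_congr rfl fun i _ => congr_arg _ ?_
    rw [pb_res]
    exact (res_pb _ _ _ _ _).symm
  choose n hn using key
  obtain ⟨m, hm⟩ := section_glue N (fun x : W => W ⊓ U x) (fun _ => inf_le_left)
    (fun x hx => ⟨⟨x, hx⟩, hx, hxU x⟩) (fun x => n x) (by
      intro x y
      refine hD.1.section_ext hN fun v => ?_
      rw [pb_res, pb_res]
      have h1 := congr_arg (EquivariantChain.res _ ((D.p v).preimage_mono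
        (inf_le_left : (W ⊓ U x) ⊓ (W ⊓ U y) ≤ _))) (hn x v)
      have h2 := congr_arg (EquivariantChain.res _ ((D.p v).preimage_mono
        (inf_le_right : (W ⊓ U x) ⊓ (W ⊓ U y) ≤ _))) (hn y v)
      rw [res_pb, res_res] at h1 h2
      rw [h1, h2])
  refine ⟨m, fun v => EquivariantChain.section_ext _ fun x hx =>
    ⟨D.p v ⁻¹ᵁ (W ⊓ U (D.p v x)), (D.p v).preimage_mono inf_le_left, ⟨hx, hxU _⟩, ?_⟩⟩
  rw [← hn, res_pb, ← hm ⟨D.p v x, hx⟩, pb_res]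

lemma IsSeparating.hom_ext (hD : D.IsSeparating) {M N : P.Modules} (hN : IsVectorBundle N)
    {φ ψ : M ⟶ N} (h : ∀ v, PullbackEq (D.p v) φ ψ) : φ = ψ := by
  apply Scheme.Modules.hom_ext
  intro U
  ext s
  refine hD.section_ext hN fun v => ?_
  rw [← map_pb, ← map_pb, show (Scheme.Modules.pullback (D.p v)).map φ =
    (Scheme.Modules.pullback (D.p v)).map ψ from h v]

/-- Over a gluing cocone, morphisms of vector bundles are compatible families of morphisms of the
pullbacks. -/
lemma IsGluing.exists_hom (hD : D.IsGluing) {M N : P.Modules} (hN : IsVectorBundle N)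
    (φ : ∀ v, (Scheme.Modules.pullback (D.p v)).obj M ⟶ (Scheme.Modules.pullback (D.p v)).obj N)
    (hφ : ∀ e, HomCompat (D.w e) (φ (D.t e)) (φ (D.s e))) :
    ∃ ψ : M ⟶ N, ∀ v, MapEq (D.p v) ψ (φ v) := by
  have hc (U : P.Opens) (m : Γ(M, U)) := hD.exists_section hN (W := U)
    (a := fun v => (φ v).app _ (pb (D.p v) M le_rfl m)) (by
      intro e
      have h1 := pullIso_hom_pb (D.w e) M le_rfl (D.preimage_le e U) m
      have h2 := ConcreteCategory.congr_hom (congr_arg (fun t => Scheme.Modules.Hom.app t _) (hφ e))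
        (pb (D.f e) _ (D.preimage_le e U) (pb (D.p (D.t e)) M (le_refl (D.p (D.t e) ⁻¹ᵁ U)) m))
      rw [Scheme.Modules.Hom.comp_app, Scheme.Modules.Hom.comp_app] at h2
      change (φ _).app _ ((pullIso (D.w e) M).hom.app _ _) =
        (pullIso (D.w e) N).hom.app _ (((Scheme.Modules.pullback (D.f e)).map _).app _ _) at h2
      rw [map_pb, h1] at h2
      exact h2.symm)
  choose ψ hψ using hc
  let Ψ : M ⟶ N := homOfSections M N ψ
    (fun U s t => hD.1.section_ext hN fun v => by simp only [hψ, map_add])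
    (fun U r s => hD.1.section_ext hN fun v => by
      rw [pb_smul, hψ, hψ, pb_smul, Scheme.Modules.Hom.app_smul])
    (fun U U' h s => hD.1.section_ext hN fun v => by
      have := congr_arg (EquivariantChain.res _ ((D.p v).preimage_mono h)) (hψ U s v)
      rw [res_pb, ← app_res, res_pb] at this
      rw [hψ, pb_res, pb_res, this])
  refine ⟨Ψ, fun v => (pullback_hom_ext _ fun U s => by
  rw [map_pb]
  exact hψ U s v : (Scheme.Modules.pullback (D.p v)).map Ψ = φ v)⟩

/-! ### The descended module -/

/-- The compatible families of sections over an open subset of `P`. -/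
def Family.sections (A : D.Family) (W : P.Opens) : AddSubgroup (∀ v, Γ(A.A v, D.p v ⁻¹ᵁ W)) where
  carrier := {a | A.Compatible a}
  add_mem' ha hb := ha.add hb
  zero_mem' e := by
    change (A.α e).hom.app _ (pb _ _ _ 0) = 0
    rw [map_zero, map_zero]
  neg_mem' {a} ha e := by
    change (A.α e).hom.app _ (pb _ _ _ (-(a _))) = -(a _)
    rw [map_neg, map_neg, ha e]

instance Family.sectionsModule (A : D.Family) (W : P.Opens) : Module Γ(P, W) (A.sections W) where
  smul r a := ⟨fun v => pbF (D.p v) (le_refl (D.p v ⁻¹ᵁ W)) r • a.1 v, a.2.smul r⟩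
  one_smul a := Subtype.ext (funext fun v => by
    change pbF _ _ (1 : Γ(P, W)) • a.1 v = a.1 v
    rw [map_one, one_smul])
  mul_smul r s a := Subtype.ext (funext fun v => by
    change pbF _ le_rfl (r * s) • a.1 v = pbF (D.p v) (le_refl (D.p v ⁻¹ᵁ W)) r • pbF (D.p v)
      (le_refl (D.p v ⁻¹ᵁ W)) s • a.1 v
    rw [map_mul, SemigroupAction.mul_smul])
  smul_zero r := Subtype.ext (funext fun v =>
    smul_zero (A := Γ(A.A v, D.p v ⁻¹ᵁ W)) (pbF (D.p v) (le_refl (D.p v ⁻¹ᵁ W)) r))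
  smul_add r a b := Subtype.ext (funext fun v =>
    smul_add (pbF (D.p v) (le_refl (D.p v ⁻¹ᵁ W)) r) (a.1 v) (b.1 v))
  add_smul r s a := Subtype.ext (funext fun v => by
    change pbF (D.p v) (le_refl (D.p v ⁻¹ᵁ W)) (r + s) • a.1 v =
      pbF (D.p v) (le_refl (D.p v ⁻¹ᵁ W)) r • a.1 v + pbF (D.p v) (le_refl (D.p v ⁻¹ᵁ W)) s • a.1 v
    rw [map_add, add_smul])
  zero_smul a := Subtype.ext (funext fun v => by
    change pbF _ _ (0 : Γ(P, W)) • a.1 v = 0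
    rw [map_zero, zero_smul])

/-- Restriction of compatible families of sections. -/
def Family.resSections (A : D.Family) {W W' : P.Opens} (h : W' ≤ W) :
    A.sections W →+ A.sections W' where
  toFun a := ⟨fun v => EquivariantChain.res _ ((D.p v).preimage_mono h) (a.1 v), a.2.res h⟩
  map_zero' := Subtype.ext (funext fun v => map_zero _)
  map_add' a b := Subtype.ext (funext fun v => map_add _ _ _)

lemma Family.resSections_self (A : D.Family) {W : P.Opens} (h : W ≤ W) :
    A.resSections h = AddMonoidHom.id _ :=
  AddMonoidHom.ext fun a => Subtype.ext (funext fun v => res_self (A.A v) _ (a.1 v))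

lemma Family.resSections_comp (A : D.Family) {W W' W'' : P.Opens} (h : W' ≤ W) (h' : W'' ≤ W') :
    A.resSections (h'.trans h) = (A.resSections h').comp (A.resSections h) :=
  AddMonoidHom.ext fun a => Subtype.ext (funext fun v => (res_res (A.A v) _ _ (a.1 v)).symm)

lemma Family.resSections_smul (A : D.Family) {W W' : P.Opens} (h : W' ≤ W) (r : Γ(P, W))
    (a : A.sections W) : A.resSections h (r • a) = resF h r • A.resSections h a :=
  Subtype.ext (funext fun v => (res_smul _ _ (pbF (D.p v) le_rfl r) (a.1 v)).trans
    (congr_arg (· • EquivariantChain.res (A.A v) ((D.p v).preimage_mono h) (a.1 v))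
      ((resF_pbF _ _ _ _).trans (pbF_resF _ le_rfl h r).symm)))

/-- The presheaf of compatible families of sections. -/
def Family.presheaf (A : D.Family) : TopCat.Presheaf Ab P where
  obj W := AddCommGrpCat.of (A.sections W.unop)
  map {W W'} f := AddCommGrpCat.ofHom (A.resSections f.unop.le)
  map_id W := congr_arg AddCommGrpCat.ofHom (A.resSections_self _)
  map_comp f g := congr_arg AddCommGrpCat.ofHom (A.resSections_comp f.unop.le g.unop.le)

lemma Family.presheaf_isSheaf (A : D.Family) : A.presheaf.IsSheaf := by
  rw [TopCat.Presheaf.IsSheaf, CategoryTheory.Presheaf.isSheaf_iff_isSheaf_forget _ _ (forget Ab)]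
  refine TopCat.Presheaf.isSheaf_of_isSheafUniqueGluing_types _ fun J U a ha => ?_
  change ∀ j, A.sections (U j) at a
  have hU (j : J) : U j ≤ iSup U := le_iSup U j
  have key (v : D.V) := section_glue (A.A v) (fun j => D.p v ⁻¹ᵁ U j)
    (U := D.p v ⁻¹ᵁ iSup U) (fun j => (D.p v).preimage_mono (hU j))
    (fun x hx => by
      obtain ⟨j, hj⟩ := TopologicalSpace.Opens.mem_iSup.mp hx
      exact ⟨j, hj⟩) (fun j => (a j).1 v) (fun i j => congr_fun (congr_arg Subtype.val (ha i j)) v)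
  choose b hb using key
  have hbc : A.Compatible b := by
    intro e
    refine EquivariantChain.section_ext _ fun x hx => ?_
    obtain ⟨j, hj⟩ := TopologicalSpace.Opens.mem_iSup.mp hx
    refine ⟨D.p (D.s e) ⁻¹ᵁ U j, (D.p (D.s e)).preimage_mono (hU j), hj, ?_⟩
    rw [hb, ← (a j).2 e, ← hb, ← app_res, res_pb, pb_res]
  refine ⟨⟨b, hbc⟩, fun j => Subtype.ext (funext fun v => hb v j), fun c hc => ?_⟩
  change A.sections (iSup U) at c
  refine Subtype.ext (funext fun v => EquivariantChain.section_ext _ fun x hx => ?_)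
  obtain ⟨j, hj⟩ := TopologicalSpace.Opens.mem_iSup.mp hx
  refine ⟨D.p v ⁻¹ᵁ U j, (D.p v).preimage_mono (hU j), hj, ?_⟩
  exact (congr_fun (congr_arg Subtype.val (hc j)) v).trans (hb v j).symm

/-- The module on `P` of compatible families of sections. -/
def Family.glue (A : D.Family) : P.Modules :=
  letI (W : P.Opensᵒᵖ) : Module (P.ringCatSheaf.obj.obj W) (A.presheaf.obj W) :=
    A.sectionsModule W.unop
  SheafOfModules.mk (PresheafOfModules.ofPresheaf (R := P.ringCatSheaf.obj) A.presheaf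
    (fun {W W'} f r a => A.resSections_smul f.unop.le r a))
    A.presheaf_isSheaf

/-- The components of a section of the glued module. -/
def Family.comp (A : D.Family) (W : P.Opens) (a : Γ(A.glue, W)) (v : D.V) :
    Γ(A.A v, D.p v ⁻¹ᵁ W) :=
  Subtype.val (p := fun a => a ∈ A.sections W) a v

variable (A : D.Family) {W : P.Opens}

lemma Family.comp_compatible (a : Γ(A.glue, W)) : A.Compatible (A.comp W a) :=
  Subtype.prop (p := fun a => a ∈ A.sections W) a

lemma Family.comp_add (a b : Γ(A.glue, W)) (v : D.V) :
    A.comp W (a + b) v = A.comp W a v + A.comp W b v := rfl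

lemma Family.comp_smul (r : Γ(P, W)) (a : Γ(A.glue, W)) (v : D.V) :
    A.comp W (r • a) v = pbF (D.p v) (le_refl (D.p v ⁻¹ᵁ W)) r • A.comp W a v := rfl

lemma Family.comp_res {W' : P.Opens} (h : W' ≤ W) (a : Γ(A.glue, W)) (v : D.V) :
    A.comp W' (EquivariantChain.res _ h a) v =
      EquivariantChain.res _ ((D.p v).preimage_mono h) (A.comp W a v) := rfl

/-- The section of the glued module given by a compatible family. -/
def Family.Compatible.toSection {A : D.Family} {a : ∀ v, Γ(A.A v, D.p v ⁻¹ᵁ W)}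
    (ha : A.Compatible a) : Γ(A.glue, W) := (⟨a, ha⟩ : A.sections W)

lemma Family.Compatible.comp_toSection {A : D.Family} {a : ∀ v, Γ(A.A v, D.p v ⁻¹ᵁ W)}
    (ha : A.Compatible a) (v : D.V) : A.comp W ha.toSection v = a v := rfl

lemma Family.glue_ext {a b : Γ(A.glue, W)} (h : ∀ v, A.comp W a v = A.comp W b v) : a = b :=
  Subtype.ext (p := fun a => a ∈ A.sections W) (funext h)

lemma Family.comp_sum_smul {I : Type*} [Fintype I] (c : I → Γ(P, W)) (a : I → Γ(A.glue, W))
    (v : D.V) : A.comp W (∑ i, c i • a i) v =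
      ∑ i, pbF (D.p v) (le_refl (D.p v ⁻¹ᵁ W)) (c i) • A.comp W (a i) v := by
  let φ : Γ(A.glue, W) →+ Γ(A.A v, D.p v ⁻¹ᵁ W) :=
    AddMonoidHom.mk' (fun a => A.comp W a v) fun a b => A.comp_add a b v
  exact map_sum φ _ _

/-- The canonical morphism from the pullback of the glued module. -/
def Family.counit (v : D.V) : (Scheme.Modules.pullback (D.p v)).obj A.glue ⟶ A.A v :=
  ((Scheme.Modules.pullbackPushforwardAdjunction (D.p v)).homEquiv _ _).symm
    (homOfSections A.glue ((Scheme.Modules.pushforward (D.p v)).obj (A.A v))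
      (fun W a => A.comp W a v) (fun W a b => A.comp_add a b v) (fun W r a => (A.comp_smul r a v).trans
        (congr_arg (· • A.comp W a v) (pbF_self (D.p v) r)))
      (fun W W' h a => A.comp_res h a v))

lemma Family.counit_pb (v : D.V) (a : Γ(A.glue, W)) :
    (A.counit v).app _ (pb (D.p v) _ le_rfl a) = A.comp W a v := by
  have h := ((Scheme.Modules.pullbackPushforwardAdjunction (D.p v)).homEquiv _ _).apply_symm_apply
    (homOfSections A.glue ((Scheme.Modules.pushforward (D.p v)).obj (A.A v))
      (fun W a => A.comp W a v) (fun W a b => A.comp_add a b v) (fun W r a => (A.comp_smul r a v).trans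
        (congr_arg (· • A.comp W a v) (pbF_self (D.p v) r)))
      (fun W W' h a => A.comp_res h a v))
  rw [Adjunction.homEquiv_unit] at h
  have := ConcreteCategory.congr_hom (congr_arg (fun t => Scheme.Modules.Hom.app t W) h) a
  rw [pb_self]
  exact this

lemma Family.counit_comm (e : D.E) :
    CounitCompat (D.w e) (A.counit (D.t e)) (A.counit (D.s e)) (A.α e).hom := by
  rw [CounitCompat, ← Iso.inv_comp_eq]
  refine pullback_hom_ext _ fun U a => ?_
  rw [A.counit_pb, ← A.comp_compatible a e, ← A.counit_pb, ← map_pb,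
    ← pullIso_inv_pb (D.w e) _ le_rfl (D.preimage_le e U) le_rfl]
  rfl

/-- Over a gluing cocone, a family of modules with compatible local bases glues to a vector
bundle. -/
lemma IsGluing.glue_isVectorBundle (hD : D.IsGluing) {A : D.Family}
    (hA : ∀ x : P, ∃ (U : P.Opens) (n : ℕ) (b : ULift.{u} (Fin n) → ∀ v, Γ(A.A v, D.p v ⁻¹ᵁ U)),
      x ∈ U ∧ (∀ i, A.Compatible (b i)) ∧ ∀ v, IsBasisOn (A.A v) (fun i => b i v)) :
    IsVectorBundle A.glue ∧ ∀ v, IsIso (A.counit v) := by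
  have key (x : P) : ∃ (U : P.Opens) (n : ℕ) (e : ULift.{u} (Fin n) → Γ(A.glue, U)), x ∈ U ∧
      IsBasisOn A.glue e ∧ ∀ v, IsBasisOn (A.A v) (fun i => A.comp U (e i) v) := by
    obtain ⟨U, n, b, hx, hb, hb'⟩ := hA x
    refine ⟨U, n, fun i => (hb i).toSection, hx, ?_, hb'⟩
    intro W hW
    constructor
    · intro c d hcd
      funext i
      refine hD.1 _ _ _ fun v => ?_
      have h1 := congr_arg (fun a => A.comp W a v) hcd
      simp only [A.comp_sum_smul, A.comp_res, Family.Compatible.comp_toSection] at h1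
      exact congr_fun ((hb' v _ ((D.p v).preimage_mono hW)).injective h1) i
    · intro a
      obtain ⟨c, hc⟩ := hD.exists_coeff hb hb' hW (A.comp_compatible a)
      refine ⟨c, A.glue_ext fun v => ?_⟩
      rw [hc v]
      simp only [A.comp_sum_smul, A.comp_res, Family.Compatible.comp_toSection]
  constructor
  · rw [isVectorBundle_iff]
    intro x
    obtain ⟨U, n, e, hx, he, -⟩ := key x
    exact ⟨U, n, e, hx, he⟩
  · intro v
    refine isIso_of_isBasisOn _ fun x => ?_
    obtain ⟨U, n, e, hx, he, he'⟩ := key (D.p v x)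
    refine ⟨D.p v ⁻¹ᵁ U, n, _, hx, he.pb (D.p v) le_rfl, ?_⟩
    simp only [A.counit_pb]
    exact he' v

end SchemeCocone
end Descent

section BaseChange
variable {A B C D T T' T'' Z Z' Z'' : Scheme.{u}}

/-! ### Base change of morphisms between pullbacks -/

/-- The base change along `f` of a morphism `x^* M ⟶ y^* N`, as a morphism
`(f ≫ x)^* M ⟶ (f ≫ y)^* N`. -/
def bc (f : T' ⟶ T) {x : T ⟶ Z} {y : T ⟶ Z'} {x' : T' ⟶ Z} {y' : T' ⟶ Z'} (hx : f ≫ x = x')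
    (hy : f ≫ y = y') {M : Z.Modules} {N : Z'.Modules}
    (θ : (Scheme.Modules.pullback x).obj M ⟶ (Scheme.Modules.pullback y).obj N) :
    (Scheme.Modules.pullback x').obj M ⟶ (Scheme.Modules.pullback y').obj N :=
  (pullIso hx M).inv ≫ (Scheme.Modules.pullback f).map θ ≫ (pullIso hy N).hom

/-- A morphism `x^* p^* M ⟶ y^* q^* N`, seen as a morphism `(x ≫ p)^* M ⟶ (y ≫ q)^* N`. -/
def dn {x : T ⟶ A} {p : A ⟶ Z} {y : T ⟶ B} {q : B ⟶ Z'} {x' : T ⟶ Z} {y' : T ⟶ Z'}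
    (hx : x ≫ p = x') (hy : y ≫ q = y') {M : Z.Modules} {N : Z'.Modules}
    (θ : (Scheme.Modules.pullback x).obj ((Scheme.Modules.pullback p).obj M) ⟶
      (Scheme.Modules.pullback y).obj ((Scheme.Modules.pullback q).obj N)) :
    (Scheme.Modules.pullback x').obj M ⟶ (Scheme.Modules.pullback y').obj N :=
  (pullIso hx M).inv ≫ θ ≫ (pullIso hy N).hom

lemma pullbackEq_of_bc {f : T' ⟶ T} {x : T ⟶ Z} {y : T ⟶ Z'} {x' : T' ⟶ Z} {y' : T' ⟶ Z'}
    (hx : f ≫ x = x') (hy : f ≫ y = y') {M : Z.Modules} {N : Z'.Modules}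
    {θ θ' : (Scheme.Modules.pullback x).obj M ⟶ (Scheme.Modules.pullback y).obj N}
    (h : bc f hx hy θ = bc f hx hy θ') : PullbackEq f θ θ' := by
  rwa [bc, bc, cancel_epi, cancel_mono] at h

lemma dn_injective {x : T ⟶ A} {p : A ⟶ Z} {y : T ⟶ B} {q : B ⟶ Z'} {x' : T ⟶ Z} {y' : T ⟶ Z'}
    (hx : x ≫ p = x') (hy : y ≫ q = y') {M : Z.Modules} {N : Z'.Modules}
    {θ θ' : (Scheme.Modules.pullback x).obj ((Scheme.Modules.pullback p).obj M) ⟶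
      (Scheme.Modules.pullback y).obj ((Scheme.Modules.pullback q).obj N)}
    (h : dn hx hy θ = dn hx hy θ') : θ = θ' := by
  rwa [dn, dn, cancel_epi, cancel_mono] at h

lemma pullIso_comp_of_bc_eq {f : T' ⟶ T} {x : T ⟶ Z} {y : T ⟶ Z'} {x' : T' ⟶ Z} {y' : T' ⟶ Z'}
    (hx : f ≫ x = x') (hy : f ≫ y = y') {M : Z.Modules} {N : Z'.Modules}
    {θ : (Scheme.Modules.pullback x).obj M ⟶ (Scheme.Modules.pullback y).obj N}
    {θ' : (Scheme.Modules.pullback x').obj M ⟶ (Scheme.Modules.pullback y').obj N}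
    (h : bc f hx hy θ = θ') :
    (pullIso hx M).hom ≫ θ' = (Scheme.Modules.pullback f).map θ ≫ (pullIso hy N).hom := by
  rw [← h, bc, Iso.hom_inv_id_assoc]

lemma bc_comp (f : T' ⟶ T) {x : T ⟶ Z} {y : T ⟶ Z'} {z : T ⟶ Z''} {x' : T' ⟶ Z} {y' : T' ⟶ Z'}
    {z' : T' ⟶ Z''} (hx : f ≫ x = x') (hy : f ≫ y = y') (hz : f ≫ z = z') {M : Z.Modules}
    {N : Z'.Modules} {K : Z''.Modules}
    (θ : (Scheme.Modules.pullback x).obj M ⟶ (Scheme.Modules.pullback y).obj N)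
    (θ' : (Scheme.Modules.pullback y).obj N ⟶ (Scheme.Modules.pullback z).obj K) :
    bc f hx hz (θ ≫ θ') = bc f hx hy θ ≫ bc f hy hz θ' := by
  simp [bc]

lemma bc_id (f : T' ⟶ T) {x : T ⟶ Z} {x' : T' ⟶ Z} (hx : f ≫ x = x') (M : Z.Modules) :
    bc f hx hx (𝟙 ((Scheme.Modules.pullback x).obj M)) = 𝟙 _ := by
  simp [bc]

lemma dn_comp {x : T ⟶ A} {p : A ⟶ Z} {y : T ⟶ B} {q : B ⟶ Z'} {z : T ⟶ C} {r : C ⟶ Z''}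
    {x' : T ⟶ Z} {y' : T ⟶ Z'} {z' : T ⟶ Z''}
    (hx : x ≫ p = x') (hy : y ≫ q = y') (hz : z ≫ r = z') {M : Z.Modules} {N : Z'.Modules}
    {K : Z''.Modules}
    (θ : (Scheme.Modules.pullback x).obj ((Scheme.Modules.pullback p).obj M) ⟶
      (Scheme.Modules.pullback y).obj ((Scheme.Modules.pullback q).obj N))
    (θ' : (Scheme.Modules.pullback y).obj ((Scheme.Modules.pullback q).obj N) ⟶
      (Scheme.Modules.pullback z).obj ((Scheme.Modules.pullback r).obj K)) :
    dn hx hz (θ ≫ θ') = dn hx hy θ ≫ dn hy hz θ' := by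
  simp [dn]

lemma dn_map {x : T ⟶ A} {p : A ⟶ Z} {q : A ⟶ Z'} {x' : T ⟶ Z} {y' : T ⟶ Z'}
    (hx : x ≫ p = x') (hy : x ≫ q = y') {M : Z.Modules} {N : Z'.Modules}
    (φ : (Scheme.Modules.pullback p).obj M ⟶ (Scheme.Modules.pullback q).obj N) :
    dn hx hy ((Scheme.Modules.pullback x).map φ) = bc x hx hy φ := rfl

lemma bc_map (f : T' ⟶ T) {x : T ⟶ Z} {x' : T' ⟶ Z} (hx : f ≫ x = x') {M N : Z.Modules}
    (φ : M ⟶ N) : bc f hx hx ((Scheme.Modules.pullback x).map φ) =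
      (Scheme.Modules.pullback x').map φ := by
  rw [bc, pullIso_naturality, Iso.inv_hom_id_assoc]

lemma pullIso_assoc_inv {f : A ⟶ B} {g : B ⟶ C} {h : C ⟶ D} {fg : A ⟶ C} {gh : B ⟶ D} {k : A ⟶ D}
    (e₁ : f ≫ g = fg) (e₂ : g ≫ h = gh) (e₃ : fg ≫ h = k) (e₄ : f ≫ gh = k) (M : D.Modules) :
    (pullIso e₃ M).inv ≫ (pullIso e₁ ((Scheme.Modules.pullback h).obj M)).inv =
      (pullIso e₄ M).inv ≫ (Scheme.Modules.pullback f).map (pullIso e₂ M).inv := by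
  rw [← cancel_epi (pullIso e₄ M).hom, Iso.hom_inv_id_assoc,
    ← cancel_epi ((Scheme.Modules.pullback f).map (pullIso e₂ M).hom), ← Functor.map_comp,
    Iso.hom_inv_id, CategoryTheory.Functor.map_id, ← reassoc_of% pullIso_assoc e₁ e₂ e₃ e₄ M]
  simp

lemma bc_bc (f : T' ⟶ T) (f' : T'' ⟶ T') {f'' : T'' ⟶ T} (hf : f' ≫ f = f'') {x : T ⟶ Z}
    {y : T ⟶ Z'} {x' : T' ⟶ Z} {y' : T' ⟶ Z'} {x'' : T'' ⟶ Z} {y'' : T'' ⟶ Z'} (hx : f ≫ x = x')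
    (hy : f ≫ y = y') (hx' : f' ≫ x' = x'') (hy' : f' ≫ y' = y'')
    (hx'' : f'' ≫ x = x'') (hy'' : f'' ≫ y = y'') {M : Z.Modules} {N : Z'.Modules}
    (θ : (Scheme.Modules.pullback x).obj M ⟶ (Scheme.Modules.pullback y).obj N) :
    bc f' hx' hy' (bc f hx hy θ) = bc f'' hx'' hy'' θ := by
  simp only [bc, Functor.map_comp, Category.assoc]
  rw [← pullIso_assoc hf hy hy'' hy' N, ← reassoc_of% pullIso_assoc_inv hf hx hx'' hx' M,
    reassoc_of% (pullIso_naturality hf θ), Iso.inv_hom_id_assoc]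

lemma bc_dn (f : T' ⟶ T) {x : T ⟶ A} {p : A ⟶ Z} {y : T ⟶ B} {q : B ⟶ Z'} {x₀ : T ⟶ Z}
    {y₀ : T ⟶ Z'} (hx : x ≫ p = x₀) (hy : y ≫ q = y₀) {x' : T' ⟶ A} {y' : T' ⟶ B} {x₀' : T' ⟶ Z}
    {y₀' : T' ⟶ Z'} (hfx : f ≫ x = x') (hfy : f ≫ y = y') (hfx₀ : f ≫ x₀ = x₀')
    (hfy₀ : f ≫ y₀ = y₀') (hx' : x' ≫ p = x₀') (hy' : y' ≫ q = y₀') {M : Z.Modules} {N : Z'.Modules}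
    (θ : (Scheme.Modules.pullback x).obj ((Scheme.Modules.pullback p).obj M) ⟶
      (Scheme.Modules.pullback y).obj ((Scheme.Modules.pullback q).obj N)) :
    bc f hfx₀ hfy₀ (dn hx hy θ) = dn hx' hy' (bc f hfx hfy θ) := by
  simp only [bc, dn, Functor.map_comp, Category.assoc]
  rw [← pullIso_assoc hfy hy hy' hfy₀ N, ← reassoc_of% pullIso_assoc_inv hfx hx hx' hfx₀ M]

lemma dn_dn {x : T ⟶ A} {y : T ⟶ A} {f : A ⟶ B} {p : B ⟶ Z} {q : A ⟶ Z} (w : f ≫ p = q)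
    {x₀ y₀ : T ⟶ Z} {x' y' : T ⟶ B} (hx : x ≫ f = x') (hy : y ≫ f = y')
    (hx' : x' ≫ p = x₀) (hy' : y' ≫ p = y₀) (hx₀ : x ≫ q = x₀) (hy₀ : y ≫ q = y₀)
    {M : Z.Modules}
    (θ : (Scheme.Modules.pullback x).obj ((Scheme.Modules.pullback f).obj
        ((Scheme.Modules.pullback p).obj M)) ⟶
      (Scheme.Modules.pullback y).obj ((Scheme.Modules.pullback f).obj
        ((Scheme.Modules.pullback p).obj M))) :
    dn hx₀ hy₀ ((Scheme.Modules.pullback x).map (pullIso w M).inv ≫ θ ≫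
      (Scheme.Modules.pullback y).map (pullIso w M).hom) = dn hx' hy' (dn hx hy θ) := by
  simp only [dn, Category.assoc]
  rw [← pullIso_assoc hy w hy' hy₀ M, ← reassoc_of% pullIso_assoc_inv hx w hx' hx₀ M]

/-- The morphism `ψ : M ⟶ N` commutes with the actions `θ` on `M` and `θ'` on `N`. -/
def Commutes {x y : T ⟶ Z} {M N : Z.Modules} (ψ : M ⟶ N)
    (θ : (Scheme.Modules.pullback x).obj M ⟶ (Scheme.Modules.pullback y).obj M)
    (θ' : (Scheme.Modules.pullback x).obj N ⟶ (Scheme.Modules.pullback y).obj N) : Prop :=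
  θ ≫ (Scheme.Modules.pullback y).map ψ = (Scheme.Modules.pullback x).map ψ ≫ θ'

lemma Commutes.of_dn {x y : T ⟶ A} {p : A ⟶ Z} {x₀ y₀ : T ⟶ Z}
    (hx : x ≫ p = x₀) (hy : y ≫ p = y₀) {M N : Z.Modules} (ψ : M ⟶ N)
    {φ : (Scheme.Modules.pullback p).obj M ⟶ (Scheme.Modules.pullback p).obj N}
    (hφ : MapEq p ψ φ)
    {θ : (Scheme.Modules.pullback x).obj ((Scheme.Modules.pullback p).obj M) ⟶
      (Scheme.Modules.pullback y).obj ((Scheme.Modules.pullback p).obj M)}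
    {θ' : (Scheme.Modules.pullback x).obj ((Scheme.Modules.pullback p).obj N) ⟶
      (Scheme.Modules.pullback y).obj ((Scheme.Modules.pullback p).obj N)}
    (h : Commutes φ θ θ') : Commutes ψ (dn hx hy θ) (dn hx hy θ') := by
  have hφ : (Scheme.Modules.pullback p).map ψ = φ := hφ
  subst hφ
  have h1 := congr_arg (dn hx hy) h
  rwa [dn_comp hx hy hy, dn_comp hx hx hy, dn_map, dn_map, bc_map, bc_map] at h1

lemma Commutes.bc (f : T' ⟶ T) {x y : T ⟶ Z} {x₀ y₀ : T' ⟶ Z}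
    (hx : f ≫ x = x₀) (hy : f ≫ y = y₀) {M N : Z.Modules} {ψ : M ⟶ N}
    {θ : (Scheme.Modules.pullback x).obj M ⟶ (Scheme.Modules.pullback y).obj M}
    {θ' : (Scheme.Modules.pullback x).obj N ⟶ (Scheme.Modules.pullback y).obj N}
    (h : Commutes ψ θ θ') :
    Commutes ψ (EquivariantChain.bc f hx hy θ) (EquivariantChain.bc f hx hy θ') := by
  have := congr_arg (EquivariantChain.bc f hx hy) h
  rwa [bc_comp f hx hy hy, bc_comp f hx hx hy, bc_map, bc_map] at this

lemma Commutes.of_bc {f : T' ⟶ T} {x y : T ⟶ Z} {x₀ y₀ : T' ⟶ Z}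
    (hx : f ≫ x = x₀) (hy : f ≫ y = y₀) {M N : Z.Modules} {ψ : M ⟶ N}
    {θ : (Scheme.Modules.pullback x).obj M ⟶ (Scheme.Modules.pullback y).obj M}
    {θ' : (Scheme.Modules.pullback x).obj N ⟶ (Scheme.Modules.pullback y).obj N}
    (h : Commutes ψ (EquivariantChain.bc f hx hy θ) (EquivariantChain.bc f hx hy θ')) :
    PullbackEq f (θ ≫ (Scheme.Modules.pullback y).map ψ)
      ((Scheme.Modules.pullback x).map ψ ≫ θ') := by
  refine pullbackEq_of_bc hx hy ?_
  rw [bc_comp f hx hy hy, bc_comp f hx hx hy, bc_map, bc_map]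
  exact h

/-- The inverse operation of base change along `f`. -/
def ub (f : T' ⟶ T) {x : T ⟶ Z} {y : T ⟶ Z'} {x' : T' ⟶ Z} {y' : T' ⟶ Z'} (hx : f ≫ x = x')
    (hy : f ≫ y = y') {M : Z.Modules} {N : Z'.Modules}
    (θ : (Scheme.Modules.pullback x').obj M ⟶ (Scheme.Modules.pullback y').obj N) :
    (Scheme.Modules.pullback f).obj ((Scheme.Modules.pullback x).obj M) ⟶
      (Scheme.Modules.pullback f).obj ((Scheme.Modules.pullback y).obj N) :=
  (pullIso hx M).hom ≫ θ ≫ (pullIso hy N).inv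

lemma bc_eq_of_mapEq_ub (f : T' ⟶ T) {x : T ⟶ Z} {y : T ⟶ Z'} {x' : T' ⟶ Z} {y' : T' ⟶ Z'}
    (hx : f ≫ x = x') (hy : f ≫ y = y') {M : Z.Modules} {N : Z'.Modules}
    {θ : (Scheme.Modules.pullback x').obj M ⟶ (Scheme.Modules.pullback y').obj N}
    {Θ : (Scheme.Modules.pullback x).obj M ⟶ (Scheme.Modules.pullback y).obj N}
    (h : MapEq f Θ (ub f hx hy θ)) : bc f hx hy Θ = θ := by
  have h : (Scheme.Modules.pullback f).map Θ = ub f hx hy θ := h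
  rw [bc, h, ub]
  simp

lemma homCompat_ub {f : T'' ⟶ T'} {p : T' ⟶ T} {q : T'' ⟶ T} (w : f ≫ p = q) {x : T ⟶ Z}
    {y : T ⟶ Z'} {x' : T' ⟶ Z} {y' : T' ⟶ Z'} {x'' : T'' ⟶ Z} {y'' : T'' ⟶ Z'}
    (hx : p ≫ x = x') (hy : p ≫ y = y') (hx' : q ≫ x = x'') (hy' : q ≫ y = y'')
    (hfx : f ≫ x' = x'') (hfy : f ≫ y' = y'') {M : Z.Modules} {N : Z'.Modules}
    {θ : (Scheme.Modules.pullback x').obj M ⟶ (Scheme.Modules.pullback y').obj N}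
    {θ' : (Scheme.Modules.pullback x'').obj M ⟶ (Scheme.Modules.pullback y'').obj N}
    (h : bc f hfx hfy θ = θ') : HomCompat w (ub p hx hy θ) (ub q hx' hy' θ') := by
  subst h
  rw [HomCompat, ub, ub, bc]
  simp only [Functor.map_comp, Category.assoc]
  rw [reassoc_of% pullIso_assoc w hx hx' hfx M, Iso.hom_inv_id_assoc]
  congr 2
  rw [Iso.comp_inv_eq, Category.assoc, pullIso_assoc w hy hy' hfy N, ← Functor.map_comp_assoc,
    Iso.inv_hom_id, CategoryTheory.Functor.map_id, Category.id_comp]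

/-- A morphism `θ : x^* N ⟶ y^* N`, transported along `ε : p^* M ≅ N` to a morphism
`(x ≫ p)^* M ⟶ (y ≫ p)^* M`. -/
def conj {x y : T ⟶ A} {p : A ⟶ Z} {x' y' : T ⟶ Z} (hx : x ≫ p = x') (hy : y ≫ p = y')
    {M : Z.Modules} {N : A.Modules} (ε : (Scheme.Modules.pullback p).obj M ≅ N)
    (θ : (Scheme.Modules.pullback x).obj N ⟶ (Scheme.Modules.pullback y).obj N) :
    (Scheme.Modules.pullback x').obj M ⟶ (Scheme.Modules.pullback y').obj M :=
  dn hx hy ((Scheme.Modules.pullback x).map ε.hom ≫ θ ≫ (Scheme.Modules.pullback y).map ε.inv)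

lemma conj_comp {x y z : T ⟶ A} {p : A ⟶ Z} {x' y' z' : T ⟶ Z} (hx : x ≫ p = x')
    (hy : y ≫ p = y') (hz : z ≫ p = z') {M : Z.Modules} {N : A.Modules}
    (ε : (Scheme.Modules.pullback p).obj M ≅ N)
    {θ : (Scheme.Modules.pullback x).obj N ⟶ (Scheme.Modules.pullback y).obj N}
    {θ' : (Scheme.Modules.pullback y).obj N ⟶ (Scheme.Modules.pullback z).obj N}
    {θ'' : (Scheme.Modules.pullback x).obj N ⟶ (Scheme.Modules.pullback z).obj N}
    (h : θ'' = θ ≫ θ') : conj hx hz ε θ'' = conj hx hy ε θ ≫ conj hy hz ε θ' := by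
  rw [conj, conj, conj, ← dn_comp, h]
  simp

lemma conj_id {x : T ⟶ A} {p : A ⟶ Z} {x' : T ⟶ Z} (hx : x ≫ p = x')
    {M : Z.Modules} {N : A.Modules} (ε : (Scheme.Modules.pullback p).obj M ≅ N) :
    conj hx hx ε (𝟙 _) = 𝟙 _ := by
  simp [conj, dn]

lemma bc_conj (f : T' ⟶ T) {x y : T ⟶ A} {p : A ⟶ Z} {x' y' : T ⟶ Z} (hx : x ≫ p = x')
    (hy : y ≫ p = y') {x₁ y₁ : T' ⟶ A} {x₁' y₁' : T' ⟶ Z} (hx₁ : x₁ ≫ p = x₁') (hy₁ : y₁ ≫ p = y₁')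
    (hfx : f ≫ x = x₁) (hfy : f ≫ y = y₁) (hfx' : f ≫ x' = x₁') (hfy' : f ≫ y' = y₁')
    {M : Z.Modules} {N : A.Modules} (ε : (Scheme.Modules.pullback p).obj M ≅ N)
    (θ : (Scheme.Modules.pullback x).obj N ⟶ (Scheme.Modules.pullback y).obj N) :
    bc f hfx' hfy' (conj hx hy ε θ) = conj hx₁ hy₁ ε (bc f hfx hfy θ) := by
  rw [conj, conj, bc_dn f hx hy hfx hfy hfx' hfy' hx₁ hy₁, bc_comp f hfx hfx hfy,
    bc_comp f hfx hfy hfy, bc_map, bc_map]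

lemma eq_of_dn_eq_conj {x y : T ⟶ A} {p : A ⟶ Z} {x' y' : T ⟶ Z} (hx : x ≫ p = x')
    (hy : y ≫ p = y') {M : Z.Modules} {N : A.Modules} (ε : (Scheme.Modules.pullback p).obj M ≅ N)
    {θ : (Scheme.Modules.pullback x).obj N ⟶ (Scheme.Modules.pullback y).obj N}
    {θ' : (Scheme.Modules.pullback x).obj ((Scheme.Modules.pullback p).obj M) ⟶
      (Scheme.Modules.pullback y).obj ((Scheme.Modules.pullback p).obj M)}
    (h : dn hx hy θ' = conj hx hy ε θ) : Commutes ε.hom θ' θ := by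
  have h1 := dn_injective hx hy h
  rw [Commutes, h1]
  simp [← Functor.map_comp]

lemma dn_eq_conj {x y : T ⟶ A} {p : A ⟶ Z} {x' y' : T ⟶ Z} (hx : x ≫ p = x')
    (hy : y ≫ p = y') {M : Z.Modules} {N : A.Modules} (ε : (Scheme.Modules.pullback p).obj M ≅ N)
    {θ : (Scheme.Modules.pullback x).obj N ⟶ (Scheme.Modules.pullback y).obj N}
    {θ' : (Scheme.Modules.pullback x).obj ((Scheme.Modules.pullback p).obj M) ⟶
      (Scheme.Modules.pullback y).obj ((Scheme.Modules.pullback p).obj M)}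
    (h : Commutes ε.hom θ' θ) : dn hx hy θ' = conj hx hy ε θ := by
  rw [Commutes] at h
  rw [conj, ← reassoc_of% h, ← Functor.map_comp, Iso.hom_inv_id, CategoryTheory.Functor.map_id,
    Category.comp_id]

/-- Transporting an action along `α` and then along `ε` is transporting it along `ε'`, when `ε'` is the
composite of `α` with the pullback of `ε`. -/
lemma conj_conj {f : A ⟶ B} {p : B ⟶ Z} {q : A ⟶ Z} (w : f ≫ p = q) {x y : T ⟶ A}
    {x' y' : T ⟶ B} {x₀ y₀ : T ⟶ Z} (hx : x ≫ f = x') (hy : y ≫ f = y')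
    (hx' : x' ≫ p = x₀) (hy' : y' ≫ p = y₀) (hx₀ : x ≫ q = x₀) (hy₀ : y ≫ q = y₀)
    {M : Z.Modules} {N : B.Modules} {N' : A.Modules}
    (ε : (Scheme.Modules.pullback p).obj M ≅ N) (ε' : (Scheme.Modules.pullback q).obj M ≅ N')
    (α : (Scheme.Modules.pullback f).obj N ≅ N') (hα : CounitCompat w ε.hom ε'.hom α.hom)
    (θ : (Scheme.Modules.pullback x).obj N' ⟶ (Scheme.Modules.pullback y).obj N') :
    conj hx' hy' ε (conj hx hy α θ) = conj hx₀ hy₀ ε' θ := by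
  have hα : (Scheme.Modules.pullback f).map ε.hom ≫ α.hom = (pullIso w M).hom ≫ ε'.hom := hα
  have h1 : ε'.hom = (pullIso w M).inv ≫ (Scheme.Modules.pullback f).map ε.hom ≫ α.hom := by
    rw [hα, Iso.inv_hom_id_assoc]
  have h2 : ε'.inv = α.inv ≫ (Scheme.Modules.pullback f).map ε.inv ≫ (pullIso w M).hom := by
    rw [← cancel_epi ε'.hom, Iso.hom_inv_id, h1]
    simp [← Functor.map_comp_assoc]
  have h3 := dn_dn w hx hy hx' hy' hx₀ hy₀ (M := M)
    ((Scheme.Modules.pullback x).map ((Scheme.Modules.pullback f).map ε.hom ≫ α.hom) ≫ θ ≫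
      (Scheme.Modules.pullback y).map (α.inv ≫ (Scheme.Modules.pullback f).map ε.inv))
  rw [conj, conj, conj, h1, h2]
  simp only [Functor.map_comp, Category.assoc] at h3 ⊢
  rw [h3]
  congr 1
  rw [← bc_map x hx ε.hom, ← bc_map y hy ε.inv, ← dn_map, ← dn_map]
  simp [dn]

/-- Base change of isomorphisms. -/
def bcIso (f : T' ⟶ T) {x : T ⟶ Z} {y : T ⟶ Z'} {x' : T' ⟶ Z} {y' : T' ⟶ Z'} (hx : f ≫ x = x')
    (hy : f ≫ y = y') {M : Z.Modules} {N : Z'.Modules}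
    (θ : (Scheme.Modules.pullback x).obj M ≅ (Scheme.Modules.pullback y).obj N) :
    (Scheme.Modules.pullback x').obj M ≅ (Scheme.Modules.pullback y').obj N where
  hom := bc f hx hy θ.hom
  inv := bc f hy hx θ.inv
  hom_inv_id := by rw [← bc_comp, θ.hom_inv_id, bc_id]
  inv_hom_id := by rw [← bc_comp, θ.inv_hom_id, bc_id]

end BaseChange
section Equivariant
variable {S : Scheme.{u}} {G : Over S} [GrpObj G]

/-! ### Descent of equivariant vector bundles -/

namespace VectG
variable {X Y : GSch G}

lemma bc_act (E : VectG X) {T T' : Over S} (f : T' ⟶ T) (g : T ⟶ G) (x y : T ⟶ X.X)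
    (h : g • x = y) (g' : T' ⟶ G) (x' y' : T' ⟶ X.X) (h' : g' • x' = y')
    (hg : f ≫ g = g') (hx : f ≫ x = x') (hy : f ≫ y = y') :
    bc f.left (by rw [← hx, Over.comp_left]) (by rw [← hy, Over.comp_left]) (E.act g x y h).hom =
      (E.act g' x' y' h').hom := by
  rw [bc, Iso.inv_comp_eq]
  exact (E.act_naturality' f g x y h g' x' y' h' hg hx hy).symm

lemma dn_pullback_act (m : X ⟶ Y) (E : VectG Y) {T : Over S} (g : T ⟶ G) (x y : T ⟶ X.X)
    (h : g • x = y) (x' y' : T ⟶ Y.X) (hx : x ≫ m.hom = x') (hy : y ≫ m.hom = y') :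
    dn (by rw [← hx, Over.comp_left]) (by rw [← hy, Over.comp_left])
      (((pullback m).obj E).act g x y h).hom =
      (E.act g x' y' (by rw [← hx, ← hy, ← h, IsModHom.map_smul])).hom := by
  rw [pullback_act m E g x y h x' y' hx hy]
  simp [dn]

end VectG

lemma whisker_γ {Y Z : GSch G} (m : Y ⟶ Z) :
    (G ◁ m.hom) ≫ γ[G, Z.X] = γ[G, Y.X] ≫ m.hom :=
  (m.isModHom.smul_hom).symm

lemma fst_smul_snd (X : GSch G) : fst G X.X • snd G X.X = γ[G, X.X] :=
  (congr_arg (· ≫ γ[G, X.X]) lift_fst_snd).trans (Category.id_comp _)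

variable {X : GSch G} {V : Type u} [Quiver.{u} V]

/-- The cocone of schemes underlying a cocone of schemes over `S`. -/
def overCocone {Y : Over S} (F : V → Over S) (f : ∀ {v w : V}, (v ⟶ w) → (F v ⟶ F w))
    (t : (v : V) → (F v ⟶ Y)) (ht : ∀ {v w : V} (e : v ⟶ w), f e ≫ t w = t v) :
    SchemeCocone Y.left where
  V := V
  E := Σ v w : V, (v ⟶ w)
  s e := e.1
  t e := e.2.1
  F v := (F v).left
  f e := (f e.2.2).left
  p v := (t v).left
  w e := by rw [← ht e.2.2, Over.comp_left]

/-- The cocone of schemes underlying a cocone of `G`-schemes. -/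
abbrev gCocone (F : V ⥤q GSch G) (t : (v : V) → (F.obj v ⟶ X))
    (ht : ∀ {v w : V} (e : v ⟶ w), F.map e ≫ t w = t v) : SchemeCocone X.X.left :=
  overCocone (fun v => (F.obj v).X) (fun e => (F.map e).hom) (fun v => (t v).hom)
    (fun e => congr_arg Mod.Hom.hom (ht e))

/-- The cocone obtained from `gCocone` by taking products with `G`. -/
abbrev gCocone₁ (F : V ⥤q GSch G) (t : (v : V) → (F.obj v ⟶ X))
    (ht : ∀ {v w : V} (e : v ⟶ w), F.map e ≫ t w = t v) : SchemeCocone (G ⊗ X.X).left :=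
  overCocone (fun v => G ⊗ (F.obj v).X) (fun e => G ◁ (F.map e).hom) (fun v => G ◁ (t v).hom)
    (fun e => by rw [← whiskerLeft_comp]; exact congr_arg (G ◁ ·) (congr_arg Mod.Hom.hom (ht e)))

/-- The cocone obtained from `gCocone` by taking products with `G × G`. -/
abbrev gCocone₂ (F : V ⥤q GSch G) (t : (v : V) → (F.obj v ⟶ X))
    (ht : ∀ {v w : V} (e : v ⟶ w), F.map e ≫ t w = t v) : SchemeCocone (G ⊗ G ⊗ X.X).left :=
  overCocone (fun v => G ⊗ G ⊗ (F.obj v).X) (fun e => G ◁ G ◁ (F.map e).hom)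
    (fun v => G ◁ G ◁ (t v).hom)
    (fun e => by
      rw [← whiskerLeft_comp, ← whiskerLeft_comp]
      exact congr_arg (G ◁ G ◁ ·) (congr_arg Mod.Hom.hom (ht e)))

namespace VectG

lemma Hom.commutes {Y : GSch G} {E E' : VectG Y} (a : Hom E E') {T : Over S} (g : T ⟶ G)
    (x y : T ⟶ Y.X) (h : g • x = y) : Commutes a.hom (E.act g x y h).hom (E'.act g x y h).hom :=
  a.comm g x y h

/-- The morphism of modules underlying a morphism of pullbacks of equivariant bundles. -/
def underHom {Y Z : GSch G} (m : Y ⟶ Z) {E E' : VectG Z}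
    (a : (pullback m).obj E ⟶ (pullback m).obj E') :
    (Scheme.Modules.pullback m.hom.left).obj E.sheaf ⟶
      (Scheme.Modules.pullback m.hom.left).obj E'.sheaf :=
  a.hom

lemma homCompat_underHom {Y Z W : GSch G} {m : Y ⟶ Z} {n : Z ⟶ W} {p : Y ⟶ W} (e : m ≫ n = p)
    {E E' : VectG W} (φ : (pullback n).obj E ⟶ (pullback n).obj E')
    (ψ : (pullback p).obj E ⟶ (pullback p).obj E')
    (h : (pullbackCompIso e E).hom ≫ ψ = (pullback m).map φ ≫ (pullbackCompIso e E').hom) :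
    HomCompat (left_comp e) (underHom n φ) (underHom p ψ) :=
  congr_arg VectG.Hom.hom h

lemma map_eq_of_mapEq_underHom {Y Z : GSch G} (m : Y ⟶ Z) {E E' : VectG Z}
    (a : (pullback m).obj E ⟶ (pullback m).obj E') (ψ : E ⟶ E')
    (hψ : MapEq m.hom.left ψ.hom (underHom m a)) : (pullback m).map ψ = a :=
  VectG.Hom.ext hψ

lemma commutes_of_mapEq_underHom {Y Z : GSch G} (m : Y ⟶ Z) {E E' : VectG Z}
    (a : (pullback m).obj E ⟶ (pullback m).obj E') {ψ : E.sheaf ⟶ E'.sheaf}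
    (hψ : MapEq m.hom.left ψ (underHom m a)) {T : Over S} (g : T ⟶ G) (x y : T ⟶ Y.X)
    (h : g • x = y) (x' y' : T ⟶ Z.X) (hx : x ≫ m.hom = x') (hy : y ≫ m.hom = y')
    (h' : g • x' = y') : Commutes ψ (E.act g x' y' h').hom (E'.act g x' y' h').hom := by
  rw [← dn_pullback_act m E g x y h x' y' hx hy, ← dn_pullback_act m E' g x y h x' y' hx hy]
  exact Commutes.of_dn _ _ ψ hψ (Hom.commutes a g x y h)

end VectG

lemma comp_heq {C : Type*} [Category* C] {A B D A' B' D' : C} (hA : A = A') (hB : B = B')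
    (hD : D = D') {f : A ⟶ B} {g : B ⟶ D} {f' : A' ⟶ B'} {g' : B' ⟶ D'} (hf : f ≍ f')
    (hg : g ≍ g') : f ≫ g ≍ f' ≫ g' := by
  subst hA hB hD hf hg
  rfl

section
variable (F : V ⥤q GSch G) (t : (v : V) → (F.obj v ⟶ X))
    (ht : ∀ {v w : V} (e : v ⟶ w), F.map e ≫ t w = t v)

/-- The components of a morphism in the 2-limit. -/
def graphHom {E E' : VectG X}
    (a : GraphLimit.Hom ((VectG.toGraphLimit F t ht).obj E) ((VectG.toGraphLimit F t ht).obj E'))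
    (v : V) : (VectG.pullback (t v)).obj E ⟶ (VectG.pullback (t v)).obj E' := a.app v

lemma graphHom_comm {E E' : VectG X}
    (a : GraphLimit.Hom ((VectG.toGraphLimit F t ht).obj E) ((VectG.toGraphLimit F t ht).obj E'))
    {v w : V} (e : v ⟶ w) :
    (VectG.pullbackCompIso (ht e) E).hom ≫ graphHom F t ht a v =
      (VectG.pullback (F.map e)).map (graphHom F t ht a w) ≫
        (VectG.pullbackCompIso (ht e) E').hom :=
  eq_of_heq ((comp_heq (C := VectG (F.obj v)) (f := (VectG.pullbackCompIso (ht e) E).hom)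
    (g := graphHom F t ht a v) (f' := (((VectG.toGraphLimit F t ht).obj E).iso e).hom)
    (g' := a.app v) rfl rfl rfl HEq.rfl HEq.rfl).trans ((heq_of_eq (a.comm e)).trans
    (comp_heq (C := VectG (F.obj v))
      (f' := (VectG.pullback (F.map e)).map (graphHom F t ht a w))
      (f := (VectG.pullback (F.map e)).map (a.app w))
      (g := (((VectG.toGraphLimit F t ht).obj E').iso e).hom)
      (g' := (VectG.pullbackCompIso (ht e) E').hom) rfl rfl rfl HEq.rfl HEq.rfl)))

/-- A morphism of vector bundles is determined by its pullbacks to the diagram. -/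
lemma toGraphLimit_faithful (h0 : (gCocone F t ht).IsSeparating) :
    (VectG.toGraphLimit F t ht).Faithful where
  map_injective {E E'} a b h := by
    ext1
    refine h0.hom_ext E'.isVectorBundle fun v => ?_
    exact congr_arg VectG.Hom.hom (congr_fun (congr_arg GraphLimit.Hom.app h) v)

/-- Morphisms on the diagram glue to a morphism over `X`, which commutes with the action because its
pullbacks to the products `G × F v` do. -/
lemma toGraphLimit_full (h0 : (gCocone F t ht).IsGluing)
    (h1 : (gCocone₁ F t ht).IsSeparating) : (VectG.toGraphLimit F t ht).Full where
  map_surjective {E E'} a := by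
    obtain ⟨ψ, hψ⟩ := h0.exists_hom E'.isVectorBundle
      (fun v => VectG.underHom (t v) (graphHom F t ht a v))
      (fun e => VectG.homCompat_underHom (ht e.2.2) _ _ (graphHom_comm F t ht a e.2.2))
    have hψ (v : V) : MapEq (t v).hom.left ψ (VectG.underHom (t v) (graphHom F t ht a v)) := hψ v
    -- by base change it suffices to treat the universal case `T = G × X`
    have huniv : Commutes ψ (E.act (fst G X.X) (snd G X.X) γ[G, X.X] (fst_smul_snd X)).hom
        (E'.act (fst G X.X) (snd G X.X) γ[G, X.X] (fst_smul_snd X)).hom := by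
      refine h1.hom_ext (E'.isVectorBundle.pullback _) fun v => ?_
      change V at v
      have e1 : (G ◁ (t v).hom) ≫ snd G X.X = snd G (F.obj v).X ≫ (t v).hom := by simp
      have e2 := whisker_γ (t v)
      have e3 : (G ◁ (t v).hom) ≫ fst G X.X = fst G (F.obj v).X := by simp
      have h' : fst G (F.obj v).X • (snd G (F.obj v).X ≫ (t v).hom) =
          γ[G, (F.obj v).X] ≫ (t v).hom := by
        rw [← e3, ← e1, ← e2, ← ModObj.comp_smul, fst_smul_snd]
      have hx : (G ◁ (t v).hom).left ≫ (snd G X.X).left =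
        (snd G (F.obj v).X ≫ (t v).hom).left := by rw [← e1, Over.comp_left]
      have hy : (G ◁ (t v).hom).left ≫ γ[G, X.X].left =
        (γ[G, (F.obj v).X] ≫ (t v).hom).left := by rw [← e2, Over.comp_left]
      have hc := VectG.commutes_of_mapEq_underHom (t v) _ (hψ v) (fst G (F.obj v).X)
        (snd G (F.obj v).X) γ[G, (F.obj v).X] (fst_smul_snd _) _ _ rfl rfl h'
      rw [← E.bc_act (G ◁ (t v).hom) _ _ _ (fst_smul_snd X) _ _ _ h' e3 e1 e2,
        ← E'.bc_act (G ◁ (t v).hom) _ _ _ (fst_smul_snd X) _ _ _ h' e3 e1 e2] at hc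
      exact hc.of_bc hx hy
    have hcomm {T : Over S} (g : T ⟶ G) (x y : T ⟶ X.X) (h : g • x = y) :
        Commutes ψ (E.act g x y h).hom (E'.act g x y h).hom := by
      have e1 : lift g x ≫ snd G X.X = x := by simp
      have e2 : lift g x ≫ γ[G, X.X] = y := h
      have e3 : lift g x ≫ fst G X.X = g := by simp
      have hb := huniv.bc (lift g x).left (x₀ := x.left) (y₀ := y.left)
        (by rw [← Over.comp_left, e1]) (by rw [← Over.comp_left, e2])
      rw [E.bc_act _ _ _ _ _ _ _ _ h e3 e1 e2, E'.bc_act _ _ _ _ _ _ _ _ h e3 e1 e2] at hb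
      exact hb
    let Ψ : E ⟶ E' := VectG.Hom.mk ψ (fun g x y h => hcomm g x y h)
    have hΨ (v : V) : (VectG.pullback (t v)).map Ψ = graphHom F t ht a v :=
      VectG.map_eq_of_mapEq_underHom (t v) _ Ψ (hψ v)
    exact ⟨Ψ, GraphLimit.Hom.ext (funext fun v => hΨ v)⟩

end

/-! ### Essential surjectivity -/

/-- The functor forgetting the action. -/
def VectG.forget (Y : GSch G) : VectG Y ⥤ Y.X.left.Modules where
  obj E := E.sheaf
  map a := Hom.hom a

/-- The sheaf isomorphism underlying an isomorphism out of a pullback. -/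
def sheafIso {Y Z : GSch G} (m : Y ⟶ Z) {E : VectG Z} {E' : VectG Y}
    (α : (VectG.pullback m).obj E ≅ E') :
    (Scheme.Modules.pullback m.hom.left).obj E.sheaf ≅ E'.sheaf :=
  (VectG.forget Y).mapIso α

namespace VectG
variable {Y Y' Z : GSch G}

/-- The action on `m^* M` transported along an isomorphism of `m^* M` with the sheaf underlying an
equivariant bundle, seen as a family of isomorphisms between pullbacks of `M`. -/
def locAct (m : Y ⟶ Z) {M : Z.X.left.Modules} (B : VectG Y)
    (ε : (Scheme.Modules.pullback m.hom.left).obj M ≅ B.sheaf) {T : Over S} (g : T ⟶ G)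
    (x y : T ⟶ Y.X) (h : g • x = y) (x' y' : T ⟶ Z.X) (hx : x ≫ m.hom = x')
    (hy : y ≫ m.hom = y') :
    (Scheme.Modules.pullback x'.left).obj M ≅ (Scheme.Modules.pullback y'.left).obj M :=
  have hx' : x.left ≫ m.hom.left = x'.left := by rw [← hx, Over.comp_left]
  have hy' : y.left ≫ m.hom.left = y'.left := by rw [← hy, Over.comp_left]
  { hom := conj hx' hy' ε (B.act g x y h).hom
    inv := conj hy' hx' ε (B.act g x y h).inv
    hom_inv_id := by rw [← conj_comp hx' hy' hx' ε (Iso.hom_inv_id _).symm, conj_id]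
    inv_hom_id := by rw [← conj_comp hy' hx' hy' ε (Iso.inv_hom_id _).symm, conj_id] }

variable (m : Y ⟶ Z) {M : Z.X.left.Modules} (B : VectG Y)
    (ε : (Scheme.Modules.pullback m.hom.left).obj M ≅ B.sheaf)

lemma bc_locAct {T T' : Over S} (f : T' ⟶ T) (g : T ⟶ G) (x y : T ⟶ Y.X) (h : g • x = y)
    (x' y' : T ⟶ Z.X) (hx : x ≫ m.hom = x') (hy : y ≫ m.hom = y') (g₁ : T' ⟶ G)
    (x₁ y₁ : T' ⟶ Y.X) (h₁ : g₁ • x₁ = y₁) (x₁' y₁' : T' ⟶ Z.X) (hx₁ : x₁ ≫ m.hom = x₁')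
    (hy₁ : y₁ ≫ m.hom = y₁') (hg : f ≫ g = g₁) (hfx : f ≫ x = x₁) (hfy : f ≫ y = y₁)
    (hfx' : f.left ≫ x'.left = x₁'.left) (hfy' : f.left ≫ y'.left = y₁'.left) :
    bc f.left hfx' hfy' (locAct m B ε g x y h x' y' hx hy).hom =
      (locAct m B ε g₁ x₁ y₁ h₁ x₁' y₁' hx₁ hy₁).hom := by
  have hfx₁ : f.left ≫ x.left = x₁.left := by rw [← hfx, Over.comp_left]
  have hfy₁ : f.left ≫ y.left = y₁.left := by rw [← hfy, Over.comp_left]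
  refine (bc_conj f.left _ _ (by rw [← hx₁, Over.comp_left]) (by rw [← hy₁, Over.comp_left])
    hfx₁ hfy₁ hfx' hfy' ε (B.act g x y h).hom).trans ?_
  rw [B.bc_act f g x y h g₁ x₁ y₁ h₁ hg hfx hfy]
  rfl

lemma locAct_mul {T : Over S} (g g' : T ⟶ G) (x y z : T ⟶ Y.X) (h : g • x = y) (h' : g' • y = z)
    (h'' : (g' * g) • x = z) (x' y' z' : T ⟶ Z.X) (hx : x ≫ m.hom = x') (hy : y ≫ m.hom = y')
    (hz : z ≫ m.hom = z') :
    (locAct m B ε (g' * g) x z h'' x' z' hx hz).hom =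
      (locAct m B ε g x y h x' y' hx hy).hom ≫ (locAct m B ε g' y z h' y' z' hy hz).hom := by
  exact conj_comp _ _ _ ε (B.act_mul g g' x y z h h')

/-- The transported actions are compatible with a morphism `n` of the diagram. -/
lemma locAct_comp (n : Y' ⟶ Y) {p : Y' ⟶ Z} (w : n ≫ m = p) (B' : VectG Y')
    (ε' : (Scheme.Modules.pullback p.hom.left).obj M ≅ B'.sheaf)
    (α : (pullback n).obj B ≅ B')
    (hα : CounitCompat (left_comp w) ε.hom ε'.hom (sheafIso n α).hom) {T : Over S} (g : T ⟶ G)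
    (x y : T ⟶ Y'.X) (h : g • x = y) (x₁ y₁ : T ⟶ Y.X) (h₁ : g • x₁ = y₁) (x' y' : T ⟶ Z.X)
    (hx₁ : x ≫ n.hom = x₁) (hy₁ : y ≫ n.hom = y₁) (hx : x₁ ≫ m.hom = x') (hy : y₁ ≫ m.hom = y')
    (hx' : x ≫ p.hom = x') (hy' : y ≫ p.hom = y') :
    (locAct m B ε g x₁ y₁ h₁ x' y' hx hy).hom = (locAct p B' ε' g x y h x' y' hx' hy').hom := by
  have hx₂ : x.left ≫ n.hom.left = x₁.left := by rw [← hx₁, Over.comp_left]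
  have hy₂ : y.left ≫ n.hom.left = y₁.left := by rw [← hy₁, Over.comp_left]
  have h1 : conj hx₂ hy₂ (sheafIso n α) (B'.act g x y h).hom = (B.act g x₁ y₁ h₁).hom := by
    rw [← dn_pullback_act n B g x y h x₁ y₁ hx₁ hy₁]
    exact (dn_eq_conj hx₂ hy₂ (sheafIso n α) (Hom.commutes α.hom g x y h)).symm
  refine Eq.trans ?_ (conj_conj (left_comp w) hx₂ hy₂ (by rw [← hx, Over.comp_left])
    (by rw [← hy, Over.comp_left]) (by rw [← hx', Over.comp_left])
    (by rw [← hy', Over.comp_left]) ε ε' (sheafIso n α) hα (B'.act g x y h).hom)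
  rw [h1]
  rfl

end VectG

end Equivariant

/-! ### Gluing of the action -/

section Equivariant
variable {S : Scheme.{u}} {G : Over S} [GrpObj G]
variable {X : GSch G} {V : Type u} [Quiver.{u} V]

section
variable {M : X.X.left.Modules}
    (Θ : (Scheme.Modules.pullback (snd G X.X).left).obj M ≅
      (Scheme.Modules.pullback γ[G, X.X].left).obj M)

lemma lift_left_snd {T : Over S} (g : T ⟶ G) (x : T ⟶ X.X) :
    (lift g x).left ≫ (snd G X.X).left = x.left := by
  rw [← Over.comp_left, lift_snd]

lemma lift_left_γ {T : Over S} (g : T ⟶ G) (x y : T ⟶ X.X) (h : g • x = y) :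
    (lift g x).left ≫ γ[G, X.X].left = y.left := by
  rw [← Over.comp_left, ← h]
  rfl

/-- The isomorphisms `x^* M ≅ (g • x)^* M` obtained by base change from an isomorphism on
`G × X`. -/
def thetaAct {T : Over S} (g : T ⟶ G) (x y : T ⟶ X.X) (h : g • x = y) :
    (Scheme.Modules.pullback x.left).obj M ≅ (Scheme.Modules.pullback y.left).obj M :=
  bcIso (lift g x).left (lift_left_snd g x) (lift_left_γ g x y h) Θ

lemma bc_thetaAct {T T' : Over S} (f : T' ⟶ T) (g : T ⟶ G) (x y : T ⟶ X.X) (h : g • x = y)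
    (g' : T' ⟶ G) (x' y' : T' ⟶ X.X) (h' : g' • x' = y') (hg : f ≫ g = g')
    (hx : f.left ≫ x.left = x'.left) (hy : f.left ≫ y.left = y'.left) :
    bc f.left hx hy (thetaAct Θ g x y h).hom = (thetaAct Θ g' x' y' h').hom := by
  refine bc_bc (lift g x).left f.left ?_ _ _ _ _ _ _ Θ.hom
  rw [← Over.comp_left, comp_lift, hg]
  congr 2
  ext1
  exact hx

/-- An equivariant structure on a vector bundle `M` is an isomorphism on `G × X` satisfying the
cocycle condition. -/
def vectGOfTheta (hM : IsVectorBundle M)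
    (hmul : ∀ {T : Over S} (g g' : T ⟶ G) (x y z : T ⟶ X.X) (h : g • x = y) (h' : g' • y = z)
      (h'' : (g' * g) • x = z), (thetaAct Θ (g' * g) x z h'').hom =
        (thetaAct Θ g x y h).hom ≫ (thetaAct Θ g' y z h').hom) : VectG X where
  sheaf := M
  isVectorBundle := hM
  act := @thetaAct S G _ X M Θ
  act_naturality f g x y h := by
    refine pullIso_comp_of_bc_eq (Over.comp_left _ _ _ f x).symm (Over.comp_left _ _ _ f y).symm ?_
    exact bc_thetaAct Θ f g x y h _ _ _ _ rfl _ _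
  act_mul g g' x y z h h' := hmul g g' x y z h h' _

variable (F : V ⥤q GSch G) (t : (v : V) → (F.obj v ⟶ X))
    (B : ∀ v, VectG (F.obj v))
    (ε : ∀ v, (Scheme.Modules.pullback (t v).hom.left).obj M ≅ (B v).sheaf)

/-- The action on the pullback of `M` to `G × F v`. -/
abbrev univAct (v : V) : (Scheme.Modules.pullback (snd G (F.obj v).X ≫ (t v).hom).left).obj M ≅
    (Scheme.Modules.pullback (γ[G, (F.obj v).X] ≫ (t v).hom).left).obj M :=
  VectG.locAct (t v) (B v) (ε v) (fst G _) (snd G _) γ[G, (F.obj v).X] (fst_smul_snd _) _ _ rfl rfl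

lemma whisker_left_snd {Y Z : GSch G} (m : Y ⟶ Z) :
    (G ◁ m.hom).left ≫ (snd G Z.X).left = (snd G Y.X ≫ m.hom).left := by
  rw [← Over.comp_left, whiskerLeft_snd]

lemma whisker_left_γ {Y Z : GSch G} (m : Y ⟶ Z) :
    (G ◁ m.hom).left ≫ γ[G, Z.X].left = (γ[G, Y.X] ≫ m.hom).left := by
  rw [← Over.comp_left, whisker_γ]

/-- `Θ` induces the given actions on the pullbacks of `M`. -/
def InducesAct : Prop := ∀ v, bc (G ◁ (t v).hom).left (whisker_left_snd (t v))
  (whisker_left_γ (t v)) Θ.hom = (univAct F t B ε v).hom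

variable {F t B ε Θ}
  (ht : ∀ {v w : V} (e : v ⟶ w), F.map e ≫ t w = t v)

lemma InducesAct.thetaAct_eq (hΘ : InducesAct Θ F t B ε) (v : V) {T : Over S} (g : T ⟶ G)
    (x y : T ⟶ (F.obj v).X) (h : g • x = y) (x' y' : T ⟶ X.X) (h' : g • x' = y')
    (hx : x ≫ (t v).hom = x') (hy : y ≫ (t v).hom = y') :
    (thetaAct Θ g x' y' h').hom =
      (VectG.locAct (t v) (B v) (ε v) g x y h x' y' hx hy).hom := by
  have e1 : (lift g x).left ≫ (snd G (F.obj v).X ≫ (t v).hom).left = x'.left := by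
    rw [← Over.comp_left, lift_snd_assoc, hx]
  have e2 : (lift g x).left ≫ (γ[G, (F.obj v).X] ≫ (t v).hom).left = y'.left := by
    rw [Over.comp_left, ← Category.assoc, lift_left_γ g x y h, ← Over.comp_left, hy]
  have e3 : (lift g x).left ≫ (G ◁ (t v).hom).left = (lift g x').left := by
    rw [← Over.comp_left, lift_whiskerLeft, hx]
  have h1 := VectG.bc_locAct (t v) (B v) (ε v) (lift g x) (fst G (F.obj v).X) (snd G (F.obj v).X)
    γ[G, (F.obj v).X] (fst_smul_snd _) (snd G (F.obj v).X ≫ (t v).hom) (γ[G, (F.obj v).X] ≫ (t v).hom)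
    rfl rfl g x y h x' y' hx hy (lift_fst _ _) (lift_snd _ _) h e1 e2
  refine Eq.trans ?_ h1
  refine Eq.trans ?_ (congr_arg (bc (lift g x).left e1 e2) (hΘ v))
  exact (bc_bc (G ◁ (t v).hom).left (lift g x).left e3 (whisker_left_snd (t v))
    (whisker_left_γ (t v)) e1 e2 (lift_left_snd g x') (lift_left_γ g x' y' h') Θ.hom).symm

/-- The cocycle condition holds, as it holds for the given actions. -/
lemma InducesAct.thetaAct_mul (hΘ : InducesAct Θ F t B ε) (hM : IsVectorBundle M)
    (h2 : (gCocone₂ F t ht).IsSeparating)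
    {T : Over S} (g g' : T ⟶ G) (x y z : T ⟶ X.X) (h : g • x = y) (h' : g' • y = z)
    (h'' : (g' * g) • x = z) : (thetaAct Θ (g' * g) x z h'').hom =
      (thetaAct Θ g x y h).hom ≫ (thetaAct Θ g' y z h').hom := by
  -- it suffices to treat the universal case `T = G × G × X`
  let a' : G ⊗ G ⊗ X.X ⟶ G := fst _ _
  let a : G ⊗ G ⊗ X.X ⟶ G := snd _ _ ≫ fst _ _
  let p : G ⊗ G ⊗ X.X ⟶ X.X := snd _ _ ≫ snd _ _
  have huniv : (thetaAct Θ (a' * a) p (a' • a • p) (mul_smul _ _ _)).hom =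
      (thetaAct Θ a p (a • p) rfl).hom ≫ (thetaAct Θ a' (a • p) (a' • a • p) rfl).hom := by
    refine h2.hom_ext (hM.pullback _) fun v => ?_
    change V at v
    let b' : G ⊗ G ⊗ (F.obj v).X ⟶ G := fst _ _
    let b : G ⊗ G ⊗ (F.obj v).X ⟶ G := snd _ _ ≫ fst _ _
    let q : G ⊗ G ⊗ (F.obj v).X ⟶ (F.obj v).X := snd _ _ ≫ snd _ _
    let r : G ⊗ G ⊗ (F.obj v).X ⟶ G ⊗ G ⊗ X.X := G ◁ G ◁ (t v).hom
    have e1 : r ≫ a' = b' := by simp [r, a', b']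
    have e2 : r ≫ a = b := by simp [r, a, b]
    have e3 : r ≫ p = q ≫ (t v).hom := by simp [r, p, q]
    have e4 : r ≫ (a • p) = (b • q) ≫ (t v).hom := by
      rw [ModObj.comp_smul, e2, e3, IsModHom.map_smul]
    have e5 : r ≫ (a' • a • p) = (b' • b • q) ≫ (t v).hom := by
      rw [ModObj.comp_smul, e1, e4, ← IsModHom.map_smul]
    have e6 : r ≫ (a' * a) = b' * b := by rw [MonObj.comp_mul, e1, e2]
    have l3 : r.left ≫ p.left = (q ≫ (t v).hom).left :=
      congr_arg Over.Hom.left e3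
    have l4 : r.left ≫ (a • p).left = ((b • q) ≫ (t v).hom).left := by rw [← e4, Over.comp_left]
    have l5 : r.left ≫ (a' • a • p).left = ((b' • b • q) ≫ (t v).hom).left := by
      rw [← e5, Over.comp_left]
    have m1 : b • (q ≫ (t v).hom) = (b • q) ≫ (t v).hom := (IsModHom.map_smul _ _ _).symm
    have m2 : b' • ((b • q) ≫ (t v).hom) = (b' • b • q) ≫ (t v).hom :=
      (IsModHom.map_smul _ _ _).symm
    have m3 : (b' * b) • (q ≫ (t v).hom) = (b' • b • q) ≫ (t v).hom := by
      rw [mul_smul, m1, m2]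
    refine pullbackEq_of_bc (f := r.left) l3 l5 ?_
    rw [bc_comp r.left l3 l4 l5, bc_thetaAct Θ r _ _ _ _ _ _ _ m3 e6 l3 l5,
      bc_thetaAct Θ r _ _ _ _ _ _ _ m1 e2 l3 l4, bc_thetaAct Θ r _ _ _ _ _ _ _ m2 e1 l4 l5,
      hΘ.thetaAct_eq v (b' * b) q (b' • b • q) (mul_smul _ _ _) _ _ m3 rfl rfl,
      hΘ.thetaAct_eq v b q (b • q) rfl _ _ m1 rfl rfl,
      hΘ.thetaAct_eq v b' (b • q) (b' • b • q) rfl _ _ m2 rfl rfl]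
    exact VectG.locAct_mul (t v) (B v) (ε v) b b' q (b • q) (b' • b • q) rfl rfl _ _ _ _ rfl rfl rfl
  let f : T ⟶ G ⊗ G ⊗ X.X := lift g' (lift g x)
  have e1 : f ≫ a' = g' := by simp [f, a']
  have e2 : f ≫ a = g := by simp [f, a]
  have e3 : f ≫ p = x := by simp [f, p]
  have e4 : f ≫ (a • p) = y := by rw [ModObj.comp_smul, e2, e3, h]
  have e5 : f ≫ (a' • a • p) = z := by rw [ModObj.comp_smul, e1, e4, h']
  have e6 : f ≫ (a' * a) = g' * g := by rw [MonObj.comp_mul, e1, e2]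
  have l3 : f.left ≫ p.left = x.left :=
      congr_arg Over.Hom.left e3
  have l4 : f.left ≫ (a • p).left = y.left := by rw [← e4, Over.comp_left]
  have l5 : f.left ≫ (a' • a • p).left = z.left := by rw [← e5, Over.comp_left]
  have := congr_arg (bc f.left l3 l5) huniv
  rwa [bc_comp f.left l3 l4 l5, bc_thetaAct Θ f _ _ _ _ _ _ _ h'' e6 l3 l5,
      bc_thetaAct Θ f _ _ _ _ _ _ _ h e2 l3 l4, bc_thetaAct Θ f _ _ _ _ _ _ _ h' e1 l4 l5] at this

variable (α : ∀ {v w : V} (e : v ⟶ w), (VectG.pullback (F.map e)).obj (B w) ≅ B v)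

attribute [local irreducible] VectG.locAct in
/-- The actions over the vertices of the diagram are compatible with its arrows. -/
lemma bc_univAct (hα : ∀ {v w : V} (e : v ⟶ w), CounitCompat (VectG.left_comp (ht e)) (ε w).hom
      (ε v).hom (sheafIso (F.map e) (α e)).hom) {v w : V} (e : v ⟶ w)
    (hx : (G ◁ (F.map e).hom).left ≫ (snd G (F.obj w).X ≫ (t w).hom).left =
      (snd G (F.obj v).X ≫ (t v).hom).left)
    (hy : (G ◁ (F.map e).hom).left ≫ (γ[G, (F.obj w).X] ≫ (t w).hom).left =
      (γ[G, (F.obj v).X] ≫ (t v).hom).left) :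
    bc (G ◁ (F.map e).hom).left hx hy (univAct F t B ε w).hom = (univAct F t B ε v).hom := by
  have h1 : fst G (F.obj v).X • (snd G (F.obj v).X ≫ (F.map e).hom) =
      γ[G, (F.obj v).X] ≫ (F.map e).hom := by
    rw [← IsModHom.map_smul, fst_smul_snd]
  have h2 : (F.map e).hom ≫ (t w).hom = (t v).hom := congr_arg Mod.Hom.hom (ht e)
  have k1 : (snd G (F.obj v).X ≫ (F.map e).hom) ≫ (t w).hom = snd G (F.obj v).X ≫ (t v).hom := by
    rw [Category.assoc, h2]
  have k2 : (γ[G, (F.obj v).X] ≫ (F.map e).hom) ≫ (t w).hom = γ[G, (F.obj v).X] ≫ (t v).hom := by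
    rw [Category.assoc, h2]
  have k3 : G ◁ (F.map e).hom ≫ fst G (F.obj w).X = fst G (F.obj v).X := by simp
  have k4 : G ◁ (F.map e).hom ≫ snd G (F.obj w).X = snd G (F.obj v).X ≫ (F.map e).hom := by simp
  refine Eq.trans (b := (VectG.locAct (t w) (B w) (ε w) (fst G (F.obj v).X)
    (snd G (F.obj v).X ≫ (F.map e).hom) (γ[G, (F.obj v).X] ≫ (F.map e).hom) h1
    (snd G (F.obj v).X ≫ (t v).hom) (γ[G, (F.obj v).X] ≫ (t v).hom) k1 k2).hom) ?_ ?_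
  · exact VectG.bc_locAct (t w) (B w) (ε w) (G ◁ (F.map e).hom) (fst G (F.obj w).X)
      (snd G (F.obj w).X) γ[G, (F.obj w).X] (fst_smul_snd (F.obj w))
      (snd G (F.obj w).X ≫ (t w).hom)
      (γ[G, (F.obj w).X] ≫ (t w).hom) rfl rfl (fst G (F.obj v).X)
      (snd G (F.obj v).X ≫ (F.map e).hom) (γ[G, (F.obj v).X] ≫ (F.map e).hom) h1
      (snd G (F.obj v).X ≫ (t v).hom) (γ[G, (F.obj v).X] ≫ (t v).hom)
      k1 k2 k3 k4 (whisker_γ (F.map e)) hx hy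
  · exact VectG.locAct_comp (t w) (B w) (ε w) (F.map e) (ht e) (B v) (ε v) (α e) (hα e)
      (fst G (F.obj v).X) (snd G (F.obj v).X) γ[G, (F.obj v).X] (fst_smul_snd (F.obj v))
      (snd G (F.obj v).X ≫ (F.map e).hom) (γ[G, (F.obj v).X] ≫ (F.map e).hom) h1
      (snd G (F.obj v).X ≫ (t v).hom) (γ[G, (F.obj v).X] ≫ (t v).hom)
      rfl rfl k1 k2 rfl rfl

/-- The actions over the vertices of the diagram glue, as functions on `G × X` do. -/
lemma exists_inducesAct (h1 : (gCocone₁ F t ht).IsGluing) (hM : IsVectorBundle M)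
    (hα : ∀ {v w : V} (e : v ⟶ w), CounitCompat (VectG.left_comp (ht e)) (ε w).hom
      (ε v).hom (sheafIso (F.map e) (α e)).hom) :
    ∃ Θ : (Scheme.Modules.pullback (snd G X.X).left).obj M ≅
      (Scheme.Modules.pullback γ[G, X.X].left).obj M, InducesAct Θ F t B ε := by
  have hx {v w : V} (e : v ⟶ w) : (G ◁ (F.map e).hom).left ≫
      (snd G (F.obj w).X ≫ (t w).hom).left = (snd G (F.obj v).X ≫ (t v).hom).left := by
    rw [← Over.comp_left, whiskerLeft_snd_assoc, ← ht e]
    rfl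
  have hy {v w : V} (e : v ⟶ w) : (G ◁ (F.map e).hom).left ≫
      (γ[G, (F.obj w).X] ≫ (t w).hom).left = (γ[G, (F.obj v).X] ≫ (t v).hom).left := by
    rw [← Over.comp_left, ← Category.assoc, whisker_γ, ← ht e, Category.assoc]
    rfl
  have hb {v w : V} (e : v ⟶ w) : bcIso (G ◁ (F.map e).hom).left (hx e) (hy e)
      (univAct F t B ε w) = univAct F t B ε v :=
    Iso.ext (bc_univAct ht α hα e (hx e) (hy e))
  obtain ⟨Θ, hΘ⟩ := h1.exists_hom (hM.pullback γ[G, X.X].left)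
    (fun v => ub (G ◁ (t v).hom).left (whisker_left_snd (t v)) (whisker_left_γ (t v))
      (univAct F t B ε v).hom)
    (fun e => homCompat_ub _ _ _ _ _ (hx e.2.2) (hy e.2.2) (congr_arg Iso.hom (hb e.2.2)))
  obtain ⟨Θ', hΘ'⟩ := h1.exists_hom (hM.pullback (snd G X.X).left)
    (fun v => ub (G ◁ (t v).hom).left (whisker_left_γ (t v)) (whisker_left_snd (t v))
      (univAct F t B ε v).inv)
    (fun e => homCompat_ub _ _ _ _ _ (hy e.2.2) (hx e.2.2) (congr_arg Iso.inv (hb e.2.2)))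
  have k1 (v : V) := bc_eq_of_mapEq_ub (G ◁ (t v).hom).left (whisker_left_snd (t v))
    (whisker_left_γ (t v)) (hΘ v)
  have k2 (v : V) := bc_eq_of_mapEq_ub (G ◁ (t v).hom).left (whisker_left_γ (t v))
    (whisker_left_snd (t v)) (hΘ' v)
  refine ⟨⟨Θ, Θ', ?_, ?_⟩, k1⟩
  · refine h1.1.hom_ext (hM.pullback _) fun v => ?_
    change V at v
    refine pullbackEq_of_bc (f := (G ◁ (t v).hom).left) (whisker_left_snd (t v))
      (whisker_left_snd (t v)) ?_
    rw [bc_comp _ _ (whisker_left_γ (t v)), k1, k2, bc_id, Iso.hom_inv_id]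
  · refine h1.1.hom_ext (hM.pullback _) fun v => ?_
    change V at v
    refine pullbackEq_of_bc (f := (G ◁ (t v).hom).left) (whisker_left_γ (t v))
      (whisker_left_γ (t v)) ?_
    rw [bc_comp _ _ (whisker_left_snd (t v)), k1, k2, bc_id, Iso.inv_hom_id]

end

variable (F : V ⥤q GSch G) (t : (v : V) → (F.obj v ⟶ X))
    (ht : ∀ {v w : V} (e : v ⟶ w), F.map e ≫ t w = t v)

/-- The modules underlying an object of the 2-limit. -/
def graphFamily (A : GraphLimit (fun v : V => VectG (F.obj v))
    (fun e => VectG.pullback (F.map e))) : (gCocone F t ht).Family where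
  A v := (A.obj v).sheaf
  α e := sheafIso (F.map e.2.2) (A.iso e.2.2)

/-- The family `A` has local bases over `X` that are compatible with the transition isomorphisms. -/
def HasLocalBases {P : Scheme.{u}} {D : SchemeCocone P} (A : D.Family) : Prop :=
  ∀ x : P, ∃ (U : P.Opens) (n : ℕ) (b : ULift.{u} (Fin n) → ∀ v, Γ(A.A v, D.p v ⁻¹ᵁ U)),
    x ∈ U ∧ (∀ i, A.Compatible (b i)) ∧ ∀ v, IsBasisOn (A.A v) (fun i => b i v)

variable {F t}

lemma isoMk_commutes {Y Z : GSch G} (m : Y ⟶ Z) (E : VectG Z) (B : VectG Y)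
    (ε : (Scheme.Modules.pullback m.hom.left).obj E.sheaf ≅ B.sheaf)
    (h : ∀ {T : Over S} (g : T ⟶ G) (x y : T ⟶ Y.X) (h : g • x = y),
      Commutes (M := ((VectG.pullback m).obj E).sheaf) (N := B.sheaf) ε.hom
        (((VectG.pullback m).obj E).act g x y h).hom (B.act g x y h).hom) :
    ∃ φ : (VectG.pullback m).obj E ≅ B, VectG.Hom.hom φ.hom = ε.hom :=
  ⟨VectG.isoMk (E := (VectG.pullback m).obj E) ε h, rfl⟩

lemma GraphLimit.nonempty_iso {C : V → Type*} [∀ v, Category* (C v)]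
    {R : ∀ {v w : V}, (v ⟶ w) → C w ⥤ C v} {A B : GraphLimit C R} (φ : ∀ v, A.obj v ≅ B.obj v)
    (h : ∀ {v w : V} (e : v ⟶ w), (A.iso e).hom ≫ (φ v).hom = (R e).map (φ w).hom ≫ (B.iso e).hom) :
    Nonempty (A ≅ B) := by
  refine ⟨⟨{ app := fun v => (φ v).hom, comm := h }, { app := fun v => (φ v).inv, comm := ?_ },
    GraphLimit.Hom.ext (funext fun v => (φ v).hom_inv_id),
    GraphLimit.Hom.ext (funext fun v => (φ v).inv_hom_id)⟩⟩
  intro v w e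
  rw [Iso.comp_inv_eq, Category.assoc, h e, ← Functor.map_comp_assoc, Iso.inv_hom_id,
    CategoryTheory.Functor.map_id, Category.id_comp]

lemma pullbackCompIso_comp_eq {Y Z W : GSch G} (m : Y ⟶ Z) (n : Z ⟶ W) (p : Y ⟶ W) (e : m ≫ n = p)
    {E : VectG W} {B : VectG Z} {B' : VectG Y} (φ' : (VectG.pullback p).obj E ⟶ B')
    (φ : (VectG.pullback n).obj E ⟶ B) (α : (VectG.pullback m).obj B ≅ B')
    (ε : (Scheme.Modules.pullback n.hom.left).obj E.sheaf ⟶ B.sheaf)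
    (ε' : (Scheme.Modules.pullback p.hom.left).obj E.sheaf ⟶ B'.sheaf)
    (hφ' : VectG.Hom.hom φ' = ε') (hφ : VectG.Hom.hom φ = ε)
    (h : CounitCompat (VectG.left_comp e) ε ε' (sheafIso m α).hom) :
    (VectG.pullbackCompIso e E).hom ≫ φ' = (VectG.pullback m).map φ ≫ α.hom := by
  subst hφ hφ'
  exact VectG.hom_ext h.symm

lemma commutes_of_thetaAct {Y Z : GSch G} (m : Y ⟶ Z) (E : VectG Z) (B : VectG Y)
    (ε : (Scheme.Modules.pullback m.hom.left).obj E.sheaf ≅ B.sheaf) {T : Over S} (g : T ⟶ G)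
    (x y : T ⟶ Y.X) (h : g • x = y) (x' y' : T ⟶ Z.X) (hx : x ≫ m.hom = x') (hy : y ≫ m.hom = y')
    (h' : g • x' = y')
    (hE : (E.act g x' y' h').hom = (VectG.locAct m B ε g x y h x' y' hx hy).hom) :
    Commutes (M := ((VectG.pullback m).obj E).sheaf) (N := B.sheaf) ε.hom
        (((VectG.pullback m).obj E).act g x y h).hom (B.act g x y h).hom :=
  eq_of_dn_eq_conj (by rw [← hx, Over.comp_left]) (by rw [← hy, Over.comp_left]) ε
    ((VectG.dn_pullback_act m E g x y h x' y' hx hy).trans hE)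

/-- If the counits are isomorphisms of sheaves that commute with the actions, then they assemble to
an isomorphism in the 2-limit. -/
lemma nonempty_iso_of_commutes (E : VectG X) (A : GraphLimit (fun v : V => VectG (F.obj v))
    (fun e => VectG.pullback (F.map e)))
    (ε : ∀ v, (Scheme.Modules.pullback (t v).hom.left).obj E.sheaf ≅ (A.obj v).sheaf)
    (hα : ∀ {v w : V} (e : v ⟶ w), CounitCompat (VectG.left_comp (ht e)) (ε w).hom
      (ε v).hom (sheafIso (F.map e) (A.iso e)).hom)
    (h : ∀ (v : V) {T : Over S} (g : T ⟶ G) (x y : T ⟶ (F.obj v).X) (h : g • x = y),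
      Commutes (M := ((VectG.pullback (t v)).obj E).sheaf) (N := (A.obj v).sheaf) (ε v).hom
        (((VectG.pullback (t v)).obj E).act g x y h).hom ((A.obj v).act g x y h).hom) :
    Nonempty ((VectG.toGraphLimit F t ht).obj E ≅ A) := by
  choose φ hφ using fun v => isoMk_commutes (t v) E (A.obj v) (ε v) (h v)
  refine GraphLimit.nonempty_iso φ fun {v w} e => ?_
  refine eq_of_heq ((comp_heq (C := VectG (F.obj v))
    (f' := (VectG.pullbackCompIso (ht e) E).hom) (g' := (φ v).hom) rfl rfl rfl HEq.rfl
      HEq.rfl).trans ((heq_of_eq ?_).trans (comp_heq (C := VectG (F.obj v))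
      (f := (VectG.pullback (F.map e)).map (φ w).hom) (g := (A.iso e).hom)
      rfl rfl rfl HEq.rfl HEq.rfl)))
  exact pullbackCompIso_comp_eq (F.map e) (t w) (t v) (ht e) (φ v).hom (φ w).hom (A.iso e)
    (ε w).hom (ε v).hom (hφ v) (hφ w) (hα e)

lemma exists_vectG {M : X.X.left.Modules} (hM : IsVectorBundle M)
    (A : GraphLimit (fun v : V => VectG (F.obj v)) (fun e => VectG.pullback (F.map e)))
    (ε : ∀ v, (Scheme.Modules.pullback (t v).hom.left).obj M ≅ (A.obj v).sheaf)
    (hα : ∀ {v w : V} (e : v ⟶ w), CounitCompat (VectG.left_comp (ht e)) (ε w).hom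
      (ε v).hom (sheafIso (F.map e) (A.iso e)).hom)
    (h1 : (gCocone₁ F t ht).IsGluing) (h2 : (gCocone₂ F t ht).IsSeparating) :
    ∃ E : VectG X, Nonempty ((VectG.toGraphLimit F t ht).obj E ≅ A) := by
  obtain ⟨Θ, hΘ⟩ := exists_inducesAct (B := A.obj) ht A.iso h1 hM hα
  let E : VectG X := vectGOfTheta Θ hM
    fun g g' x y z h h' h'' => hΘ.thetaAct_mul ht hM h2 g g' x y z h h' h''
  refine ⟨E, nonempty_iso_of_commutes ht E A ε hα fun v T g x y h => ?_⟩
  exact commutes_of_thetaAct (t v) E (A.obj v) (ε v) g x y h (x ≫ (t v).hom) (y ≫ (t v).hom) rfl rfl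
    (by rw [← h, IsModHom.map_smul])
    (hΘ.thetaAct_eq v g x y h (x ≫ (t v).hom) (y ≫ (t v).hom) (by rw [← h, IsModHom.map_smul])
      rfl rfl)

lemma toGraphLimit_essSurj (h0 : (gCocone F t ht).IsGluing) (h1 : (gCocone₁ F t ht).IsGluing)
    (h2 : (gCocone₂ F t ht).IsSeparating)
    (hb : ∀ A, HasLocalBases (graphFamily F t ht A)) : (VectG.toGraphLimit F t ht).EssSurj where
  mem_essImage A := by
    obtain ⟨hM, hε⟩ := h0.glue_isVectorBundle (hb A)
    exact exists_vectG ht hM A (fun v => @asIso _ _ _ _ ((graphFamily F t ht A).counit v) (hε v))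
      (fun {v w} e => (graphFamily F t ht A).counit_comm ⟨v, w, e⟩) h1 h2

/-- A diagram of `G`-schemes over `X` computes the category of equivariant vector bundles on `X` if
functions on `X` and on `G × X` can be glued, functions on `G × G × X` are determined by their
pullbacks, and families of vector bundles have compatible local bases. -/
lemma toGraphLimit_isEquivalence (h0 : (gCocone F t ht).IsGluing) (h1 : (gCocone₁ F t ht).IsGluing)
    (h2 : (gCocone₂ F t ht).IsSeparating)
    (hb : ∀ A, HasLocalBases (graphFamily F t ht A)) : (VectG.toGraphLimit F t ht).IsEquivalence :=
  haveI := toGraphLimit_faithful F t ht h0.1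
  haveI := toGraphLimit_full F t ht h0 h1.1
  haveI := toGraphLimit_essSurj ht h0 h1 h2 hb
  { }

end Equivariant

/-! ### Functions on a weakly normal scheme -/

lemma isIso_presheaf_map {X : Scheme.{u}} {U V : X.Opens} (h : U = V) :
    IsIso (X.presheaf.map (eqToHom h).op) := by
  subst h
  exact inferInstanceAs (IsIso (X.presheaf.map (𝟙 _)))

section WeaklyNormal
variable {X X' : Scheme.{u}}

/-- The functions on `V` that vanish outside of the open set `U`. -/
def vanishingOutside (U V : X.Opens) : Ideal Γ(X, V) where
  carrier := {b | X.basicOpen b ≤ U}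
  add_mem' {a b} ha hb := (X.basicOpen_add_le a b).trans (sup_le ha hb)
  zero_mem' := by simp
  smul_mem' a b hb := by
    change X.basicOpen (a * b) ≤ U
    rw [Scheme.basicOpen_mul]
    exact inf_le_right.trans hb

lemma mem_vanishingOutside {U V : X.Opens} {b : Γ(X, V)} :
    b ∈ vanishingOutside U V ↔ X.basicOpen b ≤ U := Iff.rfl

lemma resF_mem_vanishingOutside {U V W : X.Opens} (h : W ≤ V) {b : Γ(X, V)}
    (hb : b ∈ vanishingOutside U V) : resF h b ∈ vanishingOutside U W := by
  rw [mem_vanishingOutside] at hb ⊢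
  refine le_trans ?_ hb
  rw [resF, Scheme.basicOpen_res]
  exact inf_le_right

variable (ν : X' ⟶ X) (U : X.Opens)

/-- The functions on `ν⁻¹(V)` that differ from the pullback of a function on `V` by a function
vanishing outside of `ν⁻¹(U)`. -/
def pinchedFunctions (V : X.Opens) : Subring Γ(X', ν ⁻¹ᵁ V) :=
  ((Ideal.Quotient.mk (vanishingOutside (ν ⁻¹ᵁ U) (ν ⁻¹ᵁ V))).comp (ν.app V).hom).range.comap
    (Ideal.Quotient.mk (vanishingOutside (ν ⁻¹ᵁ U) (ν ⁻¹ᵁ V)))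

variable {ν U} in
lemma mem_pinchedFunctions {V : X.Opens} {b : Γ(X', ν ⁻¹ᵁ V)} :
    b ∈ pinchedFunctions ν U V ↔
      ∃ a, b - ν.app V a ∈ vanishingOutside (ν ⁻¹ᵁ U) (ν ⁻¹ᵁ V) := by
  rw [pinchedFunctions, Subring.mem_comap, RingHom.mem_range]
  refine exists_congr fun a => ?_
  rw [eq_comm, RingHom.comp_apply, Ideal.Quotient.eq]

lemma app_mem_pinchedFunctions (V : X.Opens) (a : Γ(X, V)) :
    ν.app V a ∈ pinchedFunctions ν U V :=
  mem_pinchedFunctions.mpr ⟨a, by simp⟩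

lemma resF_app {V W : X.Opens} (h : W ≤ V) (a : Γ(X, V)) :
    resF (ν.preimage_mono h) (ν.app V a) = ν.app W (resF h a) :=
  (ConcreteCategory.congr_hom (ν.naturality (homOfLE h).op) a).symm

lemma resF_mem_pinchedFunctions {V W : X.Opens} (h : W ≤ V) {b : Γ(X', ν ⁻¹ᵁ V)}
    (hb : b ∈ pinchedFunctions ν U V) :
    resF (ν.preimage_mono h) b ∈ pinchedFunctions ν U W := by
  obtain ⟨a, ha⟩ := mem_pinchedFunctions.mp hb
  refine mem_pinchedFunctions.mpr ⟨resF h a, ?_⟩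
  rw [← resF_app, ← map_sub]
  exact resF_mem_vanishingOutside _ ha

/-- The presheaf of rings `V ↦ pinchedFunctions ν U V`. -/
def pinchedPresheaf : X.Opensᵒᵖ ⥤ CommRingCat.{u} where
  obj V := .of (pinchedFunctions ν U V.unop)
  map {V W} i := CommRingCat.ofHom
    ((resF (X := X') (ν.preimage_mono i.unop.le)).restrict _ _
      fun _ hb => resF_mem_pinchedFunctions ν U i.unop.le hb)
  map_id V := by
    ext x
    exact resF_self (X := X') le_rfl x.1
  map_comp i j := by
    ext x
    exact (resF_resF (X := X') _ _ x.1).symm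

/-- The pullback of functions, with values in the pinched functions. -/
def pinchedIncl (V : X.Opens) : Γ(X, V) ⟶ .of (pinchedFunctions ν U V) :=
  CommRingCat.ofHom ((ν.app V).hom.codRestrict _ (app_mem_pinchedFunctions ν U V))

/-- The pullback of functions, as a morphism of presheaves. -/
def pinchedMap : X.presheaf ⟶ pinchedPresheaf ν U where
  app V := pinchedIncl ν U V.unop
  naturality {V W} i := by
    ext x
    exact Subtype.ext (ConcreteCategory.congr_hom (ν.naturality i) x)

lemma exists_resF_eq_pow_mul {V W : X.Opens} (hV : IsCompact (V : Set X))
    (hV' : IsQuasiSeparated (V : Set X)) (f : Γ(X, V)) (h : W ≤ V) (e : W = X.basicOpen f)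
    (b : Γ(X, W)) : ∃ (n : ℕ) (c : Γ(X, V)), resF h c = resF h f ^ n * b := by
  subst e
  exact exists_eq_pow_mul_of_isCompact_of_isQuasiSeparated X V hV hV' f b

lemma exists_pow_mul_eq_of_resF_eq {V W : X.Opens} (hV : IsCompact (V : Set X))
    (hV' : IsQuasiSeparated (V : Set X)) (f : Γ(X, V)) (h : W ≤ V) (e : W = X.basicOpen f)
    {b c : Γ(X, V)} (hbc : resF h b = resF h c) : ∃ n : ℕ, f ^ n * b = f ^ n * c := by
  subst e
  exact exists_of_res_eq_of_qcqs hV hV' hbc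

lemma isUnit_resF {V W : X.Opens} (f : Γ(X, V)) (h : W ≤ V) (e : W ≤ X.basicOpen f) :
    IsUnit (resF h f) := by
  have h1 : IsUnit (resF (X.basicOpen_le f) f) := RingedSpace.isUnit_res_basicOpen _ f
  simpa using h1.map (resF e)

/-- The rings of pinched functions are compatible with localization, so that they glue to a scheme
that is affine over `X`. -/
lemma pinchedFunctions_isLocalization [QuasiCompact ν] [QuasiSeparated ν] {V : X.Opens}
    (hV : IsAffineOpen V) (r : Γ(X, V)) :
    letI := ((resF (X := X') (ν.preimage_mono (X.basicOpen_le r))).restrict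
      (pinchedFunctions ν U V) (pinchedFunctions ν U (X.basicOpen r))
      fun _ hb => resF_mem_pinchedFunctions ν U (X.basicOpen_le r) hb).toAlgebra
    IsLocalization.Away (⟨ν.app V r, app_mem_pinchedFunctions ν U V r⟩ : pinchedFunctions ν U V)
      (pinchedFunctions ν U (X.basicOpen r)) := by
  have hc := ν.isCompact_preimage hV.isCompact
  have hq := ν.isQuasiSeparated_preimage hV.isQuasiSeparated
  have hle : X.basicOpen r ≤ V := X.basicOpen_le r
  have he : ν ⁻¹ᵁ X.basicOpen r = X'.basicOpen (ν.app V r) := ν.preimage_basicOpen r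
  let φ : pinchedFunctions ν U V →+* pinchedFunctions ν U (X.basicOpen r) :=
    (resF (X := X') (ν.preimage_mono hle)).restrict _ _
      fun _ hb => resF_mem_pinchedFunctions ν U hle hb
  let : Algebra (pinchedFunctions ν U V) (pinchedFunctions ν U (X.basicOpen r)) := φ.toAlgebra
  let r' : pinchedFunctions ν U V := ⟨ν.app V r, app_mem_pinchedFunctions ν U V r⟩
  change IsLocalization.Away r' (pinchedFunctions ν U (X.basicOpen r))
  have hu : IsUnit (φ r') := by
    have h1 := (isUnit_resF r hle le_rfl).map
      ((ν.app (X.basicOpen r)).hom.codRestrict _ (app_mem_pinchedFunctions ν U (X.basicOpen r)))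
    convert! h1 using 1
    exact Subtype.ext (resF_app ν hle r)
  refine ⟨⟨?_, ?_, ?_⟩⟩
  · rintro ⟨_, n, rfl⟩
    exact (map_pow φ r' n).symm ▸ hu.pow n
  · rintro ⟨b, hb⟩
    obtain ⟨a, ha⟩ := mem_pinchedFunctions.mp hb
    obtain ⟨n, a', ha'⟩ := exists_resF_eq_pow_mul hV.isCompact hV.isQuasiSeparated r hle rfl a
    obtain ⟨m, j, hj⟩ := exists_resF_eq_pow_mul hc hq (ν.app V r) (ν.preimage_mono hle) he
      (b - ν.app _ a)
    have hj' : ν.app V r * j ∈ vanishingOutside (ν ⁻¹ᵁ U) (ν ⁻¹ᵁ V) := by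
      have h1 : resF (ν.preimage_mono hle) j ∈ vanishingOutside (ν ⁻¹ᵁ U) _ := by
        rw [hj]
        exact Ideal.mul_mem_left _ _ ha
      rw [mem_vanishingOutside, Scheme.basicOpen_mul, ← he]
      rw [mem_vanishingOutside, resF, Scheme.basicOpen_res] at h1
      exact h1
    -- `r ^ (n + m + 1) * b` extends to `V`; the additional factor `r` makes the part that has to
    -- vanish outside of `ν⁻¹(U)` do so outside of `ν⁻¹(basicOpen r)` as well
    let c : Γ(X', ν ⁻¹ᵁ V) := ν.app V (r ^ (m + 1) * a') + ν.app V r ^ n * (ν.app V r * j)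
    have hc : c ∈ pinchedFunctions ν U V :=
      mem_pinchedFunctions.mpr ⟨r ^ (m + 1) * a', by
        simp only [c, add_sub_cancel_left]
        exact Ideal.mul_mem_left _ _ hj'⟩
    refine ⟨⟨⟨c, hc⟩, ⟨r' ^ (n + m + 1), n + m + 1, rfl⟩⟩, ?_⟩
    have h1 : resF (ν.preimage_mono hle) (ν.app V a') =
        resF (ν.preimage_mono hle) (ν.app V r) ^ n * ν.app _ a := by
      rw [resF_app ν hle a', resF_app ν hle r, ha', map_mul, map_pow]
    refine Subtype.ext ?_
    change b * resF (ν.preimage_mono hle) (ν.app V r ^ (n + m + 1)) =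
      resF (ν.preimage_mono hle) c
    have h2 : ν.app V (r ^ (m + 1) * a') = ν.app V r ^ (m + 1) * ν.app V a' := by
      rw [map_mul, map_pow]
    simp only [c]
    rw [h2]
    simp only [map_add, map_mul, map_pow]
    rw [h1, hj]
    ring
  · rintro ⟨b, hb⟩ ⟨c, hc'⟩ h
    obtain ⟨n, hn⟩ := exists_pow_mul_eq_of_resF_eq hc hq (ν.app V r) (ν.preimage_mono hle) he
      (congr_arg Subtype.val h)
    exact ⟨⟨r' ^ n, n, rfl⟩, Subtype.ext hn⟩

lemma coequifibered_pinchedMap [QuasiCompact ν] [QuasiSeparated ν] :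
    Functor.whiskerLeft (Scheme.AffineZariskiSite.toOpensFunctor X).op
      (pinchedMap ν U) |>.Coequifibered :=
  Scheme.AffineZariskiSite.coequifibered_iff_forall_isLocalizationAway.mpr fun V r =>
    pinchedFunctions_isLocalization ν U (V := V.1) V.2 r

/-- The scheme over `X` obtained by gluing the spectra of the rings of pinched functions. -/
def pinchedGluing [QuasiCompact ν] [QuasiSeparated ν] :
    (Scheme.AffineZariskiSite.directedCover X).RelativeGluingData :=
  Scheme.AffineZariskiSite.relativeGluingData (coequifibered_pinchedMap ν U)

section
variable [QuasiCompact ν] [QuasiSeparated ν]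

instance : ((pinchedGluing ν U).functor ⋙ Scheme.forget).IsLocallyDirected :=
  Scheme.Cover.RelativeGluingData.instIsLocallyDirectedI₀CompFunctorForgetOfIsThin ..

/-- The scheme obtained from `X'` by identifying points outside of `ν⁻¹(U)` that have the same image
in `X`. -/
def pinched : Scheme.{u} := (pinchedGluing ν U).glued

/-- The open cover of `pinched ν U` by the spectra of the rings of pinched functions. -/
def pinchedCover : (pinched ν U).OpenCover := (pinchedGluing ν U).cover

/-- The structure morphism of `pinched ν U`. -/
def pinchedToBase : pinched ν U ⟶ X := (pinchedGluing ν U).toBase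

lemma exists_openImmersion_pinched {V : X.Opens} (hV : IsAffineOpen V) :
    ∃ (j : Spec (.of (pinchedFunctions ν U V)) ⟶ pinched ν U) (_ : IsOpenImmersion j),
      j.opensRange = pinchedToBase ν U ⁻¹ᵁ V ∧
      j ≫ pinchedToBase ν U = Spec.map (pinchedIncl ν U V) ≫ hV.fromSpec :=
  ⟨(pinchedCover ν U).f ⟨V, hV⟩, (pinchedCover ν U).map_prop ⟨V, hV⟩,
    by simpa using! ((pinchedGluing ν U).toBase_preimage_eq_opensRange_ι ⟨V, hV⟩).symm,
    Limits.colimit.ι_desc _ _⟩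

lemma exists_iso_pinched {V : X.Opens} (hV : IsAffineOpen V) :
    ∃ e : (pinchedToBase ν U ⁻¹ᵁ V).toScheme ≅ Spec (.of (pinchedFunctions ν U V)),
      e.hom ≫ Spec.map (pinchedIncl ν U V) =
        (pinchedToBase ν U ∣_ V) ≫ hV.isoSpec.hom := by
  obtain ⟨j, hj, hr, hw⟩ := exists_openImmersion_pinched ν U hV
  let e := IsOpenImmersion.isoOfRangeEq (pinchedToBase ν U ⁻¹ᵁ V).ι j
    (by simpa using congr_arg (fun t => t.1) hr.symm)
  refine ⟨e, ?_⟩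
  rw [← cancel_mono hV.fromSpec, Category.assoc, ← hw]
  simp [IsAffineOpen.isoSpec_hom, e]

/-- A property of the structure morphism of `pinched ν U` that is local on the target can be checked
on rings of functions. -/
lemma pinchedToBase_of_forall (Q : MorphismProperty Scheme.{u}) [IsZariskiLocalAtTarget Q]
    (h : ∀ V : X.Opens, IsAffineOpen V → Q (Spec.map (pinchedIncl ν U V))) :
    Q (pinchedToBase ν U) := by
  rw [IsZariskiLocalAtTarget.iff_of_iSup_eq_top (P := Q) _ (iSup_affineOpens_eq_top _)]
  intro V
  obtain ⟨e, he⟩ := exists_iso_pinched ν U V.2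
  rw [← MorphismProperty.cancel_right_of_respectsIso Q _ V.2.isoSpec.hom, ← he,
    MorphismProperty.cancel_left_of_respectsIso Q]
  exact h V.1 V.2

lemma exists_pinched_chart {V : X.Opens} (hV : IsAffineOpen V) :
    ∃ j : Spec (.of (pinchedFunctions ν U V)) ⟶ pinched ν U,
      j ≫ pinchedToBase ν U = Spec.map (pinchedIncl ν U V) ≫ hV.fromSpec ∧
      (∀ z : pinched ν U, pinchedToBase ν U z ∈ V → z ∈ Set.range j) := by
  obtain ⟨j, hj, hr, hw⟩ := exists_openImmersion_pinched ν U hV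
  refine ⟨j, hw, fun z hz => ?_⟩
  have : z ∈ j.opensRange := by rw [hr]; exact hz
  exact this

lemma bijective_app_of_le [IsIso (ν ∣_ U)] {V : X.Opens} (h : V ≤ U) :
    Function.Bijective (ν.app V) := by
  have hV : U.ι ''ᵁ (U.ι ⁻¹ᵁ V) = V := by
    rw [Scheme.Hom.image_preimage_eq_opensRange_inf, Scheme.Opens.opensRange_ι]
    exact inf_eq_right.mpr h
  have h1 := morphismRestrict_app ν U (U.ι ⁻¹ᵁ V)
  have h2 : IsIso (ν.app (U.ι ''ᵁ (U.ι ⁻¹ᵁ V))) := by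
    have h3 : IsIso ((ν ∣_ U).app (U.ι ⁻¹ᵁ V)) := inferInstance
    rw [h1] at h3
    exact @IsIso.of_isIso_comp_right _ _ _ _ _ _ _ (isIso_presheaf_map _) h3
  rw [hV] at h2
  exact (ConcreteCategory.isIso_iff_bijective _).mp h2

lemma isIso_pinchedIncl [IsIso (ν ∣_ U)] {V : X.Opens} (h : V ≤ U) :
    IsIso (pinchedIncl ν U V) := by
  have hb := bijective_app_of_le ν U h
  rw [ConcreteCategory.isIso_iff_bijective]
  refine ⟨fun a b hab => hb.1 (congr_arg Subtype.val hab), fun b => ?_⟩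
  obtain ⟨a, ha⟩ := hb.2 b.1
  exact ⟨a, Subtype.ext ha⟩

lemma isIso_pinchedToBase_morphismRestrict_iff {V : X.Opens} (hV : IsAffineOpen V) :
    IsIso (pinchedToBase ν U ∣_ V) ↔ IsIso (pinchedIncl ν U V) := by
  obtain ⟨e, he⟩ := exists_iso_pinched ν U hV
  rw [← isIso_comp_right_iff _ hV.isoSpec.hom, ← he, isIso_comp_left_iff]
  exact ⟨fun h => (isIso_SpecMap_iff.mp h : _) |> (ConcreteCategory.isIso_iff_bijective _).mpr, fun h => inferInstance⟩

lemma isIso_pinchedToBase_restrict [IsIso (ν ∣_ U)] : IsIso (pinchedToBase ν U ∣_ U) := by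
  change MorphismProperty.isomorphisms Scheme _
  rw [IsZariskiLocalAtTarget.iff_of_iSup_eq_top (P := MorphismProperty.isomorphisms Scheme) _
    (iSup_affineOpens_eq_top _)]
  intro W
  rw [MorphismProperty.arrow_mk_iso_iff (MorphismProperty.isomorphisms Scheme) (morphismRestrictRestrict _ _ _)]
  have hle : U.ι ''ᵁ W.1 ≤ U := by simpa using (U.ι).image_le_opensRange W.1
  exact (isIso_pinchedToBase_morphismRestrict_iff ν U (W.2.image_of_isOpenImmersion U.ι)).mpr
    (isIso_pinchedIncl ν U hle)

end

lemma pinchedIncl_finite [IsFinite ν] [IsLocallyNoetherian X] {V : X.Opens} (hV : IsAffineOpen V) :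
    (pinchedIncl ν U V).hom.Finite := by
  have h1 : (ν.app V).hom.Finite := ν.finite_app V hV
  have h2 : IsNoetherianRing Γ(X, V) := IsLocallyNoetherian.component_noetherian ⟨V, hV⟩
  algebraize [(ν.app V).hom, (pinchedIncl ν U V).hom]
  let f : pinchedFunctions ν U V →ₗ[Γ(X, V)] Γ(X', ν ⁻¹ᵁ V) :=
    { toFun := Subtype.val
      map_add' := fun _ _ => rfl
      map_smul' := fun a b => by
        rw [Algebra.smul_def, Algebra.smul_def]
        rfl }
  exact Module.Finite.of_injective f Subtype.val_injective

instance [IsFinite ν] [IsLocallyNoetherian X] : IsFinite (pinchedToBase ν U) :=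
  haveI : IsZariskiLocalAtTarget (@IsFinite : MorphismProperty Scheme.{u}) := 
    @HasAffineProperty.instIsZariskiLocalAtTarget _ _
      IsFinite.instHasAffinePropertyAndIsAffineFiniteCarrierObjOppositeOpensCarrierCarrierCommRingCatPresheafOpOpensTopHomAppTop
  pinchedToBase_of_forall ν U @IsFinite fun V hV =>
    (IsFinite.SpecMap_iff _).mpr (pinchedIncl_finite ν U hV)

instance [QuasiCompact ν] [QuasiSeparated ν] [AlgebraicGeometry.IsReduced X'] :
    AlgebraicGeometry.IsReduced (pinched ν U) := by
  have (V : X.AffineZariskiSite) : AlgebraicGeometry.IsReduced ((pinchedCover ν U).X V) := by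
    have : _root_.IsReduced (pinchedFunctions ν U V.1) :=
      isReduced_of_injective (pinchedFunctions ν U V.1).subtype Subtype.val_injective
    exact inferInstanceAs (AlgebraicGeometry.IsReduced (Spec (.of (pinchedFunctions ν U V.1))))
  exact @IsReduced.of_openCover _ (pinchedCover ν U) this

section
variable [IsFinite ν]

lemma isIntegral_subtype_pinchedFunctions {V : X.Opens} (hV : IsAffineOpen V) :
    (pinchedFunctions ν U V).subtype.IsIntegral := by
  have h1 : (ν.app V).hom.IsIntegral := (ν.finite_app V hV).to_isIntegral
  exact RingHom.IsIntegral.tower_top (pinchedIncl ν U V).hom _ h1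

lemma surjective_SpecMap_pinchedIncl [Surjective ν] {V : X.Opens} (hV : IsAffineOpen V) :
    Function.Surjective (Spec.map (pinchedIncl ν U V)) := by
  intro p
  obtain ⟨y, hy⟩ := ν.surjective (hV.fromSpec p)
  have hpV : hV.fromSpec p ∈ V := by
    have := Set.mem_range_self (f := hV.fromSpec) p
    rwa [hV.range_fromSpec] at this
  have hV' : IsAffineOpen (ν ⁻¹ᵁ V) := hV.preimage ν
  have hy' : y ∈ ν ⁻¹ᵁ V := by
    change ν y ∈ V
    rwa [hy]
  obtain ⟨q, hq⟩ : y ∈ Set.range hV'.fromSpec := by rwa [hV'.range_fromSpec]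
  refine ⟨Spec.map (CommRingCat.ofHom (pinchedFunctions ν U V).subtype) q, ?_⟩
  refine hV.fromSpec.isOpenEmbedding.injective ?_
  have h1 : Spec.map (CommRingCat.ofHom (pinchedFunctions ν U V).subtype) ≫
      Spec.map (pinchedIncl ν U V) ≫ hV.fromSpec = hV'.fromSpec ≫ ν := by
    rw [← Spec.map_comp_assoc, ← IsAffineOpen.SpecMap_appLE_fromSpec ν hV hV' le_rfl]
    congr 2
    rw [← Scheme.Hom.app_eq_appLE]
    rfl
  have h2 := congr_arg (fun t => t q) h1
  simp only [Scheme.Hom.comp_apply, hq, hy] at h2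
  exact h2

/-- A function vanishing outside of `ν⁻¹(U)` vanishes at the points of `pinched ν U` that do not lie
over `U`, since these come from points of `X'`. -/
lemma mem_of_mem_vanishingOutside {V : X.Opens} (hV : IsAffineOpen V)
    (q : Spec (.of (pinchedFunctions ν U V)))
    (hq : hV.fromSpec (Spec.map (pinchedIncl ν U V) q) ∉ U) (b : pinchedFunctions ν U V)
    (hb : b.1 ∈ vanishingOutside (ν ⁻¹ᵁ U) (ν ⁻¹ᵁ V)) : b ∈ q.asIdeal := by
  have hV' : IsAffineOpen (ν ⁻¹ᵁ V) := hV.preimage ν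
  obtain ⟨p, hp⟩ := (isIntegral_subtype_pinchedFunctions ν U hV).comap_surjective
    Subtype.val_injective q
  by_contra hbq
  have h1 : Spec.map (CommRingCat.ofHom (pinchedFunctions ν U V).subtype) ≫
      Spec.map (pinchedIncl ν U V) ≫ hV.fromSpec = hV'.fromSpec ≫ ν := by
    rw [← Spec.map_comp_assoc, ← IsAffineOpen.SpecMap_appLE_fromSpec ν hV hV' le_rfl]
    congr 2
    rw [← Scheme.Hom.app_eq_appLE]
    rfl
  have h2 : hV.fromSpec (Spec.map (pinchedIncl ν U V)
      (Spec.map (CommRingCat.ofHom (pinchedFunctions ν U V).subtype) p)) = ν (hV'.fromSpec p) :=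
    congr_arg (fun t => t p) h1
  have h3 : Spec.map (CommRingCat.ofHom (pinchedFunctions ν U V).subtype) p = q := hp
  rw [h3] at h2
  rw [h2] at hq
  refine hq (hb (?_ : hV'.fromSpec p ∈ X'.basicOpen b.1))
  have h4 : p ∈ PrimeSpectrum.basicOpen b.1 := by
    rw [← hp] at hbq
    exact hbq
  rw [← hV'.fromSpec_preimage_basicOpen] at h4
  exact h4

/-- Over `U` the structure morphism is an isomorphism. Outside of `U`, the values of a pinched function
are those of a function on `X`, so that they do not separate the points of a fibre. -/
lemma injective_pinchedToBase [IsIso (ν ∣_ U)] : Function.Injective (pinchedToBase ν U) := by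
  intro y z h
  by_cases hU : pinchedToBase ν U y ∈ U
  · have h1 := isIso_pinchedToBase_restrict ν U
    have hz : pinchedToBase ν U z ∈ U := by rwa [← h]
    have h2 := (pinchedToBase ν U ∣_ U).isOpenEmbedding.injective (a₁ := ⟨y, hU⟩) (a₂ := ⟨z, hz⟩)
      (Subtype.ext ((morphismRestrict_base_coe (pinchedToBase ν U) U ⟨y, hU⟩).trans
        (h.trans (morphismRestrict_base_coe (pinchedToBase ν U) U ⟨z, hz⟩).symm)))
    exact congr_arg Subtype.val h2
  · obtain ⟨V, hV, hyV, -⟩ := exists_isAffineOpen_mem_and_subset (x := pinchedToBase ν U y)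
      (U := ⊤) trivial
    obtain ⟨j, hj, hr⟩ := exists_pinched_chart ν U hV
    obtain ⟨p, rfl⟩ := hr y hyV
    obtain ⟨q, rfl⟩ := hr z (by rwa [← h])
    have hp : pinchedToBase ν U (j p) = hV.fromSpec (Spec.map (pinchedIncl ν U V) p) :=
      congr_arg (fun t => t p) hj
    have hq : pinchedToBase ν U (j q) = hV.fromSpec (Spec.map (pinchedIncl ν U V) q) :=
      congr_arg (fun t => t q) hj
    have hpq : Spec.map (pinchedIncl ν U V) p = Spec.map (pinchedIncl ν U V) q :=
      hV.fromSpec.isOpenEmbedding.injective (by rw [← hp, ← hq, h])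
    have hpU : hV.fromSpec (Spec.map (pinchedIncl ν U V) p) ∉ U := by rwa [← hp]
    have hqU : hV.fromSpec (Spec.map (pinchedIncl ν U V) q) ∉ U := by rwa [← hpq]
    have key (p q : Spec (.of (pinchedFunctions ν U V)))
        (hpq : Spec.map (pinchedIncl ν U V) p = Spec.map (pinchedIncl ν U V) q)
        (hpU : hV.fromSpec (Spec.map (pinchedIncl ν U V) p) ∉ U)
        (hqU : hV.fromSpec (Spec.map (pinchedIncl ν U V) q) ∉ U) : p.asIdeal ≤ q.asIdeal := by
      intro t ht
      obtain ⟨a, ha⟩ := mem_pinchedFunctions.mp t.2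
      -- a pinched function is the sum of a function on `V` and a function vanishing off `ν⁻¹(U)`
      have hja : t = pinchedIncl ν U V a + (t - pinchedIncl ν U V a) := by ring
      have h1 := mem_of_mem_vanishingOutside ν U hV p hpU (t - pinchedIncl ν U V a) ha
      have h2 := mem_of_mem_vanishingOutside ν U hV q hqU (t - pinchedIncl ν U V a) ha
      have h3 : pinchedIncl ν U V a ∈ p.asIdeal := by
        have := p.asIdeal.sub_mem ht h1
        simpa using this
      have h4 : a ∈ (Spec.map (pinchedIncl ν U V) p).asIdeal := h3
      rw [hpq] at h4
      have h5 : pinchedIncl ν U V a ∈ q.asIdeal := h4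
      rw [hja]
      exact q.asIdeal.add_mem h5 h2
    exact congr_arg j (PrimeSpectrum.ext (le_antisymm (key p q hpq hpU hqU)
      (key q p hpq.symm hqU hpU)))

lemma surjective_pinchedToBase [Surjective ν] : Function.Surjective (pinchedToBase ν U) := by
  intro x
  obtain ⟨V, hV, hxV, -⟩ := exists_isAffineOpen_mem_and_subset (x := x) (U := ⊤) trivial
  obtain ⟨j, hj, hr⟩ := exists_pinched_chart ν U hV
  obtain ⟨p, rfl⟩ : x ∈ Set.range hV.fromSpec := by rwa [hV.range_fromSpec]
  obtain ⟨q, rfl⟩ := surjective_SpecMap_pinchedIncl ν U hV p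
  exact ⟨j q, congr_arg (fun t => t q) hj⟩

/-- Over a weakly normal scheme `X`, a function on the source of a finite morphism `ν : X' ⟶ X` that
is an isomorphism over the dense open set `U` descends to `X` if it vanishes outside of `ν⁻¹(U)`:
adjoining all these functions to the structure sheaf of `X` yields a finite, birational and
bijective morphism to `X`. -/
lemma IsWeaklyNormal.exists_app_eq (hX : IsWeaklyNormal X) [IsLocallyNoetherian X]
    [AlgebraicGeometry.IsReduced X'] [Surjective ν] [IsIso (ν ∣_ U)] (hU : Dense (U : Set X))
    {V : X.Opens} (hV : IsAffineOpen V) (b : Γ(X', ν ⁻¹ᵁ V)) (hb : X'.basicOpen b ≤ ν ⁻¹ᵁ U) :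
    ∃ a, ν.app V a = b := by
  have hinj := injective_pinchedToBase ν U
  have hsurj := surjective_pinchedToBase ν U
  have hdense : Dense ((pinchedToBase ν U ⁻¹ᵁ U : (pinched ν U).Opens) : Set (pinched ν U)) := by
    intro y
    have h1 : (U : Set X) ⊆ pinchedToBase ν U ''
        closure ((pinchedToBase ν U ⁻¹ᵁ U : (pinched ν U).Opens) : Set (pinched ν U)) := by
      intro x hx
      obtain ⟨z, rfl⟩ := hsurj x
      exact ⟨z, subset_closure hx, rfl⟩
    have h2 := ((pinchedToBase ν U).isClosedMap _ isClosed_closure).closure_subset_iff.mpr h1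
      (hU (pinchedToBase ν U y))
    obtain ⟨z, hz, hzy⟩ := h2
    rwa [← hinj hzy]
  have hiso : IsIso (pinchedToBase ν U) :=
    hX (pinchedToBase ν U) inferInstance inferInstance
      ⟨U, hU, hdense, isIso_pinchedToBase_restrict ν U⟩ ⟨hinj, hsurj⟩
  have h1 := (isIso_pinchedToBase_morphismRestrict_iff ν U hV).mp inferInstance
  obtain ⟨a, ha⟩ := ((ConcreteCategory.isIso_iff_bijective _).mp h1).2
    ⟨b, mem_pinchedFunctions.mpr ⟨0, by simpa using! hb⟩⟩
  exact ⟨a, congr_arg Subtype.val ha⟩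

end

end WeaklyNormal

/-! ### Gluing of functions and flat base change -/

section Algebra
open TensorProduct

/-- Finite equalizers of rings, written as compatible families, are preserved by flat base change. -/
lemma exists_tmul_one_of_flat {A A' : Type*} [CommRing A] [CommRing A'] [Algebra A A']
    [Module.Flat A A'] {V E : Type*} [Finite V] [Finite E] {s t : E → V} {B : V → Type*}
    [∀ v, CommRing (B v)] [∀ v, Algebra A (B v)] (ψ : ∀ e, B (t e) →ₗ[A] B (s e))
    (hψ : ∀ e, ψ e 1 = 1)
    (hinj : ∀ a a' : A, (∀ v, algebraMap A (B v) a = algebraMap A (B v) a') → a = a')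
    (hex : ∀ b : ∀ v, B v, (∀ e, ψ e (b (t e)) = b (s e)) →
      ∃ a, ∀ v, algebraMap A (B v) a = b v) :
    (∀ a a' : A', (∀ v, a ⊗ₜ[A] (1 : B v) = a' ⊗ₜ[A] (1 : B v)) → a = a') ∧
    ∀ β : ∀ v, A' ⊗[A] B v, (∀ e, (ψ e).lTensor A' (β (t e)) = β (s e)) →
      ∃ a, ∀ v, a ⊗ₜ[A] (1 : B v) = β v := by
  classical
  cases nonempty_fintype V
  cases nonempty_fintype E
  let i : A →ₗ[A] ∀ v, B v := LinearMap.pi fun v => Algebra.linearMap A (B v)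
  let d : (∀ v, B v) →ₗ[A] ∀ e, B (s e) :=
    LinearMap.pi fun e => ψ e ∘ₗ LinearMap.proj (t e) - LinearMap.proj (s e)
  have hi : Function.Injective i := fun a a' h => hinj a a' fun v => congr_fun h v
  have hid : Function.Exact i d := by
    intro b
    constructor
    · intro h
      obtain ⟨a, ha⟩ := hex b fun e => sub_eq_zero.mp (congr_fun h e)
      exact ⟨a, funext ha⟩
    · rintro ⟨a, rfl⟩
      funext e
      have h1 (v : V) : i a v = a • (1 : B v) := Algebra.algebraMap_eq_smul_one a
      change ψ e (i a (t e)) - i a (s e) = 0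
      rw [h1, h1, map_smul, hψ, sub_self]
  have hi' := Module.Flat.lTensor_preserves_injective_linearMap (M := A') i hi
  have hid' := Module.Flat.lTensor_exact A' hid
  have hp (x : A' ⊗[A] ∀ v, B v) (v : V) : TensorProduct.piRight A A A' B x v =
      (LinearMap.proj v : (∀ v, B v) →ₗ[A] B v).lTensor A' x := by
    induction x with
    | zero => simp
    | add x y hx hy => rw [map_add, Pi.add_apply, hx, hy, map_add]
    | tmul a b => simp
  have hq (a : A') (v : V) : TensorProduct.piRight A A A' B (i.lTensor A' (a ⊗ₜ 1)) v =
      a ⊗ₜ[A] (1 : B v) := by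
    simp [i]
  refine ⟨fun a a' h => ?_, fun β hβ => ?_⟩
  · refine (TensorProduct.rid A A').symm.injective (hi' ?_)
    refine (TensorProduct.piRight A A A' B).injective (funext fun v => ?_)
    rw [TensorProduct.rid_symm_apply, TensorProduct.rid_symm_apply, hq, hq, h v]
  · set x := (TensorProduct.piRight A A A' B).symm β with hx
    have hx' : TensorProduct.piRight A A A' B x = β := LinearEquiv.apply_symm_apply _ _
    have h1 : d.lTensor A' x = 0 := by
      refine (TensorProduct.piRight A A A' (fun e => B (s e))).injective (funext fun e => ?_)
      have h2 (x : A' ⊗[A] ∀ v, B v) :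
          TensorProduct.piRight A A A' (fun e => B (s e)) (d.lTensor A' x) e =
          (ψ e).lTensor A' (TensorProduct.piRight A A A' B x (t e)) -
            TensorProduct.piRight A A A' B x (s e) := by
        induction x with
        | zero => simp
        | add x y hx hy =>
          rw [map_add, map_add, Pi.add_apply, hx, hy, map_add, Pi.add_apply, Pi.add_apply, map_add]
          abel
        | tmul a b => simp [d, TensorProduct.tmul_sub]
      rw [h2, hx', hβ, sub_self, map_zero]
      rfl
    obtain ⟨y, hy⟩ := (hid' x).mp h1
    obtain ⟨a, rfl⟩ := (TensorProduct.rid A A').symm.surjective y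
    refine ⟨a, fun v => ?_⟩
    rw [← hq, ← TensorProduct.rid_symm_apply, hy, hx']

/-- A pushout of commutative rings is a tensor product. -/
lemma exists_equiv_tensorProduct {A A' B B' : CommRingCat.{u}} {f : A ⟶ B} {g : A ⟶ A'} {h : B ⟶ B'}
    {g' : A' ⟶ B'} (H : IsPushout f g h g') :
    letI := f.hom.toAlgebra
    letI := g.hom.toAlgebra
    ∃ e : A' ⊗[A] B ≃+* B', ∀ a b, e (a ⊗ₜ b) = g' a * h b := by
  algebraize [f.hom, g.hom]
  let e := ((CommRingCat.isPushout_tensorProduct A A' B).isoIsPushout A' B H.flip).commRingCatIsoToRingEquiv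
  refine ⟨e, fun a b => ?_⟩
  have h1 : e (a ⊗ₜ 1) = g' a := congr($((CommRingCat.isPushout_tensorProduct A A' B).inl_isoIsPushout_hom A' B H.flip).hom a)
  have h2 : e (1 ⊗ₜ b) = h b := congr($((CommRingCat.isPushout_tensorProduct A A' B).inr_isoIsPushout_hom A' B H.flip).hom b)
  rw [← h1, ← h2, ← map_mul]
  simp

end Algebra

namespace SchemeCocone

lemma isSeparating_of_local {P : Scheme.{u}} (D : SchemeCocone P)
    (h : ∀ (W : P.Opens), ∀ x ∈ W, ∃ W' ≤ W, x ∈ W' ∧ ∀ (a b : Γ(P, W')),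
      (∀ v, pbF (D.p v) (le_refl (D.p v ⁻¹ᵁ W')) a = pbF (D.p v) le_rfl b) → a = b) :
    D.IsSeparating := by
  intro W a b hab
  refine function_ext fun x hx => ?_
  obtain ⟨W', hW', hx', H⟩ := h W x hx
  refine ⟨W', hW', hx', H _ _ fun v => ?_⟩
  rw [pbF_resF, pbF_resF, ← resF_pbF (D.p v) (le_refl _) ((D.p v).preimage_mono hW'), hab v,
    resF_pbF]

/-- Whether functions can be glued can be checked on arbitrarily small open neighbourhoods. -/
lemma isGluing_of_local {P : Scheme.{u}} (D : SchemeCocone P)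
    (h : ∀ (W : P.Opens), ∀ x ∈ W, ∃ W' ≤ W, x ∈ W' ∧ (∀ (a b : Γ(P, W')),
      (∀ v, pbF (D.p v) (le_refl (D.p v ⁻¹ᵁ W')) a = pbF (D.p v) le_rfl b) → a = b) ∧
      ∀ (c : ∀ v, Γ(D.F v, D.p v ⁻¹ᵁ W')),
      (∀ e, pbF (D.f e) (D.preimage_le e W') (c (D.t e)) = c (D.s e)) →
        ∃ a : Γ(P, W'), ∀ v, pbF (D.p v) le_rfl a = c v) : D.IsGluing := by
  have hs : D.IsSeparating := D.isSeparating_of_local fun W x hx => by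
    obtain ⟨W', h1, h2, h3, -⟩ := h W x hx
    exact ⟨W', h1, h2, h3⟩
  refine ⟨hs, fun W c hc => ?_⟩
  choose W' hW' hx' _ H using h W
  have key (x : W) := H x.1 x.2 (fun v => resF ((D.p v).preimage_mono (hW' x.1 x.2)) (c v))
    (fun e => by rw [pbF_resF, ← hc, resF_pbF])
  choose a ha using key
  obtain ⟨b, hb⟩ := function_glue (fun x : W => W' x.1 x.2) (fun x => hW' x.1 x.2)
    (fun x hx => ⟨⟨x, hx⟩, hx' x hx⟩) a (fun x y => hs _ _ _ fun v => by
      have h1 (x : W) (W₁ : P.Opens) (hW₁ : W₁ ≤ W' x.1 x.2) :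
          pbF (D.p v) (le_refl (D.p v ⁻¹ᵁ W₁)) (resF hW₁ (a x)) =
            resF ((D.p v).preimage_mono (hW₁.trans (hW' x.1 x.2))) (c v) := by
        rw [pbF_resF, ← resF_pbF (D.p v) (le_refl _) ((D.p v).preimage_mono hW₁), ha, resF_resF]
      rw [h1, h1])
  refine ⟨b, fun v => function_ext fun y hy => ?_⟩
  refine ⟨D.p v ⁻¹ᵁ W' (D.p v y) hy, (D.p v).preimage_mono (hW' _ hy), hx' _ hy, ?_⟩
  rw [← ha ⟨D.p v y, hy⟩ v, ← hb ⟨D.p v y, hy⟩, pbF_resF, resF_pbF]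

/-- Gluing of functions is preserved by flat base change, for finite diagrams of schemes that are
quasi-compact and quasi-separated over the base. -/
lemma IsGluing.of_flat {X P : Scheme.{u}} {D : SchemeCocone X} (hD : D.IsGluing) (q : P ⟶ X)
    [Flat q] [Finite D.V] [Finite D.E] (hc : ∀ v, QuasiCompact (D.p v))
    (hq : ∀ v, QuasiSeparated (D.p v)) (F : D.V → Scheme.{u})
    (f : ∀ e, F (D.s e) ⟶ F (D.t e)) (p : ∀ v, F v ⟶ P) (w : ∀ e, f e ≫ p (D.t e) = p (D.s e))
    (h : ∀ v, F v ⟶ D.F v) (hp : ∀ v, IsPullback (h v) (p v) (D.p v) q)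
    (hf : ∀ e, f e ≫ h (D.t e) = h (D.s e) ≫ D.f e) :
    (⟨D.V, D.E, D.s, D.t, F, f, p, w⟩ : SchemeCocone P).IsGluing := by
  refine isGluing_of_local _ fun W₀ x hx => ?_
  obtain ⟨V, hV, hxV, -⟩ := exists_isAffineOpen_mem_and_subset (x := q x) (U := ⊤) trivial
  obtain ⟨W, hW, hxW, hWV⟩ := exists_isAffineOpen_mem_and_subset (x := x) (U := W₀ ⊓ q ⁻¹ᵁ V)
    ⟨hx, hxV⟩
  have hWV' : W ≤ q ⁻¹ᵁ V := hWV.trans inf_le_right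
  refine ⟨W, hWV.trans inf_le_left, hxW, ?_⟩
  have hle (v) : p v ⁻¹ᵁ W ≤ h v ⁻¹ᵁ D.p v ⁻¹ᵁ V := by
    rw [← Scheme.Hom.comp_preimage, (hp v).w, Scheme.Hom.comp_preimage]
    exact (p v).preimage_mono hWV'
  have hpo (v) : IsPushout ((D.p v).appLE V (D.p v ⁻¹ᵁ V) le_rfl) (q.appLE V W hWV')
      ((h v).appLE (D.p v ⁻¹ᵁ V) (p v ⁻¹ᵁ W) (hle v)) ((p v).appLE W (p v ⁻¹ᵁ W) le_rfl) := by
    refine (isIso_pushoutSection_iff (hp v) hWV' le_rfl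
      (show p v ⁻¹ᵁ W = _ from (inf_eq_right.mpr (hle v)).symm)).mp ?_
    exact isIso_pushoutSection_of_isQuasiSeparated_of_flat_right (hp v) hWV' le_rfl _ hV hW
      ((hc v).isCompact_preimage _ V.2 hV.isCompact)
      ((D.p v).isQuasiSeparated_preimage hV.isQuasiSeparated)
  let : ∀ v, Algebra Γ(X, V) Γ(D.F v, D.p v ⁻¹ᵁ V) := fun v =>
    ((D.p v).appLE V (D.p v ⁻¹ᵁ V) le_rfl).hom.toAlgebra
  let : Algebra Γ(X, V) Γ(P, W) := (q.appLE V W hWV').hom.toAlgebra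
  have : Module.Flat Γ(X, V) Γ(P, W) := q.flat_appLE hV hW hWV'
  choose ε hε using fun v => exists_equiv_tensorProduct (hpo v)
  have hε (v a b) : ε v (a ⊗ₜ b) = pbF (p v) (le_refl (p v ⁻¹ᵁ W)) a * pbF (h v) (hle v) b :=
    hε v a b
  let ψ (e : D.E) : Γ(D.F (D.t e), D.p (D.t e) ⁻¹ᵁ V) →ₗ[Γ(X, V)] Γ(D.F (D.s e), D.p (D.s e) ⁻¹ᵁ V) :=
    { toFun := pbF (D.f e) (D.preimage_le e V)
      map_add' := map_add _
      map_smul' := fun a b => by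
        change pbF _ _ (pbF (D.p (D.t e)) le_rfl a * b) = pbF (D.p (D.s e)) le_rfl a * pbF _ _ b
        rw [map_mul, pbF_pbF (D.w e)] }
  have hψ (e : D.E) (β) : ε (D.s e) ((ψ e).lTensor _ β) =
      pbF (f e) (by rw [← Scheme.Hom.comp_preimage, w e]) (ε (D.t e) β) := by
    induction β with
    | zero => simp
    | add x y hx hy => rw [map_add, map_add, hx, hy, map_add, map_add]
    | tmul a b =>
      rw [LinearMap.lTensor_tmul, hε, hε, map_mul, pbF_pbF (w e), pbF_pbF (hf e)]
      congr 1
      exact pbF_pbF rfl _ _ _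
  obtain ⟨h1, h2⟩ := exists_tmul_one_of_flat (A' := Γ(P, W)) ψ (fun e => map_one (pbF (D.f e) (D.preimage_le e V)))
    (fun a a' haa' => hD.1 V a a' haa') (fun b hb => hD.2 V b hb)
  refine ⟨fun a b hab => h1 a b fun v => (ε v).injective ?_, fun c hc => ?_⟩
  · rw [hε, hε, map_one, _root_.mul_one, _root_.mul_one]
    exact hab v
  · obtain ⟨a, ha⟩ := h2 (fun v => (ε v).symm (c v)) fun e => (ε (D.s e)).injective (by
      rw [hψ, RingEquiv.apply_symm_apply, RingEquiv.apply_symm_apply]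
      exact hc e)
    refine ⟨a, fun v => ?_⟩
    have := congr_arg (ε v) (ha v)
    rw [hε, map_one, _root_.mul_one, RingEquiv.apply_symm_apply] at this
    exact this

end SchemeCocone

/-- Functions on the members of an open covering, indexed so that the overlaps are covered by
members of the covering as well, glue if they are compatible with the inclusions. -/
lemma function_glue_of_isOpenImmersion {Y : Scheme.{u}} {I : Type*} {U : I → Scheme.{u}}
    (j : ∀ i, U i ⟶ Y) [∀ i, IsOpenImmersion (j i)] {W : Y.Opens}
    (hcov : ∀ y ∈ W, ∃ i, y ∈ Set.range (j i)) (c : ∀ i, Γ(U i, j i ⁻¹ᵁ W))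
    (hc : ∀ a b y, y ∈ Set.range (j a) → y ∈ Set.range (j b) → ∃ (d : I) (f : U d ⟶ U a)
      (g : U d ⟶ U b) (hf : f ≫ j a = j d) (hg : g ≫ j b = j d), y ∈ Set.range (j d) ∧
        pbF f (by rw [← Scheme.Hom.comp_preimage, hf]) (c a) = c d ∧
        pbF g (by rw [← Scheme.Hom.comp_preimage, hg]) (c b) = c d) :
    ∃ b : Γ(Y, W), ∀ i, pbF (j i) le_rfl b = c i := by
  have hle (i : I) : W ⊓ (j i).opensRange ≤ W := inf_le_left
  have hpre (i : I) : j i ⁻¹ᵁ W = j i ⁻¹ᵁ (W ⊓ (j i).opensRange) := by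
    ext x
    simp
  choose b hb using fun i => (pbF_bijective (j i) (inf_le_right : W ⊓ (j i).opensRange ≤ _)
    (hpre i)).surjective (c i)
  obtain ⟨t, ht⟩ := function_glue (fun i => W ⊓ (j i).opensRange) hle
    (fun y hy => (hcov y hy).imp fun i hi => ⟨hy, hi⟩) b (fun i i' => function_ext fun y hy => by
      obtain ⟨d, f, g, hf, hg, hyd, hfc, hgc⟩ := hc i i' y hy.1.2 hy.2.2
      have h1 (i : I) (f : U d ⟶ U i) (hf : f ≫ j i = j d) :
          W ⊓ (j d).opensRange ≤ W ⊓ (j i).opensRange := by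
        refine inf_le_inf_left _ ?_
        rintro _ ⟨x, rfl⟩
        exact ⟨f x, congr_arg (fun t => t x) hf⟩
      have h2 (i : I) (f : U d ⟶ U i) (hf : f ≫ j i = j d)
          (hfc : pbF f (by rw [← Scheme.Hom.comp_preimage, hf]) (c i) = c d) :
          resF (h1 i f hf) (b i) = b d := by
        refine (pbF_bijective (j d) (inf_le_right : W ⊓ (j d).opensRange ≤ _) (hpre d)).injective ?_
        rw [hb, ← hfc, ← hb, pbF_pbF hf, pbF_resF]
      refine ⟨W ⊓ (j d).opensRange, le_inf (h1 i f hf) (h1 i' g hg), ⟨hy.1.1, hyd⟩, ?_⟩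
      rw [resF_resF, resF_resF, h2 i f hf hfc, h2 i' g hg hgc])
  refine ⟨t, fun i => ?_⟩
  rw [← hb i, ← ht i, pbF_resF]

/-- Functions on a scheme are determined by their restrictions to an open covering. -/
lemma function_ext_of_isOpenImmersion {Y : Scheme.{u}} {I : Type*} {U : I → Scheme.{u}}
    (j : ∀ i, U i ⟶ Y) [∀ i, IsOpenImmersion (j i)] {W : Y.Opens}
    (hcov : ∀ y ∈ W, ∃ i, y ∈ Set.range (j i)) {a b : Γ(Y, W)}
    (h : ∀ i, pbF (j i) (le_refl (j i ⁻¹ᵁ W)) a = pbF (j i) le_rfl b) : a = b := by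
  refine function_ext fun y hy => ?_
  obtain ⟨i, hi⟩ := hcov y hy
  refine ⟨W ⊓ (j i).opensRange, inf_le_left, ⟨hy, hi⟩, ?_⟩
  have hpre : j i ⁻¹ᵁ W = j i ⁻¹ᵁ (W ⊓ (j i).opensRange) := by
    ext x
    simp
  refine (pbF_bijective (j i) (inf_le_right : W ⊓ (j i).opensRange ≤ _) hpre).injective ?_
  rw [pbF_resF, pbF_resF]
  exact h i

/-! ### Gluing functions along a non-isomorphism locus -/

section
variable {X Y : Scheme.{u}}

lemma pbF_eq_app (f : X ⟶ Y) {V : Y.Opens} (a : Γ(Y, V)) :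
    pbF f (le_refl (f ⁻¹ᵁ V)) a = f.app V a := pbF_self f a

lemma subsingleton_of_isEmpty {V : X.Opens} (h : ∀ x, x ∉ V) : Subsingleton Γ(X, V) := by
  obtain rfl : V = ⊥ := by
    ext x
    exact iff_of_false (h x) id
  infer_instance

lemma function_eq_zero [AlgebraicGeometry.IsReduced X] {V : X.Opens} {a : Γ(X, V)}
    (h : ∀ x, x ∉ X.basicOpen a) : a = 0 :=
  (basicOpen_eq_bot_iff a).mp (by ext x; exact iff_of_false (h x) id)

lemma mem_basicOpen_app (f : X ⟶ Y) {V : Y.Opens} {a : Γ(Y, V)} {x : X} :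
    x ∈ X.basicOpen (f.app V a) ↔ f x ∈ Y.basicOpen a := by
  rw [← Scheme.preimage_basicOpen]
  rfl

lemma app_injective [AlgebraicGeometry.IsReduced Y] (f : X ⟶ Y) [Surjective f] (V : Y.Opens) :
    Function.Injective (f.app V) := by
  rw [injective_iff_map_eq_zero]
  intro a ha
  refine function_eq_zero fun y hy => ?_
  obtain ⟨x, rfl⟩ := f.surjective y
  rw [← mem_basicOpen_app f, ha, Scheme.basicOpen_zero] at hy
  exact hy

/-- Functions on a weakly normal scheme `X` correspond to the functions `b` on `X'` whose
restrictions to the complement of `ν⁻¹(U)` come from functions `c` on the complement of `U`. Here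
the `Z i` are disjoint closed subschemes outside of `U`, and the complement of `ν⁻¹(U)` is covered by
the `Z' l`, each of which maps to one of the `Z i`. -/
lemma IsWeaklyNormal.exists_function {X X' : Scheme.{u}} (hX : IsWeaklyNormal X)
    [IsLocallyNoetherian X] [AlgebraicGeometry.IsReduced X'] (ν : X' ⟶ X) [IsFinite ν]
    [Surjective ν] (U : X.Opens) (hU : Dense (U : Set X)) [IsIso (ν ∣_ U)] {I L : Type*}
    {Z : I → Scheme.{u}} (z : ∀ i, Z i ⟶ X) [∀ i, IsClosedImmersion (z i)]
    [∀ i, AlgebraicGeometry.IsReduced (Z i)] {Z' : L → Scheme.{u}} (z' : ∀ l, Z' l ⟶ X')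
    (β : L → I) (r : ∀ l, Z' l ⟶ Z (β l)) (hr : ∀ l, r l ≫ z (β l) = z' l ≫ ν)
    (hz : ∀ i x, z i x ∉ U) (hz' : ∀ y, ν y ∉ U → ∃ l, y ∈ Set.range (z' l)) {V : X.Opens}
    (hV : IsAffineOpen V) (hdisj : ∀ i j x y, z i x ∈ V → z j y ∈ V → i = j)
    (b : Γ(X', ν ⁻¹ᵁ V)) (c : ∀ i, Γ(Z i, z i ⁻¹ᵁ V))
    (hbc : ∀ l, pbF (z' l) (le_refl (z' l ⁻¹ᵁ ν ⁻¹ᵁ V)) b =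
      pbF (r l) (by
        rw [← Scheme.Hom.comp_preimage, ← Scheme.Hom.comp_preimage, hr]) (c (β l))) :
    ∃ a : Γ(X, V), pbF ν le_rfl a = b ∧ ∀ i, pbF (z i) le_rfl a = c i := by
  obtain ⟨a₀, ha₀⟩ : ∃ a : Γ(X, V), ∀ i, pbF (z i) (le_refl (z i ⁻¹ᵁ V)) a = c i := by
    by_cases h : ∃ i x, z i x ∈ V
    · obtain ⟨i, x, hx⟩ := h
      obtain ⟨a, ha⟩ := (z i).app_surjective V hV (c i)
      refine ⟨a, fun j => ?_⟩
      by_cases hj : ∃ y, z j y ∈ V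
      · obtain ⟨y, hy⟩ := hj
        obtain rfl := hdisj i j x y hx hy
        rw [pbF_eq_app, ← ha]
      · exact (subsingleton_of_isEmpty fun y hy => hj ⟨y, hy⟩).elim _ _
    · refine ⟨0, fun j => (subsingleton_of_isEmpty fun y hy => h ⟨j, y, hy⟩).elim _ _⟩
  obtain ⟨a₁, ha₁⟩ := hX.exists_app_eq ν U hU hV (b - ν.app V a₀) (fun y hy => by
    by_contra hyU
    obtain ⟨l, p, rfl⟩ := hz' y hyU
    rw [← mem_basicOpen_app (z' l), map_sub, ← pbF_eq_app (z' l), ← pbF_eq_app (z' l), hbc, ← ha₀,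
      ← pbF_eq_app ν, pbF_pbF (hr l), pbF_pbF rfl, sub_self, Scheme.basicOpen_zero] at hy
    exact hy)
  have hb : (b - ν.app V a₀) + ν.app V a₀ = b := sub_add_cancel _ _
  refine ⟨a₁ + a₀, by rw [map_add, pbF_eq_app, pbF_eq_app, ha₁, hb], fun i => ?_⟩
  rw [map_add, ha₀, pbF_eq_app]
  refine add_eq_right.mpr (function_eq_zero fun x hx => hz i x ?_)
  rw [mem_basicOpen_app] at hx
  obtain ⟨y, hy⟩ := ν.surjective (z i x)
  by_contra hxU
  obtain ⟨l, p, rfl⟩ := hz' y (by rwa [hy])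
  rw [← hy, ← mem_basicOpen_app ν, ha₁, ← mem_basicOpen_app (z' l), map_sub, ← pbF_eq_app (z' l),
    ← pbF_eq_app (z' l), hbc, ← ha₀, ← pbF_eq_app ν, pbF_pbF (hr l), pbF_pbF rfl, sub_self,
    Scheme.basicOpen_zero] at hx
  exact hx

end

/-! ### Extension of sections and bases of vector bundles -/

section
variable {X : Scheme.{u}} {M : X.Modules} {I : Type*} [Fintype I]

lemma IsBasisOn.exists_res_eq_pow_smul {V W : X.Opens} {e : I → Γ(M, V)} (he : IsBasisOn M e)
    (hV : IsCompact (V : Set X)) (hV' : IsQuasiSeparated (V : Set X)) (g : Γ(X, V)) (h : W ≤ V)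
    (hW : W = X.basicOpen g) (s : Γ(M, W)) :
    ∃ N, ∀ n ≥ N, ∃ t : Γ(M, V), EquivariantChain.res M h t = resF h g ^ n • s := by
  obtain ⟨a, ha, -⟩ := he.existsUnique h s
  choose N c hc using fun i => exists_resF_eq_pow_mul hV hV' g h hW (a i)
  refine ⟨Finset.univ.sup N, fun n hn => ⟨∑ i, (g ^ (n - N i) * c i) • e i, ?_⟩⟩
  rw [res_sum_smul, ← ha, Finset.smul_sum]
  refine Finset.sum_congr rfl fun i _ => ?_
  rw [map_mul, map_pow, hc, smul_smul, ← _root_.mul_assoc, ← pow_add, Nat.sub_add_cancel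
    ((Finset.le_sup (Finset.mem_univ i)).trans hn)]

lemma IsBasisOn.exists_pow_smul_eq_zero {V W : X.Opens} {e : I → Γ(M, V)} (he : IsBasisOn M e)
    (hV : IsCompact (V : Set X)) (hV' : IsQuasiSeparated (V : Set X)) (g : Γ(X, V)) (h : W ≤ V)
    (hW : W = X.basicOpen g) {s : Γ(M, V)} (hs : EquivariantChain.res M h s = 0) : ∃ N, ∀ n ≥ N, g ^ n • s = 0 := by
  obtain ⟨a, ha, -⟩ := he.existsUnique le_rfl s
  simp only [res_self] at ha
  have h0 : (fun i => resF h (a i)) = 0 := (he W h).injective (by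
    simp only [Pi.zero_apply, zero_smul, Finset.sum_const_zero]
    rw [← res_sum_smul, ha, hs])
  choose N hN using fun i => exists_pow_mul_eq_of_resF_eq hV hV' g h hW
    (b := a i) (c := 0) (by rw [map_zero]; exact congr_fun h0 i)
  refine ⟨Finset.univ.sup N, fun n hn => ?_⟩
  rw [← ha, Finset.smul_sum]
  refine Finset.sum_eq_zero fun i _ => ?_
  rw [smul_smul, ← Nat.sub_add_cancel ((Finset.le_sup (Finset.mem_univ i)).trans hn), pow_add,
    _root_.mul_assoc, hN, mul_zero, mul_zero, zero_smul]

/-- A section of a vector bundle on the locus where the function `g` on an affine open set `V` is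
invertible extends to `V` after multiplication by a power of `g`. -/
lemma IsVectorBundle.exists_res_eq_pow_smul (hM : IsVectorBundle M) {V W : X.Opens}
    (hV : IsAffineOpen V) (g : Γ(X, V)) (h : W ≤ V) (hW : W = X.basicOpen g) (s : Γ(M, W)) :
    ∃ (n : ℕ) (t : Γ(M, V)), res M h t = resF h g ^ n • s := by
  have hloc (x : V) : ∃ (A : X.Opens) (n : ℕ) (e : ULift.{u} (Fin n) → Γ(M, A)), x.1 ∈ A ∧
      IsAffineOpen A ∧ A ≤ V ∧ IsBasisOn M e := by
    obtain ⟨U, n, e, hx, he⟩ := isVectorBundle_iff.mp hM x.1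
    obtain ⟨A, hA, hxA, hAU⟩ := exists_isAffineOpen_mem_and_subset (x := x.1) (U := U ⊓ V)
      ⟨hx, x.2⟩
    exact ⟨A, n, _, hxA, hA, hAU.trans inf_le_right, he.res (hAU.trans inf_le_left)⟩
  choose A k e hxA hA hAV he using hloc
  obtain ⟨F, hF⟩ := hV.isCompact.elim_finite_subcover (fun x => (A x : Set X)) (fun x => (A x).2)
    (fun x hx => Set.mem_iUnion.mpr ⟨⟨x, hx⟩, hxA _⟩)
  have hcov (x) (hx : x ∈ V) : ∃ a : F, x ∈ A a.1 := by
    obtain ⟨a, ha, hxa⟩ := Set.mem_iUnion₂.mp (hF hx)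
    exact ⟨⟨a, ha⟩, hxa⟩
  have hAW (a : F) : A a.1 ⊓ W = X.basicOpen (resF (hAV a.1) g) := by
    rw [hW]
    exact (X.basicOpen_res g (homOfLE (hAV a.1)).op).symm
  have h1 (a : F) := (he a.1).exists_res_eq_pow_smul (hA a.1).isCompact (hA a.1).isQuasiSeparated
    (resF (hAV a.1) g) inf_le_left (hAW a) (res M inf_le_right s)
  choose N hN using h1
  choose t ht using fun a : F => hN a (Finset.univ.sup N) (Finset.le_sup (Finset.mem_univ a))
  have h2 (a b : F) : ∃ N, ∀ n ≥ N, resF (inf_le_left.trans (hAV a.1) : A a.1 ⊓ A b.1 ≤ V) g ^ n •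
      (res M (inf_le_left : A a.1 ⊓ A b.1 ≤ A a.1) (t a) -
        res M (inf_le_right : A a.1 ⊓ A b.1 ≤ A b.1) (t b)) = 0 := by
    refine IsBasisOn.exists_pow_smul_eq_zero ((he a.1).res (inf_le_left : A a.1 ⊓ A b.1 ≤ A a.1))
      (W := (A a.1 ⊓ A b.1) ⊓ W) (hV.isQuasiSeparated _ _ (hAV a.1) (A a.1).2 (hA a.1).isCompact
        (hAV b.1) (A b.1).2 (hA b.1).isCompact)
      (hV.isQuasiSeparated.of_subset (inf_le_left.trans (hAV a.1)))
      _ inf_le_left ?_ ?_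
    · rw [hW]
      exact (X.basicOpen_res g (homOfLE _).op).symm
    · have h3 (a : F) (B : X.Opens) (hB : B ≤ A a.1) (hB' : B ≤ A a.1 ⊓ W) :
          res M hB (t a) = res M hB' (res M inf_le_left (t a)) := by simp
      rw [map_sub, res_res, res_res, h3 a _ _ (inf_le_inf_right _ inf_le_left),
        h3 b _ _ (inf_le_inf_right _ inf_le_right), ht, ht, res_smul, res_smul, map_pow, map_pow,
        resF_resF, resF_resF, resF_resF, resF_resF, res_res, res_res, sub_self]
  choose N' hN' using h2
  set m := Finset.univ.sup fun p : F × F => N' p.1 p.2 with hm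
  obtain ⟨T, hT⟩ := section_glue M (fun a : F => A a.1) (fun a => hAV a.1) hcov
    (fun a => resF (hAV a.1) g ^ m • t a) (fun a b => by
      have h3 := hN' a b m (Finset.le_sup (f := fun p : F × F => N' p.1 p.2) (Finset.mem_univ (a, b)))
      rw [smul_sub, sub_eq_zero] at h3
      simpa only [res_smul, map_pow, resF_resF] using h3)
  refine ⟨m + Finset.univ.sup N, T, EquivariantChain.section_ext M fun x hx => ?_⟩
  obtain ⟨a, ha⟩ := hcov x (h hx)
  refine ⟨A a.1 ⊓ W, inf_le_right, ⟨ha, hx⟩, ?_⟩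
  have h4 : res M (inf_le_left.trans (hAV a.1) : A a.1 ⊓ W ≤ V) T =
      res M (inf_le_left : A a.1 ⊓ W ≤ A a.1) (res M (hAV a.1) T) := by simp
  rw [res_res, h4, hT, res_smul, ht, res_smul, map_pow, map_pow, resF_resF, resF_resF,
    smul_smul, pow_add]

open Matrix

/-- A family of sections obtained from a basis by an invertible matrix is a basis. -/
lemma IsBasisOn.of_isUnit_det [DecidableEq I] {U : X.Opens} {e e' : I → Γ(M, U)}
    (he : IsBasisOn M e) (A : Matrix I I Γ(X, U)) (hA : IsUnit A.det)
    (h : ∀ k, e' k = ∑ j, A k j • e j) : IsBasisOn M e' := by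
  intro V hV
  let B : Matrix I I Γ(X, V) := (resF hV).mapMatrix A
  have hB : IsUnit B.det := by
    have := hA.map (resF hV)
    rwa [RingHom.map_det] at this
  have h1 : (fun a : I → Γ(X, V) => ∑ k, a k • EquivariantChain.res M hV (e' k)) =
      (fun a : I → Γ(X, V) => ∑ j, a j • EquivariantChain.res M hV (e j)) ∘ (fun a => a ᵥ* B) := by
    funext a
    simp only [h, res_sum_smul, Function.comp, Matrix.vecMul, dotProduct, Finset.sum_smul,
      Finset.smul_sum, smul_smul]
    exact Finset.sum_comm
  rw [h1]
  refine (he V hV).comp ⟨Function.LeftInverse.injective (g := fun a => a ᵥ* B⁻¹) fun a => ?_,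
    Function.RightInverse.surjective (g := fun a => a ᵥ* B⁻¹) fun a => ?_⟩
  · simp [Matrix.vecMul_vecMul, Matrix.mul_nonsing_inv _ hB]
  · simp [Matrix.vecMul_vecMul, Matrix.nonsing_inv_mul _ hB]

/-- The matrix that expresses a basis by a basis is invertible. -/
lemma IsBasisOn.isUnit_det [DecidableEq I] {U : X.Opens} {e e' : I → Γ(M, U)}
    (he : IsBasisOn M e) (he' : IsBasisOn M e') (A : Matrix I I Γ(X, U))
    (h : ∀ k, e' k = ∑ j, A k j • e j) : IsUnit A.det := by
  choose B hB _ using fun j => he'.existsUnique le_rfl (e j)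
  simp only [res_self] at hB
  refine Matrix.isUnit_det_of_left_inverse (B := Matrix.of B) ?_
  ext i j
  have h1 : (fun j => (Matrix.of B * A) i j) = fun j => (1 : Matrix I I Γ(X, U)) i j := by
    refine (he U le_rfl).injective ?_
    simp only [res_self, Matrix.one_apply, ite_smul, one_smul, zero_smul, Finset.sum_ite_eq,
      Finset.mem_univ, if_true]
    rw [← hB i]
    simp only [h, Finset.smul_sum, smul_smul, Matrix.mul_apply, Finset.sum_smul, Matrix.of_apply]
    exact Finset.sum_comm
  exact congr_fun h1 j

/-- Two bases over the same nonempty open set have the same cardinality. -/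
lemma IsBasisOn.card_eq {J : Type*} [Fintype J] {U : X.Opens} {e : I → Γ(M, U)} {e' : J → Γ(M, U)}
    (he : IsBasisOn M e) (he' : IsBasisOn M e') {x : X} (hx : x ∈ U) :
    Fintype.card I = Fintype.card J := by
  have : Nonempty U := ⟨⟨x, hx⟩⟩
  have h1 := LinearEquiv.ofBijective (Fintype.linearCombination Γ(X, U) e) (by
    simpa [Fintype.linearCombination_apply] using! he U le_rfl)
  have h2 := LinearEquiv.ofBijective (Fintype.linearCombination Γ(X, U) e') (by
    simpa [Fintype.linearCombination_apply] using! he' U le_rfl)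
  exact card_eq_of_linearEquiv Γ(X, U) (h1.trans h2.symm)

/-- Being a basis of the module `M` in a neighbourhood of the point `y`. -/
def IsBasisAt {V : X.Opens} (e : I → Γ(M, V)) (y : X) : Prop :=
  ∃ (U : X.Opens) (h : U ≤ V), y ∈ U ∧ IsBasisOn M (fun i => res M h (e i))

/-- Sections that form a basis at each point of a set form a basis over an open neighbourhood of
that set. -/
lemma exists_isBasisOn_of_forall_isBasisAt {V : X.Opens} {e : I → Γ(M, V)} {T : Set X}
    (h : ∀ y ∈ T, IsBasisAt e y) : ∃ (U : X.Opens) (hU : U ≤ V), T ⊆ U ∧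
      IsBasisOn M (fun i => res M hU (e i)) := by
  choose! U hU hy hb using h
  refine ⟨⨆ y : T, U y, iSup_le fun y => hU y y.2, fun y hyT =>
    TopologicalSpace.Opens.mem_iSup.mpr ⟨⟨y, hyT⟩, hy y hyT⟩, .of_local fun x hx => ?_⟩
  obtain ⟨y, hxy⟩ := TopologicalSpace.Opens.mem_iSup.mp hx
  refine ⟨U y, le_iSup (fun y : T => U y) y, hxy, ?_⟩
  simpa only [res_res] using hb y y.2

lemma IsBasisOn.isBasisAt_of_mem_basicOpen_det [DecidableEq I] {U V : X.Opens} {e : I → Γ(M, U)}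
    (he : IsBasisOn M e) (hU : U ≤ V) {e' : I → Γ(M, V)} (A : Matrix I I Γ(X, U))
    (h : ∀ k, EquivariantChain.res M hU (e' k) = ∑ j, A k j • e j) {y : X} (hy : y ∈ X.basicOpen A.det) :
    IsBasisAt e' y := by
  have hle := X.basicOpen_le A.det
  refine ⟨X.basicOpen A.det, hle.trans hU, hy, (he.res hle).of_isUnit_det
    ((resF hle).mapMatrix A) ?_ fun k => ?_⟩
  · rw [← RingHom.map_det]
    exact isUnit_resF _ _ le_rfl
  · rw [← res_res M hU hle, h, res_sum_smul]
    rfl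

end

/-! ### Semi-local bases -/

section
variable {X : Scheme.{u}} {M : X.Modules}

/-- A function on an affine open set that does not vanish at `x`, but vanishes at a finite set of
points that are not generizations of `x`. -/
lemma exists_mem_basicOpen_of_finite {V : X.Opens} (hV : IsAffineOpen V) {x : X} (hx : x ∈ V)
    {T : Set X} (hT : T.Finite) (h : ∀ y ∈ T, ¬ y ⤳ x) :
    ∃ f : Γ(X, V), x ∈ X.basicOpen f ∧ ∀ y ∈ T, y ∉ X.basicOpen f := by
  have hcl : IsClosed (⋃ y ∈ T, closure {y}) := hT.isClosed_biUnion fun y _ => isClosed_closure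
  have hxcl : x ∈ (⟨(⋃ y ∈ T, closure {y})ᶜ, hcl.isOpen_compl⟩ : X.Opens) := by
    intro hmem
    obtain ⟨y, hy, hxy⟩ := Set.mem_iUnion₂.mp hmem
    exact h y hy (specializes_iff_mem_closure.mpr hxy)
  obtain ⟨f, hf, hxf⟩ := hV.exists_basicOpen_le ⟨x, hxcl⟩ hx
  exact ⟨f, hxf, fun y hy hyf => hf hyf (Set.mem_iUnion₂.mpr ⟨y, hy, subset_closure rfl⟩)⟩

lemma evaluation_resF {U V : X.Opens} (h : U ≤ V) {y : X} (hy : y ∈ U) (f : Γ(X, V)) :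
    X.evaluation U y hy (resF h f) = X.evaluation V y (h hy) f := by
  have := X.presheaf.germ_res_apply (homOfLE h) y hy f
  exact congr_arg (IsLocalRing.residue _) this

/-- A vector bundle has sections over a given affine open set that form bases at finitely many given
points, provided that its rank is constant on these points and there are no specializations among
them. -/
lemma IsVectorBundle.exists_isBasisAt (hM : IsVectorBundle M) {V : X.Opens} (hV : IsAffineOpen V)
    {I : Type*} [Fintype I] (T : Finset X) (hTV : ∀ y ∈ T, y ∈ V)
    (hT : ∀ y ∈ T, ∀ z ∈ T, y ⤳ z → y = z)
    (hn : ∀ y ∈ T, ∃ (U : X.Opens) (e : I → Γ(M, U)), y ∈ U ∧ IsBasisOn M e) :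
    ∃ s : I → Γ(M, V), ∀ y ∈ T, IsBasisAt s y := by
  classical
  have h1 (y : T) : ∃ (g : Γ(X, V)) (e : I → Γ(M, X.basicOpen g)), y.1 ∈ X.basicOpen g ∧
      IsBasisOn M e := by
    obtain ⟨U, e, hy, he⟩ := hn y y.2
    obtain ⟨g, hg, hyg⟩ := hV.exists_basicOpen_le ⟨y, hy⟩ (hTV y y.2)
    exact ⟨g, _, hyg, he.res hg⟩
  choose g e hyg he using h1
  choose N t ht using fun (y : T) (i : I) =>
    hM.exists_res_eq_pow_smul hV (g y) (X.basicOpen_le (g y)) rfl (e y i)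
  choose h hyh hzh using fun y : T => exists_mem_basicOpen_of_finite hV (hTV y y.2)
    (T := (T.erase y.1 : Finset X)) (Finset.finite_toSet _) (fun z hz hzy => by
      have hz := Finset.mem_erase.mp (Finset.mem_coe.mp hz)
      exact hz.1 (hT z hz.2 y y.2 hzy))
  -- `h z` vanishes at the points of `T` other than `z`, so only one summand matters at each point
  refine ⟨fun i => ∑ z : T, h z • t z i, fun y hy => ?_⟩
  have hle := X.basicOpen_le (g ⟨y, hy⟩)
  choose B hB hB' using fun (z : T) (i : I) =>
    (he ⟨y, hy⟩).existsUnique le_rfl (res M hle (t z i))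
  simp only [res_self] at hB hB'
  have hBy (i j : I) : B ⟨y, hy⟩ i j = if i = j then resF hle (g ⟨y, hy⟩) ^ N ⟨y, hy⟩ i else 0 := by
    refine (congr_fun (hB' ⟨y, hy⟩ i (fun j => if i = j then
      resF hle (g ⟨y, hy⟩) ^ N ⟨y, hy⟩ i else 0) ?_) j).symm
    simp [ht]
  refine (he ⟨y, hy⟩).isBasisAt_of_mem_basicOpen_det hle
    (Matrix.of fun i j => ∑ z : T, resF hle (h z) * B z i j) (fun i => ?_) ?_
  · rw [map_sum]
    simp only [res_smul, ← hB, Finset.smul_sum, smul_smul, Matrix.of_apply, Finset.sum_smul]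
    exact Finset.sum_comm
  · -- modulo the maximal ideal at `y` the matrix is diagonal, with invertible diagonal entries
    rw [← X.evaluation_ne_zero_iff_mem_basicOpen y (hyg ⟨y, hy⟩), RingHom.map_det]
    have hev (z : T) (hz : z ≠ ⟨y, hy⟩) : X.evaluation V y (hTV y hy) (h z) = 0 := by
      refine (X.evaluation_eq_zero_iff_notMem_basicOpen y (hTV y hy) (h z)).mpr (hzh z y ?_)
      exact Finset.mem_coe.mpr (Finset.mem_erase.mpr ⟨fun h => hz (Subtype.ext h.symm), hy⟩)
    have hmat : (X.evaluation (X.basicOpen (g ⟨y, hy⟩)) y (hyg ⟨y, hy⟩)).hom.mapMatrix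
        (Matrix.of fun i j => ∑ z : T, resF hle (h z) * B z i j) =
        Matrix.diagonal fun i => X.evaluation V y (hTV y hy) (h ⟨y, hy⟩) *
          X.evaluation V y (hTV y hy) (g ⟨y, hy⟩) ^ N ⟨y, hy⟩ i := by
      ext i j
      rw [RingHom.mapMatrix_apply, Matrix.map_apply, Matrix.of_apply, map_sum,
        Finset.sum_eq_single ⟨y, hy⟩]
      · rw [map_mul, hBy, Matrix.diagonal_apply]
        split_ifs
        · rw [map_pow, evaluation_resF, evaluation_resF]
        · rw [map_zero, mul_zero]
      · intro z _ hz
        rw [map_mul, evaluation_resF, hev z hz, zero_mul]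
      · simp
    rw [hmat, Matrix.det_diagonal, Finset.prod_ne_zero_iff]
    intro i _
    refine mul_ne_zero ?_ (pow_ne_zero _ ?_)
    · exact (X.evaluation_ne_zero_iff_mem_basicOpen y (hTV y hy) _).mpr (hyh ⟨y, hy⟩)
    · exact (X.evaluation_ne_zero_iff_mem_basicOpen y (hTV y hy) _).mpr (hyg ⟨y, hy⟩)

end

/-! ### Compatible bases on a finite cover and a closed subscheme -/

section
variable {X X' Z : Scheme.{u}}

/-- An open neighbourhood of a fibre of a closed morphism contains the preimage of a neighbourhood
of the point. -/
lemma exists_preimage_le (ν : X' ⟶ X) (hν : IsClosedMap ν) {x : X} {U : X'.Opens}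
    (h : ∀ y, ν y = x → y ∈ U) : ∃ V : X.Opens, x ∈ V ∧ ν ⁻¹ᵁ V ≤ U := by
  refine ⟨⟨(ν '' (U : Set X')ᶜ)ᶜ, (hν _ U.2.isClosed_compl).isOpen_compl⟩, ?_, ?_⟩
  · rintro ⟨y, hy, hyx⟩
    exact hy (h y hyx)
  · intro y hy
    by_contra hyU
    exact hy ⟨y, hyU, rfl⟩

lemma exists_preimage_le_of_isClosedImmersion (z : Z ⟶ X) [IsClosedImmersion z] {p : Z}
    {U : Z.Opens} (hp : p ∈ U) : ∃ V : X.Opens, z p ∈ V ∧ z ⁻¹ᵁ V ≤ U := by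
  obtain ⟨t, ht, htU⟩ := z.isClosedEmbedding.isInducing.isOpen_iff.mp U.2
  refine ⟨⟨t, ht⟩, ?_, fun q hq => ?_⟩
  · have : p ∈ z ⁻¹' t := htU ▸ hp
    exact this
  · have h : q ∈ z ⁻¹' t := hq
    rw [htU] at h
    exact h

lemma eq_of_specializes_of_isFinite (ν : X' ⟶ X) [IsFinite ν] {y z : X'} (h : y ⤳ z)
    (hyz : ν y = ν z) : y = z := by
  have := (ν.isDiscrete_preimage_singleton (ν z)).1
  have h1 : (⟨y, hyz⟩ : ν ⁻¹' {ν z}) ⤳ ⟨z, rfl⟩ := Topology.IsInducing.subtypeVal.specializes_iff.mp h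
  exact congr_arg Subtype.val h1.eq

/-- Functions on finitely many pairwise disjoint closed subschemes of an affine scheme extend to a
common function. -/
lemma exists_function_of_disjoint {L : Type*} [Finite L] {Z' : L → Scheme.{u}}
    (z : ∀ l, Z' l ⟶ X) [∀ l, IsClosedImmersion (z l)] [∀ l, AlgebraicGeometry.IsReduced (Z' l)]
    (hdisj : ∀ l m p q, z l p = z m q → l = m) {V : X.Opens} (hV : IsAffineOpen V)
    (a : ∀ l, Γ(Z' l, z l ⁻¹ᵁ V)) :
    ∃ f : Γ(X, V), ∀ l, pbF (z l) (le_refl (z l ⁻¹ᵁ V)) f = a l := by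
  choose f hf using fun l => (z l).app_surjective V hV (a l)
  have key (l : L) (y : X) (hyV : y ∈ V) (hy : ∀ g ∈ RingHom.ker ((z l).app V).hom,
      y ∉ X.basicOpen g) : y ∈ Set.range (z l) := by
    by_contra h
    obtain ⟨g, hg, hyg⟩ := hV.exists_basicOpen_le
      (V := ⟨(Set.range (z l))ᶜ, (z l).isClosedEmbedding.isClosed_range.isOpen_compl⟩) ⟨y, h⟩ hyV
    refine hy g (function_eq_zero fun p hp => ?_) hyg
    exact hg ((mem_basicOpen_app (z l)).mp hp) ⟨p, rfl⟩
  obtain ⟨r, hr⟩ := Ideal.exists_forall_sub_mem_ideal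
    (I := fun l => RingHom.ker ((z l).app V).hom) (fun l m hlm => by
      rw [Function.onFun, Ideal.isCoprime_iff_sup_eq]
      by_contra hne
      obtain ⟨P, hP, hle⟩ := Ideal.exists_le_maximal _ hne
      let y : X := hV.fromSpec (⟨P, hP.isPrime⟩ : PrimeSpectrum _)
      have hyV : y ∈ V := by
        have := Set.mem_range_self (f := hV.fromSpec) (⟨P, hP.isPrime⟩ : PrimeSpectrum _)
        rwa [hV.range_fromSpec] at this
      have hy (g : Γ(X, V)) (hg : g ∈ P) : y ∉ X.basicOpen g := by
        intro h
        have h2 : (⟨P, hP.isPrime⟩ : PrimeSpectrum Γ(X, V)) ∈ hV.fromSpec ⁻¹ᵁ X.basicOpen g := h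
        rw [hV.fromSpec_preimage_basicOpen] at h2
        exact h2 hg
      obtain ⟨p, hp⟩ := key l y hyV fun g hg => hy g (hle (Ideal.mem_sup_left hg))
      obtain ⟨q, hq⟩ := key m y hyV fun g hg => hy g (hle (Ideal.mem_sup_right hg))
      exact hlm (hdisj l m p q (hp.trans hq.symm))) f
  refine ⟨r, fun l => ?_⟩
  have h1 : (z l).app V (r - f l) = 0 := hr l
  rw [map_sub, sub_eq_zero, hf] at h1
  rw [pbF_eq_app, h1]

/-- Let `E` be a vector bundle on `X'` and `C` a vector bundle on a closed subscheme `Z` of `X`, with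
isomorphisms `θ` of their pullbacks to closed subschemes `Z' l` of `X'` that cover the preimage of
`Z`. Locally on `X` there are bases of `E` and `C` that agree under `θ`.

The bundle `E` has a basis near the finite fibre over the given point, in which the transported basis
of `C` is expressed by an invertible matrix on each `Z' l`. As the `Z' l` are disjoint, these matrices
extend to one matrix of functions on `X'`. It is invertible near the fibre, and it carries the basis
of `E` to one that agrees with the basis of `C`. -/
lemma exists_isBasisOn_compatible (ν : X' ⟶ X) [IsFinite ν] [Surjective ν] (z : Z ⟶ X)
    [IsClosedImmersion z] {L : Type*} [Finite L] {Z' : L → Scheme.{u}} (z' : ∀ l, Z' l ⟶ X')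
    [∀ l, IsClosedImmersion (z' l)] [∀ l, AlgebraicGeometry.IsReduced (Z' l)] (r : ∀ l, Z' l ⟶ Z)
    (hr : ∀ l, r l ≫ z = z' l ≫ ν) (hdisj : ∀ l m p q, z' l p = z' m q → l = m) (p₀ : Z)
    (hz' : ∀ y, ν y = z p₀ → ∃ l, y ∈ Set.range (z' l)) {E : X'.Modules} (hE : IsVectorBundle E)
    {C : Z.Modules} (hC : IsVectorBundle C)
    (θ : ∀ l, (Scheme.Modules.pullback (r l)).obj C ≅ (Scheme.Modules.pullback (z' l)).obj E)
    {V₀ : X.Opens} (hV₀ : z p₀ ∈ V₀) :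
    ∃ V ≤ V₀, z p₀ ∈ V ∧ ∃ (n : ℕ) (s : ULift.{u} (Fin n) → Γ(E, ν ⁻¹ᵁ V))
      (c : ULift.{u} (Fin n) → Γ(C, z ⁻¹ᵁ V)), IsBasisOn E s ∧ IsBasisOn C c ∧
      ∀ l (h : z' l ⁻¹ᵁ ν ⁻¹ᵁ V ≤ r l ⁻¹ᵁ z ⁻¹ᵁ V) k,
        (θ l).hom.app _ (pb (r l) C h (c k)) = pb (z' l) E (le_refl (z' l ⁻¹ᵁ ν ⁻¹ᵁ V)) (s k) := by
  classical
  have hle (l : L) (V : X.Opens) : z' l ⁻¹ᵁ ν ⁻¹ᵁ V ≤ r l ⁻¹ᵁ z ⁻¹ᵁ V := by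
    rw [← Scheme.Hom.comp_preimage, ← Scheme.Hom.comp_preimage, hr]
  obtain ⟨UC, n, c₀, hp₀, hc₀⟩ := isVectorBundle_iff.mp hC p₀
  obtain ⟨O, hpO, hO⟩ := exists_preimage_le_of_isClosedImmersion z hp₀
  obtain ⟨V₁, hV₁, hpV₁, hV₁O⟩ := exists_isAffineOpen_mem_and_subset (x := z p₀) (U := V₀ ⊓ O)
    ⟨hV₀, hpO⟩
  have hV₁UC : z ⁻¹ᵁ V₁ ≤ UC := (z.preimage_mono (hV₁O.trans inf_le_right)).trans hO
  have hfin : (ν ⁻¹' {z p₀}).Finite := ν.finite_preimage_singleton _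
  have hfib (y : X') (hy : ν y = z p₀) {V : X.Opens} (hV : z p₀ ∈ V) : y ∈ ν ⁻¹ᵁ V := by
    change ν y ∈ V
    rwa [hy]
  -- the basis of `C`, pulled back to `Z' l` and considered there as a basis of `E`
  have hθ (l : L) {V : X.Opens} (hV : z ⁻¹ᵁ V ≤ UC) : IsBasisOn ((Scheme.Modules.pullback (z' l)).obj E)
      (fun k => (θ l).hom.app _ (pb (r l) C (hle l V) (res C hV (c₀ k)))) :=
    ((hc₀.res hV).pb (r l) (hle l V)).map_iso (θ l)
  -- a basis of `E` at the points of the fibre; its size is right because `θ l` compares the ranks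
  obtain ⟨s₁, hs₁⟩ := hE.exists_isBasisAt (hV₁.preimage ν) (I := ULift.{u} (Fin n)) hfin.toFinset
    (fun y hy => hfib y (hfin.mem_toFinset.mp hy) hpV₁)
    (fun y hy y' hy' h => eq_of_specializes_of_isFinite ν h
      ((hfin.mem_toFinset.mp hy).trans (hfin.mem_toFinset.mp hy').symm)) (fun y hy => by
      obtain ⟨l, q, rfl⟩ := hz' y (hfin.mem_toFinset.mp hy)
      obtain ⟨U, m, e, hyU, he⟩ := isVectorBundle_iff.mp hE (z' l q)
      have hq : q ∈ z' l ⁻¹ᵁ ν ⁻¹ᵁ V₁ := hfib _ (hfin.mem_toFinset.mp hy) hpV₁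
      have hmn := ((he.pb (z' l) (le_refl (z' l ⁻¹ᵁ U))).res inf_le_left).card_eq
        ((hθ l hV₁UC).res (inf_le_right : z' l ⁻¹ᵁ U ⊓ z' l ⁻¹ᵁ ν ⁻¹ᵁ V₁ ≤ _)) (x := q) ⟨hyU, hq⟩
      simp only [Fintype.card_ulift, Fintype.card_fin] at hmn
      subst hmn
      exact ⟨U, e, hyU, he⟩)
  obtain ⟨U₂, hU₂, hTU₂, hs₂⟩ := exists_isBasisOn_of_forall_isBasisAt
    (fun y hy => hs₁ y (Finset.mem_coe.mp hy))
  obtain ⟨O₂, hpO₂, hO₂⟩ := exists_preimage_le ν ν.isClosedMap (U := U₂) (x := z p₀)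
    fun y hy => hTU₂ (Finset.mem_coe.mpr (hfin.mem_toFinset.mpr hy))
  obtain ⟨V₂, hV₂, hpV₂, hV₂O⟩ := exists_isAffineOpen_mem_and_subset (x := z p₀) (U := V₁ ⊓ O₂)
    ⟨hpV₁, hpO₂⟩
  have hV₂UC : z ⁻¹ᵁ V₂ ≤ UC := (z.preimage_mono (hV₂O.trans inf_le_left)).trans hV₁UC
  have hs₃ := hs₂.res ((ν.preimage_mono (hV₂O.trans inf_le_right)).trans hO₂)
  simp only [res_res] at hs₃
  set s₃ : ULift.{u} (Fin n) → Γ(E, ν ⁻¹ᵁ V₂) := fun k => res E _ (s₁ k) with hs₃def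
  have hb (l : L) := hs₃.pb (z' l) (le_refl (z' l ⁻¹ᵁ ν ⁻¹ᵁ V₂))
  -- the matrix `a l` expresses the basis of `C` on `Z' l`, and `f` extends all of the `a l`
  choose a ha _ using fun (l : L) k => (hb l).existsUnique le_rfl
    ((θ l).hom.app _ (pb (r l) C (hle l V₂) (res C hV₂UC (c₀ k))))
  simp only [res_self] at ha
  choose f hf using fun k j => exists_function_of_disjoint z' hdisj (hV₂.preimage ν)
    (fun l => a l k j)
  have hdet (y : X') (hy : ν y = z p₀) : y ∈ X'.basicOpen (Matrix.of f).det := by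
    obtain ⟨l, q, rfl⟩ := hz' y hy
    have hq : q ∈ z' l ⁻¹ᵁ ν ⁻¹ᵁ V₂ := hfib _ hy hpV₂
    have hu := (hb l).isUnit_det (hθ l hV₂UC) (Matrix.of (a l)) (fun k => (ha l k).symm)
    have h1 : (Matrix.of (a l)).det = (z' l).app _ (Matrix.of f).det := by
      rw [← pbF_eq_app, RingHom.map_det]
      congr 1
      ext k j
      exact (hf k j l).symm
    rw [← mem_basicOpen_app (z' l), ← h1, Scheme.basicOpen_of_isUnit _ hu]
    exact hq
  obtain ⟨O₃, hpO₃, hO₃⟩ := exists_preimage_le ν ν.isClosedMap hdet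
  have h32 : V₂ ⊓ O₃ ≤ V₂ := inf_le_left
  have hν32 : ν ⁻¹ᵁ (V₂ ⊓ O₃) ≤ ν ⁻¹ᵁ V₂ := ν.preimage_mono h32
  have hUC : z ⁻¹ᵁ (V₂ ⊓ O₃) ≤ UC := (z.preimage_mono h32).trans hV₂UC
  refine ⟨V₂ ⊓ O₃, h32.trans (hV₂O.trans (inf_le_left.trans (hV₁O.trans inf_le_left))),
    ⟨hpV₂, hpO₃⟩, n, fun k => res E hν32 (∑ j, f k j • s₃ j), fun k => res C hUC (c₀ k), ?_,
    hc₀.res hUC, fun l h k => ?_⟩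
  · refine (hs₃.res hν32).of_isUnit_det ((resF hν32).mapMatrix (Matrix.of f)) ?_ fun k => ?_
    · rw [← RingHom.map_det]
      exact isUnit_resF _ _ ((ν.preimage_mono inf_le_right).trans hO₃)
    · rw [res_sum_smul]
      rfl
  · have h1 := congr_arg (res _ ((z' l).preimage_mono hν32)) (ha l k)
    rw [← app_res, res_pb, pb_res, res_sum_smul] at h1
    rw [pb_res, pb_res, ← h1, pb_sum_smul]
    refine Finset.sum_congr rfl fun j _ => ?_
    rw [← hf k j l, resF_pbF, res_pb]

end

/-! ### Gluing of modules along an open covering -/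

section
variable {Y : Scheme.{u}} {I S : Type u} (a : S → I) (U : I → Scheme.{u}) (W : S → Scheme.{u})
  (f : ∀ s, U (a s) ⟶ W s) (jU : ∀ i, U i ⟶ Y) (jW : ∀ s, W s ⟶ Y)
  (hf : ∀ s, f s ≫ jW s = jU (a s))

/-- The cocone to `Y` of schemes `U i`, `W s` over `Y` and morphisms `U (a s) ⟶ W s`. -/
@[reducible]
def starCocone : SchemeCocone Y where
  V := I ⊕ S
  E := S
  s s := .inl (a s)
  t := .inr
  F := Sum.elim U W
  f := f
  p
    | .inl i => jU i
    | .inr s => jW s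
  w := hf

/-- The `U i` are disjoint open subschemes, and the `W s` are open subschemes that cover `Y` together
with the `U i`, such that `U i` meets `W s` only for `i = a s`, and different `W s` meet only in the
`U i`. -/
structure IsStarCovering : Prop where
  isOpenImmersion_left (i : I) : IsOpenImmersion (jU i)
  isOpenImmersion_right (s : S) : IsOpenImmersion (jW s)
  eq_of_left {i i' : I} {y : Y} (h : y ∈ Set.range (jU i)) (h' : y ∈ Set.range (jU i')) : i = i'
  eq_of_right {i : I} {s : S} {y : Y} (h : y ∈ Set.range (jU i)) (h' : y ∈ Set.range (jW s)) :
    i = a s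
  eq_or_mem {s s' : S} {y : Y} (h : y ∈ Set.range (jW s)) (h' : y ∈ Set.range (jW s')) :
    s = s' ∨ ∃ i, y ∈ Set.range (jU i)
  cover (y : Y) : (∃ i, y ∈ Set.range (jU i)) ∨ ∃ s, y ∈ Set.range (jW s)

lemma pbF_id {X : Scheme.{u}} {V V' : X.Opens} (h : V' ≤ V) (r : Γ(X, V)) :
    pbF (𝟙 X) h r = resF h r := by
  have : (𝟙 X : X ⟶ X).appLE V V' h = X.presheaf.map (homOfLE h).op := by
    simp only [Scheme.Hom.appLE, Scheme.Hom.id_app]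
    exact Category.id_comp _
  exact congr_arg (fun t => t.hom r) this

variable {a U W f jU jW}

namespace IsStarCovering

lemma isOpenImmersion (H : IsStarCovering a U W jU jW) (v : I ⊕ S) : IsOpenImmersion ((starCocone a U W f jU jW hf).p v) :=
  match v with
  | .inl i => H.isOpenImmersion_left i
  | .inr s => H.isOpenImmersion_right s

/-- Functions glue along a star covering: an arrow of the diagram accounts for each non-empty
intersection of two members of the covering. -/
lemma isGluing (H : IsStarCovering a U W jU jW) : (starCocone a U W f jU jW hf).IsGluing := by
  have := H.isOpenImmersion hf
  have hcov (y : Y) : ∃ v, y ∈ Set.range ((starCocone a U W f jU jW hf).p v) :=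
    (H.cover y).elim (fun ⟨i, hi⟩ => ⟨.inl i, hi⟩) (fun ⟨s, hs⟩ => ⟨.inr s, hs⟩)
  refine ⟨fun V b b' hb => function_ext_of_isOpenImmersion _ (fun y _ => hcov y) hb,
    fun V c hc => function_glue_of_isOpenImmersion _ (fun y _ => hcov y) c ?_⟩
  have h1 (i : I) (v : I ⊕ S) (y : Y) (hy : y ∈ Set.range (jU i))
      (hv : y ∈ Set.range ((starCocone a U W f jU jW hf).p v)) :
      ∃ (g : U i ⟶ (starCocone a U W f jU jW hf).F v)
        (hg : g ≫ (starCocone a U W f jU jW hf).p v = jU i),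
        pbF g (V := (starCocone a U W f jU jW hf).p v ⁻¹ᵁ V)
          (W := (starCocone a U W f jU jW hf).p (.inl i) ⁻¹ᵁ V)
          (by rw [← Scheme.Hom.comp_preimage, hg]) (c v) = c (.inl i) := by
    match v, hv with
    | .inl i', hv =>
      obtain rfl := H.eq_of_left hy hv
      exact ⟨𝟙 _, Category.id_comp _, (pbF_id _ _).trans (resF_self _ _)⟩
    | .inr s, hv =>
      obtain rfl := H.eq_of_right hy hv
      exact ⟨f s, hf s, hc s⟩
  have h2 (v w : I ⊕ S) (y : Y) (hv : y ∈ Set.range ((starCocone a U W f jU jW hf).p v))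
      (hw : y ∈ Set.range ((starCocone a U W f jU jW hf).p w)) :
      v = w ∨ ∃ i, y ∈ Set.range (jU i) := by
    match v, w, hv, hw with
    | .inl i, _, hv, _ => exact .inr ⟨i, hv⟩
    | _, .inl i, _, hw => exact .inr ⟨i, hw⟩
    | .inr s, .inr s', hv, hw => exact (H.eq_or_mem hv hw).imp_left (congr_arg _)
  intro v w y hv hw
  obtain rfl | ⟨i, hi⟩ := h2 v w y hv hw
  · exact ⟨v, 𝟙 _, 𝟙 _, Category.id_comp _, Category.id_comp _, hv,
      (pbF_id _ _).trans (resF_self _ _), (pbF_id _ _).trans (resF_self _ _)⟩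
  · obtain ⟨g, hg, hgc⟩ := h1 i v y hi hv
    obtain ⟨g', hg', hgc'⟩ := h1 i w y hi hw
    exact ⟨.inl i, g, g', hg, hg', hi, hgc, hgc'⟩

lemma isBasisOn_of_isEmpty {X : Scheme.{u}} {M : X.Modules} {V : X.Opens} {J : Type*} [Fintype J]
    {e : J → Γ(M, V)} (h : ∀ x, x ∉ V) : IsBasisOn M e :=
  .of_local fun x hx => (h x hx).elim

lemma subsingleton_sections {X : Scheme.{u}} (M : X.Modules) {V : X.Opens} (h : ∀ x, x ∉ V) :
    Subsingleton Γ(M, V) :=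
  ⟨fun _ _ => section_ext M fun x hx => (h x hx).elim⟩

variable {hf}

lemma isOpenImmersion_f (H : IsStarCovering a U W jU jW)
    (hf : ∀ s, f s ≫ jW s = jU (a s)) (s : S) : IsOpenImmersion (f s) := by
  have := H.isOpenImmersion_left (a s)
  have := H.isOpenImmersion_right s
  have : IsOpenImmersion (f s ≫ jW s) := by rwa [hf]
  exact IsOpenImmersion.of_comp (f s) (jW s)

lemma mem_range_f (H : IsStarCovering a U W jU jW)
    (hf : ∀ s, f s ≫ jW s = jU (a s)) {s : S} {q : W s} {i : I} (h : jW s q ∈ Set.range (jU i)) :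
    q ∈ Set.range (f s) := by
  have := H.isOpenImmersion_right s
  obtain rfl := H.eq_of_right h ⟨q, rfl⟩
  obtain ⟨p, hp⟩ := h
  refine ⟨p, (jW s).isOpenEmbedding.injective ?_⟩
  rw [← hp, ← hf s]
  rfl

variable (A : (starCocone a U W f jU jW hf).Family)

/-- A section over `U (a s)` extends to `W s` over open sets whose preimage in `W s` lies in
`U (a s)`. -/
lemma exists_section (H : IsStarCovering a U W jU jW)
    {V : Y.Opens} (s : S) (hV : ∀ q : W s, jW s q ∈ V → q ∈ Set.range (f s))
    (u : Γ(A.A (.inl (a s)), jU (a s) ⁻¹ᵁ V)) :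
    ∃ t : Γ(A.A (.inr s), jW s ⁻¹ᵁ V), (A.α s).hom.app _ (pb (f s) (A.A (.inr s))
      ((starCocone a U W f jU jW hf).preimage_le s V) t) = u := by
  have := H.isOpenImmersion_f hf s
  have h1 : jU (a s) ⁻¹ᵁ V = f s ⁻¹ᵁ jW s ⁻¹ᵁ V := by rw [← Scheme.Hom.comp_preimage, hf]
  obtain ⟨t, ht⟩ := (pb_bijective (f s) (A.A (.inr s)) (V := jW s ⁻¹ᵁ V) hV h1).surjective
    ((A.α s).inv.app _ u)
  exact ⟨t, (congr_arg _ ht).trans (inv_hom_app_apply _ _)⟩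

/-- If a compatible family of sections is a basis over `U (a s)`, then it is one over `W s` at the
points of `U (a s)`. -/
lemma exists_isBasisOn (H : IsStarCovering a U W jU jW) {J : Type*} [Fintype J]
    {V : Y.Opens} {b : J → ∀ v, Γ(A.A v, (starCocone a U W f jU jW hf).p v ⁻¹ᵁ V)} (hb : ∀ k, A.Compatible (b k))
    (s : S) (h : IsBasisOn (A.A (.inl (a s))) (fun k => b k (.inl (a s))))
    (hV : ∀ q : W s, jW s q ∈ V → q ∈ Set.range (f s)) :
    IsBasisOn (A.A (.inr s)) (fun k => b k (.inr s)) := by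
  have := H.isOpenImmersion_f hf s
  have h1 : jU (a s) ⁻¹ᵁ V = f s ⁻¹ᵁ jW s ⁻¹ᵁ V := by rw [← Scheme.Hom.comp_preimage, hf]
  refine (isBasisOn_pb_iff (f s) (A.A (.inr s)) (V := jW s ⁻¹ᵁ V) hV h1 _).mp ?_
  refine (h.map_iso (A.α s).symm).congr fun k => ?_
  rw [← hb k s]
  exact hom_inv_app_apply _ _

/-- A section over one member of a family extends to a family of sections. -/
lemma exists_section_eq {J : Type*} (β : J → Type*) [∀ j, Zero (β j)] (j : J) (x : β j) :
    ∃ u : ∀ j, β j, u j = x := by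
  classical
  exact ⟨Function.update (fun _ => 0) j x, Function.update_self ..⟩

/-- Every family of vector bundles on a star covering has compatible local bases. A basis over one
member of the covering is transported to the only other members that its domain meets. -/
lemma hasLocalBases (H : IsStarCovering a U W jU jW) (hA : ∀ v, IsVectorBundle (A.A v)) :
    HasLocalBases A := by
  classical
  intro y
  by_cases hy : ∃ i, y ∈ Set.range (jU i)
  · obtain ⟨i, p, rfl⟩ := hy
    have := H.isOpenImmersion_left i
    obtain ⟨V, n, e, hpV, he⟩ := isVectorBundle_iff.mp (hA (.inl i)) p
    have hV : jU i ⁻¹ᵁ jU i ''ᵁ V ≤ V := ((jU i).preimage_image_eq V).le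
    have hVi : ∀ x ∈ jU i ''ᵁ V, x ∈ Set.range (jU i) := by
      rintro _ ⟨x, -, rfl⟩
      exact ⟨x, rfl⟩
    choose u hu' using fun k : ULift.{u} (Fin n) => exists_section_eq
      (fun i' => Γ(A.A (.inl i'), jU i' ⁻¹ᵁ jU i ''ᵁ V)) i (res (A.A (.inl i)) hV (e k))
    have hsV (s : S) (q : W s) (hq : jW s q ∈ jU i ''ᵁ V) : q ∈ Set.range (f s) :=
      H.mem_range_f hf (hVi _ hq)
    choose t ht using fun k s => H.exists_section A s (hsV s) (u k (a s))
    have hu (i' : I) : IsBasisOn (A.A (.inl i')) (fun k => u k i') := by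
      by_cases hi : i' = i
      · subst hi
        exact (he.res hV).congr fun k => (hu' k).symm
      · exact isBasisOn_of_isEmpty fun x hx => hi (H.eq_of_left ⟨x, rfl⟩ (hVi _ hx))
    let b (k : ULift.{u} (Fin n)) :
        ∀ v, Γ(A.A v, (starCocone a U W f jU jW hf).p v ⁻¹ᵁ jU i ''ᵁ V)
      | .inl i' => u k i'
      | .inr s => t k s
    have hb (k) : A.Compatible (b k) := fun s => ht k s
    refine ⟨jU i ''ᵁ V, n, b, ⟨p, hpV, rfl⟩, hb, fun v => ?_⟩
    match v with
    | .inl i' => exact hu i'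
    | .inr s => exact H.exists_isBasisOn A hb s (hu (a s)) (hsV s)
  · obtain ⟨s, p, rfl⟩ := (H.cover y).resolve_left hy
    have := H.isOpenImmersion_right s
    obtain ⟨V, n, e, hpV, he⟩ := isVectorBundle_iff.mp (hA (.inr s)) p
    have hV : jW s ⁻¹ᵁ jW s ''ᵁ V ≤ V := ((jW s).preimage_image_eq V).le
    have hVs : ∀ x ∈ jW s ''ᵁ V, x ∈ Set.range (jW s) := by
      rintro _ ⟨x, -, rfl⟩
      exact ⟨x, rfl⟩
    have he' := he.res hV
    have hle := (starCocone a U W f jU jW hf).preimage_le s (jW s ''ᵁ V)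
    choose u hu' using fun k : ULift.{u} (Fin n) => exists_section_eq
      (fun i' => Γ(A.A (.inl i'), jU i' ⁻¹ᵁ jW s ''ᵁ V)) (a s) ((A.α s).hom.app _
        (pb (f s) (A.A (.inr s)) hle (res (A.A (.inr s)) hV (e k))))
    have hsV (s' : S) (hs : s' ≠ s) (q : W s') (hq : jW s' q ∈ jW s ''ᵁ V) :
        q ∈ Set.range (f s') := by
      obtain h | ⟨i, hi⟩ := H.eq_or_mem ⟨q, rfl⟩ (hVs _ hq)
      · exact absurd h hs
      · exact H.mem_range_f hf hi
    have hu (i' : I) : IsBasisOn (A.A (.inl i')) (fun k => u k i') := by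
      by_cases hi : i' = a s
      · subst hi
        exact ((he'.pb (f s) hle).map_iso (A.α s)).congr fun k => (hu' k).symm
      · exact isBasisOn_of_isEmpty fun x hx => hi (H.eq_of_right ⟨x, rfl⟩ (hVs _ hx))
    have ht (k : ULift.{u} (Fin n)) (s' : S) : ∃ t : Γ(A.A (.inr s'), jW s' ⁻¹ᵁ jW s ''ᵁ V),
        (A.α s').hom.app _ (pb (f s') (A.A (.inr s'))
          ((starCocone a U W f jU jW hf).preimage_le s' (jW s ''ᵁ V)) t) = u k (a s') ∧
        ∀ h : s = s', t = h ▸ res (A.A (.inr s)) hV (e k) := by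
      by_cases hs : s' = s
      · subst hs
        exact ⟨_, (hu' k).symm, fun _ => rfl⟩
      · obtain ⟨t, ht⟩ := H.exists_section A s' (hsV s' hs) (u k (a s'))
        exact ⟨t, ht, fun h => absurd h.symm hs⟩
    choose t ht hts using ht
    let b (k : ULift.{u} (Fin n)) :
        ∀ v, Γ(A.A v, (starCocone a U W f jU jW hf).p v ⁻¹ᵁ jW s ''ᵁ V)
      | .inl i' => u k i'
      | .inr s => t k s
    have hb (k) : A.Compatible (b k) := fun s => ht k s
    refine ⟨jW s ''ᵁ V, n, b, ⟨p, hpV, rfl⟩, hb, fun v => ?_⟩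
    match v with
    | .inl i' => exact hu i'
    | .inr s' =>
      by_cases hs : s' = s
      · subst hs
        exact he'.congr fun k => (hts k s' rfl).symm
      · exact H.exists_isBasisOn A hb s' (hu (a s')) (hsV s' hs)

end IsStarCovering
end

/-! ### Dimension of topological spaces -/

section
open TopologicalSpace Topology Order
variable {X Y : Type*} [TopologicalSpace X] [TopologicalSpace Y]

/-- The closure of a point as an irreducible closed set. -/
def pointClosure (x : X) : IrreducibleCloseds X :=
  ⟨closure {x}, isIrreducible_singleton.closure, isClosed_closure⟩

lemma isGenericPoint_genericPoint [QuasiSober X] (T : IrreducibleCloseds X) :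
    IsGenericPoint T.isIrreducible.genericPoint (T : Set X) :=
  T.isIrreducible.isGenericPoint_genericPoint T.isClosed

lemma le_iff_specializes {T T' : IrreducibleCloseds X} {x x' : X} (h : IsGenericPoint x (T : Set X))
    (h' : IsGenericPoint x' (T' : Set X)) : T ≤ T' ↔ x' ⤳ x := by
  rw [h'.specializes_iff_mem]
  exact (h.mem_closed_set_iff T'.isClosed).symm

lemma pointClosure_le_iff {x x' : X} : pointClosure x ≤ pointClosure x' ↔ x' ⤳ x :=
  le_iff_specializes isGenericPoint_closure isGenericPoint_closure

lemma isGenericPoint_map {f : Y → X} (hf : Continuous f) {T : IrreducibleCloseds Y} {y : Y}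
    (h : IsGenericPoint y (T : Set Y)) :
    IsGenericPoint (f y) (IrreducibleCloseds.map f hf T : Set X) := by
  rw [IrreducibleCloseds.coe_map]
  exact h.image hf

/-- A closed surjective map without proper specializations in its fibres, such as a finite
surjective morphism, preserves the dimension: chains can be lifted from the top by going up. -/
lemma topologicalKrullDim_eq_of_isClosedMap [T0Space X] [QuasiSober X] [QuasiSober Y] {f : Y → X}
    (hf : Continuous f) (hc : IsClosedMap f) (hs : Function.Surjective f)
    (hi : ∀ y z, y ⤳ z → f y = f z → y = z) :
    topologicalKrullDim Y = topologicalKrullDim X := by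
  have hgen (T : IrreducibleCloseds Y) := isGenericPoint_genericPoint T
  have hmono : StrictMono (IrreducibleCloseds.map f hf) := by
    intro T T' h
    have h' := (le_iff_specializes (hgen T) (hgen T')).mp h.le
    rw [lt_iff_le_not_ge, le_iff_specializes (isGenericPoint_map hf (hgen T))
      (isGenericPoint_map hf (hgen T')), le_iff_specializes (isGenericPoint_map hf (hgen T'))
      (isGenericPoint_map hf (hgen T))]
    refine ⟨h'.map hf, fun h'' => h.not_ge ?_⟩
    rw [le_iff_specializes (hgen T') (hgen T), hi _ _ h' ((h'.map hf).antisymm h'').eq]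
  have hsurj : Function.Surjective (IrreducibleCloseds.map f hf) := by
    intro A
    obtain ⟨y, hy⟩ := hs A.isIrreducible.genericPoint
    refine ⟨pointClosure y, IrreducibleCloseds.ext ?_⟩
    rw [← (isGenericPoint_map hf (T := pointClosure y) isGenericPoint_closure).def, hy]
    exact isGenericPoint_genericPoint A
  rw [topologicalKrullDim, topologicalKrullDim, krullDim_eq_iSup_height, krullDim_eq_iSup_height,
    ← hsurj.iSup_comp]
  refine iSup_congr fun T => congr_arg _ (height_eq_of_strictMono _ hmono (fun T A hA => ?_) T)
  have hA' := isGenericPoint_genericPoint A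
  have h1 : A.isIrreducible.genericPoint ∈ f '' T := by
    rw [← (hc _ T.isClosed).closure_eq, ← IrreducibleCloseds.coe_map f hf]
    exact hA.le hA'.mem
  obtain ⟨y, hyT, hy⟩ := h1
  have h2 : IrreducibleCloseds.map f hf (pointClosure y) = A := IrreducibleCloseds.ext (by
    rw [← (isGenericPoint_map hf (T := pointClosure y) isGenericPoint_closure).def, hy]
    exact hA')
  refine ⟨pointClosure y, lt_of_le_of_ne ?_ ?_, h2⟩
  · rw [le_iff_specializes isGenericPoint_closure (hgen T)]
    exact (hgen T).specializes hyT
  · rintro rfl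
    exact hA.ne h2.symm

/-- If the closure of the image of each irreducible closed subset of `Y` is properly contained in an
irreducible closed subset of `X`, then every chain in `Y` gives a longer one in `X`. -/
lemma topologicalKrullDim_add_one_le {f : Y → X} (hf : IsInducing f)
    (h : ∀ T : IrreducibleCloseds Y, ¬ IsMax (IrreducibleCloseds.map f hf.continuous T)) :
    topologicalKrullDim Y + 1 ≤ topologicalKrullDim X := by
  rcases isEmpty_or_nonempty (IrreducibleCloseds Y) with hY | hY
  · rw [topologicalKrullDim, krullDim_eq_bot, WithBot.bot_add]
    exact bot_le
  rw [topologicalKrullDim, krullDim_eq_iSup_height_of_nonempty]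
  have h1 (T : IrreducibleCloseds Y) : ((height T + 1 : ℕ∞) : WithBot ℕ∞) ≤ topologicalKrullDim X := by
    obtain ⟨A, hA⟩ := not_isMax_iff.mp (h T)
    refine le_trans (WithBot.coe_le_coe.mpr ?_) (height_le_krullDim A)
    refine le_trans ?_ (height_add_one_le hA)
    gcongr
    exact height_le_height_apply_of_strictMono _
      (IrreducibleCloseds.map_strictMono_of_isInducing hf) T
  have h2 : topologicalKrullDim X ≠ ⊥ := fun h0 => by simpa [h0] using h1 hY.some
  obtain ⟨n, hn⟩ := WithBot.ne_bot_iff_exists.mp h2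
  rw [← hn]
  norm_cast
  rw [ENat.iSup_add]
  refine iSup_le fun T => ?_
  have := h1 T
  rw [← hn] at this
  exact_mod_cast this

/-- If `B` lies in the closure of `A` and is disjoint from `A`, and if points of the closure of `A`
and `B` specialize from points of `A` and `B`, then the dimension drops. -/
lemma topologicalKrullDim_closure_add_one_le [T0Space X] [QuasiSober X] {A B : Set X}
    (hBA : B ⊆ closure A) (hAB : Disjoint A B) (hA : ∀ x ∈ closure A, ∃ a ∈ A, a ⤳ x)
    (hB : ∀ x ∈ closure B, ∃ b ∈ B, b ⤳ x) :
    topologicalKrullDim (closure B) + 1 ≤ topologicalKrullDim (closure A) := by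
  have hle : closure B ⊆ closure A := closure_minimal hBA isClosed_closure
  have hq (C : Set X) : QuasiSober (closure C) := isClosed_closure.isClosedEmbedding_subtypeVal.quasiSober
  have := hq B
  refine topologicalKrullDim_add_one_le (f := Set.inclusion hle) (IsEmbedding.inclusion hle).isInducing fun T hT => ?_
  have hg := isGenericPoint_genericPoint T
  obtain ⟨b, hb, hbt⟩ := hB _ T.isIrreducible.genericPoint.2
  obtain ⟨a, ha, hab⟩ := hA b (hBA hb)
  let a' : closure A := ⟨a, subset_closure ha⟩
  have h1 := isGenericPoint_map (continuous_inclusion hle) hg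
  have h2 : IsGenericPoint a' (pointClosure a' : Set (closure A)) := isGenericPoint_closure
  have h3 : Set.inclusion hle T.isIrreducible.genericPoint ⤳ a' := by
    rw [← le_iff_specializes h2 h1]
    refine hT ?_
    rw [le_iff_specializes h1 h2, ← IsInducing.subtypeVal.specializes_iff]
    exact hab.trans hbt
  have h4 : b ⤳ a := hbt.trans (IsInducing.subtypeVal.specializes_iff.mpr h3)
  exact Set.disjoint_left.mp hAB ha ((hab.antisymm h4).eq ▸ hb)

/-- A chain of irreducible closed subsets of `X` whose generic points lie in a subspace has a length
bounded by the dimension of the subspace. -/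
lemma length_le_topologicalKrullDim {f : Y → X} (hf : IsInducing f)
    (p : LTSeries (IrreducibleCloseds X))
    (h : ∀ i, ∃ y, IsGenericPoint (f y) (p i : Set X)) :
    (p.length : WithBot ℕ∞) ≤ topologicalKrullDim Y := by
  choose y hy using h
  let q : LTSeries (IrreducibleCloseds Y) := LTSeries.mk p.length (fun i => pointClosure (y i)) (by
    intro i j hij
    have h := p.strictMono hij
    rw [lt_iff_le_not_ge, le_iff_specializes (hy i) (hy j), le_iff_specializes (hy j) (hy i),
      hf.specializes_iff, hf.specializes_iff] at h
    rwa [lt_iff_le_not_ge, pointClosure_le_iff, pointClosure_le_iff])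
  exact q.length_le_krullDim

end

/-! ### Dimension of algebras of finite type -/

section
variable (k : Type u) [Field k]

/-- By Noether normalization, the dimension of a domain of finite type over a field is its
transcendence degree. -/
lemma exists_ringKrullDim_eq_trdeg (S : Type u) [CommRing S] [IsDomain S] [Algebra k S]
    [Algebra.FiniteType k S] : ∃ n : ℕ, ringKrullDim S = n ∧ Algebra.trdeg k S = n := by
  obtain ⟨n, g, hg, hi⟩ := exists_integral_inj_algHom_of_fg k S
  algebraize [g.toRingHom]
  have hinj : Function.Injective (algebraMap (MvPolynomial (Fin n) k) S) := hg
  have := (faithfulSMul_iff_algebraMap_injective _ _).mpr hinj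
  refine ⟨n, ?_, ?_⟩
  · rw [← PrimeSpectrum.topologicalKrullDim_eq_ringKrullDim,
      topologicalKrullDim_eq_of_isClosedMap (PrimeSpectrum.continuous_comap g.toRingHom)
        (PrimeSpectrum.isClosedMap_comap_of_isIntegral _ hi) (hi.comap_surjective hg)
        (fun y z hyz h => ?_),
      PrimeSpectrum.topologicalKrullDim_eq_ringKrullDim, MvPolynomial.ringKrullDim_of_isNoetherianRing,
      ringKrullDim_eq_zero_of_field, zero_add]
    · simp
    · by_contra hne
      have hlt : y.asIdeal < z.asIdeal := lt_of_le_of_ne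
        ((PrimeSpectrum.le_iff_specializes y z).mpr hyz) fun h' => hne (PrimeSpectrum.ext h')
      have := Ideal.IsIntegral.comap_lt_comap (R := MvPolynomial (Fin n) k) hlt
      exact this.ne (congr_arg PrimeSpectrum.asIdeal h)
  · rw [← trdeg_add_eq k (MvPolynomial (Fin n) k), MvPolynomial.trdeg_of_isDomain,
      trdeg_eq_zero]
    simp

/-- Nonempty open subsets of an integral affine scheme of finite type over a field have the same
dimension as the scheme, because the transcendence degree does not change under localization. -/
lemma topologicalKrullDim_le_of_isOpen (S : Type u) [CommRing S] [IsDomain S] [Algebra k S]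
    [Algebra.FiniteType k S] {U : Set (PrimeSpectrum S)} (hU : IsOpen U) (hU' : U.Nonempty) :
    topologicalKrullDim (PrimeSpectrum S) ≤ topologicalKrullDim U := by
  obtain ⟨x, hx⟩ := hU'
  obtain ⟨_, ⟨_, ⟨f, rfl⟩, rfl⟩, hxf, hfU⟩ :=
    PrimeSpectrum.isBasis_basic_opens.exists_subset_of_mem_open hx hU
  have hf : f ≠ 0 := by
    rintro rfl
    simp at hxf
  have hle : Submonoid.powers f ≤ nonZeroDivisors S := powers_le_nonZeroDivisors_of_noZeroDivisors hf
  have := IsLocalization.isDomain_localization hle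
  have hfin : Algebra.FiniteType k (Localization.Away f) :=
    (inferInstance : Algebra.FiniteType k S).trans
      (IsLocalization.finiteType_of_monoid_fg (Submonoid.powers f) (Localization.Away f))
  obtain ⟨n, hn, hn'⟩ := exists_ringKrullDim_eq_trdeg k S
  obtain ⟨m, hm, hm'⟩ := exists_ringKrullDim_eq_trdeg k (Localization.Away f)
  have hnm : n = m := by
    have := (faithfulSMul_iff_algebraMap_injective _ _).mpr
      (IsLocalization.injective (Localization.Away f) hle)
    have := IsLocalization.isAlgebraic (R := S) (Localization.Away f) (Submonoid.powers f)
    have h := trdeg_add_eq k S (A := Localization.Away f)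
    rw [trdeg_eq_zero (R := S), add_zero, hn', hm'] at h
    exact_mod_cast h
  have he := PrimeSpectrum.localization_away_isOpenEmbedding (Localization.Away f) f
  have hr : ∀ y, PrimeSpectrum.comap (algebraMap S (Localization.Away f)) y ∈ U := fun y =>
    hfU ((PrimeSpectrum.localization_away_comap_range (Localization.Away f) f).le ⟨y, rfl⟩)
  calc topologicalKrullDim (PrimeSpectrum S)
      = topologicalKrullDim (PrimeSpectrum (Localization.Away f)) := by
        rw [PrimeSpectrum.topologicalKrullDim_eq_ringKrullDim,
          PrimeSpectrum.topologicalKrullDim_eq_ringKrullDim, hn, hm, hnm]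
    _ ≤ topologicalKrullDim U := (he.isInducing.codRestrict hr).topologicalKrullDim_le

end

/-! ### Dimension of schemes locally of finite type over a field -/

section
open TopologicalSpace Topology Order
variable {k : Type u} [Field k]

/-- The generic points of a chain of irreducible closed sets specialize to the lowest one. -/
lemma genericPoint_mem_of_genericPoint_zero_mem {X : Type*} [TopologicalSpace X]
    [QuasiSober X] {W : Set X} (hW : IsOpen W) (p : LTSeries (IrreducibleCloseds X))
    (h : (p 0).isIrreducible.genericPoint ∈ W) (i) : (p i).isIrreducible.genericPoint ∈ W := by
  refine Specializes.mem_open ?_ hW h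
  rw [← le_iff_specializes (isGenericPoint_genericPoint _) (isGenericPoint_genericPoint _)]
  exact p.strictMono.monotone (Fin.zero_le i)

lemma exists_finiteType_ringHom (X : Over (Spec (.of k))) [LocallyOfFiniteType X.hom]
    {W : X.left.Opens} (hW : IsAffineOpen W) : ∃ φ : k →+* Γ(X.left, W), φ.FiniteType :=
  ⟨_, ((X.hom.finiteType_appLE (isAffineOpen_top _) hW le_top)).comp
    (RingHom.FiniteType.of_surjective (Scheme.ΓSpecIso (.of k)).inv.hom
      (ConcreteCategory.bijective_of_isIso (Scheme.ΓSpecIso (.of k)).inv).surjective)⟩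

lemma exists_topologicalKrullDim_le (X : Over (Spec (.of k))) [LocallyOfFiniteType X.hom]
    {W : X.left.Opens} (hW : IsAffineOpen W) :
    ∃ n : ℕ, topologicalKrullDim (Spec Γ(X.left, W)) ≤ n := by
  obtain ⟨φ, hφ⟩ := exists_finiteType_ringHom X hW
  algebraize [φ]
  obtain ⟨n, f, hf⟩ := Algebra.FiniteType.iff_quotient_mvPolynomial''.mp
    (inferInstance : Algebra.FiniteType k Γ(X.left, W))
  refine ⟨n, (PrimeSpectrum.topologicalKrullDim_eq_ringKrullDim _).le.trans
    ((ringKrullDim_le_of_surjective f.toRingHom hf).trans ?_)⟩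
  rw [MvPolynomial.ringKrullDim_of_isNoetherianRing, ringKrullDim_eq_zero_of_field, zero_add]
  simp

/-- Schemes of finite type over a field have finite dimension. -/
lemma topologicalKrullDim_ne_top (X : Over (Spec (.of k))) [LocallyOfFiniteType X.hom]
    [CompactSpace X.left] : topologicalKrullDim X.left ≠ ⊤ := by
  obtain ⟨s, hs, hs'⟩ := (isCompact_iff_finite_and_eq_biUnion_affineOpens (X := X.left)
    (U := ⊤)).mp isCompact_univ
  choose n hn using fun W : X.left.affineOpens => exists_topologicalKrullDim_le X W.2
  obtain ⟨N, hN⟩ := (hs.image n).bddAbove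
  have h : topologicalKrullDim X.left ≤ N := by
    refine iSup_le fun p => ?_
    obtain ⟨W, hW, hx⟩ : ∃ W ∈ s, (p 0).isIrreducible.genericPoint ∈ W.1 := by
      have : (p 0).isIrreducible.genericPoint ∈ (⊤ : X.left.Opens) := trivial
      rw [hs'] at this
      simpa using this
    have hW' : IsAffineOpen W.1 := W.2
    have hp := length_le_topologicalKrullDim hW'.fromSpec.isOpenEmbedding.isInducing p fun i => by
      obtain ⟨y, hy⟩ := hW'.range_fromSpec.ge
        (genericPoint_mem_of_genericPoint_zero_mem W.1.isOpen p hx i)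
      exact ⟨y, hy ▸ isGenericPoint_genericPoint _⟩
    refine hp.trans ((hn W).trans ?_)
    exact_mod_cast hN ⟨W, hW, rfl⟩
  exact fun h' => ENat.natCast_ne_top N (WithBot.coe_injective (top_le_iff.mp (h'.ge.trans h)))

/-- An open set has at least the dimension of every irreducible closed set that it meets. -/
lemma topologicalKrullDim_le_of_nonempty_inter (X : Over (Spec (.of k))) [LocallyOfFiniteType X.hom]
    (T : IrreducibleCloseds X.left) (U : X.left.Opens) (h : ((T : Set X.left) ∩ U).Nonempty) :
    topologicalKrullDim (T : Set X.left) ≤ topologicalKrullDim (U : Set X.left) := by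
  have hT := isGenericPoint_genericPoint T
  set g := T.isIrreducible.genericPoint
  have := T.isClosed.isClosedEmbedding_subtypeVal.quasiSober
  refine iSup_le fun p => ?_
  let q : LTSeries (IrreducibleCloseds X.left) := p.map _
    (IrreducibleCloseds.map_strictMono_of_isInducing (IsInducing.subtypeVal (t := (T : Set X.left))))
  have hq (i) : IsGenericPoint ((p i).isIrreducible.genericPoint : X.left) (q i : Set X.left) :=
    isGenericPoint_map continuous_subtype_val (isGenericPoint_genericPoint (p i))
  obtain ⟨_, ⟨W, hW, rfl⟩, hx, -⟩ := X.left.isBasis_affineOpens.exists_subset_of_mem_open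
      (Set.mem_univ (p 0).isIrreducible.genericPoint.1) isOpen_univ
  replace hW : IsAffineOpen W := hW
  have hxW (i) : ((p i).isIrreducible.genericPoint : X.left) ∈ W :=
    genericPoint_mem_of_genericPoint_zero_mem (W.isOpen.preimage continuous_subtype_val) p hx i
  have hgx (i) : g ⤳ (p i).isIrreducible.genericPoint.1 :=
    hT.specializes (p i).isIrreducible.genericPoint.2
  obtain ⟨P, hP⟩ := hW.range_fromSpec.ge ((hgx 0).mem_open W.isOpen (hxW 0))
  have hj := hW.fromSpec.isOpenEmbedding
  obtain ⟨φ, hφ⟩ := exists_finiteType_ringHom X hW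
  let S := Γ(X.left, W) ⧸ P.asIdeal
  let π : Γ(X.left, W) →+* S := Ideal.Quotient.mk P.asIdeal
  have hφ' : (π.comp φ).FiniteType := hφ.comp_surjective Ideal.Quotient.mk_surjective
  algebraize [π.comp φ]
  have hP' := P.isPrime
  have : IsDomain S := Ideal.Quotient.isDomain P.asIdeal
  let f : PrimeSpectrum S → X.left := fun y => hW.fromSpec (PrimeSpectrum.comap π y)
  have hf : IsInducing f := hj.isInducing.comp
    (PrimeSpectrum.isClosedEmbedding_comap_of_surjective _ π Ideal.Quotient.mk_surjective).isInducing
  have hrange (z : PrimeSpectrum Γ(X.left, W)) (hz : P ⤳ z) :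
      z ∈ Set.range (PrimeSpectrum.comap π) := by
    rw [range_comap_of_surjective _ _ Ideal.Quotient.mk_surjective, Ideal.mk_ker]
    exact (PrimeSpectrum.le_iff_specializes (R := Γ(X.left, W)) P z).mpr hz
  have h1 : (p.length : WithBot ℕ∞) ≤ topologicalKrullDim (PrimeSpectrum S) := by
    refine length_le_topologicalKrullDim hf q fun i => ?_
    obtain ⟨z, hz⟩ := hW.range_fromSpec.ge (hxW i)
    obtain ⟨y, hy⟩ := hrange z (by
      rw [← hj.isInducing.specializes_iff]
      exact hP.symm ▸ hz.symm ▸ hgx i)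
    refine ⟨y, ?_⟩
    change IsGenericPoint (hW.fromSpec (PrimeSpectrum.comap π y)) _
    rw [hy, hz]
    exact hq i
  have h2 : IsOpen (f ⁻¹' U) := U.isOpen.preimage hf.continuous
  have h3 : (f ⁻¹' U).Nonempty := by
    obtain ⟨y, hy⟩ := hrange P specializes_rfl
    refine ⟨y, ?_⟩
    change hW.fromSpec (PrimeSpectrum.comap π y) ∈ U
    rw [hy, hP]
    exact (hT.mem_open_set_iff U.isOpen).mpr h
  refine h1.trans ((topologicalKrullDim_le_of_isOpen k S h2 h3).trans ?_)
  exact ((hf.comp IsInducing.subtypeVal).codRestrict fun y => y.2).topologicalKrullDim_le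

end

/-! ### Constructible sets -/

section
open TopologicalSpace Topology
variable {X : Type*} [TopologicalSpace X]

lemma exists_specializes_of_mem_closure_sdiff [NoetherianSpace X] [QuasiSober X] {U V : Set X}
    (hU : IsOpen U) (hV : IsOpen V) {x : X} (hx : x ∈ closure (U \ V)) : ∃ y ∈ U \ V, y ⤳ x := by
  obtain ⟨S, hS, hSc, hSi, hSu⟩ := NoetherianSpace.exists_finite_set_isClosed_irreducible
    (isClosed_closure (s := U \ V))
  obtain ⟨T, ⟨hT, hTU⟩, hxT⟩ : ∃ T ∈ {T ∈ S | (T ∩ (U \ V)).Nonempty}, x ∈ T := by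
    have h1 : closure (U \ V) ⊆ ⋃ T ∈ {T ∈ S | (T ∩ (U \ V)).Nonempty}, T := by
      refine closure_minimal (fun y hy => ?_)
        ((hS.subset (Set.sep_subset _ _)).isClosed_biUnion fun T hT => hSc T hT.1)
      obtain ⟨T, hT, hyT⟩ := hSu.le (subset_closure hy)
      exact Set.mem_biUnion (show T ∈ {T ∈ S | (T ∩ (U \ V)).Nonempty} from ⟨hT, y, hyT, hy⟩) hyT
    simpa using h1 hx
  have hg := (hSi T hT).isGenericPoint_genericPoint (hSc T hT)
  have hTV : T ⊆ Vᶜ := (Set.subset_sUnion_of_mem hT).trans (hSu.ge.trans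
    (closure_minimal (fun y hy => hy.2) hV.isClosed_compl))
  exact ⟨_, ⟨(hg.mem_open_set_iff hU).mpr (hTU.mono fun y hy => ⟨hy.1, hy.2.1⟩), hTV hg.mem⟩,
    hg.specializes hxT⟩

lemma exists_specializes_of_mem_closure [NoetherianSpace X] [QuasiSober X] {A : Set X}
    (hA : IsConstructible A) {x : X} (hx : x ∈ closure A) : ∃ y ∈ A, y ⤳ x := by
  revert x
  induction A, hA using BooleanSubalgebra.closure_sdiff_sup_induction with
  | isSublattice => exact ⟨fun _ hs _ ht => ⟨hs.1.union ht.1, hs.2.union ht.2⟩, fun _ hs _ ht => ⟨hs.1.inter ht.1, hs.2.inter_isOpen ht.2 ht.1⟩⟩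
  | bot_mem => exact ⟨isOpen_empty, .empty⟩
  | top_mem => exact ⟨isOpen_univ, .univ⟩
  | sdiff U hU V hV => exact fun hx => exists_specializes_of_mem_closure_sdiff hU.1 hV.1 hx
  | sup A hA B hB ihA ihB =>
    intro x hx
    change x ∈ closure (A ∪ B) at hx
    rw [closure_union] at hx
    obtain hx | hx := hx
    · obtain ⟨y, hy, h⟩ := ihA hx
      exact ⟨y, .inl hy, h⟩
    · obtain ⟨y, hy, h⟩ := ihB hx
      exact ⟨y, .inr hy, h⟩

lemma nonempty_inter_closedPoints_of_isConstructible [JacobsonSpace X] {A : Set X}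
    (hA : IsConstructible A) (h : A.Nonempty) : (A ∩ closedPoints X).Nonempty := by
  revert h
  induction A, hA using BooleanSubalgebra.closure_sdiff_sup_induction with
  | isSublattice => exact ⟨fun _ hs _ ht => ⟨hs.1.union ht.1, hs.2.union ht.2⟩, fun _ hs _ ht => ⟨hs.1.inter ht.1, hs.2.inter_isOpen ht.2 ht.1⟩⟩
  | bot_mem => exact ⟨isOpen_empty, .empty⟩
  | top_mem => exact ⟨isOpen_univ, .univ⟩
  | sdiff U hU V hV =>
    exact fun h => nonempty_inter_closedPoints h
      (hU.1.isLocallyClosed.inter hV.1.isClosed_compl.isLocallyClosed)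
  | sup A hA B hB ihA ihB =>
    rintro ⟨x, hx | hx⟩
    · exact (ihA ⟨x, hx⟩).mono (Set.inter_subset_inter_left _ Set.subset_union_left)
    · exact (ihB ⟨x, hx⟩).mono (Set.inter_subset_inter_left _ Set.subset_union_right)

lemma exists_genericPoints_specializes [QuasiSober X] (x : X) : ∃ y ∈ genericPoints X, y ⤳ x :=
  let C : irreducibleComponents X := ⟨_, irreducibleComponent_mem_irreducibleComponents x⟩
  ⟨_, (genericPoints.ofComponent C).2,
    (genericPoints.isGenericPoint_ofComponent C).specializes mem_irreducibleComponent⟩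

lemma eq_of_specializes_of_mem_genericPoints [T0Space X] {x y : X} (hx : x ∈ genericPoints X)
    (h : y ⤳ x) : y = x := by
  have h1 : closure {x} ⊆ closure {y} := h.closure_subset
  have h2 : closure {y} ⊆ closure {x} := hx.2 isIrreducible_singleton.closure h1
  exact (h.antisymm (specializes_iff_closure_subset.mpr h2)).eq

end

/-! ### Stable sets and orbits -/

section
variable {k : Type u} [Field k] {G : Over (Spec (.of k))} [GrpObj G] {X X' : GSch G}

/-- The involution `(g, x) ↦ (g⁻¹, g x)` of `G × X`. It exchanges the projection to `X` and the
action map. -/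
def actionInvolution (X : GSch G) : G ⊗ X.X ⟶ G ⊗ X.X :=
  lift (fst G X.X)⁻¹ γ[G, X.X]

lemma actionInvolution_snd : actionInvolution X ≫ snd G X.X = γ[G, X.X] := lift_snd _ _

lemma smul_eq_smul_snd : γ[G, X.X] = fst G X.X • snd G X.X := by
  rw [Hom.smul_def, lift_fst_snd, Category.id_comp]

lemma actionInvolution_smul : actionInvolution X ≫ γ[G, X.X] = snd G X.X := by
  rw [actionInvolution, ← Hom.smul_def, smul_eq_smul_snd, inv_smul_smul]

lemma actionInvolution_actionInvolution : actionInvolution X ≫ actionInvolution X = 𝟙 _ := by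
  ext1
  · simp only [Category.assoc, Category.id_comp]
    rw [actionInvolution, lift_fst, GrpObj.comp_inv, lift_fst, inv_inv]
  · rw [Category.assoc, actionInvolution_snd, actionInvolution_smul, Category.id_comp]

instance : IsIso (actionInvolution X) :=
  ⟨actionInvolution X, actionInvolution_actionInvolution, actionInvolution_actionInvolution⟩

instance : IsIso (actionInvolution X).left :=
  inferInstanceAs (IsIso ((Over.forget (Spec (.of k))).map (actionInvolution X)))

instance [LocallyOfFiniteType G.hom] : UniversallyOpen G.hom := by
  have : Flat G.hom := inferInstance
  infer_instance

lemma isOpenMap_snd [LocallyOfFiniteType G.hom] : IsOpenMap (snd G X.X).left := by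
  have : UniversallyOpen (snd G X.X).left :=
    inferInstanceAs (UniversallyOpen (Limits.pullback.snd G.hom X.X.hom))
  exact Scheme.Hom.isOpenMap _

lemma isOpenMap_smul [LocallyOfFiniteType G.hom] : IsOpenMap (γ[G, X.X]).left := by
  have h : (γ[G, X.X]).left = (actionInvolution X).left ≫ (snd G X.X).left := by
    rw [← Over.comp_left, actionInvolution_snd]
  rw [h]
  rw [Scheme.Hom.comp_base]
  exact isOpenMap_snd.comp (actionInvolution X).left.isOpenEmbedding.isOpenMap

lemma IsStable.closure [LocallyOfFiniteType G.hom] {A : Set X.X.left} (hA : IsStable A) :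
    IsStable (closure A) := by
  intro p hp
  have h1 := isOpenMap_snd.preimage_closure_subset_closure_preimage hp
  have h2 : (γ[G, X.X]).left ⁻¹' (_root_.closure A) ⊇ (snd G X.X).left ⁻¹' A :=
    fun q hq => subset_closure (hA q hq)
  exact closure_minimal h2 (isClosed_closure.preimage (γ[G, X.X]).left.continuous) h1

lemma IsStable.interior [LocallyOfFiniteType G.hom] {A : Set X.X.left} (hA : IsStable A) :
    IsStable (interior A) := by
  have h : (γ[G, X.X]).left '' ((snd G X.X).left ⁻¹' (_root_.interior A)) ⊆ _root_.interior A := by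
    refine interior_maximal ?_ (isOpenMap_smul _ (isOpen_interior.preimage (snd G X.X).left.continuous))
    rintro _ ⟨p, hp, rfl⟩
    exact hA p (interior_subset hp)
  exact fun p hp => h ⟨p, hp, rfl⟩

/-- Every point of an orbit is moved to every other one by a point of the group: for `g x` and `h x`,
the point `(h g⁻¹, g x)` of `G × X`. -/
lemma IsOrbit.exists_point {A : Set X.X.left} (hA : IsOrbit A) {y z : X.X.left} (hy : y ∈ A)
    (hz : z ∈ A) : ∃ p, (snd G X.X).left p = y ∧ (γ[G, X.X]).left p = z := by
  obtain ⟨x, rfl⟩ := hA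
  set o : G ⟶ X.X := (𝟙 G : G ⟶ G) • (toUnit G ≫ x) with ho
  obtain ⟨g₀, rfl⟩ := hy
  obtain ⟨g₁, rfl⟩ := hz
  obtain ⟨z, hz₁, hz₂⟩ := Scheme.Pullback.exists_preimage_pullback (f := G.hom) (g := G.hom) g₁ g₀
    (Subsingleton.elim _ _)
  change (fst G G).left z = g₁ at hz₁
  change (snd G G).left z = g₀ at hz₂
  let c : G ⊗ G ⟶ G ⊗ X.X := lift (fst G G * (snd G G)⁻¹) (snd G G ≫ o)
  have hc : c ≫ γ[G, X.X] = fst G G ≫ o := by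
    rw [← Hom.smul_def, ho, ModObj.comp_smul, ModObj.comp_smul, Category.comp_id, Category.comp_id,
      smul_smul, inv_mul_cancel_right]
    simp
  refine ⟨c.left z, ?_, ?_⟩
  · rw [← hz₂]
    exact congr_arg (fun t => t.left z) (lift_snd (fst G G * (snd G G)⁻¹) (snd G G ≫ o))
  · rw [← hz₁]
    exact congr_arg (fun t => t.left z) hc

/-- A stable set that meets an orbit contains it. -/
lemma IsOrbit.subset_of_isStable {A W : Set X.X.left} (hA : IsOrbit A) (hW : IsStable W)
    (h : (A ∩ W).Nonempty) : A ⊆ W := by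
  obtain ⟨y, hy, hyW⟩ := h
  intro z hz
  obtain ⟨p, rfl, rfl⟩ := hA.exists_point hy hz
  exact hW p hyW

lemma IsOrbit.eq_of_inter {A B : Set X.X.left} (hA : IsOrbit A) (hB : IsOrbit B)
    (h : (A ∩ B).Nonempty) : A = B :=
  (hA.subset_of_isStable hB.isStable h).antisymm
    (hB.subset_of_isStable hA.isStable (Set.inter_comm A B ▸ h))

lemma mem_range_orbit (x : 𝟙_ (Over (Spec (.of k))) ⟶ X.X) (p : ↥(𝟙_ (Over (Spec (.of k)))).left) :
    x.left p ∈ Set.range ((𝟙 G : G ⟶ G) • (toUnit G ≫ x) : G ⟶ X.X).left := by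
  have h : η[G] ≫ ((𝟙 G : G ⟶ G) • (toUnit G ≫ x) : G ⟶ X.X) = x := by
    rw [ModObj.comp_smul, Category.comp_id, ← Category.assoc, toUnit_unique (η[G] ≫ toUnit G) (𝟙 _),
      Category.id_comp]
    have : (η[G] : 𝟙_ _ ⟶ G) = 1 := by simp [Hom.one_def]
    rw [this, one_smul]
  refine ⟨η[G].left p, ?_⟩
  exact congr_arg (fun t => t.left p) h

lemma IsOrbit.nonempty {A : Set X.X.left} (hA : IsOrbit A) : A.Nonempty := by
  obtain ⟨x, rfl⟩ := hA
  exact ⟨_, mem_range_orbit x (default : ↥(Spec (.of k)))⟩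

lemma IsStable.preimage (ν : X' ⟶ X) {A : Set X.X.left} (hA : IsStable A) :
    IsStable (ν.hom.left ⁻¹' A) := by
  intro p hp
  have h1 : γ[G, X'.X] ≫ ν.hom = (G ◁ ν.hom) ≫ γ[G, X.X] := ν.isModHom.smul_hom
  have h2 : ν.hom.left ((γ[G, X'.X]).left p) = (γ[G, X.X]).left ((G ◁ ν.hom).left p) :=
    congr_arg (fun t => t.left p) h1
  have h3 : (snd G X.X).left ((G ◁ ν.hom).left p) = ν.hom.left ((snd G X'.X).left p) :=
    congr_arg (fun t => t.left p) (whiskerLeft_snd G ν.hom)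
  change ν.hom.left ((γ[G, X'.X]).left p) ∈ A
  rw [h2]
  exact hA _ (by rwa [h3])

lemma IsOrbit.image (ν : X' ⟶ X) {A : Set X'.X.left} (hA : IsOrbit A) :
    IsOrbit (ν.hom.left '' A) := by
  obtain ⟨x, rfl⟩ := hA
  refine ⟨x ≫ ν.hom, ?_⟩
  have h : ((𝟙 G : G ⟶ G) • (toUnit G ≫ x) : G ⟶ X'.X) ≫ ν.hom =
      ((𝟙 G : G ⟶ G) • (toUnit G ≫ x ≫ ν.hom) : G ⟶ X.X) := by
    rw [IsModHom.map_smul, Category.assoc]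
  rw [← h, ← Set.range_comp]
  rfl

lemma exists_isOrbit_mem_of_mem_closedPoints [IsAlgClosed k] [LocallyOfFiniteType X.X.hom]
    {x : X.X.left} (hx : x ∈ closedPoints X.X.left) : ∃ A : Set X.X.left, IsOrbit A ∧ x ∈ A := by
  let y : 𝟙_ (Over (Spec (.of k))) ⟶ X.X := Over.homMk (pointOfClosedPoint X.X.hom x hx)
    (pointOfClosedPoint_comp X.X.hom x hx)
  refine ⟨_, ⟨y, rfl⟩, ?_⟩
  have := mem_range_orbit y (default : ↥(Spec (.of k)))
  rwa [show y.left (default : ↥(Spec (.of k))) = x from pointOfClosedPoint_apply X.X.hom x hx _] at this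

variable [IsVariety X.X]

lemma IsVariety.isNoetherian (X : Over (Spec (.of k))) [IsVariety X] : IsNoetherian X.left := by
  have := LocallyOfFiniteType.isLocallyNoetherian X.hom
  have := IsVariety.quasiCompact (X := X)
  have := QuasiCompact.compactSpace_of_compactSpace X.hom
  constructor

lemma IsOrbit.isConstructible [IsAffine G.left] [LocallyOfFiniteType G.hom] {A : Set X.X.left}
    (hA : IsOrbit A) : Topology.IsConstructible A := by
  obtain ⟨x, rfl⟩ := hA
  set o : G ⟶ X.X := (𝟙 G : G ⟶ G) • (toUnit G ≫ x)
  have := IsVariety.isNoetherian X.X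
  have : LocallyOfFiniteType (o.left ≫ X.X.hom) := by
    rw [Over.w]
    infer_instance
  have : LocallyOfFiniteType o.left := locallyOfFiniteType_of_comp o.left X.X.hom
  have : IsLocallyNoetherian G.left := LocallyOfFiniteType.isLocallyNoetherian G.hom
  have : IsNoetherian G.left := {}
  rw [← Set.image_univ]
  exact Scheme.Hom.isConstructible_image _ .univ

lemma IsOrbit.exists_specializes [IsAffine G.left] [LocallyOfFiniteType G.hom] {A : Set X.X.left}
    (hA : IsOrbit A) (x : X.X.left) (hx : x ∈ closure A) : ∃ a ∈ A, a ⤳ x := by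
  have := IsVariety.isNoetherian X.X
  exact exists_specializes_of_mem_closure hA.isConstructible hx

/-- If there are finitely many orbits, then they cover the scheme: their union is constructible and
contains all closed points. -/
lemma exists_isOrbit_mem [IsAlgClosed k] [IsAffine G.left] [LocallyOfFiniteType G.hom]
    (hfin : {A : Set X.X.left | IsOrbit A}.Finite) (x : X.X.left) :
    ∃ A : Set X.X.left, IsOrbit A ∧ x ∈ A := by
  by_contra hx
  have := LocallyOfFiniteType.jacobsonSpace X.X.hom
  obtain ⟨y, hy, hy'⟩ := nonempty_inter_closedPoints_of_isConstructible
    (A := (⋃₀ {A : Set X.X.left | IsOrbit A})ᶜ)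
    (Topology.isConstructible_compl.mpr (.sUnion hfin fun A hA => hA.isConstructible))
    ⟨x, by simpa using hx⟩
  obtain ⟨A, hA, hyA⟩ := exists_isOrbit_mem_of_mem_closedPoints hy'
  exact hy ⟨A, hA, hyA⟩

end

/-! ### The locus over which a morphism is an isomorphism -/

section
variable {S : Scheme.{u}} {G : Over S}

lemma isPullback_whiskerLeft {X Y : Over S} (f : Y ⟶ X) :
    IsPullback (snd G Y).left (G ◁ f).left f.left (snd G X).left := by
  have h (Z : Over S) : IsPullback (fst G Z).left (snd G Z).left G.hom Z.hom :=
    IsPullback.of_hasPullback G.hom Z.hom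
  refine (IsPullback.of_right ?_ ?_ (h X)).flip
  · rw [← Over.comp_left, whiskerLeft_fst, Over.w]
    exact h Y
  · rw [← Over.comp_left, whiskerLeft_snd, Over.comp_left]

variable {X X' T T' : Scheme.{u}} {ν : X' ⟶ X} {a : T' ⟶ X'} {b : T' ⟶ T}

lemma isIso_of_isPullback {q : T ⟶ X} (h : IsPullback a b ν q) {V : X.Opens} [IsIso (ν ∣_ V)]
    (hV : Set.range q ⊆ V) : IsIso b := by
  let q' : T ⟶ V := IsOpenImmersion.lift V.ι q (by simpa using hV)
  have hq' : q' ≫ V.ι = q := IsOpenImmersion.lift_fac _ _ _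
  let a' : T' ⟶ (ν ⁻¹ᵁ V) := IsOpenImmersion.lift (ν ⁻¹ᵁ V).ι a (by
    rw [Scheme.Opens.range_ι]
    rintro _ ⟨t, rfl⟩
    change ν (a t) ∈ V
    rw [← Scheme.Hom.comp_apply, h.w]
    exact hV ⟨b t, rfl⟩)
  have ha' : a' ≫ (ν ⁻¹ᵁ V).ι = a := IsOpenImmersion.lift_fac _ _ _
  have h1 : IsPullback a' b (ν ∣_ V) q' := by
    refine IsPullback.of_right ?_ ?_ (isPullback_morphismRestrict ν V).flip
    · rwa [ha', hq']
    · rw [← cancel_mono V.ι, Category.assoc, Category.assoc, hq', morphismRestrict_ι, ← Category.assoc,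
        ha', h.w]
  exact (MorphismProperty.isomorphisms Scheme.{u}).of_isPullback h1 ‹_›

/-- Flat descent for the property of being an isomorphism. -/
lemma isIso_morphismRestrict_of_flat {q : T ⟶ X} (h : IsPullback a b ν q) [Flat q]
    [LocallyOfFinitePresentation q] [IsIso b] {U : X.Opens} (hU : (U : Set X) ⊆ Set.range q) :
    IsIso (ν ∣_ U) := by
  have h1 : IsPullback (Limits.pullback.snd (q ∣_ U) (ν ∣_ U) ≫ (ν ⁻¹ᵁ U).ι)
      (Limits.pullback.fst (q ∣_ U) (ν ∣_ U)) ν ((q ⁻¹ᵁ U).ι ≫ q) := by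
    rw [← morphismRestrict_ι]
    exact (IsPullback.of_hasPullback (q ∣_ U) (ν ∣_ U)).flip.paste_horiz
      (isPullback_morphismRestrict ν U).flip
  have h2 : IsPullback (h.lift _ _ (h1.w.trans (Category.assoc _ _ _).symm))
      (Limits.pullback.fst (q ∣_ U) (ν ∣_ U)) b (q ⁻¹ᵁ U).ι :=
    IsPullback.of_right (by rwa [h.lift_fst]) (h.lift_snd _ _ _) h
  have h3 : IsIso (Limits.pullback.fst (q ∣_ U) (ν ∣_ U)) :=
    (MorphismProperty.isomorphisms Scheme.{u}).of_isPullback h2 ‹_›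
  have hs : Surjective (q ∣_ U) := by
    refine ⟨fun x => ?_⟩
    obtain ⟨t, ht⟩ := hU x.2
    have ht' : t ∈ q ⁻¹ᵁ U := by
      change q t ∈ U
      rw [ht]
      exact x.2
    refine ⟨⟨t, ht'⟩, U.ι.isOpenEmbedding.injective ?_⟩
    exact (congr_arg (fun f => f (⟨t, ht'⟩ : q ⁻¹ᵁ U)) (morphismRestrict_ι q U)).trans ht
  exact MorphismProperty.of_pullback_fst_of_descendsAlong (P := .isomorphisms Scheme.{u})
    (Q := @Surjective ⊓ @Flat ⊓ @LocallyOfFinitePresentation) (f := q ∣_ U) (g := ν ∣_ U)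
    ⟨⟨hs, inferInstance⟩, inferInstance⟩ h3

end

section
variable {k : Type u} [Field k] {G : Over (Spec (.of k))} [GrpObj G] {X X' : GSch G}

instance [LocallyOfFiniteType G.hom] : LocallyOfFinitePresentation (snd G X.X).left :=
  inferInstanceAs (LocallyOfFinitePresentation (Limits.pullback.snd G.hom X.X.hom))

instance (Y : Over (Spec (.of k))) : Flat (snd G Y).left := by
  have : Flat G.hom := inferInstance
  exact inferInstanceAs (Flat (Limits.pullback.snd G.hom Y.hom))

lemma isPullback_smul (ν : X' ⟶ X) :
    IsPullback (γ[G, X'.X]).left (G ◁ ν.hom).left ν.hom.left (γ[G, X.X]).left := by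
  have h1 : γ[G, X'.X] ≫ ν.hom = (G ◁ ν.hom) ≫ γ[G, X.X] := ν.isModHom.smul_hom
  have h2 : actionInvolution X' ≫ (G ◁ ν.hom) = (G ◁ ν.hom) ≫ actionInvolution X := by
    ext1
    · rw [Category.assoc, Category.assoc, whiskerLeft_fst, actionInvolution, actionInvolution,
        lift_fst, lift_fst, GrpObj.comp_inv, whiskerLeft_fst]
    · rw [Category.assoc, Category.assoc, whiskerLeft_snd, actionInvolution_snd, ← Category.assoc,
        actionInvolution_snd, h1]
  have h3 : IsPullback (actionInvolution X').left (G ◁ ν.hom).left (G ◁ ν.hom).left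
      (actionInvolution X).left :=
    IsPullback.of_horiz_isIso ⟨by rw [← Over.comp_left, h2, Over.comp_left]⟩
  have h4 := h3.paste_horiz (isPullback_whiskerLeft ν.hom)
  rwa [← Over.comp_left, ← Over.comp_left, actionInvolution_snd, actionInvolution_snd] at h4

/-- The locus over which an equivariant morphism is an isomorphism is stable, so that it contains an
orbit if it meets it. -/
lemma IsOrbit.isIso_morphismRestrict [LocallyOfFiniteType G.hom] (ν : X' ⟶ X) {U V : X.X.left.Opens}
    (hU : IsOrbit (U : Set X.X.left)) [IsIso (ν.hom.left ∣_ V)]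
    (hUV : ((U : Set X.X.left) ∩ V).Nonempty) : IsIso (ν.hom.left ∣_ U) := by
  let T := (γ[G, X.X]).left ⁻¹ᵁ V
  have h0 := (isPullback_morphismRestrict (G ◁ ν.hom).left T).flip
  have h1 := h0.paste_horiz (isPullback_smul ν)
  have h2 := h0.paste_horiz (isPullback_whiskerLeft ν.hom)
  have : IsIso ((G ◁ ν.hom).left ∣_ T) := by
    refine isIso_of_isPullback h1 (V := V) ?_
    rintro _ ⟨t, rfl⟩
    exact t.2
  refine isIso_morphismRestrict_of_flat h2 fun x hx => ?_
  obtain ⟨y, hyU, hyV⟩ := hUV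
  obtain ⟨p, hp, hp'⟩ := hU.exists_point hx hyU
  exact ⟨⟨p, show (γ[G, X.X]).left p ∈ V from hp' ▸ hyV⟩, hp⟩

end

/-! ### The orbits of a chain -/

lemma not_add_one_le {a : WithBot ℕ∞} (h : a ≠ ⊥) (h' : a ≠ ⊤) : ¬ a + 1 ≤ a := by
  obtain ⟨b, rfl⟩ := WithBot.ne_bot_iff_exists.mp h
  obtain ⟨n, rfl⟩ := ENat.ne_top_iff_exists.mp (fun hb : b = ⊤ => h' (by rw [hb]; rfl))
  norm_cast
  omega

section
variable {k : Type u} [Field k] {G : Over (Spec (.of k))} [GrpObj G]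
  [IsAffine G.left] [LocallyOfFiniteType G.hom] {X : GSch G}

lemma IsVariety.topologicalKrullDim_ne_top (X : Over (Spec (.of k))) [IsVariety X] :
    topologicalKrullDim X.left ≠ ⊤ :=
  haveI := IsVariety.isNoetherian X
  EquivariantChain.topologicalKrullDim_ne_top X

lemma topologicalKrullDim_ne_top_of_subset (X : Over (Spec (.of k))) [IsVariety X] (A : Set X.left) :
    topologicalKrullDim A ≠ ⊤ :=
  ne_top_of_le_ne_top (IsVariety.topologicalKrullDim_ne_top X)
    (topologicalKrullDim_subspace_le _ A)

lemma topologicalKrullDim_ne_bot_of_nonempty {Y : Type*} [TopologicalSpace Y] {A : Set Y}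
    (h : A.Nonempty) : topologicalKrullDim A ≠ ⊥ := by
  rw [topologicalKrullDim, Ne, Order.krullDim_eq_bot_iff, not_isEmpty_iff]
  obtain ⟨x, hx⟩ := h
  exact ⟨pointClosure ⟨x, hx⟩⟩

lemma topologicalKrullDim_mono {Y : Type*} [TopologicalSpace Y] {A B : Set Y} (h : A ⊆ B) :
    topologicalKrullDim A ≤ topologicalKrullDim B :=
  (Topology.IsEmbedding.inclusion h).isInducing.topologicalKrullDim_le

/-- Different orbits of the same dimension do not specialize to each other. -/
lemma IsOrbit.topologicalKrullDim_closure_add_one_le [IsVariety X.X] {A B : Set X.X.left}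
    (hA : IsOrbit A) (hB : IsOrbit B) (hAB : A ≠ B) (h : (B ∩ closure A).Nonempty) :
    topologicalKrullDim (closure B) + 1 ≤ topologicalKrullDim (closure A) :=
  EquivariantChain.topologicalKrullDim_closure_add_one_le
    (hB.subset_of_isStable hA.isStable.closure h)
    (Set.disjoint_iff_inter_eq_empty.mpr (Set.not_nonempty_iff_eq_empty.mp
      fun h => hAB (hA.eq_of_inter hB h))) hA.exists_specializes hB.exists_specializes

variable [IsAlgClosed k]

/-- If there are finitely many orbits, then those that contain the generic point of an irreducible
component are open. -/
lemma IsOrbit.isOpen_of_mem_genericPoints [IsVariety X.X]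
    (hfin : {A : Set X.X.left | IsOrbit A}.Finite) {A : Set X.X.left} (hA : IsOrbit A)
    {x : X.X.left} (hx : x ∈ genericPoints X.X.left) (hxA : x ∈ A) : IsOpen A := by
  let N : Set X.X.left := ⋃ B ∈ {B : Set X.X.left | IsOrbit B ∧ B ≠ A}, closure B
  have hN : IsClosed N := (hfin.subset fun B hB => hB.1).isClosed_biUnion fun B _ => isClosed_closure
  have hxN : x ∉ N := by
    intro h
    simp only [N, Set.mem_iUnion] at h
    obtain ⟨B, ⟨hB, hBA⟩, hxB⟩ := h
    obtain ⟨y, hy, hyx⟩ := hB.exists_specializes x hxB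
    rw [eq_of_specializes_of_mem_genericPoints hx hyx] at hy
    exact hBA (hB.eq_of_inter hA ⟨x, hy, hxA⟩)
  have hNA : Nᶜ ⊆ A := by
    intro y hy
    obtain ⟨B, hB, hyB⟩ := exists_isOrbit_mem hfin y
    by_cases hBA : B = A
    · exact hBA ▸ hyB
    · exact (hy (Set.mem_biUnion (show B ∈ {B : Set X.X.left | IsOrbit B ∧ B ≠ A} from ⟨hB, hBA⟩)
        (subset_closure hyB))).elim
  have h := hA.subset_of_isStable hA.isStable.interior
    ⟨x, hxA, interior_maximal hNA hN.isOpen_compl hxN⟩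
  exact (interior_eq_iff_isOpen.mp (interior_subset.antisymm h))

variable [IsGChain X]

lemma IsOrbit.exists_openOrbit {A : Set X.X.left} (hA : IsOrbit A) {x : X.X.left}
    (hx : x ∈ genericPoints X.X.left) (hxA : x ∈ A) :
    ∃ U : OpenOrbit X, (U.carrier : Set X.X.left) = A := by
  have hop := hA.isOpen_of_mem_genericPoints IsGChain.finite_orbits hx hxA
  refine ⟨⟨⟨A, hop⟩, hA, (topologicalKrullDim_subspace_le _ A).antisymm ?_⟩, rfl⟩
  rw [← IsGChain.pure_dim _ hx]
  exact topologicalKrullDim_le_of_nonempty_inter X.X (pointClosure x) ⟨A, hop⟩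
    ⟨x, subset_closure rfl, hxA⟩

/-- Every orbit of a chain is open of codimension `0` or closed of codimension `1`. An orbit that
contains no generic point of `X` has codimension at least `1` by going up to the generic points, and
the orbits in its boundary would have codimension at least `2`. -/
lemma IsOrbit.exists_openOrbit_or_exists_closedOrbit {A : Set X.X.left} (hA : IsOrbit A) :
    (∃ U : OpenOrbit X, (U.carrier : Set X.X.left) = A) ∨
      ∃ Z : ClosedOrbit X, (Z.carrier : Set X.X.left) = A := by
  by_cases hg : ∃ x ∈ genericPoints X.X.left, x ∈ A
  · obtain ⟨x, hx, hxA⟩ := hg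
    exact .inl (hA.exists_openOrbit hx hxA)
  · have h1 : topologicalKrullDim (closure A) + 1 ≤ topologicalKrullDim X.X.left := by
      have h := EquivariantChain.topologicalKrullDim_closure_add_one_le
        (A := genericPoints X.X.left) (B := A) (by rw [genericPoints.closure]; exact Set.subset_univ _)
        (Set.disjoint_left.mpr fun x hx hxA => hg ⟨x, hx, hxA⟩)
        (fun x _ => exists_genericPoints_specializes x) hA.exists_specializes
      exact h.trans (topologicalKrullDim_subspace_le _ _)
    have htop := IsVariety.topologicalKrullDim_ne_top X.X
    have hcodim : ∀ B : Set X.X.left, IsOrbit B → topologicalKrullDim B + 1 ≤ topologicalKrullDim X.X.left →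
        topologicalKrullDim B + 1 = topologicalKrullDim X.X.left := by
      intro B hB hle
      refine (IsGChain.codim_le_one B hB).resolve_left fun h => ?_
      rw [← h] at hle
      exact not_add_one_le (topologicalKrullDim_ne_bot_of_nonempty hB.nonempty)
        (topologicalKrullDim_ne_top_of_subset X.X B) hle
    have hle : topologicalKrullDim A + 1 ≤ topologicalKrullDim X.X.left :=
      (add_le_add_left (topologicalKrullDim_mono subset_closure) 1).trans h1
    have hcl : closure A ⊆ A := by
      intro y hy
      by_contra hyA
      obtain ⟨B, hB, hyB⟩ := exists_isOrbit_mem IsGChain.finite_orbits y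
      have hAB : A ≠ B := fun h => hyA (h ▸ hyB)
      have h2 := hA.topologicalKrullDim_closure_add_one_le hB hAB ⟨y, hyB, hy⟩
      have h3 : topologicalKrullDim B + 1 ≤ topologicalKrullDim (closure A) :=
        (add_le_add_left (topologicalKrullDim_mono subset_closure) 1).trans h2
      have h4 := hcodim B hB (h3.trans (topologicalKrullDim_subspace_le _ _))
      rw [h4] at h3
      exact not_add_one_le (fun h => by simp [h, topologicalKrullDim_ne_bot_of_nonempty hA.nonempty.closure] at h3 h1) htop ((add_le_add_left h3 1).trans h1)
    exact .inr ⟨⟨⟨A, closure_subset_iff_isClosed.mp hcl⟩, hA, hcodim A hA hle⟩, rfl⟩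

instance : Finite (ClosedOrbit X) :=
  haveI := (IsGChain.finite_orbits (X := X)).to_subtype
  Finite.of_injective (fun Z : ClosedOrbit X => (⟨Z.carrier, Z.isOrbit⟩ : {A : Set X.X.left | IsOrbit A}))
    fun _ _ h => ClosedOrbit.ext (TopologicalSpace.Closeds.ext (congr_arg Subtype.val h))

end

/-! ### The orbits of the normalization -/

section
variable {X X' : Scheme.{u}} {ν : X' ⟶ X}

lemma ι_morphismRestrict_apply {V : X.Opens} (z : (ν ⁻¹ᵁ V).toScheme) :
    V.ι ((ν ∣_ V) z) = ν ((ν ⁻¹ᵁ V).ι z) :=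
  congr_arg (fun f => f z) (morphismRestrict_ι ν V)

lemma exists_apply_eq_of_isIso {V : X.Opens} [IsIso (ν ∣_ V)] {x : X} (hx : x ∈ V) :
    ∃ y, ν y = x := by
  obtain ⟨y, hy⟩ := (ν ∣_ V).surjective ⟨x, hx⟩
  exact ⟨(ν ⁻¹ᵁ V).ι y, (ι_morphismRestrict_apply y).symm.trans (congr_arg V.ι hy)⟩

lemma specializes_of_isIso {V : X.Opens} [IsIso (ν ∣_ V)] {y z : X'} (hy : ν y ∈ V) (hz : ν z ∈ V)
    (h : ν y ⤳ ν z) : y ⤳ z := by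
  let y' : (ν ⁻¹ᵁ V).toScheme := ⟨y, hy⟩
  let z' : (ν ⁻¹ᵁ V).toScheme := ⟨z, hz⟩
  have h1 : (ν ∣_ V) y' ⤳ (ν ∣_ V) z' := by
    rw [← V.ι.isOpenEmbedding.isInducing.specializes_iff, ι_morphismRestrict_apply,
      ι_morphismRestrict_apply]
    exact h
  exact ((ν ∣_ V).isOpenEmbedding.isInducing.specializes_iff.mp h1).map (ν ⁻¹ᵁ V).ι.continuous

lemma IsNormalization.surjective (hν : IsNormalization ν) : Function.Surjective ν := by
  have := hν.isFinite
  obtain ⟨V, hV, -, hiso⟩ := hν.isBirational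
  have h1 : (V : Set X) ⊆ Set.range ν := by
    intro x hx
    exact exists_apply_eq_of_isIso hx
  rw [← Set.range_eq_univ, ← ν.isClosedMap.isClosed_range.closure_eq]
  exact (hV.mono h1).closure_eq

lemma topologicalKrullDim_image (hν : IsFinite ν) {C : Set X'} (hC : IsClosed C) :
    topologicalKrullDim (ν '' C) = topologicalKrullDim C := by
  have hC' := ν.isClosedMap _ hC
  have := hC.isClosedEmbedding_subtypeVal.quasiSober
  have := hC'.isClosedEmbedding_subtypeVal.quasiSober
  refine (topologicalKrullDim_eq_of_isClosedMap
    (f := fun y : C => (⟨ν y, y, y.2, rfl⟩ : ν '' C)) (by fun_prop) ?_ ?_ ?_).symm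
  · exact (ν.isClosedMap.comp hC.isClosedMap_subtype_val).codRestrict _
  · rintro ⟨_, y, hy, rfl⟩
    exact ⟨⟨y, hy⟩, rfl⟩
  · intro y z h h'
    exact Subtype.ext (eq_of_specializes_of_isFinite ν
      (Topology.IsInducing.subtypeVal.specializes_iff.mpr h) (congr_arg Subtype.val h'))

lemma topologicalKrullDim_univ (X : Type*) [TopologicalSpace X] :
    topologicalKrullDim (Set.univ : Set X) = topologicalKrullDim X :=
  IsHomeomorph.topologicalKrullDim_eq _ (Homeomorph.Set.univ X).isHomeomorph

lemma topologicalKrullDim_preimage (hν : IsFinite ν) (hs : Function.Surjective ν) {C : Set X}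
    (hC : IsClosed C) : topologicalKrullDim (ν ⁻¹' C) = topologicalKrullDim C := by
  rw [← topologicalKrullDim_image hν (hC.preimage ν.continuous), Set.image_preimage_eq _ hs]

lemma IsNormalization.topologicalKrullDim_eq (hν : IsNormalization ν) :
    topologicalKrullDim X' = topologicalKrullDim X := by
  rw [← topologicalKrullDim_univ X', ← topologicalKrullDim_univ X, ← Set.preimage_univ (f := ν),
    topologicalKrullDim_preimage hν.isFinite hν.surjective isClosed_univ]

/-- The points of a normal scheme lie on only one irreducible component. -/
lemma IsNormalScheme.eq_of_specializes (h : IsNormalScheme X) {x y z : X}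
    (hy : y ∈ genericPoints X) (hz : z ∈ genericPoints X) (hyx : y ⤳ x) (hzx : z ⤳ x) : y = z := by
  have := (h x).1
  have key (w : X) (hw : w ∈ genericPoints X) (hwx : w ⤳ x) :
      X.fromSpecStalk x (⊥ : PrimeSpectrum (X.presheaf.stalk x)) = w := by
    obtain ⟨p, rfl⟩ := (Scheme.range_fromSpecStalk (X := X) (x := x)).ge hwx
    refine eq_of_specializes_of_mem_genericPoints hw (Specializes.map ?_ (X.fromSpecStalk x).continuous)
    exact (PrimeSpectrum.le_iff_specializes (R := X.presheaf.stalk x) _ _).mp bot_le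
  rw [← key y hy hyx, key z hz hzx]

/-- A birational morphism maps generic points to generic points. -/
lemma IsBirationalHom.mem_genericPoints [TopologicalSpace.NoetherianSpace X'] (h : IsBirationalHom ν) {y : X'}
    (hy : y ∈ genericPoints X') : ν y ∈ genericPoints X := by
  obtain ⟨V, -, hV', hiso⟩ := h
  have hyV : y ∈ ν ⁻¹ᵁ V := by
    obtain ⟨z, hz, hzy⟩ := exists_specializes_of_mem_closure_sdiff (ν ⁻¹ᵁ V).isOpen isOpen_empty
      (x := y) (by rw [Set.sdiff_empty]; exact hV' y)
    rw [← eq_of_specializes_of_mem_genericPoints hy hzy]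
    exact hz.1
  obtain ⟨x, hx, hxy⟩ := exists_genericPoints_specializes (ν y)
  have hxV : x ∈ V := hxy.mem_open V.isOpen hyV
  obtain ⟨z, rfl⟩ := exists_apply_eq_of_isIso (ν := ν) hxV
  rwa [← eq_of_specializes_of_mem_genericPoints hy (specializes_of_isIso hxV hyV hxy)]

end

section
variable {k : Type u} [Field k] {G : Over (Spec (.of k))} [GrpObj G] {X X' : GSch G}

lemma OpenOrbit.eq_of_mem {U V : OpenOrbit X} {x : X.X.left} (h : x ∈ U.carrier)
    (h' : x ∈ V.carrier) : U = V :=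
  OpenOrbit.ext (TopologicalSpace.Opens.ext (U.isOrbit.eq_of_inter V.isOrbit ⟨x, h, h'⟩))

lemma ClosedOrbit.eq_of_mem {Z W : ClosedOrbit X} {x : X.X.left} (h : x ∈ Z.carrier)
    (h' : x ∈ W.carrier) : Z = W :=
  ClosedOrbit.ext (TopologicalSpace.Closeds.ext (Z.isOrbit.eq_of_inter W.isOrbit ⟨x, h, h'⟩))

lemma OpenOrbit.notMem_closedOrbit [IsVariety X.X] (U : OpenOrbit X) (Z : ClosedOrbit X)
    {x : X.X.left} (h : x ∈ U.carrier) : x ∉ Z.carrier := by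
  intro h'
  have h1 : (U.carrier : Set X.X.left) = Z.carrier := U.isOrbit.eq_of_inter Z.isOrbit ⟨x, h, h'⟩
  have h2 := Z.codim_one
  rw [← h1, U.codim_zero] at h2
  refine not_add_one_le ?_ (IsVariety.topologicalKrullDim_ne_top X.X) h2.le
  rw [← U.codim_zero]
  exact topologicalKrullDim_ne_bot_of_nonempty ⟨x, h⟩

/-- A normalization is an isomorphism over the open orbits. -/
lemma OpenOrbit.isIso_morphismRestrict [LocallyOfFiniteType G.hom] {ν : X' ⟶ X}
    (hν : IsNormalization ν.hom.left) (U : OpenOrbit X) : IsIso (ν.hom.left ∣_ U.carrier) := by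
  obtain ⟨V, hV, -, hiso⟩ := hν.isBirational
  refine U.isOrbit.isIso_morphismRestrict ν (V := V) ?_
  exact hV.inter_open_nonempty _ U.carrier.isOpen U.isOrbit.nonempty

lemma finite_isOrbit_of_isNormalization {ν : X' ⟶ X} [IsGChain X] (hν : IsNormalization ν.hom.left) :
    {A : Set X'.X.left | IsOrbit A}.Finite := by
  have := hν.isFinite
  have h1 : {A : Set X'.X.left | IsOrbit A} ⊆ ⋃ B ∈ {B : Set X.X.left | IsOrbit B},
      {A | IsOrbit A ∧ ν.hom.left '' A = B} := fun A hA =>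
    Set.mem_biUnion (show ν.hom.left '' A ∈ {B : Set X.X.left | IsOrbit B} from hA.image ν) ⟨hA, rfl⟩
  refine (IsGChain.finite_orbits.biUnion fun B hB => ?_).subset h1
  obtain ⟨x, hx⟩ := IsOrbit.nonempty hB
  refine ((ν.hom.left.finite_preimage_singleton x).image
    fun y => ⋃₀ {A : Set X'.X.left | IsOrbit A ∧ y ∈ A}).subset ?_
  rintro A ⟨hA, rfl⟩
  obtain ⟨y, hy, rfl⟩ := hx
  refine ⟨y, rfl, Set.Subset.antisymm (Set.sUnion_subset fun C hC => ?_)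
    (Set.subset_sUnion_of_mem ⟨hA, hy⟩)⟩
  rw [hC.1.eq_of_inter hA ⟨y, hC.2, hy⟩]

lemma OpenOrbit.eq_preimage [LocallyOfFiniteType G.hom] {ν : X' ⟶ X}
    (hν : IsNormalization ν.hom.left) (U : OpenOrbit X)
    {A : Set X'.X.left} (hA : IsOrbit A) (h : (A ∩ ν.hom.left ⁻¹' U.carrier).Nonempty) :
    A = ν.hom.left ⁻¹' U.carrier := by
  have := U.isIso_morphismRestrict hν
  have h1 : A ⊆ ν.hom.left ⁻¹' U.carrier :=
    hA.subset_of_isStable (U.isOrbit.isStable.preimage ν) h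
  have h2 : ν.hom.left '' A = U.carrier := by
    obtain ⟨y, hy, hyU⟩ := h
    exact (hA.image ν).eq_of_inter U.isOrbit ⟨_, ⟨y, hy, rfl⟩, hyU⟩
  refine h1.antisymm fun y hy => ?_
  obtain ⟨z, hz, hzy⟩ := h2.ge hy
  have h4 : z = y := ((specializes_of_isIso (h1 hz) hy (specializes_of_eq hzy)).antisymm
    (specializes_of_isIso hy (h1 hz) (specializes_of_eq hzy.symm))).eq
  exact h4 ▸ hz

lemma finite_openOrbit [IsGChain X] {ν : X' ⟶ X}
    (hν : IsNormalization ν.hom.left) : Finite (OpenOrbit X') :=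
  haveI := (finite_isOrbit_of_isNormalization hν).to_subtype
  Finite.of_injective
    (fun U : OpenOrbit X' => (⟨U.carrier, U.isOrbit⟩ : {A : Set X'.X.left | IsOrbit A}))
    fun _ _ h => OpenOrbit.ext (TopologicalSpace.Opens.ext (congr_arg Subtype.val h))

lemma finite_closedOrbit [IsGChain X] {ν : X' ⟶ X}
    (hν : IsNormalization ν.hom.left) : Finite (ClosedOrbit X') :=
  haveI := (finite_isOrbit_of_isNormalization hν).to_subtype
  Finite.of_injective
    (fun Z : ClosedOrbit X' => (⟨Z.carrier, Z.isOrbit⟩ : {A : Set X'.X.left | IsOrbit A}))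
    fun _ _ h => ClosedOrbit.ext (TopologicalSpace.Closeds.ext (congr_arg Subtype.val h))

variable [IsAffine G.left] [LocallyOfFiniteType G.hom]

lemma IsGChain.exists_mem [IsAlgClosed k] [IsGChain X] (x : X.X.left) :
    (∃ U : OpenOrbit X, x ∈ U.carrier) ∨ ∃ Z : ClosedOrbit X, x ∈ Z.carrier := by
  obtain ⟨A, hA, hx⟩ := exists_isOrbit_mem IsGChain.finite_orbits x
  refine hA.exists_openOrbit_or_exists_closedOrbit.imp ?_ ?_
  · rintro ⟨U, rfl⟩
    exact ⟨U, hx⟩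
  · rintro ⟨Z, rfl⟩
    exact ⟨Z, hx⟩

variable [IsVariety X'.X] {ν : X' ⟶ X}

lemma OpenOrbit.eq_of_mem_closure (hν : IsNormalization ν.hom.left) {U V : OpenOrbit X'}
    {y : X'.X.left} (hU : y ∈ closure (U.carrier : Set X'.X.left))
    (hV : y ∈ closure (V.carrier : Set X'.X.left)) : U = V := by
  have key (U : OpenOrbit X') (hU : y ∈ closure (U.carrier : Set X'.X.left)) :
      ∃ z ∈ U.carrier, z ∈ genericPoints X'.X.left ∧ z ⤳ y := by
    obtain ⟨a, ha, hay⟩ := U.isOrbit.exists_specializes y hU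
    obtain ⟨z, hz, hza⟩ := exists_genericPoints_specializes a
    exact ⟨z, hza.mem_open U.carrier.isOpen ha, hz, hza.trans hay⟩
  obtain ⟨z, hzU, hz, hzy⟩ := key U hU
  obtain ⟨w, hwV, hw, hwy⟩ := key V hV
  obtain rfl := hν.isNormal.eq_of_specializes hz hw hzy hwy
  exact OpenOrbit.eq_of_mem hzU hwV

lemma SimpleSubchain.eq_of_Z_eq (hν : IsNormalization ν.hom.left) {W W' : SimpleSubchain X'}
    (h : W.Z = W'.Z) : W = W' := by
  obtain ⟨y, hy⟩ := W.Z.isOrbit.nonempty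
  have hU : W.U = W'.U := OpenOrbit.eq_of_mem_closure hν (W.adjacent hy) (W'.adjacent (h ▸ hy))
  refine SimpleSubchain.ext hU h (TopologicalSpace.Opens.ext ?_)
  rw [W.coe_carrier, W'.coe_carrier, hU, h]

variable [IsGChain X]

variable [IsAlgClosed k]

lemma exists_isOrbit_mem_of_isNormalization (hν : IsNormalization ν.hom.left) (y : X'.X.left) :
    ∃ A : Set X'.X.left, IsOrbit A ∧ y ∈ A :=
  exists_isOrbit_mem (finite_isOrbit_of_isNormalization hν) y

/-- The preimage of an open orbit in the normalization. -/
def OpenOrbit.preimage (hν : IsNormalization ν.hom.left) (U : OpenOrbit X) : OpenOrbit X' where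
  carrier := ν.hom.left ⁻¹ᵁ U.carrier
  isOrbit := by
    obtain ⟨x, hx⟩ := U.isOrbit.nonempty
    obtain ⟨y, rfl⟩ := hν.surjective x
    obtain ⟨A, hA, hy⟩ := exists_isOrbit_mem_of_isNormalization hν y
    have h := U.eq_preimage hν hA ⟨y, hy, hx⟩
    change IsOrbit (ν.hom.left ⁻¹' U.carrier)
    exact h ▸ hA
  codim_zero := by
    have := U.isIso_morphismRestrict hν
    rw [hν.topologicalKrullDim_eq, ← U.codim_zero]
    exact IsHomeomorph.topologicalKrullDim_eq _ (ν.hom.left ∣_ U.carrier).homeomorph.isHomeomorph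

/-- The orbits of the normalization over closed orbits are closed: orbits in the boundary of such an
orbit have a smaller dimension but the same image. -/
lemma exists_closedOrbit_of_isOrbit (hν : IsNormalization ν.hom.left) (Z : ClosedOrbit X)
    {A : Set X'.X.left} (hA : IsOrbit A) (h : (A ∩ ν.hom.left ⁻¹' Z.carrier).Nonempty) :
    ∃ Z' : ClosedOrbit X', (Z'.carrier : Set X'.X.left) = A := by
  have hfin := hν.isFinite
  have hst := Z.isOrbit.isStable.preimage ν
  have hcl : IsClosed (ν.hom.left ⁻¹' Z.carrier) := Z.carrier.isClosed.preimage ν.hom.left.continuous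
  have key (B : Set X'.X.left) (hB : IsOrbit B) (h : (B ∩ ν.hom.left ⁻¹' Z.carrier).Nonempty) :
      B ⊆ ν.hom.left ⁻¹' Z.carrier ∧
        topologicalKrullDim (closure B) = topologicalKrullDim (Z.carrier : Set X.X.left) := by
    have h1 : B ⊆ ν.hom.left ⁻¹' Z.carrier := hB.subset_of_isStable hst h
    refine ⟨h1, ?_⟩
    obtain ⟨y, hy, hyU⟩ := h
    have h2 : ν.hom.left '' B = Z.carrier := (hB.image ν).eq_of_inter Z.isOrbit ⟨_, ⟨y, hy, rfl⟩, hyU⟩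
    have h3 : ν.hom.left '' closure B = Z.carrier :=
      (Set.image_subset_iff.mpr (closure_minimal h1 hcl)).antisymm
        (h2.ge.trans (Set.image_mono subset_closure))
    rw [← topologicalKrullDim_image hfin isClosed_closure, h3]
  obtain ⟨hAZ, hdim⟩ := key A hA h
  have hcA : closure A ⊆ A := by
    intro y hy
    by_contra hyA
    obtain ⟨B, hB, hyB⟩ := exists_isOrbit_mem_of_isNormalization hν y
    have h2 := hA.topologicalKrullDim_closure_add_one_le hB (fun h => hyA (h ▸ hyB)) ⟨y, hyB, hy⟩
    rw [hdim, (key B hB ⟨y, hyB, closure_minimal hAZ hcl hy⟩).2] at h2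
    exact not_add_one_le (topologicalKrullDim_ne_bot_of_nonempty Z.isOrbit.nonempty)
      (topologicalKrullDim_ne_top_of_subset X.X _) h2
  have hcA' := closure_subset_iff_isClosed.mp hcA
  refine ⟨⟨⟨A, hcA'⟩, hA, ?_⟩, rfl⟩
  rw [hcA'.closure_eq] at hdim
  rw [hν.topologicalKrullDim_eq, ← Z.codim_one, ← hdim]
  rfl

lemma OpenOrbit.exists_eq_preimage (hν : IsNormalization ν.hom.left) (U' : OpenOrbit X') :
    ∃ U : OpenOrbit X, U'.carrier = ν.hom.left ⁻¹ᵁ U.carrier := by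
  obtain ⟨y, hy⟩ := U'.isOrbit.nonempty
  obtain ⟨U, hU⟩ | ⟨Z, hZ⟩ := IsGChain.exists_mem (ν.hom.left y)
  · exact ⟨U, TopologicalSpace.Opens.ext (U.eq_preimage hν U'.isOrbit ⟨y, hy, hU⟩)⟩
  · obtain ⟨Z', hZ'⟩ := exists_closedOrbit_of_isOrbit hν Z U'.isOrbit ⟨y, hy, hZ⟩
    exact (U'.notMem_closedOrbit Z' hy (hZ'.ge hy)).elim

lemma ClosedOrbit.exists_subset_preimage (hν : IsNormalization ν.hom.left) (Z' : ClosedOrbit X') :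
    ∃ Z : ClosedOrbit X, (Z'.carrier : Set X'.X.left) ⊆ ν.hom.left ⁻¹' Z.carrier := by
  obtain ⟨y, hy⟩ := Z'.isOrbit.nonempty
  obtain ⟨U, hU⟩ | ⟨Z, hZ⟩ := IsGChain.exists_mem (ν.hom.left y)
  · exact ((U.preimage hν).notMem_closedOrbit Z' hU hy).elim
  · exact ⟨Z, Z'.isOrbit.subset_of_isStable (Z.isOrbit.isStable.preimage ν) ⟨y, hy, hZ⟩⟩

lemma exists_mem_of_isNormalization (hν : IsNormalization ν.hom.left) (y : X'.X.left) :
    (∃ U : OpenOrbit X', y ∈ U.carrier) ∨ ∃ Z : ClosedOrbit X', y ∈ Z.carrier := by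
  obtain ⟨U, hU⟩ | ⟨Z, hZ⟩ := IsGChain.exists_mem (ν.hom.left y)
  · exact .inl ⟨U.preimage hν, hU⟩
  · obtain ⟨A, hA, hy⟩ := exists_isOrbit_mem_of_isNormalization hν y
    obtain ⟨Z', rfl⟩ := exists_closedOrbit_of_isOrbit hν Z hA ⟨y, hy, hZ⟩
    exact .inr ⟨Z', hy⟩

/-- Every point of the normalization specializes from a generic point, which lies in an open orbit. -/
lemma exists_openOrbit_specializes (hν : IsNormalization ν.hom.left) (y : X'.X.left) :
    ∃ U : OpenOrbit X', ∃ z ∈ U.carrier, z ⤳ y := by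
  have := IsVariety.isNoetherian X'.X
  obtain ⟨z, hz, hzy⟩ := exists_genericPoints_specializes y
  obtain ⟨A, hA, hzA⟩ := exists_isOrbit_mem IsGChain.finite_orbits (ν.hom.left z)
  obtain ⟨U, rfl⟩ := hA.exists_openOrbit (hν.isBirational.mem_genericPoints hz) hzA
  exact ⟨U.preimage hν, z, hzA, hzy⟩

/-- Every closed orbit of the normalization belongs to a simple chain: it is adjacent to one open
orbit `U` only, and `U ∪ Z` is the complement of the other closed orbits and of the closures of the
other open orbits. -/
lemma ClosedOrbit.exists_simpleSubchain (hν : IsNormalization ν.hom.left) (Z : ClosedOrbit X') :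
    ∃ W : SimpleSubchain X', W.Z = Z := by
  have := finite_openOrbit hν
  have := finite_closedOrbit hν
  obtain ⟨y, hy⟩ := Z.isOrbit.nonempty
  obtain ⟨U, z, hzU, hzy⟩ := exists_openOrbit_specializes hν y
  have hyU : y ∈ closure (U.carrier : Set X'.X.left) :=
    closure_mono (Set.singleton_subset_iff.mpr hzU) hzy.mem_closure
  let N : Set X'.X.left := (⋃ V : {V : OpenOrbit X' // V ≠ U}, closure (V.1.carrier : Set X'.X.left)) ∪
    ⋃ C : {C : ClosedOrbit X' // C ≠ Z}, (C.1.carrier : Set X'.X.left)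
  have hN : IsClosed N := (isClosed_iUnion_of_finite fun _ => isClosed_closure).union
    (isClosed_iUnion_of_finite fun C => C.1.carrier.isClosed)
  have hZU : (Z.carrier : Set X'.X.left) ⊆ closure U.carrier :=
    Z.isOrbit.subset_of_isStable U.isOrbit.isStable.closure ⟨y, hy, hyU⟩
  refine ⟨⟨U, Z, hZU, ⟨Nᶜ, hN.isOpen_compl⟩, ?_⟩, rfl⟩
  ext x
  simp only [TopologicalSpace.Opens.coe_mk, N, Set.mem_compl_iff, Set.mem_union, Set.mem_iUnion,
    not_or, not_exists]
  constructor
  · rintro ⟨h1, h2⟩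
    obtain ⟨V, hV⟩ | ⟨C, hC⟩ := exists_mem_of_isNormalization hν x
    · by_cases hVU : V = U
      · exact .inl (hVU ▸ hV)
      · exact (h1 ⟨V, hVU⟩ (subset_closure hV)).elim
    · by_cases hCZ : C = Z
      · exact .inr (hCZ ▸ hC)
      · exact (h2 ⟨C, hCZ⟩ hC).elim
  · rintro (h | h)
    · exact ⟨fun V hV => V.2 (OpenOrbit.eq_of_mem_closure hν hV (subset_closure h)),
        fun C hC => U.notMem_closedOrbit C.1 h hC⟩
    · exact ⟨fun V hV => V.2 (OpenOrbit.eq_of_mem_closure hν hV (hZU h)),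
        fun C hC => C.2 (ClosedOrbit.eq_of_mem hC h)⟩

lemma bijective_simpleSubchain_Z (hν : IsNormalization ν.hom.left) :
    Function.Bijective (SimpleSubchain.Z : SimpleSubchain X' → ClosedOrbit X') :=
  ⟨fun _ _ => SimpleSubchain.eq_of_Z_eq hν, fun Z => Z.exists_simpleSubchain hν⟩

end

/-! ### Functions on a weakly normal chain -/

lemma isIso_morphismRestrict_iSup {X Y : Scheme.{u}} (f : X ⟶ Y) {I : Type*} (U : I → Y.Opens)
    (h : ∀ i, IsIso (f ∣_ U i)) : IsIso (f ∣_ ⨆ i, U i) := by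
  refine IsZariskiLocalAtTarget.of_iSup_eq_top (P := MorphismProperty.isomorphisms Scheme.{u})
    (fun i => (⨆ i, U i).ι ⁻¹ᵁ U i) ?_ fun i => ?_
  · rw [← Scheme.Hom.preimage_iSup]
    ext x
    exact iff_of_true x.2 trivial
  · rw [MorphismProperty.arrow_mk_iso_iff (MorphismProperty.isomorphisms Scheme.{u})
      (morphismRestrictRestrict f _ _ ≪≫ morphismRestrictEq f (V := U i) ?_)]
    · exact h i
    · refine (Scheme.Hom.image_preimage_eq_opensRange_inf _ _).trans ?_
      rw [Scheme.Opens.opensRange_ι]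
      exact inf_eq_right.mpr (le_iSup U i)

section
variable {k : Type u} [Field k] {G : Over (Spec (.of k))} [GrpObj G] [GeometricallyReduced G.hom]
  {X X' : GSch G} [IsVariety X.X] [IsVariety X'.X] (ν : X' ⟶ X)

instance (U : OpenOrbit X) : IsOpenImmersion U.ι.hom.left :=
  inferInstanceAs (IsOpenImmersion U.carrier.ι)

instance (W : SimpleSubchain X) : IsOpenImmersion W.ι.hom.left :=
  inferInstanceAs (IsOpenImmersion W.carrier.ι)

instance (Z : ClosedOrbit X) : IsClosedImmersion Z.ι.hom.left :=
  inferInstanceAs (IsClosedImmersion (Scheme.IdealSheafData.vanishingIdeal Z.carrier).subschemeι)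

lemma OpenOrbit.range_ι (U : OpenOrbit X) : Set.range U.ι.hom.left = U.carrier :=
  Scheme.Opens.range_ι U.carrier

lemma SimpleSubchain.range_ι (W : SimpleSubchain X) :
    Set.range W.ι.hom.left = (W.U.carrier : Set X.X.left) ∪ W.Z.carrier :=
  (Scheme.Opens.range_ι W.carrier).trans W.coe_carrier

lemma SimpleSubchain.openIncl_ι (W : SimpleSubchain X) :
    W.openIncl.hom.left ≫ W.ι.hom.left = W.U.ι.hom.left :=
  VectG.left_comp (openSubLift_ι W.carrier W.isStable W.U.ι _)

lemma SimpleSubchain.closedIncl_ι (W : SimpleSubchain X) :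
    W.closedIncl.hom.left ≫ W.ι.hom.left = W.Z.ι.hom.left :=
  VectG.left_comp (openSubLift_ι W.carrier W.isStable W.Z.ι _)

lemma orbitRestrict_ι_left (l : ClosedOrbit X') (i : ClosedOrbit X)
    (h : (l.carrier : Set X'.X.left) ⊆ ν.hom.left ⁻¹' i.carrier) :
    (orbitRestrict ν l i h).hom.left ≫ i.ι.hom.left = l.ι.hom.left ≫ ν.hom.left :=
  VectG.left_comp (orbitRestrict_ι ν l i h)

end

section
variable {k : Type u} [Field k] [IsAlgClosed k] {G : Over (Spec (.of k))} [GrpObj G]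
  [IsAffine G.left] [LocallyOfFiniteType G.hom] [GeometricallyReduced G.hom] {X X' : GSch G}
  [IsGChain X] [IsVariety X'.X] {ν : X' ⟶ X}

/-- The open orbits and the simple chains of the normalization form an open covering. -/
lemma isStarCovering (hν : IsNormalization ν.hom.left) :
    IsStarCovering SimpleSubchain.U (fun i : OpenOrbit X' => i.toGSch.X.left)
      (fun s : SimpleSubchain X' => s.toGSch.X.left) (fun i => i.ι.hom.left)
      (fun s => s.ι.hom.left) where
  isOpenImmersion_left _ := inferInstance
  isOpenImmersion_right _ := inferInstance
  eq_of_left h h' := OpenOrbit.eq_of_mem ((OpenOrbit.range_ι _).le h) ((OpenOrbit.range_ι _).le h')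
  eq_of_right {i s y} h h' := by
    rw [OpenOrbit.range_ι] at h
    obtain h' | h' := (SimpleSubchain.range_ι _).le h'
    · exact OpenOrbit.eq_of_mem h h'
    · exact (i.notMem_closedOrbit s.Z h h').elim
  eq_or_mem {s s' y} h h' := by
    obtain h | h := (SimpleSubchain.range_ι _).le h
    · exact .inr ⟨s.U, (OpenOrbit.range_ι _).ge h⟩
    · obtain h' | h' := (SimpleSubchain.range_ι _).le h'
      · exact .inr ⟨s'.U, (OpenOrbit.range_ι _).ge h'⟩
      · exact .inl (SimpleSubchain.eq_of_Z_eq hν (ClosedOrbit.eq_of_mem h h'))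
  cover y := by
    refine (exists_mem_of_isNormalization hν y).imp
      (fun ⟨U, hU⟩ => ⟨U, (OpenOrbit.range_ι _).ge hU⟩) fun ⟨Z, hZ⟩ => ?_
    obtain ⟨W, rfl⟩ := Z.exists_simpleSubchain hν
    exact ⟨W, (SimpleSubchain.range_ι _).ge (.inr hZ)⟩

/-- The union of the open orbits. -/
def openLocus (X : GSch G) : X.X.left.Opens := ⨆ U : OpenOrbit X, U.carrier

lemma mem_openLocus {x : X.X.left} : x ∈ openLocus X ↔ ∃ U : OpenOrbit X, x ∈ U.carrier :=
  TopologicalSpace.Opens.mem_iSup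

variable (X) in
lemma dense_openLocus : Dense (openLocus X : Set X.X.left) := by
  have := IsVariety.isNoetherian X.X
  rw [dense_iff_inter_open]
  rintro O hO ⟨x, hx⟩
  obtain ⟨z, hz, hzx⟩ := exists_genericPoints_specializes x
  obtain ⟨A, hA, hzA⟩ := exists_isOrbit_mem IsGChain.finite_orbits z
  obtain ⟨U, rfl⟩ := hA.exists_openOrbit hz hzA
  exact ⟨z, hzx.mem_open hO hx, mem_openLocus.mpr ⟨U, hzA⟩⟩

lemma isIso_openLocus (hν : IsNormalization ν.hom.left) : IsIso (ν.hom.left ∣_ openLocus X) :=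
  isIso_morphismRestrict_iSup _ _ fun U => U.isIso_morphismRestrict hν

lemma ClosedOrbit.notMem_openLocus (Z : ClosedOrbit X) {x : X.X.left} (h : x ∈ Z.carrier) :
    x ∉ openLocus X := fun hx =>
  have ⟨U, hU⟩ := mem_openLocus.mp hx
  U.notMem_closedOrbit Z hU h

lemma exists_closedOrbit_of_notMem (hν : IsNormalization ν.hom.left) {y : X'.X.left}
    (h : ν.hom.left y ∉ openLocus X) : ∃ Z : ClosedOrbit X', y ∈ Z.carrier := by
  refine (exists_mem_of_isNormalization hν y).resolve_left ?_
  rintro ⟨U', hU'⟩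
  obtain ⟨U, hU⟩ := U'.exists_eq_preimage hν
  rw [hU] at hU'
  exact h (mem_openLocus.mpr ⟨U, hU'⟩)

/-- The complement of the closed orbits that do not contain `x`. -/
def orbitNhd (x : X.X.left) : X.X.left.Opens where
  carrier := (⋃ Z : {Z : ClosedOrbit X // x ∉ Z.carrier}, (Z.1.carrier : Set X.X.left))ᶜ
  is_open' := (isClosed_iUnion_of_finite fun Z => Z.1.carrier.isClosed).isOpen_compl

lemma mem_orbitNhd {x y : X.X.left} :
    y ∈ orbitNhd x ↔ ∀ Z : ClosedOrbit X, y ∈ Z.carrier → x ∈ Z.carrier := by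
  change y ∉ ⋃ Z : {Z : ClosedOrbit X // x ∉ Z.carrier}, (Z.1.carrier : Set X.X.left) ↔ _
  simp only [Set.mem_iUnion, Subtype.exists, not_exists]
  exact forall_congr' fun Z => ⟨fun h hy => by_contra fun hx => h hx hy, fun h hx hy => hx (h hy)⟩

/-- Functions on a weakly normal chain are the functions on the normalization that are induced on
each closed orbit from a function on its image. -/
lemma isGluing_chain (hX : IsWeaklyNormal X.X.left) (hν : IsNormalization ν.hom.left) :
    (gCocone (chainDiagram ν) (chainCocone ν) (chainCocone_comm ν)).IsGluing := by
  have := hν.isFinite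
  have : Surjective ν.hom.left := ⟨hν.surjective⟩
  have := IsVariety.isNoetherian X.X
  have := isIso_openLocus hν
  have hstar := (isStarCovering hν).isGluing (f := fun s => s.openIncl.hom.left)
    fun s => s.openIncl_ι
  refine SchemeCocone.isGluing_of_local _ fun W x hx => ?_
  obtain ⟨V, hV, hxV, hVW⟩ := exists_isAffineOpen_mem_and_subset (x := x) (U := W ⊓ orbitNhd x)
    ⟨hx, mem_orbitNhd.mpr fun _ h => h⟩
  refine ⟨V, hVW.trans inf_le_left, hxV, fun a b hab => ?_, fun c hc => ?_⟩
  · refine app_injective ν.hom.left V ?_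
    rw [← pbF_eq_app, ← pbF_eq_app]
    refine hstar.1 _ _ _ fun v => ?_
    match v with
    | .inl i => exact (pbF_pbF rfl _ _ _).trans ((hab (.openOrbit i)).trans (pbF_pbF rfl _ _ _).symm)
    | .inr s => exact (pbF_pbF rfl _ _ _).trans ((hab (.simple s)).trans (pbF_pbF rfl _ _ _).symm)
  · choose β hβ using fun l : ClosedOrbit X' => l.exists_subset_preimage hν
    obtain ⟨b, hb⟩ := hstar.2 (ν.hom.left ⁻¹ᵁ V)
      (fun | .inl i => c (.openOrbit i) | .inr s => c (.simple s))
      fun s => hc ⟨_, _, Arrow.openIncl s⟩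
    have hbW (s : SimpleSubchain X') :
        pbF s.ι.hom.left (le_refl (s.ι.hom.left ⁻¹ᵁ ν.hom.left ⁻¹ᵁ V)) b = c (.simple s) := hb (.inr s)
    have hbl (l : ClosedOrbit X') :
        pbF l.ι.hom.left (le_refl (l.ι.hom.left ⁻¹ᵁ ν.hom.left ⁻¹ᵁ V)) b = c (.normClosed l) := by
      obtain ⟨s, rfl⟩ := l.exists_simpleSubchain hν
      have h1 := hc ⟨_, _, Arrow.closedIncl s⟩
      refine Eq.trans ?_ h1
      change _ = pbF s.closedIncl.hom.left _ (c (.simple s))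
      rw [← hbW]
      exact (pbF_pbF s.closedIncl_ι _ _ _).symm
    obtain ⟨a, ha, haz⟩ := hX.exists_function ν.hom.left (openLocus X) (dense_openLocus X)
      (fun i : ClosedOrbit X => i.ι.hom.left) (fun l : ClosedOrbit X' => l.ι.hom.left) β
      (fun l => (orbitRestrict ν l (β l) (hβ l)).hom.left)
      (fun l => orbitRestrict_ι_left ν l (β l) (hβ l))
      (fun i y => i.notMem_openLocus (i.range_ι.le ⟨y, rfl⟩))
      (fun y hy => (exists_closedOrbit_of_notMem hν hy).imp fun l hl => l.range_ι.ge hl) hV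
      (fun i j y z hy hz => ClosedOrbit.eq_of_mem
        (mem_orbitNhd.mp (hVW hy).2 i (i.range_ι.le ⟨y, rfl⟩))
        (mem_orbitNhd.mp (hVW hz).2 j (j.range_ι.le ⟨z, rfl⟩)))
      b (fun i => c (.closed i))
      fun l => (hbl l).trans (hc ⟨_, _, Arrow.restrict l (β l) (hβ l)⟩).symm
    refine ⟨a, fun v => ?_⟩
    match v with
    | .openOrbit i =>
      refine Eq.trans ?_ (hb (.inl i))
      rw [← ha]
      exact (pbF_pbF rfl _ _ _).symm
    | .simple s =>
      rw [← hbW, ← ha]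
      exact (pbF_pbF rfl _ _ _).symm
    | .normClosed l =>
      rw [← hbl, ← ha]
      exact (pbF_pbF rfl _ _ _).symm
    | .closed i => exact haz i

end

/-! ### Functions on products with the group -/

section
variable {S : Scheme.{u}} {V : Type u} [Quiver.{u} V] {Y : Over S} {F : V → Over S}
  {f : ∀ {v w : V}, (v ⟶ w) → (F v ⟶ F w)} {t : (v : V) → (F v ⟶ Y)}
  (ht : ∀ {v w : V} (e : v ⟶ w), f e ≫ t w = t v)

/-- The gluing property is inherited by the product with a flat scheme. -/
lemma isGluing_whiskerLeft (h0 : (overCocone F f t ht).IsGluing) (G : Over S)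
    [Flat (snd G Y).left] [Finite V] [∀ v w : V, Finite (v ⟶ w)]
    (hc : ∀ v, QuasiCompact (t v).left) (hq : ∀ v, QuasiSeparated (t v).left) :
    (overCocone (fun v => G ⊗ F v) (fun e => G ◁ f e) (fun v => G ◁ t v)
      (fun e => by rw [← whiskerLeft_comp, ht])).IsGluing := by
  have : Finite (overCocone F f t ht).V := ‹Finite V›
  have : Finite (overCocone F f t ht).E := inferInstanceAs (Finite (Σ v w : V, (v ⟶ w)))
  have hf {v w : V} (e : v ⟶ w) :
      (G ◁ f e).left ≫ (snd G (F w)).left = (snd G (F v)).left ≫ (f e).left := by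
    rw [← Over.comp_left, whiskerLeft_snd, Over.comp_left]
  exact h0.of_flat (snd G Y).left hc hq _ _ _ _ (fun v => (snd G (F v)).left)
    (fun v => isPullback_whiskerLeft (t v)) fun e => hf e.2.2
end

section
variable {k : Type u} [Field k] {G : Over (Spec (.of k))}

variable [GrpObj G] {X : GSch G} {V : Type u} [Quiver.{u} V] [Finite V]
  [∀ v w : V, Finite (v ⟶ w)] {F : V ⥤q GSch G} {t : (v : V) → (F.obj v ⟶ X)}
  {ht : ∀ {v w : V} (e : v ⟶ w), F.map e ≫ t w = t v}

lemma gCocone₁_isGluing (h0 : (gCocone F t ht).IsGluing)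
    (hc : ∀ v, QuasiCompact (t v).hom.left) (hq : ∀ v, QuasiSeparated (t v).hom.left) :
    (gCocone₁ F t ht).IsGluing :=
  isGluing_whiskerLeft (fun e => congr_arg Mod.Hom.hom (ht e)) h0 G hc hq

lemma gCocone₂_isGluing (h0 : (gCocone F t ht).IsGluing)
    (hc : ∀ v, QuasiCompact (t v).hom.left) (hq : ∀ v, QuasiSeparated (t v).hom.left) :
    (gCocone₂ F t ht).IsGluing :=
  isGluing_whiskerLeft
    (fun e => by rw [← whiskerLeft_comp]; exact congr_arg (G ◁ ·) (congr_arg Mod.Hom.hom (ht e)))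
    (gCocone₁_isGluing h0 hc hq) G
    (fun v => MorphismProperty.of_isPullback (P := @QuasiCompact)
      (isPullback_whiskerLeft (t v).hom) (hc v))
    (fun v => MorphismProperty.of_isPullback (P := @QuasiSeparated)
      (isPullback_whiskerLeft (t v).hom) (hq v))
end

section
variable {k : Type u} [Field k] [IsAlgClosed k] {G : Over (Spec (.of k))} [GrpObj G]
  [IsAffine G.left] [LocallyOfFiniteType G.hom] [GeometricallyReduced G.hom] {X X' : GSch G}
  [IsGChain X] [IsVariety X'.X] {ν : X' ⟶ X}

lemma Arrow.heq {v w v' w' : Vertex ν} (a : Arrow ν v w) (b : Arrow ν v' w') (h : v = v')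
    (h' : w = w') : a ≍ b := by
  cases a <;> cases b <;> cases h' <;> first | rfl | (cases h <;> rfl)

instance (v w : Vertex ν) : Subsingleton (v ⟶ w) :=
  ⟨fun a b => eq_of_heq (Arrow.heq a b rfl rfl)⟩

lemma finite_vertex (hν : IsNormalization ν.hom.left) : Finite (Vertex ν) := by
  have := finite_openOrbit hν
  have := finite_closedOrbit hν
  have := Finite.of_injective _ (bijective_simpleSubchain_Z hν).injective
  exact Finite.of_surjective (α := OpenOrbit X' ⊕ SimpleSubchain X' ⊕ ClosedOrbit X' ⊕ ClosedOrbit X)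
    (fun
      | .inl j => .openOrbit j
      | .inr (.inl W) => .simple W
      | .inr (.inr (.inl l)) => .normClosed l
      | .inr (.inr (.inr i)) => .closed i)
    fun
      | .openOrbit j => ⟨.inl j, rfl⟩
      | .simple W => ⟨.inr (.inl W), rfl⟩
      | .normClosed l => ⟨.inr (.inr (.inl l)), rfl⟩
      | .closed i => ⟨.inr (.inr (.inr i)), rfl⟩

lemma quasiCompact_chainCocone (hν : IsNormalization ν.hom.left) (v : Vertex ν) :
    QuasiCompact (chainCocone ν v).hom.left := by
  have := hν.isFinite
  have := IsVariety.isNoetherian X'.X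
  match v with
  | .openOrbit j => exact inferInstanceAs (QuasiCompact (j.ι.hom.left ≫ ν.hom.left))
  | .simple W => exact inferInstanceAs (QuasiCompact (W.ι.hom.left ≫ ν.hom.left))
  | .normClosed l => exact inferInstanceAs (QuasiCompact (l.ι.hom.left ≫ ν.hom.left))
  | .closed i => exact inferInstanceAs (QuasiCompact i.ι.hom.left)

lemma quasiSeparated_chainCocone (hν : IsNormalization ν.hom.left) (v : Vertex ν) :
    QuasiSeparated (chainCocone ν v).hom.left := by
  have := hν.isFinite
  match v with
  | .openOrbit j => exact inferInstanceAs (QuasiSeparated (j.ι.hom.left ≫ ν.hom.left))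
  | .simple W => exact inferInstanceAs (QuasiSeparated (W.ι.hom.left ≫ ν.hom.left))
  | .normClosed l => exact inferInstanceAs (QuasiSeparated (l.ι.hom.left ≫ ν.hom.left))
  | .closed i => exact inferInstanceAs (QuasiSeparated i.ι.hom.left)

end

/-! ### Local bases of families of vector bundles on a chain -/

lemma exists_pi_eq_of_bijective {S L : Type*} {f : S → L} (hf : Function.Bijective f)
    {β : L → Type*} (x : ∀ s, β (f s)) : ∃ t : ∀ l, β l, ∀ s, t (f s) = x s :=
  ⟨(Equiv.ofBijective f hf).piCongrLeft β x,
    (Equiv.ofBijective f hf).piCongrLeft_apply_apply β x⟩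

lemma CounitCompat.app_pb {X Y Z : Scheme.{u}} {f : X ⟶ Y} {p : Y ⟶ Z} {q : X ⟶ Z}
    {w : f ≫ p = q} {M : Z.Modules} {N : Y.Modules} {N' : X.Modules}
    {ε : (Scheme.Modules.pullback p).obj M ⟶ N} {ε' : (Scheme.Modules.pullback q).obj M ⟶ N'}
    {α : (Scheme.Modules.pullback f).obj N ⟶ N'} (h : CounitCompat w ε ε' α) {U : Z.Opens}
    {V : Y.Opens} {W : X.Opens} (hV : V ≤ p ⁻¹ᵁ U) (hW : W ≤ f ⁻¹ᵁ V) (hWU : W ≤ q ⁻¹ᵁ U)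
    (s : Γ(M, U)) :
    α.app W (pb f N hW (ε.app V (pb p M hV s))) = ε'.app W (pb q M hWU s) := by
  rw [← map_pb, ← comp_app_apply, h, comp_app_apply, pullIso_hom_pb]

section
variable {k : Type u} [Field k] [IsAlgClosed k] {G : Over (Spec (.of k))} [GrpObj G]
  [IsAffine G.left] [LocallyOfFiniteType G.hom] [GeometricallyReduced G.hom] {X X' : GSch G}
  [IsGChain X] [IsVariety X'.X] {ν : X' ⟶ X}
  (A : (gCocone (chainDiagram ν) (chainCocone ν) (chainCocone_comm ν)).Family)

/-- The family `A` is given by a vector bundle `E` on the normalization and the bundles on the closed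
orbits of `X`. -/
structure IsInducedBy (E : X'.X.left.Modules)
    (εU : ∀ i : OpenOrbit X', (Scheme.Modules.pullback i.ι.hom.left).obj E ≅ A.A (.openOrbit i))
    (εW : ∀ s : SimpleSubchain X', (Scheme.Modules.pullback s.ι.hom.left).obj E ≅ A.A (.simple s))
    (εZ : ∀ l : ClosedOrbit X', (Scheme.Modules.pullback l.ι.hom.left).obj E ≅ A.A (.normClosed l)) :
    Prop where
  openIncl (s : SimpleSubchain X') : CounitCompat s.openIncl_ι (εW s).hom (εU s.U).hom
    (A.α ⟨_, _, Arrow.openIncl s⟩).hom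
  closedIncl (s : SimpleSubchain X') : CounitCompat s.closedIncl_ι (εW s).hom (εZ s.Z).hom
    (A.α ⟨_, _, Arrow.closedIncl s⟩).hom

/-- The family on the open orbits and the simple chains, which cover the normalization, glues to a
vector bundle `E`, and `E` restricts to the given bundles on the closed orbits. -/
lemma exists_isInducedBy (hν : IsNormalization ν.hom.left) (hA : ∀ v, IsVectorBundle (A.A v)) :
    ∃ E εU εW εZ, IsVectorBundle E ∧ IsInducedBy A E εU εW εZ := by
  let B : (starCocone SimpleSubchain.U (fun i : OpenOrbit X' => i.toGSch.X.left)
      (fun s : SimpleSubchain X' => s.toGSch.X.left) (fun s => s.openIncl.hom.left)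
      (fun i => i.ι.hom.left) (fun s => s.ι.hom.left) fun s => s.openIncl_ι).Family :=
    { A := fun
        | .inl i => A.A (.openOrbit i)
        | .inr s => A.A (.simple s)
      α := fun s => A.α ⟨_, _, Arrow.openIncl s⟩ }
  have hB (v) : IsVectorBundle (B.A v) :=
    match v with
    | .inl i => hA (.openOrbit i)
    | .inr s => hA (.simple s)
  obtain ⟨hE, hε⟩ := ((isStarCovering hν).isGluing _).glue_isVectorBundle
    ((isStarCovering hν).hasLocalBases B hB)
  let εU (i : OpenOrbit X') :
      (Scheme.Modules.pullback i.ι.hom.left).obj B.glue ≅ A.A (.openOrbit i) :=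
    @asIso _ _ _ _ (B.counit (.inl i)) (hε (.inl i))
  let εW (s : SimpleSubchain X') :
      (Scheme.Modules.pullback s.ι.hom.left).obj B.glue ≅ A.A (.simple s) :=
    @asIso _ _ _ _ (B.counit (.inr s)) (hε (.inr s))
  -- each closed orbit belongs to exactly one simple chain, through which it is compared with `E`
  let θ (s : SimpleSubchain X') :
      (Scheme.Modules.pullback s.Z.ι.hom.left).obj B.glue ≅ A.A (.normClosed s.Z) :=
    (pullIso s.closedIncl_ι B.glue).symm ≪≫
      (Scheme.Modules.pullback s.closedIncl.hom.left).mapIso (εW s) ≪≫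
        A.α ⟨_, _, Arrow.closedIncl s⟩
  obtain ⟨εZ, hεZ⟩ := exists_pi_eq_of_bijective (bijective_simpleSubchain_Z hν)
    (β := fun l : ClosedOrbit X' =>
      (Scheme.Modules.pullback l.ι.hom.left).obj B.glue ≅ A.A (.normClosed l)) θ
  refine ⟨B.glue, εU, εW, εZ, hE, fun s => B.counit_comm s, fun s => ?_⟩
  refine Eq.trans ?_ (congr_arg (fun t => (pullIso s.closedIncl_ι B.glue).hom ≫ Iso.hom t)
    (hεZ s).symm)
  exact ((pullIso s.closedIncl_ι B.glue).hom_inv_id_assoc _).symm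

variable {A} {E : X'.X.left.Modules}
  {εU : ∀ i : OpenOrbit X', (Scheme.Modules.pullback i.ι.hom.left).obj E ≅ A.A (.openOrbit i)}
  {εW : ∀ s : SimpleSubchain X', (Scheme.Modules.pullback s.ι.hom.left).obj E ≅ A.A (.simple s)}
  {εZ : ∀ l : ClosedOrbit X', (Scheme.Modules.pullback l.ι.hom.left).obj E ≅ A.A (.normClosed l)}

/-- A basis of `E` and bases on the closed orbits of `X` that agree on the closed orbits of the
normalization define a compatible family of bases. -/
lemma IsInducedBy.exists_compatible (H : IsInducedBy A E εU εW εZ) {V : X.X.left.Opens} {n : ℕ}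
    {s : ULift.{u} (Fin n) → Γ(E, ν.hom.left ⁻¹ᵁ V)} (hs : IsBasisOn E s)
    {c : ∀ i : ClosedOrbit X, ULift.{u} (Fin n) → Γ(A.A (.closed i), i.ι.hom.left ⁻¹ᵁ V)}
    (hc : ∀ i, IsBasisOn (A.A (.closed i)) (c i))
    (hsc : ∀ (l : ClosedOrbit X') (i : ClosedOrbit X) (h)
      (hle : l.ι.hom.left ⁻¹ᵁ ν.hom.left ⁻¹ᵁ V ≤
        (orbitRestrict ν l i h).hom.left ⁻¹ᵁ i.ι.hom.left ⁻¹ᵁ V) (m),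
      (A.α ⟨_, _, Arrow.restrict l i h⟩).hom.app (l.ι.hom.left ⁻¹ᵁ ν.hom.left ⁻¹ᵁ V)
        (pb (orbitRestrict ν l i h).hom.left (A.A (.closed i)) hle (c i m)) =
      (εZ l).hom.app _ (pb l.ι.hom.left E (le_refl (l.ι.hom.left ⁻¹ᵁ ν.hom.left ⁻¹ᵁ V)) (s m))) :
    ∃ b : ULift.{u} (Fin n) → ∀ v, Γ(A.A v, (chainCocone ν v).hom.left ⁻¹ᵁ V),
      (∀ m, A.Compatible (b m)) ∧ ∀ v, IsBasisOn (A.A v) (fun m => b m v) := by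
  let b (m : ULift.{u} (Fin n)) : ∀ v, Γ(A.A v, (chainCocone ν v).hom.left ⁻¹ᵁ V)
    | .openOrbit i => (εU i).hom.app (i.ι.hom.left ⁻¹ᵁ ν.hom.left ⁻¹ᵁ V) (pb i.ι.hom.left E le_rfl (s m))
    | .simple W => (εW W).hom.app (W.ι.hom.left ⁻¹ᵁ ν.hom.left ⁻¹ᵁ V) (pb W.ι.hom.left E le_rfl (s m))
    | .normClosed l => (εZ l).hom.app (l.ι.hom.left ⁻¹ᵁ ν.hom.left ⁻¹ᵁ V) (pb l.ι.hom.left E le_rfl (s m))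
    | .closed i => c i m
  refine ⟨b, fun m => ?_, fun v => ?_⟩
  · rintro ⟨v, w, e⟩
    change Arrow ν v w at e
    cases e with
    | openIncl W =>
      have h := (H.openIncl W).app_pb (U := ν.hom.left ⁻¹ᵁ V)
        (W := W.U.ι.hom.left ⁻¹ᵁ ν.hom.left ⁻¹ᵁ V) (le_refl (W.ι.hom.left ⁻¹ᵁ ν.hom.left ⁻¹ᵁ V))
        (congr_arg (· ⁻¹ᵁ ν.hom.left ⁻¹ᵁ V) W.openIncl_ι).ge le_rfl (s m)
      exact h
    | closedIncl W =>
      have h := (H.closedIncl W).app_pb (U := ν.hom.left ⁻¹ᵁ V)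
        (W := W.Z.ι.hom.left ⁻¹ᵁ ν.hom.left ⁻¹ᵁ V) (le_refl (W.ι.hom.left ⁻¹ᵁ ν.hom.left ⁻¹ᵁ V))
        (congr_arg (· ⁻¹ᵁ ν.hom.left ⁻¹ᵁ V) W.closedIncl_ι).ge le_rfl (s m)
      exact h
    | restrict l i h => exact hsc l i h _ m
  · match v with
    | .openOrbit i => exact (hs.pb i.ι.hom.left le_rfl).map_iso (εU i)
    | .simple W => exact (hs.pb W.ι.hom.left le_rfl).map_iso (εW W)
    | .normClosed l => exact (hs.pb l.ι.hom.left le_rfl).map_iso (εZ l)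
    | .closed i => exact hc i

/-- Near a point of an open orbit, a basis of `E` at the only point of the fibre will do. -/
lemma IsInducedBy.exists_basis_openOrbit (H : IsInducedBy A E εU εW εZ)
    (hν : IsNormalization ν.hom.left) (hE : IsVectorBundle E) (U : OpenOrbit X) {x : X.X.left}
    (hx : x ∈ U.carrier) :
    ∃ (V : X.X.left.Opens) (n : ℕ)
      (b : ULift.{u} (Fin n) → ∀ v, Γ(A.A v, (chainCocone ν v).hom.left ⁻¹ᵁ V)), x ∈ V ∧
      (∀ m, A.Compatible (b m)) ∧ ∀ v, IsBasisOn (A.A v) (fun m => b m v) := by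
  have := hν.isFinite
  have := U.isIso_morphismRestrict hν
  obtain ⟨y, rfl⟩ := hν.surjective x
  obtain ⟨O, n, e, hyO, he⟩ := isVectorBundle_iff.mp hE y
  obtain ⟨V, hyV, hVO⟩ := exists_preimage_le ν.hom.left ν.hom.left.isClosedMap (x := ν.hom.left y)
    (U := O) fun z hz => by
      have hzU : ν.hom.left z ∈ U.carrier := hz ▸ hx
      obtain rfl : z = y := ((specializes_of_isIso hzU hx (specializes_of_eq hz)).antisymm
        (specializes_of_isIso hx hzU (specializes_of_eq hz.symm))).eq
      exact hyO
  let V' := V ⊓ orbitNhd (ν.hom.left y)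
  have hempty (i : ClosedOrbit X) (p : i.toGSch.X.left) : p ∉ i.ι.hom.left ⁻¹ᵁ V' := fun hp =>
    U.notMem_closedOrbit i hx (mem_orbitNhd.mp hp.2 i (i.range_ι.le ⟨p, rfl⟩))
  have hle : ν.hom.left ⁻¹ᵁ V' ≤ O := (ν.hom.left.preimage_mono inf_le_left).trans hVO
  obtain ⟨b, hb, hb'⟩ := H.exists_compatible (V := V') (he.res hle) (c := fun _ _ => 0)
    (fun i => IsStarCovering.isBasisOn_of_isEmpty (hempty i))
    (fun l i h hl m => (IsStarCovering.subsingleton_sections _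
      fun p hp => hempty i _ (hl hp)).elim _ _)
  exact ⟨V', n, b, ⟨hyV, mem_orbitNhd.mpr fun _ h => h⟩, hb, hb'⟩

/-- At a point of a closed orbit `Z`, there are a basis of `E` near the fibre and a basis on `Z` that
agree on the closed orbits of the normalization over `Z`. -/
lemma IsInducedBy.exists_basis_closedOrbit (H : IsInducedBy A E εU εW εZ)
    (hν : IsNormalization ν.hom.left) (hE : IsVectorBundle E) (hA : ∀ v, IsVectorBundle (A.A v))
    (Z : ClosedOrbit X) {x : X.X.left} (hx : x ∈ Z.carrier) :
    ∃ (V : X.X.left.Opens) (n : ℕ)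
      (b : ULift.{u} (Fin n) → ∀ v, Γ(A.A v, (chainCocone ν v).hom.left ⁻¹ᵁ V)), x ∈ V ∧
      (∀ m, A.Compatible (b m)) ∧ ∀ v, IsBasisOn (A.A v) (fun m => b m v) := by
  have := hν.isFinite
  have : Surjective ν.hom.left := ⟨hν.surjective⟩
  have := finite_closedOrbit hν
  obtain ⟨p, rfl⟩ := Z.range_ι.ge hx
  let L := {l : ClosedOrbit X' // (l.carrier : Set X'.X.left) ⊆ ν.hom.left ⁻¹' Z.carrier}
  obtain ⟨V, hV, hpV, n, s, c, hs, hc, hsc⟩ := exists_isBasisOn_compatible ν.hom.left Z.ι.hom.left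
    (L := L) (fun l => l.1.ι.hom.left) (fun l => (orbitRestrict ν l.1 Z l.2).hom.left)
    (fun l => orbitRestrict_ι_left ν l.1 Z l.2)
    (fun l m q q' h => Subtype.ext (ClosedOrbit.eq_of_mem (l.1.range_ι.le ⟨q, rfl⟩)
      (h ▸ m.1.range_ι.le ⟨q', rfl⟩))) p
    (fun y hy => by
      have hyZ : ν.hom.left y ∈ Z.carrier := hy ▸ hx
      obtain ⟨l, hl⟩ := exists_closedOrbit_of_notMem hν (Z.notMem_openLocus hyZ)
      exact ⟨⟨l, l.isOrbit.subset_of_isStable (Z.isOrbit.isStable.preimage ν) ⟨y, hl, hyZ⟩⟩,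
        l.range_ι.ge hl⟩)
    hE (hA (.closed Z)) (fun l => A.α ⟨_, _, Arrow.restrict l.1 Z l.2⟩ ≪≫ (εZ l.1).symm)
    (V₀ := orbitNhd (Z.ι.hom.left p)) (mem_orbitNhd.mpr fun _ h => h)
  have hempty (i : ClosedOrbit X) (hi : i ≠ Z) (q : i.toGSch.X.left) : q ∉ i.ι.hom.left ⁻¹ᵁ V :=
    fun hq => hi (ClosedOrbit.eq_of_mem
      (mem_orbitNhd.mp (hV hq) i (i.range_ι.le ⟨q, rfl⟩)) hx)
  choose c' hc' using fun m : ULift.{u} (Fin n) => IsStarCovering.exists_section_eq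
    (fun i : ClosedOrbit X => Γ(A.A (.closed i), i.ι.hom.left ⁻¹ᵁ V)) Z (c m)
  obtain ⟨b, hb, hb'⟩ := H.exists_compatible (V := V) hs (c := fun i m => c' m i) (fun i => by
      by_cases hi : i = Z
      · subst hi
        exact hc.congr fun m => (hc' m).symm
      · exact IsStarCovering.isBasisOn_of_isEmpty (hempty i hi))
    (fun l i h hl m => by
      by_cases hi : i = Z
      · subst hi
        rw [hc', ← hsc ⟨l, h⟩ hl m]
        exact (inv_hom_app_apply (εZ l) _).symm
      · exact (IsStarCovering.subsingleton_sections _ fun q hq => hempty i hi _ (hl hq)).elim _ _)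
  exact ⟨V, n, b, hpV, hb, hb'⟩

lemma hasLocalBases_chain (hν : IsNormalization ν.hom.left) (hA : ∀ v, IsVectorBundle (A.A v)) :
    HasLocalBases A := by
  intro x
  obtain ⟨E, εU, εW, εZ, hE, H⟩ := exists_isInducedBy A hν hA
  obtain ⟨U, hU⟩ | ⟨Z, hZ⟩ := IsGChain.exists_mem x
  · exact H.exists_basis_openOrbit hν hE U hU
  · exact H.exists_basis_closedOrbit hν hE hA Z hZ

/-- The category of equivariant vector bundles on a weakly normal chain is the limit of those on the
pieces of its normalization. -/
lemma chainComparison_isEquivalence (hX : IsWeaklyNormal X.X.left)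
    (hν : IsNormalization ν.hom.left) : (chainComparison ν).IsEquivalence :=
  have h0 := isGluing_chain hX hν
  have := finite_vertex hν
  have hc := quasiCompact_chainCocone hν
  have hq := quasiSeparated_chainCocone hν
  toGraphLimit_isEquivalence (ht := chainCocone_comm ν) h0 (gCocone₁_isGluing h0 hc hq)
    (gCocone₂_isGluing h0 hc hq).1
    fun A => hasLocalBases_chain hν fun v => (A.obj v).isVectorBundle

end

end

end EquivariantChain

theorem mainTheorem10 {k : Type u} [Field k] [IsAlgClosed k] [CharZero k]
    (G : Over (Spec (.of k))) [GrpObj G] [IsAffine G.left] [LocallyOfFiniteType G.hom]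
    [GeometricallyReduced G.hom]
    (X : GSch G) [IsGChain X] (hX : IsWeaklyNormal X.X.left)
    (X' : GSch G) [IsVariety X'.X] (ν : X' ⟶ X) (hν : IsNormalization ν.hom.left) :
    -- `ν` identifies the open orbits of `X'` with those of `X`
    (∀ U : OpenOrbit X, IsIso (ν.hom.left ∣_ U.carrier) ∧
      ∃ U' : OpenOrbit X', U'.carrier = ν.hom.left ⁻¹ᵁ U.carrier) ∧
    (∀ U' : OpenOrbit X', ∃ U : OpenOrbit X, U'.carrier = ν.hom.left ⁻¹ᵁ U.carrier) ∧
    -- each closed orbit of `X'` lies in exactly one simple chain of `X'` and over one orbit of `X`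
    (∀ Z' : ClosedOrbit X', (∃! W : SimpleSubchain X', W.Z = Z') ∧
      ∃! Z : ClosedOrbit X, (Z'.carrier : Set X'.X.left) ⊆ ν.hom.left ⁻¹' Z.carrier) ∧
    (chainComparison ν).IsEquivalence := by
  refine ⟨fun U => ⟨U.isIso_morphismRestrict hν, U.preimage hν, rfl⟩,
    fun U' => U'.exists_eq_preimage hν, fun Z' => ⟨?_, ?_⟩, chainComparison_isEquivalence hX hν⟩
  · obtain ⟨W, hW⟩ := Z'.exists_simpleSubchain hν
    exact ⟨W, hW, fun W' hW' => SimpleSubchain.eq_of_Z_eq hν (hW'.trans hW.symm)⟩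
  · obtain ⟨Z, hZ⟩ := Z'.exists_subset_preimage hν
    obtain ⟨y, hy⟩ := Z'.isOrbit.nonempty
    exact ⟨Z, hZ, fun W hW => ClosedOrbit.eq_of_mem (hW hy) (hZ hy)⟩
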